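/- For a real number $X\ge 2$ let $u$ be any real, non-negative $C^\infty$ function with $\int u=1$ and support in $[e^{1-1/X},e]$, and put $$U(z)=\int_0^\infty u(x)E_1(z\log x)\,dx,\qquad E_1(z)=\int_z^\infty \frac{e^{-w}}{w}\,dw$$ (principal branch of $E_1$). For a primitive Dirichlet character $\chi$ modulo $q$ let $$Z_X(\chi)=\exp\Big(-\sum_\rho U\big((\tfrac12-\rho)\log X\big)\Big),$$ where $\rho$ runs over the zeros of $L(s,\chi)$ with $0<\operatorname{Re}\rho<1$, counted with multiplicity; since $e^{-U(z)}\sim Cz$ as $z\to0$ for a constant $C$, $Z_X(\chi)$ is read as $0$ if $L(\tfrac12,\chi)=0$. Let $\varphi^*(q)$ be the number of primitive characters modulo $q$, let $\sum^*$ denote summation over them, let $\omega(q)$ be the number of distinct prime factors of $q$, and let $\gamma$ be Euler's constant. Let $\delta>0$, and let $X,q\to\infty$ through values with $X\ge2$, $\varphi^*(q)>0$ (that is, $q\not\equiv 2 \pmod 4$) and $X\ll(\log q)^{2-\delta}$; the function $u$ may be chosen arbitrarily, as above, for each pair $(X,q)$. Then for all sufficiently large $X,q$ the series over $\rho$ in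 the definition of $Z_X(\chi)$ converges absolutely for every primitive $\chi$ modulo $q$ (leaving aside the term $\rho=\tfrac12$, if present), and $$\frac1{\varphi^*(q)}\sum_{\chi\,(\mathrm{mod}\ q)}^{*}|Z_X(\chi)|^2\sim\prod_{\substack{p>X\\ p\mid q}}\Big(1-\frac1p\Big)\frac{\log q}{e^{\gamma}\log X}.$$ If moreover, for every $\varepsilon>0$, $\omega(q)\ll_\varepsilon X^{1+\varepsilon}$, then $$\frac1{\varphi^*(q)}\sum_{\chi\,(\mathrm{mod}\ q)}^{*}|Z_X(\chi)|^2\sim\frac{\log q}{e^{\gamma}\log X}.$$ -/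

import Mathlib

open Asymptotics Filter

open scoped ContDiff

noncomputable section

namespace HybridL

/-- The exponential integral `E₁(z) = ∫_z^∞ e^{-w} / w dw`, principal branch. Off `(-∞, 0]` the path
is the horizontal ray `w = z + t`, `t > 0`. For real `z < 0`, where that ray runs into the origin,
the path is the ray `w = z + (1 + i) t`, which gives the boundary value from the upper half plane
(the same convention as for `Complex.log`). The value at `z = 0` has no meaning. -/
def E₁ (z : ℂ) : ℂ :=
  open Classical in
  if z ∈ Complex.slitPlane then
    ∫ t in Set.Ioi (0 : ℝ), Complex.exp (-(z + t)) / (z + t)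
  else
    ∫ t in Set.Ioi (0 : ℝ),
      Complex.exp (-(z + (1 + Complex.I) * t)) / (z + (1 + Complex.I) * t) * (1 + Complex.I)

/-- `u` is a real, non-negative `C^∞` function of mass `1` supported on `[e^{1-1/X}, e]`. -/
structure IsWeight (X : ℝ) (u : ℝ → ℝ) : Prop where
  smooth : ContDiff ℝ ∞ u
  nonneg : ∀ x, 0 ≤ u x
  support_subset : Function.support u ⊆ Set.Icc (Real.exp (1 - 1 / X)) (Real.exp 1)
  mass : ∫ x, u x = 1

/-- `U(z) = ∫_0^∞ u(x) E₁(z log x) dx`. -/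
def U (u : ℝ → ℝ) (z : ℂ) : ℂ :=
  ∫ x in Set.Ioi (0 : ℝ), (u x : ℂ) * E₁ (z * (Real.log x : ℂ))

variable {q : ℕ} [NeZero q]

/-- The non-trivial zeros of `L(s, χ)`, for `χ` primitive. -/
def nontrivialZeros (χ : DirichletCharacter ℂ q) : Set ℂ :=
  {ρ | 0 < ρ.re ∧ ρ.re < 1 ∧ χ.LFunction ρ = 0}

/-- The term of the zero `ρ` in `∑_ρ U((1/2 - ρ) log X)`, counted with multiplicity. -/
def zeroTerm (u : ℝ → ℝ) (X : ℝ) (χ : DirichletCharacter ℂ q) (ρ : ℂ) : ℂ :=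
  (analyticOrderNatAt χ.LFunction ρ : ℂ) * U u ((1 / 2 - ρ) * (Real.log X : ℂ))

/-- `Z_X(χ) = exp(-∑_ρ U((1/2 - ρ) log X))`, the sum being over the non-trivial zeros of `L(s, χ)`
with multiplicity. Since `exp(-U(z))` is asymptotic to a constant times `z` as `z → 0`, a zero at
`s = 1/2` contributes the factor `0`. -/
def Z (u : ℝ → ℝ) (X : ℝ) (χ : DirichletCharacter ℂ q) : ℂ :=
  open Classical in
  if χ.LFunction (1 / 2) = 0 then 0
  else Complex.exp (-∑' ρ : nontrivialZeros χ, zeroTerm u X χ ρ)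

/-- The finite set of primitive characters modulo `q`. -/
def primitiveChars (q : ℕ) [NeZero q] : Finset (DirichletCharacter ℂ q) :=
  open Classical in Finset.univ.filter fun χ => χ.IsPrimitive

/-- `φ*(q)⁻¹ ∑* |Z_X(χ)|²`, the sum being over the primitive characters modulo `q`
and `φ*(q)` being their number. -/
def secondMoment (u : ℝ → ℝ) (X : ℝ) (q : ℕ) [NeZero q] : ℝ :=
  ((primitiveChars q).card : ℝ)⁻¹ * ∑ χ ∈ primitiveChars q, ‖Z u X χ‖ ^ 2

/-- `∏_{p > X, p ∣ q} (1 - 1/p)`. -/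
def largePrimeProduct (X : ℝ) (q : ℕ) : ℝ :=
  open Classical in ∏ p ∈ q.primeFactors.filter fun p => X < (p : ℝ), (1 - 1 / (p : ℝ))

end HybridL

end

noncomputable section

namespace HybridL

open Metric Set Topology MeasureTheory Real LSeries
open ArithmeticFunction hiding log map_zero
open Complex (norm_real ofReal_mul mem_slitPlane_iff continuous_re slitPlane continuous_ofReal
  norm_exp ofReal_re re_le_norm ofReal_zero natCast_log norm_cpow_eq_rpow_re_of_pos re_mul_ofReal
  ofRealCLM continuous_im abs_im_le_norm ofReal_im ofReal_div ofReal_pow conj_ofReal ofReal_cpow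
  normSq_eq_norm_sq)
open Finset (sum_congr mul_sum mem_filter sum_le_sum sum_mul prod_le_prod sum_add_distrib
  sum_const sum_sub_distrib sum_nonneg prod_congr sum_filter prod_nonneg prod_ne_zero_iff prod_pos
  sum_neg_distrib prod_mul_distrib prod_le_one sum_eq_zero)
open Nat (factoredNumbers prime_of_mem_primeFactors cast_nonneg mem_divisorsAntidiagonal
  pos_of_mem_divisors mem_factoredNumbers_of_dvd mem_factoredNumbers' le_floor mem_divisors)
open scoped Complex ComplexConjugate

/-! ### Zeros of entire functions of order less than two -/

/-! The product `Z_X(χ)` is, up to a factor tending to 1 uniformly in `χ` and `u`, the central value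
`L(1/2, χ)` times a Dirichlet series over integers with small prime factors. The theorem is
therefore a mollified second moment.

Hybrid formula. Put `v(n) = weightCdf u (log n / log X)` and `w = 1 - v` (`primeWeight`). For `Re s
> 1`, `log L(s, χ)` is the sum of `Λ(n) χ(n) / (log n · n^s)`. The part weighted by `w` is a finite
sum over `n < X`; the part weighted by `v` is minus the sum of `U((s - ρ) log X)` over all zeros
(`hasSum_U_zeros`). No contour is shifted for this. The partial fractions of `(L'/L)'`
(`deriv_logDeriv_eq_tsum`), read at the points `2 + k`, are an identity for the test functions
`e^{-ky}`, and Weierstrass approximation in `e^{-y}` carries it over to the required test function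
(`tsum_eq_tsum_laplace`). Because `exp(-U)` is entire, the formula continues from large real `s` to
`1/2` (`LFunction_half_eq`), and the trivial zeros contribute only `exp(O(X^{-1/4} / log X))`
(`norm_Z_eq`). So `|Z_X(χ)|` is asymptotically `|L(1/2, χ) A(χ)|`, where `A(χ) = ∑ a(n) χ(n)
n^{-1/2}`, `|a| ≤ 1`, and `a` lives on integers composed of primes `p ≤ X` with `p ∤ q`
(`exp_neg_logEulerPart`). Constants depending on `u` occur only in convergence statements, which is
why `u` may vary freely.

Twisted moment. The approximate functional equation comes from squaring a theta integral that has a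
reflection symmetry (`norm_integral_sq_eq`). Averaging `χ(h) conj χ(k) |L(1/2, χ)|²` over primitive
characters leaves the diagonal `hm = kn`, worth `φ(q)/q · (h,k)/√(hk) · log q` to leading order. The
other terms are bounded by `gcd(q, hm ± kn)`, which saves a power of `q`
(`exists_twistedMoment_le`).

Length of the mollifier. `A(χ)` is an infinite series, truncated by Rankin's trick at `N = exp((log
q)^θ)` with `θ < 1`. The price is a power of `∏ (1 - p^{-1/2+σ})⁻¹ = exp(O(X^{1/2+σ}))`. The
hypothesis `X ≪ (log q)^{2-δ}` is what keeps this below `N^σ` while `N` is still `q^{o(1)}`.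

Main term. It is `φ(q)/q · log q · G` with `G = ∑ a(h) a(k) (h,k)/(hk)`. With `Q = ∏_{p ≤ X, p ∤ q}
(1 - 1/p)⁻¹`, diagonalisation gives `G Q = ∑_r (∑_{m ∣ r} a(m))² / r`, where `r` runs over the
integers composed of those primes (`gcdForm_mul_smoothSum`). The inner sums are the coefficients of
the exponential formed with `v`, and `v` vanishes up to `X^{1-1/X}`, so `1 ≤ G Q ≤ 1 + o(1)`
(`gcdForm_eulerCoeff_mem_Icc`). Finally `φ(q)/(q Q)` is the full product over `p ≤ X` times the
product over `p > X`, `p ∣ q` (`totient_div_eq`), and Mertens' theorem evaluates the former. If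
`ω(q) ≪ X^{1+ε}` for every `ε > 0`, a second use of Mertens shows that the latter tends to 1
(`tendsto_largePrimeProduct`). -/

lemma analyticOrderAt_ne_top_of_entire {f : ℂ → ℂ} (hf : Differentiable ℂ f) {c : ℂ}
    (hc : f c ≠ 0) (a : ℂ) : analyticOrderAt f a ≠ ⊤ := by
  have hA : AnalyticOnNhd ℂ f univ := fun z _ => hf.analyticAt z
  refine hA.analyticOrderAt_ne_top_of_isPreconnected isPreconnected_univ (mem_univ c)
    (mem_univ a) ?_
  rw [(hf.analyticAt c).analyticOrderAt_eq_zero.mpr hc]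
  simp

lemma exists_entire_factor {f : ℂ → ℂ} (hf : Differentiable ℂ f) {a : ℂ}
    (ha : analyticOrderAt f a ≠ ⊤) :
    ∃ g : ℂ → ℂ, Differentiable ℂ g ∧ g a ≠ 0 ∧
      ∀ z, f z = (z - a) ^ analyticOrderNatAt f a * g z := by
  classical
  set n := analyticOrderNatAt f a with hn
  have h1 : analyticOrderAt f a = n := by simp_all
  obtain ⟨h, hh, hha, hev⟩ := ((hf.analyticAt a).analyticOrderAt_eq_natCast).mp h1
  refine ⟨fun z => if z = a then h a else f z / (z - a) ^ n, ?_, by lia, ?_⟩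
  · intro z
    rcases eq_or_ne z a with rfl | hz
    · refine hh.differentiableAt.congr_of_eventuallyEq ?_
      filter_upwards [hev] with w hw
      rcases eq_or_ne w z with rfl | hwz
      · simp
      · have : (w - z) ^ n ≠ 0 := by positivity
        simp only [hwz, if_false, hw, smul_eq_mul]
        field_simp
    · have h2 : DifferentiableAt ℂ (fun z => f z / (z - a) ^ n) z :=
        (hf z).div (by fun_prop) (pow_ne_zero _ (sub_ne_zero.mpr hz))
      refine h2.congr_of_eventuallyEq ?_
      filter_upwards [isOpen_ne.mem_nhds hz] with w hw
      lia
  · intro z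
    rcases eq_or_ne z a with rfl | hz
    · have := hev.self_of_nhds
      simpa using this
    · have : (z - a) ^ n ≠ 0 := by positivity
      grind

lemma exists_entire_factor_finset {f : ℂ → ℂ} (hf : Differentiable ℂ f) {c : ℂ} (hc : f c ≠ 0)
    (S : Finset ℂ) :
    ∃ g : ℂ → ℂ, Differentiable ℂ g ∧ (∀ a ∈ S, g a ≠ 0) ∧
      ∀ z, f z = (∏ a ∈ S, (z - a) ^ analyticOrderNatAt f a) * g z := by
  classical
  induction S using Finset.induction_on with
  | empty => grind
  | insert a S haS ih =>
    obtain ⟨g, hg, hgS, hfg⟩ := ih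
    have hgc : g c ≠ 0 := by grind
    obtain ⟨k, hk, hka, hgk⟩ := exists_entire_factor hg (analyticOrderAt_ne_top_of_entire hg hgc a)
    have hord : analyticOrderNatAt f a = analyticOrderNatAt g a := by
      have hP : Differentiable ℂ fun z => ∏ b ∈ S, (z - b) ^ analyticOrderNatAt f b := by fun_prop
      have hPa : (∏ b ∈ S, (a - b) ^ analyticOrderNatAt f b) ≠ 0 :=
        prod_ne_zero_iff.mpr fun b hb => pow_ne_zero _ (sub_ne_zero.mpr fun h => haS (h ▸ hb))
      have : f = (fun z => ∏ b ∈ S, (z - b) ^ analyticOrderNatAt f b) * g := funext hfg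
      have h3 := analyticOrderAt_mul (hP.analyticAt a) (hg.analyticAt a)
      rw [← this, (hP.analyticAt a).analyticOrderAt_eq_zero.mpr hPa, zero_add] at h3
      simp [analyticOrderNatAt, h3]
    grind

lemma finite_zeros_inter_closedBall {f : ℂ → ℂ} (hf : Differentiable ℂ f) {c : ℂ} (hc : f c ≠ 0)
    (R : ℝ) : ({z | f z = 0} ∩ closedBall 0 R).Finite := by
  have hA : AnalyticOnNhd ℂ f univ := fun z _ => hf.analyticAt z
  have h := hA.preimage_zero_mem_codiscrete (x := c) hc
  obtain ⟨h1, h2⟩ := mem_codiscrete'.mp h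
  have e : (f ⁻¹' {0}ᶜ)ᶜ = {z | f z = 0} := by ext; simp
  rw [inter_comm]
  have h1' : IsClosed {z | f z = 0} := by simp_all
  rw [e] at h2
  exact ((isCompact_closedBall 0 R).inter_right h1').finite (h2.mono inter_subset_right)

/-- The zeros of norm at most `R` of an entire function. -/
def zerosIn (f : ℂ → ℂ) (R : ℝ) : Finset ℂ :=
  open Classical in
  if h : ({z | f z = 0} ∩ closedBall 0 R).Finite then h.toFinset else ∅

lemma mem_zerosIn {f : ℂ → ℂ} (hf : Differentiable ℂ f) {c : ℂ} (hc : f c ≠ 0) {R : ℝ} {z : ℂ} :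
    z ∈ zerosIn f R ↔ f z = 0 ∧ ‖z‖ ≤ R := by
  rw [zerosIn, dif_pos (finite_zeros_inter_closedBall hf hc R)]
  simp

/-- Dividing out the zeros of norm at most `R` costs a power of `4 R`. -/
lemma exists_zerosIn_quotient {f : ℂ → ℂ} (hf : Differentiable ℂ f) {c : ℂ} (hc : f c ≠ 0)
    {R M : ℝ} (hR : 0 < R) (hM : ∀ z, ‖z‖ ≤ 5 * R → ‖f z‖ ≤ M) :
    ∃ g : ℂ → ℂ, Differentiable ℂ g ∧ (∀ z, ‖z‖ ≤ R → g z ≠ 0) ∧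
      (∀ z, f z = (∏ a ∈ zerosIn f R, (z - a) ^ analyticOrderNatAt f a) * g z) ∧
      ∀ z, ‖z‖ ≤ 5 * R → (4 * R) ^ (∑ a ∈ zerosIn f R, analyticOrderNatAt f a) * ‖g z‖ ≤ M := by
  obtain ⟨g, hg, hgS, hfg⟩ := exists_entire_factor_finset hf hc (zerosIn f R)
  refine ⟨g, hg, ?_, hfg, ?_⟩
  · intro z hz h0
    exact hgS z ((mem_zerosIn hf hc).mpr ⟨by grind, hz⟩) h0
  · intro z hz
    set n := ∑ a ∈ zerosIn f R, analyticOrderNatAt f a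
    have hpow : (0 : ℝ) < (4 * R) ^ n := by positivity
    rw [mul_comm, ← le_div_iff₀ hpow]
    -- Maximum principle for the quotient `g`: on the circle `|w| = 5R` each divided factor
    -- satisfies `|w - a| ≥ 4R`, and the resulting bound for `g` holds inside the disc as well.
    refine Complex.norm_le_of_forall_mem_frontier_norm_le (U := ball 0 (5 * R)) isBounded_ball
      hg.diffContOnCl ?_ (by rw [closure_ball _ (by positivity)]; simp_all)
    intro w hw
    rw [frontier_ball _ (by positivity)] at hw
    have hw' : ‖w‖ = 5 * R := by simp_all
    rw [le_div_iff₀ hpow]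
    refine le_trans ?_ (hM w hw'.le)
    rw [hfg w, norm_mul, norm_prod, mul_comm]
    gcongr
    rw [← Finset.prod_pow_eq_pow_sum]
    refine prod_le_prod (fun _ _ => by positivity) fun a ha => ?_
    rw [norm_pow]
    have := ((mem_zerosIn hf hc).mp ha).2
    gcongr
    calc 4 * R ≤ ‖w‖ - ‖a‖ := by linarith
      _ ≤ ‖w - a‖ := norm_sub_norm_le _ _

/-- A substitute for Jensen's formula. At `c` each factor has modulus at most `2R`, whereas the
bound for the quotient gains `4R` per zero, so every zero contributes a factor 2. -/
lemma two_pow_card_zerosIn_le {f : ℂ → ℂ} (hf : Differentiable ℂ f) {c : ℂ} (hc : f c ≠ 0)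
    {R M : ℝ} (hR : 0 < R) (hcR : ‖c‖ ≤ R) (hM : ∀ z, ‖z‖ ≤ 5 * R → ‖f z‖ ≤ M) :
    2 ^ (∑ a ∈ zerosIn f R, analyticOrderNatAt f a) * ‖f c‖ ≤ M := by
  obtain ⟨g, hg, -, hfg, hgM⟩ := exists_zerosIn_quotient hf hc hR hM
  refine le_trans ?_ (hgM c (by linarith))
  set n := ∑ a ∈ zerosIn f R, analyticOrderNatAt f a
  have h1 : ‖f c‖ ≤ (2 * R) ^ n * ‖g c‖ := by
    rw [hfg c, norm_mul, norm_prod]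
    gcongr
    rw [← Finset.prod_pow_eq_pow_sum]
    refine prod_le_prod (fun _ _ => by positivity) fun a ha => ?_
    rw [norm_pow]
    have := ((mem_zerosIn hf hc).mp ha).2
    gcongr
    calc ‖c - a‖ ≤ ‖c‖ + ‖a‖ := norm_sub_le _ _
      _ ≤ 2 * R := by linarith
  calc 2 ^ n * ‖f c‖ ≤ 2 ^ n * ((2 * R) ^ n * ‖g c‖) := by gcongr
    _ = (4 * R) ^ n * ‖g c‖ := by rw [← mul_assoc, ← mul_pow]; ring_nf

/-- Growth condition: order at most `3/2`. -/
def GrowthBound (f : ℂ → ℂ) (C : ℝ) : Prop :=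
  ∀ z, ‖f z‖ ≤ exp (C * (1 + ‖z‖) ^ (3 / 2 : ℝ))

/-- Logarithms in `two_pow_card_zerosIn_le`, with `M` supplied by the growth condition. The
requirement `‖c‖ ≤ R` is removed at the end by passing to the radius `(1 + ‖c‖) R`. -/
lemma sum_order_zerosIn_le {f : ℂ → ℂ} (hf : Differentiable ℂ f) {c : ℂ} (hc : f c ≠ 0)
    {C : ℝ} (hC : GrowthBound f C) :
    ∃ K, 0 ≤ K ∧ ∀ R, 1 ≤ R →
      ((∑ a ∈ zerosIn f R, analyticOrderNatAt f a : ℕ) : ℝ) ≤ K * R ^ (3 / 2 : ℝ) := by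
  have hmain : ∃ K, 0 ≤ K ∧ ∀ R, 1 ≤ R → ‖c‖ ≤ R →
      ((∑ a ∈ zerosIn f R, analyticOrderNatAt f a : ℕ) : ℝ) ≤ K * R ^ (3 / 2 : ℝ) := by
    refine ⟨(|C| * 6 ^ (3 / 2 : ℝ) + |log ‖f c‖|) / log 2, by positivity, ?_⟩
    intro R hR hcR
    have hM : ∀ z, ‖z‖ ≤ 5 * R → ‖f z‖ ≤ exp (|C| * 6 ^ (3 / 2 : ℝ) * R ^ (3 / 2 : ℝ)) := by
      intro z hz
      refine (hC z).trans (exp_le_exp.mpr ?_)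
      rw [mul_assoc, ← mul_rpow (by norm_num) (by linarith)]
      bound
    have h := two_pow_card_zerosIn_le hf hc (by linarith) hcR hM
    have hfc : 0 < ‖f c‖ := by positivity
    have h2 := log_le_log (by positivity) h
    rw [log_mul (by positivity) hfc.ne', log_exp, log_pow] at h2
    have hR1 : 1 ≤ R ^ (3 / 2 : ℝ) := one_le_rpow hR (by norm_num)
    have hl2 : 0 < log 2 := by positivity
    rw [div_mul_eq_mul_div, le_div_iff₀ hl2]
    nlinarith [neg_abs_le (log ‖f c‖), abs_nonneg (log ‖f c‖)]
  obtain ⟨K, hK, h⟩ := hmain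
  refine ⟨K * (1 + ‖c‖) ^ (3 / 2 : ℝ), by positivity, fun R hR => ?_⟩
  have hc1 : 1 ≤ 1 + ‖c‖ := by simp
  have h1 : zerosIn f R ⊆ zerosIn f ((1 + ‖c‖) * R) := by
    intro z hz
    rw [mem_zerosIn hf hc] at hz ⊢
    exact ⟨hz.1, hz.2.trans (by nlinarith)⟩
  calc ((∑ a ∈ zerosIn f R, analyticOrderNatAt f a : ℕ) : ℝ)
      ≤ ((∑ a ∈ zerosIn f ((1 + ‖c‖) * R), analyticOrderNatAt f a : ℕ) : ℝ) := by gcongr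
    _ ≤ K * ((1 + ‖c‖) * R) ^ (3 / 2 : ℝ) :=
        h _ (by bound) (by nlinarith)
    _ = _ := by rw [mul_rpow (by positivity) (by linarith)]; ring

/-- The zeros of an entire function of order at most `3/2` have `∑ |ρ|⁻² < ∞`. -/
theorem summable_zeros {f : ℂ → ℂ} (hf : Differentiable ℂ f) {c : ℂ} (hc : f c ≠ 0)
    {C : ℝ} (hC : GrowthBound f C) :
    Summable fun ρ : {z | f z = 0} => (analyticOrderNatAt f ρ : ℝ) / (1 + ‖(ρ : ℂ)‖) ^ 2 := by
  classical
  obtain ⟨K, hK, h⟩ := sum_order_zerosIn_le hf hc hC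
  have hgeo : Summable fun k : ℕ => K * (2 : ℝ) ^ (3 / 2 : ℝ) * ((2 : ℝ) ^ (-(1 / 2) : ℝ)) ^ k :=
    (summable_geometric_of_lt_one (by positivity)
      (rpow_lt_one_of_one_lt_of_neg (by norm_num) (by norm_num))).mul_left _
  refine summable_of_sum_le (c := ∑' k : ℕ, K * (2 : ℝ) ^ (3 / 2 : ℝ) *
    ((2 : ℝ) ^ (-(1 / 2) : ℝ)) ^ k) (fun ρ => by positivity) fun F => ?_
  -- Dyadic shells: `2^κ ≤ 1 + |ρ| < 2^(κ+1)`. A shell holds `O(2^{3k/2})` zeros, each weighing at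
  -- most `4^{-k}`, which leaves a geometric series in `2^{-k/2}`.
  set κ : {z | f z = 0} → ℕ := fun ρ => Nat.log 2 ⌊1 + ‖(ρ : ℂ)‖⌋₊
  have hlow : ∀ ρ : {z | f z = 0}, (2 : ℝ) ^ κ ρ ≤ 1 + ‖(ρ : ℂ)‖ := by
    intro ρ
    have h1 : ⌊1 + ‖(ρ : ℂ)‖⌋₊ ≠ 0 := by simp
    have := Nat.pow_log_le_self 2 h1
    calc (2 : ℝ) ^ κ ρ = ((2 ^ κ ρ : ℕ) : ℝ) := by simp
      _ ≤ (⌊1 + ‖(ρ : ℂ)‖⌋₊ : ℝ) := mod_cast this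
      _ ≤ _ := Nat.floor_le (by positivity)
  have hup : ∀ ρ : {z | f z = 0}, ‖(ρ : ℂ)‖ ≤ (2 : ℝ) ^ (κ ρ + 1) := by
    intro ρ
    have := Nat.lt_pow_succ_log_self (b := 2) (by norm_num) ⌊1 + ‖(ρ : ℂ)‖⌋₊
    have h2 : (1 + ‖(ρ : ℂ)‖) < ((2 ^ (κ ρ + 1) : ℕ) : ℝ) :=
      (Nat.floor_lt (by positivity)).mp this
    grind
  rw [← Finset.sum_fiberwise_of_maps_to (t := F.image κ) (g := κ)
    (fun ρ hρ => Finset.mem_image_of_mem _ hρ)]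
  refine le_trans (sum_le_sum fun k _ => ?_) (hgeo.sum_le_tsum _ fun k _ => by positivity)
  set G : Finset {z | f z = 0} := F.filter fun ρ => κ ρ = k with hG
  have h3 : ∑ ρ ∈ G, (analyticOrderNatAt f ρ : ℝ) / (1 + ‖(ρ : ℂ)‖) ^ 2
      ≤ ∑ ρ ∈ G, (analyticOrderNatAt f ρ : ℝ) / ((2 : ℝ) ^ k) ^ 2 := by
    refine sum_le_sum fun ρ hρ => ?_
    have hk := (mem_filter.mp hρ).2
    bound
  refine h3.trans ?_
  rw [← Finset.sum_div]
  have h4 : ∑ ρ ∈ G, (analyticOrderNatAt f ρ : ℝ) ≤ K * ((2 : ℝ) ^ (k + 1)) ^ (3 / 2 : ℝ) := by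
    refine le_trans ?_ (h _ (one_le_pow₀ (by norm_num)))
    have : (G.map (Function.Embedding.subtype _)) ⊆ zerosIn f ((2 : ℝ) ^ (k + 1)) := by
      intro z hz
      obtain ⟨ρ, hρ, rfl⟩ := Finset.mem_map.mp hz
      have hk := (mem_filter.mp hρ).2
      rw [mem_zerosIn hf hc]
      exact ⟨ρ.2, hk ▸ hup ρ⟩
    have h5 := Finset.sum_le_sum_of_subset (f := fun a => analyticOrderNatAt f a) this
    rw [Finset.sum_map] at h5
    exact_mod_cast h5
  have e : ((2 : ℝ) ^ (k + 1)) ^ (3 / 2 : ℝ) =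
      (2 : ℝ) ^ (3 / 2 : ℝ) * ((2 : ℝ) ^ (-(1 / 2) : ℝ)) ^ k * ((2 : ℝ) ^ k) ^ 2 := by
    rw [← rpow_natCast ((2 : ℝ) ^ (-(1 / 2) : ℝ)), ← rpow_mul (by norm_num),
      ← rpow_natCast 2 k, ← rpow_natCast 2 (k + 1), ← rpow_natCast _ 2,
      ← rpow_mul (by norm_num), ← rpow_mul (by norm_num), ← rpow_add (by norm_num),
      ← rpow_add (by norm_num)]
    grind
  rw [div_le_iff₀ (by positivity)]
  nlinarith

lemma hasDerivAt_logDeriv_prod {S : Finset ℂ} {m : ℂ → ℕ} {s : ℂ} (hs : ∀ a ∈ S, s ≠ a) :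
    HasDerivAt (fun z => ∑ a ∈ S, (m a : ℂ) / (z - a)) (-∑ a ∈ S, (m a : ℂ) / (s - a) ^ 2) s := by
  rw [← sum_neg_distrib]
  refine HasDerivAt.fun_sum fun a ha => ?_
  have h0 : s - a ≠ 0 := by grind
  have h := (((hasDerivAt_id s).sub_const a).fun_inv h0).const_mul (m a : ℂ)
  grind

lemma logDeriv_prod_mul {S : Finset ℂ} {m : ℂ → ℕ} {g : ℂ → ℂ} (hg : Differentiable ℂ g) {s : ℂ}
    (hs : ∀ a ∈ S, s ≠ a) (hgs : g s ≠ 0) :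
    logDeriv (fun z => (∏ a ∈ S, (z - a) ^ m a) * g z) s =
      ∑ a ∈ S, (m a : ℂ) / (s - a) + logDeriv g s := by
  have h0 : ∀ a ∈ S, (s - a) ^ m a ≠ 0 := fun a ha => pow_ne_zero _ (sub_ne_zero.mpr (hs a ha))
  rw [logDeriv_mul (f := fun z => ∏ a ∈ S, (z - a) ^ m a) s (prod_ne_zero_iff.mpr h0) hgs (by fun_prop) (hg s)]
  congr 1
  rw [logDeriv_prod h0 (fun a _ => by fun_prop)]
  refine sum_congr rfl fun a ha => ?_
  rw [logDeriv_fun_pow (by fun_prop)]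
  simp [logDeriv_apply, div_eq_mul_inv]

/-- A zero-free function bounded on a disc has a small second logarithmic derivative at the
centre. -/
lemma norm_deriv_logDeriv_le {g : ℂ → ℂ} (hg : Differentiable ℂ g) {s : ℂ} {r A : ℝ} (hr : 0 < r)
    (hA : 0 < A) (h0 : ∀ z ∈ ball s (2 * r), g z ≠ 0)
    (hb : ∀ z ∈ ball s (2 * r), ‖g z‖ ≤ exp A * ‖g s‖) :
    ‖deriv (logDeriv g) s‖ ≤ 4 * A / r ^ 2 := by
  have hs : s ∈ ball s (2 * r) := by simp_all
  have hld : DifferentiableOn ℂ (logDeriv g) (ball s (2 * r)) := fun z hz =>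
    ((hg.deriv z).div (hg z) (h0 z hz)).differentiableWithinAt
  -- `L` is the branch of `log (g / g(s))` vanishing at `s`. Its real part is at most `A`, so
  -- Borel–Carathéodory gives `|L| ≤ 2A` on the circle of radius `r`, and Cauchy's estimate for the
  -- second derivative gives `2! · 2A / r²`.
  obtain ⟨L, hLs, hL⟩ := (hld.isExactOn_ball).with_val_at s 0
  have hexp : ∀ z ∈ ball s (2 * r), g z = g s * cexp (L z) := by
    have hd : ∀ z ∈ ball s (2 * r), HasDerivAt (fun z => g z * cexp (-L z)) 0 z := by
      intro z hz
      have h1 := (hg z).hasDerivAt.mul (hL z hz).neg.cexp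
      have h2 : deriv g z * cexp ((-L) z) + g z * (cexp ((-L) z) * -logDeriv g z)
          = 0 := by
        rw [logDeriv_apply]
        grind
      rw [h2] at h1
      exact h1
    intro z hz
    have h2 := (convex_ball s (2 * r)).is_const_of_fderivWithin_eq_zero (𝕜 := ℂ)
      (f := fun z => g z * cexp (-L z))
      (fun w hw => (hd w hw).differentiableAt.differentiableWithinAt)
      (fun w hw => by
        rw [fderivWithin_of_isOpen isOpen_ball hw, (hd w hw).hasFDerivAt.fderiv]
        ext; simp) hz hs
    simp only [hLs, neg_zero, Complex.exp_zero, mul_one] at h2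
    rw [← h2, mul_assoc, ← Complex.exp_add]
    simp
  have hre : ∀ z ∈ ball s (2 * r), (L z).re ≤ A := by
    intro z hz
    have h1 := hb z hz
    rw [hexp z hz, norm_mul, norm_exp, mul_comm] at h1
    exact exp_le_exp.mp (le_of_mul_le_mul_right h1 (norm_pos_iff.mpr (h0 s hs)))
  have hmem : ∀ w : ℂ, w ∈ ball (0 : ℂ) (2 * r) → s + w ∈ ball s (2 * r) := by simp
  have hLdiff : DifferentiableOn ℂ L (ball s (2 * r)) := fun z hz =>
    (hL z hz).differentiableAt.differentiableWithinAt
  have hbc : ∀ z ∈ sphere s r, ‖L z‖ ≤ 2 * A := by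
    intro z hz
    have hz' : ‖z - s‖ = r := by simpa [] using hz
    have h1 := Complex.borelCaratheodory_zero (f := fun w => L (s + w)) (z := z - s) (R := 2 * r) hA
      (hLdiff.comp (by fun_prop) hmem) (fun w hw => hre _ (hmem w hw)) (by positivity)
      (by rw [mem_ball_zero_iff, hz']; linarith) (by grind)
    simp only [add_sub_cancel, hz'] at h1
    refine h1.trans (le_of_eq ?_)
    grind
  have h2 := Complex.norm_iteratedDeriv_le_of_forall_mem_sphere_norm_le 2 hr
    ((hLdiff.mono (closedBall_subset_ball (by linarith))).diffContOnCl_ball (subset_refl _)) hbc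
  have h3 : iteratedDeriv 2 L s = deriv (logDeriv g) s := by
    rw [iteratedDeriv_succ, iteratedDeriv_one]
    refine Filter.EventuallyEq.deriv_eq ?_
    filter_upwards [isOpen_ball.mem_nhds hs] with z hz using (hL z hz).deriv
  rw [h3] at h2
  refine h2.trans (le_of_eq ?_)
  ring

/-- Partial fractions for the second logarithmic derivative of an entire function of order at most
`3/2`. -/
theorem deriv_logDeriv_eq_tsum {f : ℂ → ℂ} (hf : Differentiable ℂ f) {C : ℝ}
    (hC : GrowthBound f C) {s : ℂ} (hs : f s ≠ 0) :
    deriv (logDeriv f) s = -∑' ρ : {z | f z = 0}, (analyticOrderNatAt f ρ : ℂ) / (s - ρ) ^ 2 := by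
  classical
  have hsum0 := summable_zeros hf hs hC
  have hfin := finite_zeros_inter_closedBall hf hs (1 + 2 * ‖s‖)
  have hsum : Summable fun ρ : {z | f z = 0} => (analyticOrderNatAt f ρ : ℂ) / (s - ρ) ^ 2 := by
    refine Summable.of_norm_bounded_eventually (hsum0.mul_left 16) ?_
    have hfin' : {ρ : {z | f z = 0} | ‖(ρ : ℂ)‖ ≤ 1 + 2 * ‖s‖}.Finite := by
      refine Set.Finite.of_finite_image (f := Subtype.val) (hfin.subset ?_)
        Subtype.val_injective.injOn
      rintro _ ⟨ρ, hρ, rfl⟩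
      simp_all
    refine Filter.mem_of_superset hfin'.compl_mem_cofinite ?_
    intro ρ hρ
    have hρ' : 1 + 2 * ‖s‖ < ‖(ρ : ℂ)‖ := by grind
    have h1 : (1 + ‖(ρ : ℂ)‖) / 4 ≤ ‖s - ρ‖ := by
      have := norm_sub_norm_le (ρ : ℂ) s
      rw [norm_sub_rev] at this
      linarith [norm_nonneg s]
    show ‖_‖ ≤ _
    rw [norm_div, norm_pow, Complex.norm_natCast]
    calc (analyticOrderNatAt f ρ : ℝ) / ‖s - ρ‖ ^ 2
        ≤ (analyticOrderNatAt f ρ : ℝ) / ((1 + ‖(ρ : ℂ)‖) / 4) ^ 2 := by gcongr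
      _ = _ := by grind
  set T : ℕ → Finset {z | f z = 0} := fun N => (zerosIn f N).subtype _ with hT
  have hTtop : Tendsto T atTop atTop := by
    refine tendsto_atTop_finset_of_monotone ?_ ?_
    · intro a b hab ρ hρ
      simp only [hT, Finset.mem_subtype, mem_zerosIn hf hs] at hρ ⊢
      exact ⟨hρ.1, hρ.2.trans (by gcongr)⟩
    · intro ρ
      obtain ⟨N, hN⟩ := exists_nat_ge ‖(ρ : ℂ)‖
      exact ⟨N, by simp only [hT, Finset.mem_subtype, mem_zerosIn hf hs]; grind⟩
  have hlim : Tendsto (fun N => -∑ ρ ∈ T N, (analyticOrderNatAt f ρ : ℂ) / (s - ρ) ^ 2) atTop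
      (𝓝 (-∑' ρ : {z | f z = 0}, (analyticOrderNatAt f ρ : ℂ) / (s - ρ) ^ 2)) :=
    (hsum.hasSum.comp hTtop).neg
  refine tendsto_nhds_unique ?_ hlim
  rw [tendsto_iff_norm_sub_tendsto_zero]
  -- The sum over zeros in `|ρ| ≤ N` misses the truth by `(g'/g)'(s)`, `g` being the zero-free
  -- quotient. `norm_deriv_logDeriv_le` with `r = N/4` and `A ≍ N^{3/2}` bounds this by `N^{-1/2}`:
  -- order less than 2 is exactly what is needed.
  obtain ⟨K, hK0, hK⟩ : ∃ K, 0 < K ∧ ∀ N : ℕ, 1 + 2 * ‖s‖ ≤ N →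
      ‖(-∑ ρ ∈ T N, (analyticOrderNatAt f ρ : ℂ) / (s - ρ) ^ 2) - deriv (logDeriv f) s‖ ≤
        K * (N : ℝ) ^ (-(1 / 2) : ℝ) := by
    refine ⟨64 * ((|C| + 1) * 6 ^ (3 / 2 : ℝ) + |log ‖f s‖|), by positivity, ?_⟩
    intro N hN
    have hN1 : (1 : ℝ) ≤ N := by linarith [norm_nonneg s]
    have hN0 : (0 : ℝ) < N := by linarith
    set M := exp ((|C| + 1) * 6 ^ (3 / 2 : ℝ) * (N : ℝ) ^ (3 / 2 : ℝ)) with hM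
    have hMb : ∀ z, ‖z‖ ≤ 5 * (N : ℝ) → ‖f z‖ ≤ M := by
      intro z hz
      refine (hC z).trans (exp_le_exp.mpr ?_)
      rw [mul_assoc, ← mul_rpow (by norm_num) (by linarith)]
      exact mul_le_mul (by grind) (rpow_le_rpow (by positivity)
        (by linarith) (by norm_num)) (by positivity) (by positivity)
    obtain ⟨g, hg, hg0, hfg, hgM⟩ := exists_zerosIn_quotient hf hs hN0 hMb
    have hsN : ‖s‖ ≤ N := by linarith
    have hsS : ∀ a ∈ zerosIn f N, s ≠ a := by
      rintro a ha rfl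
      exact hs ((mem_zerosIn hf hs).mp ha).1
    have hTS : ∑ ρ ∈ T N, (analyticOrderNatAt f ρ : ℂ) / (s - ρ) ^ 2 =
        ∑ a ∈ zerosIn f N, (analyticOrderNatAt f a : ℂ) / (s - a) ^ 2 := by
      refine Finset.sum_subtype_of_mem (p := fun z => z ∈ {z | f z = 0})
        (fun a => (analyticOrderNatAt f a : ℂ) / (s - a) ^ 2) ?_
      intro a ha
      exact ((mem_zerosIn hf hs).mp ha).1
    have hgs : g s ≠ 0 := hg0 s hsN
    have hev : logDeriv f =ᶠ[𝓝 s] fun z =>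
        ∑ a ∈ zerosIn f N, (analyticOrderNatAt f a : ℂ) / (z - a) + logDeriv g z := by
      have h1 : ∀ᶠ z in 𝓝 s, f z ≠ 0 := hf.continuous.continuousAt.eventually_ne hs
      have h2 : ∀ᶠ z in 𝓝 s, g z ≠ 0 := hg.continuous.continuousAt.eventually_ne hgs
      filter_upwards [h1, h2] with z hz1 hz2
      conv_lhs => rw [show f = _ from funext hfg]
      exact logDeriv_prod_mul hg (by
        rintro a ha rfl
        exact hz1 ((mem_zerosIn hf hs).mp ha).1) hz2
    have hld : DifferentiableAt ℂ (logDeriv g) s :=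
      (hg.deriv s).div (hg s) hgs
    have hder : deriv (logDeriv f) s =
        -(∑ a ∈ zerosIn f N, (analyticOrderNatAt f a : ℂ) / (s - a) ^ 2) +
          deriv (logDeriv g) s := by
      rw [hev.deriv_eq]
      exact ((hasDerivAt_logDeriv_prod hsS).add hld.hasDerivAt).deriv
    rw [hTS, hder, sub_add_cancel_left, norm_neg]
    set n := ∑ a ∈ zerosIn f N, analyticOrderNatAt f a
    have hfs : 0 < ‖f s‖ := by positivity
    have hball : ∀ z ∈ ball s (2 * ((N : ℝ) / 4)), ‖z‖ ≤ N := by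
      intro z hz
      have h1 : ‖z - s‖ < 2 * ((N : ℝ) / 4) := by simpa [dist_eq_norm] using hz
      have h2 := norm_le_norm_add_norm_sub' z s
      linarith
    -- The power `(4N)^n` appears here and in the upper bound for `g`, so it cancels from the ratio
    -- `|g(z)| / |g(s)|`; the number of zeros never enters.
    have hfg' : ‖f s‖ ≤ (4 * N) ^ n * ‖g s‖ := by
      rw [hfg s, norm_mul, norm_prod]
      gcongr
      rw [← Finset.prod_pow_eq_pow_sum]
      refine prod_le_prod (fun _ _ => by positivity) fun a ha => ?_
      rw [norm_pow]
      have := ((mem_zerosIn hf hs).mp ha).2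
      gcongr
      calc ‖s - a‖ ≤ ‖s‖ + ‖a‖ := norm_sub_le _ _
        _ ≤ 4 * N := by linarith
    set A := ((|C| + 1) * 6 ^ (3 / 2 : ℝ) + |log ‖f s‖|) * (N : ℝ) ^ (3 / 2 : ℝ) with hA
    have hN32 : 1 ≤ (N : ℝ) ^ (3 / 2 : ℝ) := one_le_rpow hN1 (by norm_num)
    have hMA : M ≤ exp A * ‖f s‖ := by
      rw [← exp_log hfs, ← exp_add, hM, exp_le_exp, hA]
      nlinarith [neg_abs_le (log ‖f s‖), abs_nonneg (log ‖f s‖)]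
    have hfin := norm_deriv_logDeriv_le hg (s := s) (r := (N : ℝ) / 4) (A := A) (by positivity)
      (by positivity) (fun z hz => hg0 z (hball z hz)) (fun z hz => by
        have h1 := hgM z (by grind)
        have h2 : (0 : ℝ) < (4 * N) ^ n := by positivity
        refine le_of_mul_le_mul_left ?_ h2
        calc (4 * (N : ℝ)) ^ n * ‖g z‖ ≤ M := h1
          _ ≤ exp A * ‖f s‖ := hMA
          _ ≤ exp A * ((4 * N) ^ n * ‖g s‖) := by gcongr
          _ = _ := by ring)
    refine hfin.trans (le_of_eq ?_)
    have e : (N : ℝ) ^ (3 / 2 : ℝ) = (N : ℝ) ^ (-(1 / 2) : ℝ) * (N : ℝ) ^ 2 := by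
      rw [← rpow_natCast, ← rpow_add hN0]; norm_num
    grind
  refine squeeze_zero' (.of_forall fun _ => norm_nonneg _) ?_
    (g := fun N : ℕ => K * (N : ℝ) ^ (-(1 / 2) : ℝ)) ?_
  · filter_upwards [tendsto_natCast_atTop_atTop.eventually_ge_atTop (1 + 2 * ‖s‖)] with N hN
    bound
  · have := ((tendsto_rpow_neg_atTop (y := 1 / 2) (by norm_num)).comp
      (tendsto_natCast_atTop_atTop (R := ℝ))).const_mul K
    lia

/-! ### Growth of Dirichlet `L`-functions -/

section growth

variable {N : ℕ} [NeZero N]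

lemma sum_range_zmod (f : ZMod N → ℂ) : ∑ x ∈ Finset.range N, f (x : ZMod N) = ∑ j, f j := by
  refine Finset.sum_nbij' (fun x : ℕ => (x : ZMod N)) (fun j => j.val) ?_ ?_ ?_ ?_ ?_
  · simp
  · grind
  · intro x hx; exact ZMod.val_cast_of_lt (by grind)
  · simp
  · simp

/-- Sums over complete residue systems vanish, so the partial sums are periodic in their length and
take finitely many values. -/
lemma exists_bound_sum_range_zmod {Φ : ZMod N → ℂ} (hΦ : ∑ j, Φ j = 0) :
    ∃ B, 0 ≤ B ∧ ∀ n : ℕ, ‖∑ k ∈ Finset.Icc 1 n, Φ (k : ZMod N)‖ ≤ B := by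
  set f : ℕ → ℂ := fun n => ∑ k ∈ Finset.range n, Φ (k : ZMod N) with hf
  have hper : Function.Periodic f N := by
    intro n
    simp only [hf]
    rw [Finset.sum_range_add]
    have : ∑ x ∈ Finset.range N, Φ ((n + x : ℕ) : ZMod N) = 0 := by
      have h1 := sum_range_zmod (N := N) fun j => Φ (n + j)
      push_cast
      rw [h1, ← hΦ]
      exact Fintype.sum_equiv (Equiv.addLeft (n : ZMod N)) _ _ fun _ => rfl
    grind
  have hb : ∀ n, ‖f n‖ ≤ ∑ i ∈ Finset.range N, ‖f i‖ := by
    intro n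
    rw [← hper.map_mod_nat n]
    exact Finset.single_le_sum (f := fun i => ‖f i‖) (fun _ _ => norm_nonneg _)
      (Finset.mem_range.mpr (Nat.mod_lt _ (NeZero.pos N)))
  refine ⟨∑ i ∈ Finset.range N, ‖f i‖ + ‖Φ 0‖, by positivity, fun n => ?_⟩
  have h2 : ∑ k ∈ Finset.Icc 1 n, Φ (k : ZMod N) = f (n + 1) - Φ 0 := by
    simp only [hf]
    rw [Finset.range_eq_Ico, Finset.sum_eq_sum_Ico_succ_bot (by omega)]
    simp only [Nat.cast_zero, add_sub_cancel_left]
    rfl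
  rw [h2]
  exact (norm_sub_le _ _).trans (by grind)

/-- Abel summation proves this for `Re s > 1`. The integral is the Mellin transform, at `-s`, of a
bounded function vanishing on `t ≤ 1`, hence analytic in `Re s > 0`, and the identity continues. -/
lemma LFunction_eq_mul_mellin {Φ : ZMod N → ℂ} (hΦ : ∑ j, Φ j = 0) {s : ℂ} (hs : 0 < s.re) :
    ZMod.LFunction Φ s =
      s * ∫ t in Ioi (1 : ℝ), (∑ k ∈ Finset.Icc 1 ⌊t⌋₊, Φ (k : ZMod N)) * (t : ℂ) ^ (-(s + 1)) := by
  obtain ⟨B, hB, hS⟩ := exists_bound_sum_range_zmod hΦ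
  set S : ℝ → ℂ := fun t => ∑ k ∈ Finset.Icc 1 ⌊t⌋₊, Φ (k : ZMod N) with hSdef
  have hSm : Measurable S :=
    (measurable_from_nat (f := fun n => ∑ k ∈ Finset.Icc 1 n, Φ (k : ZMod N))).comp
      Nat.measurable_floor
  set F : ℝ → ℂ := (Ioi 1).indicator S with hF
  have hFm : Measurable F := hSm.indicator measurableSet_Ioi
  have hFb : ∀ t, ‖F t‖ ≤ B := by
    intro t
    by_cases ht : t ∈ Ioi (1 : ℝ)
    · simp_all
    simp_all
  have hintg : ∀ s : ℂ, ∫ t in Ioi (1 : ℝ), S t * (t : ℂ) ^ (-(s + 1)) = mellin F (-s) := by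
    intro s
    rw [mellin, ← integral_indicator measurableSet_Ioi, ← integral_indicator measurableSet_Ioi]
    congr 1
    ext t
    by_cases ht : t ∈ Ioi (1 : ℝ)
    · have ht0 : t ∈ Ioi (0 : ℝ) := by grind
      rw [indicator_of_mem ht, indicator_of_mem ht0, hF, indicator_of_mem ht, smul_eq_mul, mul_comm]
      ring
    · simp only [hF, indicator_apply] at ht ⊢
      simp [ht]
  have hdiff : DifferentiableOn ℂ (fun s => s * mellin F (-s)) {s | 0 < s.re} := by
    intro s hs
    have h1 : DifferentiableAt ℂ (mellin F) (-s) := by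
      refine mellin_differentiableAt_of_isBigO_rpow (a := 0) (b := (-s).re - 1) ?_ ?_ (by simp_all) ?_ (by linarith)
      · refine LocallyIntegrable.locallyIntegrableOn ?_ _
        exact (locallyIntegrable_const B).mono hFm.aestronglyMeasurable
          (.of_forall fun t => (hFb t).trans (le_abs_self B))
      · refine IsBigO.of_bound B (.of_forall fun t => ?_)
        simp_all
      · refine IsBigO.of_bound 0 ?_
        filter_upwards [Ioo_mem_nhdsGT (one_pos)] with t ht
        simp_all
    exact (differentiableAt_id.mul (h1.comp s differentiableAt_id.neg)).differentiableWithinAt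
  have hopen : IsOpen {s : ℂ | 0 < s.re} := isOpen_lt continuous_const continuous_re
  have hconn : IsPreconnected {s : ℂ | 0 < s.re} := (convex_halfSpace_re_gt 0).isPreconnected
  have heq : EqOn (ZMod.LFunction Φ) (fun s => s * mellin F (-s)) {s | 0 < s.re} := by
    refine AnalyticOnNhd.eqOn_of_preconnected_of_eventuallyEq (z₀ := 2)
      (fun z _ => (ZMod.differentiable_LFunction_of_sum_zero hΦ).analyticAt z)
      (hdiff.analyticOnNhd hopen) hconn (by simp) ?_
    have h1 : {s : ℂ | 1 < s.re} ∈ 𝓝 (2 : ℂ) :=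
      (isOpen_lt continuous_const continuous_re).mem_nhds (by simp)
    filter_upwards [h1] with s hs
    rw [ZMod.LFunction_eq_LSeries Φ hs, ← hintg]
    refine LSeries_eq_mul_integral _ le_rfl (one_pos.trans hs)
      (ZMod.LSeriesSummable_of_one_lt_re Φ hs) ?_
    refine IsBigO.of_bound B (.of_forall fun n => ?_)
    simp_all
  rw [heq hs, hintg]

lemma norm_zmod_LFunction_le {Φ : ZMod N → ℂ} (hΦ : ∑ j, Φ j = 0) :
    ∃ B, 0 ≤ B ∧ ∀ s : ℂ, 1 / 2 ≤ s.re → ‖ZMod.LFunction Φ s‖ ≤ B * ‖s‖ := by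
  obtain ⟨B, hB, hS⟩ := exists_bound_sum_range_zmod hΦ
  refine ⟨2 * B, by positivity, fun s hs => ?_⟩
  rw [LFunction_eq_mul_mellin hΦ (by linarith), norm_mul, mul_comm]
  gcongr
  have h1 : ∀ᵐ t : ℝ ∂(volume.restrict (Ioi (1 : ℝ))),
      ‖(∑ k ∈ Finset.Icc 1 ⌊t⌋₊, Φ (k : ZMod N)) * (t : ℂ) ^ (-(s + 1))‖ ≤
        B * t ^ (-(3 / 2) : ℝ) := by
    refine (ae_restrict_iff' measurableSet_Ioi).mpr (.of_forall fun t ht => ?_)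
    have ht1 : (1 : ℝ) < t := ht
    rw [norm_mul, norm_cpow_eq_rpow_re_of_pos (by linarith)]
    refine mul_le_mul (hS _) (rpow_le_rpow_of_exponent_le ht1.le ?_) (by positivity) hB
    simp; linarith
  refine (norm_integral_le_of_norm_le
    ((integrableOn_Ioi_rpow_of_lt (by norm_num) one_pos).const_mul B) h1).trans (le_of_eq ?_)
  rw [integral_const_mul, integral_Ioi_rpow_of_lt (by norm_num) one_pos]
  ring

lemma norm_Gamma_le {s : ℂ} (hs : 0 < s.re) : ‖Complex.Gamma s‖ ≤ Gamma s.re := by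
  rw [Complex.Gamma_eq_integral hs, Gamma_eq_integral hs, Complex.GammaIntegral]
  refine (norm_integral_le_integral_norm _).trans (le_of_eq ?_)
  refine setIntegral_congr_fun measurableSet_Ioi fun t ht => ?_
  have ht0 : (0 : ℝ) < t := ht
  simp [norm_cpow_eq_rpow_re_of_pos ht0, norm_exp]

/-- A crude Stirling bound: `n! ≤ n^n` and `log n ≤ 2 √n`. This is where the exponent `3/2` of
`GrowthBound` originates; the argument needs only some exponent below 2. -/
lemma Gamma_le_exp {σ : ℝ} (hσ : 1 / 2 ≤ σ) : Gamma σ ≤ exp (1 + 2 * (σ + 3) ^ (3 / 2 : ℝ)) := by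
  have h1 : Gamma (σ + 2) = (σ + 1) * σ * Gamma σ := by
    rw [show σ + 2 = (σ + 1) + 1 by ring, Gamma_add_one (by linarith), Gamma_add_one (by linarith)]
    ring
  have hpos : 0 < Gamma σ := by positivity
  have h2 : Gamma σ ≤ 2 * Gamma (σ + 2) := by
    nlinarith [mul_nonneg (by linarith : (0:ℝ) ≤ σ - 1/2) (by linarith : (0:ℝ) ≤ σ + 1)]
  set n := ⌈σ + 1⌉₊
  have hn1 : σ + 1 ≤ n := by bound
  have hn2 : (n : ℝ) < σ + 2 := by
    have := Nat.ceil_lt_add_one (by linarith : 0 ≤ σ + 1)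
    linarith
  have h3 : Gamma (σ + 2) ≤ Gamma (n + 1) :=
    Gamma_strictMonoOn_Ici.monotoneOn (by grind) (by grind) (by linarith)
  rw [Gamma_nat_eq_factorial] at h3
  have h4 : (n.factorial : ℝ) ≤ (n : ℝ) ^ n := mod_cast Nat.factorial_le_pow n
  have hn0 : (0 : ℝ) < n := by linarith
  have h5 : (n : ℝ) ^ n ≤ exp (2 * (σ + 3) ^ (3 / 2 : ℝ)) := by
    rw [← exp_log (pow_pos hn0 n), log_pow]
    refine exp_le_exp.mpr ?_
    have h6 := log_le_rpow_div hn0.le (ε := 1 / 2) (by norm_num)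
    have h7 : (n : ℝ) * (n : ℝ) ^ (1 / 2 : ℝ) = (n : ℝ) ^ (3 / 2 : ℝ) := by
      nth_rw 1 [← rpow_one (n : ℝ)]
      rw [← rpow_add hn0]; norm_num
    have h8 : (n : ℝ) ^ (3 / 2 : ℝ) ≤ (σ + 3) ^ (3 / 2 : ℝ) :=
      rpow_le_rpow hn0.le (by linarith) (by norm_num)
    nlinarith
  have h2e : (2 : ℝ) ≤ exp 1 := by
    have := add_one_le_exp (1 : ℝ); linarith
  rw [exp_add]
  nlinarith

/-- Dirichlet `L`-functions of non-trivial characters have order at most `3/2`. -/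
theorem exists_growthBound_LFunction {χ : DirichletCharacter ℂ N} (hχ : χ ≠ 1) :
    ∃ C, GrowthBound χ.LFunction C := by
  have hN : N ≠ 1 := hχ ∘ DirichletCharacter.level_one' _
  have h0 : χ 0 = 0 := χ.map_zero' hN
  have hsum : ∑ j, χ j = 0 := χ.sum_eq_zero_of_ne_one hχ
  -- Fourier inversion at 0: the transform sums to a multiple of `Φ 0`. Since `χ 0 = 0`, both
  -- `L`-functions on the far side of the functional equation also have coefficients of sum zero.
  have hdft : ∀ Φ : ZMod N → ℂ, Φ 0 = 0 → ∑ j, ZMod.dft Φ j = 0 := by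
    intro Φ hΦ
    have := congrFun (ZMod.dft_dft Φ) 0
    rw [ZMod.dft_apply] at this
    simp_all
  obtain ⟨B₀, hB₀, h₀⟩ := norm_zmod_LFunction_le hsum
  obtain ⟨B₁, hB₁, h₁⟩ := norm_zmod_LFunction_le (hdft χ h0)
  obtain ⟨B₂, hB₂, h₂⟩ := norm_zmod_LFunction_le (hdft (fun x => χ (-x)) (by simp_all))
  have hN1 : (1 : ℝ) ≤ N := mod_cast NeZero.one_le
  have hlogN : 0 ≤ log N := by bound
  have hrr : ∀ z : ℂ, (1 + ‖z‖) ≤ (1 + ‖z‖) ^ (3 / 2 : ℝ) := by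
    intro z
    nth_rw 1 [← rpow_one (1 + ‖z‖)]
    bound
  refine ⟨log N + 17 + 8 * 2 + 2 + (B₀ + B₁ + B₂), fun z => ?_⟩
  have hr := hrr z
  set r := (1 + ‖z‖) ^ (3 / 2 : ℝ)
  have hr1 : 1 ≤ r := by linarith [norm_nonneg z]
  have hzr : ‖z‖ ≤ r := by linarith
  have hlin : ∀ B : ℝ, 0 ≤ B → B ≤ exp B := fun B _ => by
    have := add_one_le_exp B; linarith
  rcases le_total (1 / 2) z.re with hz | hz
  · calc ‖χ.LFunction z‖ ≤ B₀ * ‖z‖ := h₀ z hz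
      _ ≤ exp B₀ * exp r := by
        refine mul_le_mul (hlin _ hB₀) (hzr.trans (hlin r (by linarith))) (norm_nonneg _)
          (exp_nonneg _)
      _ ≤ _ := by
        rw [← exp_add]
        refine exp_le_exp.mpr ?_
        nlinarith
  -- The left half plane is reflected to `Re s ≥ 1/2`. Each factor of the functional equation, the
  -- Gamma factor included, is bounded by the exponential of a multiple of `r`.
  · set s := 1 - z with hs
    have hsre : 1 / 2 ≤ s.re := by simp [hs]; linarith
    have hsn : ‖s‖ ≤ 1 + ‖z‖ := by simpa using norm_sub_le (1 : ℂ) z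
    have hσ : s.re ≤ 1 + ‖z‖ := (re_le_norm s).trans hsn
    have hfe := ZMod.LFunction_one_sub (χ : ZMod N → ℂ) (s := s)
      (fun n h => by rw [h] at hsre; simp at hsre; linarith)
      (Or.inl h0)
    have e1 : ‖(N : ℂ) ^ (s - 1)‖ ≤ exp (log N * r) := by
      rw [show (N : ℂ) = ((N : ℝ) : ℂ) by simp, norm_cpow_eq_rpow_re_of_pos (by linarith),
        rpow_def_of_pos (by linarith)]
      refine exp_le_exp.mpr (mul_le_mul_of_nonneg_left ?_ hlogN)
      simp; linarith
    have e2 : ‖(2 * (π : ℂ)) ^ (-s)‖ ≤ 1 := by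
      rw [show (2 * (π : ℂ)) = ((2 * π : ℝ) : ℂ) by simp,
        norm_cpow_eq_rpow_re_of_pos (by positivity)]
      refine rpow_le_one_of_one_le_of_nonpos (by linarith [pi_gt_three]) ?_
      simp; linarith
    have e3 : ‖Complex.Gamma s‖ ≤ exp (17 * r) := by
      refine (norm_Gamma_le (by linarith)).trans ((Gamma_le_exp hsre).trans (exp_le_exp.mpr ?_))
      have h1 : (s.re + 3) ^ (3 / 2 : ℝ) ≤ (4 * (1 + ‖z‖)) ^ (3 / 2 : ℝ) :=
        rpow_le_rpow (by linarith) (by linarith [norm_nonneg z]) (by norm_num)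
      rw [mul_rpow (by norm_num) (by positivity)] at h1
      linarith
    have e4 : ∀ w : ℂ, ‖w‖ ≤ 2 * r → ‖cexp w‖ ≤ exp (2 * r) := fun w hw => by
      rw [norm_exp]
      exact exp_le_exp.mpr ((re_le_norm w).trans hw)
    have hpi : ‖(π : ℂ) * Complex.I * s / 2‖ ≤ 2 * r := by
      simp only [norm_div, norm_mul, norm_real, Complex.norm_I, norm_eq_abs, abs_of_pos pi_pos, Complex.norm_ofNat]
      nlinarith [pi_le_four, norm_nonneg s]
    have hpi' : ‖-(π : ℂ) * Complex.I * s / 2‖ ≤ 2 * r := by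
      rw [show -(π : ℂ) * Complex.I * s / 2 = -((π : ℂ) * Complex.I * s / 2) by ring, norm_neg]
      exact hpi
    have e5 : ‖cexp ((π : ℂ) * Complex.I * s / 2) * ZMod.LFunction (ZMod.dft χ) s +
        cexp (-(π : ℂ) * Complex.I * s / 2) * ZMod.LFunction (ZMod.dft fun x => χ (-x)) s‖ ≤
        exp (2 * r) * (exp (B₁ + B₂) * exp r) := by
      refine (norm_add_le _ _).trans ?_
      rw [norm_mul, norm_mul]
      have := h₁ s hsre
      have := h₂ s hsre
      calc _ ≤ exp (2 * r) * (B₁ * ‖s‖) + exp (2 * r) * (B₂ * ‖s‖) := by bound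
        _ = exp (2 * r) * ((B₁ + B₂) * ‖s‖) := by ring
        _ ≤ _ := by
            gcongr
            · grind
            grind
    have hz' : χ.LFunction z = ZMod.LFunction χ (1 - s) := by rw [hs]; simp [DirichletCharacter.LFunction]
    rw [hz', hfe, norm_mul, norm_mul, norm_mul]
    calc _ ≤ exp (log N * r) * 1 * exp (17 * r) *
          (exp (2 * r) * (exp (B₁ + B₂) * exp r)) := by gcongr
      _ = exp (log N * r + 17 * r + 2 * r + (B₁ + B₂) + r) := by simp only [exp_add]; ring
      _ ≤ _ := by
        refine exp_le_exp.mpr ?_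
        nlinarith

end growth

/-! ### The exponential integral -/

/-- The exponential integral along the ray from `z` in the direction `η`. -/
def rayE (η z : ℂ) : ℂ :=
  ∫ t in Ioi (0 : ℝ), cexp (-(z + η * t)) / (z + η * t) * η

/-- The points whose ray in the direction `η` avoids the origin. -/
def rayDomain (η : ℂ) : Set ℂ := {z | z / η ∈ slitPlane}

lemma isOpen_rayDomain (η : ℂ) : IsOpen (rayDomain η) :=
  Complex.isOpen_slitPlane.preimage (continuous_id.div_const η)

lemma exists_lower_bound_slitPlane {ζ : ℂ} (hζ : ζ ∈ slitPlane) :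
    ∃ δ : ℝ, 0 < δ ∧ ∀ᶠ w : ℂ in 𝓝 ζ, ∀ t : ℝ, 0 ≤ t → δ ≤ ‖w + t‖ := by
  by_cases h : 0 < ζ.re
  · refine ⟨ζ.re / 2, by positivity, ?_⟩
    filter_upwards [(isOpen_lt continuous_const continuous_re).mem_nhds
      (show ζ.re / 2 < ζ.re by linarith)] with w hw t ht
    calc ζ.re / 2 ≤ (w + t).re := by simp; linarith
      _ ≤ _ := re_le_norm _
  · have him : ζ.im ≠ 0 := (mem_slitPlane_iff.mp hζ).resolve_left h
    refine ⟨|ζ.im| / 2, by positivity, ?_⟩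
    filter_upwards [(isOpen_lt continuous_const continuous_im.abs).mem_nhds
      (show |ζ.im| / 2 < |ζ.im| by grind)] with w hw t ht
    calc |ζ.im| / 2 ≤ |(w + t).im| := by simp; linarith
      _ ≤ _ := abs_im_le_norm _

lemma exists_lower_bound_rayDomain {η z : ℂ} (hη : η ≠ 0) (hz : z ∈ rayDomain η) :
    ∃ δ : ℝ, 0 < δ ∧ ∀ᶠ w : ℂ in 𝓝 z, ∀ t : ℝ, 0 ≤ t → δ ≤ ‖w + η * t‖ := by
  obtain ⟨δ, hδ, h⟩ := exists_lower_bound_slitPlane hz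
  refine ⟨‖η‖ * δ, by positivity, ?_⟩
  have h2 := ((continuous_id.div_const η).tendsto z).eventually h
  filter_upwards [h2] with w hw t ht
  have : w + η * t = η * (w / η + t) := by field_simp
  simp_all

lemma norm_exp_neg_ray (η z : ℂ) (t : ℝ) :
    ‖cexp (-(z + η * t))‖ = exp (-z.re) * exp (-η.re * t) := by
  rw [norm_exp, ← exp_add]
  simp
  ring

lemma tendsto_exp_div_ray {η z : ℂ} (hη : 0 < η.re) {δ : ℝ} (hδ : 0 < δ)
    (h : ∀ t : ℝ, 0 ≤ t → δ ≤ ‖z + η * t‖) :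
    Tendsto (fun t : ℝ => cexp (-(z + η * t)) / (z + η * t)) atTop (𝓝 0) := by
  refine squeeze_zero_norm' (a := fun t : ℝ => exp (-z.re) / δ * exp (-η.re * t)) ?_ ?_
  · filter_upwards [eventually_ge_atTop 0] with t ht
    rw [norm_div, norm_exp_neg_ray, div_mul_eq_mul_div]
    bound
  · have : Tendsto (fun t : ℝ => exp (-η.re * t)) atTop (𝓝 0) := by
      refine tendsto_exp_atBot.comp ?_
      exact (tendsto_const_mul_atBot_of_neg (by linarith)).mpr tendsto_id
    simpa using this.const_mul (exp (-z.re) / δ)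

/-- Differentiation under the integral sign. The `z`-derivative of the integrand equals the
`t`-derivative of `e^{-(z+ηt)} / (z+ηt)`, because the factor `η` of the line element supplies the
chain-rule factor; so the integral telescopes to its value at `t = 0`. -/
lemma hasDerivAt_rayE {η z : ℂ} (hη : 0 < η.re) (hz : z ∈ rayDomain η) :
    HasDerivAt (rayE η) (-(cexp (-z) / z)) z := by
  have hη0 : η ≠ 0 := fun h => by simp_all
  obtain ⟨δ, hδ, hev⟩ := exists_lower_bound_rayDomain hη0 hz
  obtain ⟨ε, hε, hball⟩ := Metric.eventually_nhds_iff_ball.mp hev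
  set s := ball z (min ε 1) with hs
  have hs_nhds : s ∈ 𝓝 z := ball_mem_nhds _ (by positivity)
  have hlow : ∀ w ∈ s, ∀ t : ℝ, 0 ≤ t → δ ≤ ‖w + η * t‖ := by simp_all
  have hre : ∀ w ∈ s, -w.re ≤ -z.re + 1 := by
    intro w hw
    have h1 : ‖w - z‖ < 1 := by
      have := ball_subset_ball (min_le_right ε 1) hw
      simpa [dist_eq_norm] using this
    have h2 := (abs_le.mp (Complex.abs_re_le_norm (w - z))).1
    simp at h2
    linarith
  have hzs : z ∈ s := by simp_all
  have hne : ∀ w ∈ s, ∀ t : ℝ, 0 ≤ t → w + η * t ≠ 0 := fun w hw t ht h0 => by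
    have := hlow w hw t ht
    rw [h0, norm_zero] at this
    linarith
  have hcontF : ∀ w ∈ s, ContinuousOn
      (fun t : ℝ => cexp (-(w + η * t)) / (w + η * t) * η) (Ioi 0) := by
    intro w hw t ht
    have := hne w hw t (le_of_lt ht)
    fun_prop
  set F' : ℂ → ℝ → ℂ := fun w t =>
    (-(cexp (-(w + η * t)) / (w + η * t)) -
      cexp (-(w + η * t)) / (w + η * t) ^ 2) * η with hF'
  have hder1 : ∀ w ∈ s, ∀ t : ℝ, 0 ≤ t →
      HasDerivAt (fun w => cexp (-(w + η * t)) / (w + η * t) * η) (F' w t) w := by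
    intro w hw t ht
    have h0 := hne w hw t ht
    have h1 : HasDerivAt (fun w : ℂ => w + η * t) 1 w := (hasDerivAt_id w).add_const _
    have h2 := ((h1.neg.cexp).div h1 h0).mul_const η
    refine h2.congr_deriv ?_
    simp only [hF', Pi.neg_apply]
    field_simp
  have hder2 : ∀ t : ℝ, t ∈ Ici (0 : ℝ) →
      HasDerivAt (fun t : ℝ => cexp (-(z + η * t)) / (z + η * t)) (F' z t) t := by
    intro t ht
    have h0 := hne z hzs t ht
    have h1 : HasDerivAt (fun t : ℝ => z + η * t) η t := by
      have := ((ofRealCLM.hasDerivAt (x := t)).const_mul η).const_add z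
      simpa using this
    have h2 := (h1.neg.cexp).div h1 h0
    refine h2.congr_deriv ?_
    simp only [hF', Pi.neg_apply]
    field_simp
  set bound : ℝ → ℝ := fun t =>
    exp (-z.re + 1) * (1 / δ + 1 / δ ^ 2) * ‖η‖ * exp (-η.re * t)
  have hbound_int : IntegrableOn bound (Ioi 0) :=
    (integrableOn_exp_mul_Ioi (by linarith : -η.re < 0) 0).const_mul _
  have hFbound : ∀ w ∈ s, ∀ t : ℝ, 0 ≤ t → ‖F' w t‖ ≤ bound t := by
    intro w hw t ht
    have h1 := hlow w hw t ht
    have h2 : ‖cexp (-(w + η * t))‖ ≤ exp (-z.re + 1) * exp (-η.re * t) := by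
      rw [norm_exp_neg_ray]
      bound
    rw [hF', norm_mul]
    calc _ ≤ (‖cexp (-(w + η * t))‖ / ‖w + η * t‖ +
          ‖cexp (-(w + η * t))‖ / ‖w + η * t‖ ^ 2) * ‖η‖ := by
          gcongr
          refine (norm_sub_le _ _).trans ?_
          simp
      _ ≤ (exp (-z.re + 1) * exp (-η.re * t) / δ +
          exp (-z.re + 1) * exp (-η.re * t) / δ ^ 2) * ‖η‖ := by gcongr
      _ = bound t := by ring
  have hFint : IntegrableOn (fun t : ℝ => cexp (-(z + η * t)) / (z + η * t) * η)
      (Ioi 0) := by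
    have hi : IntegrableOn (fun t : ℝ => exp (-z.re) / δ * ‖η‖ * exp (-η.re * t))
      (Ioi 0) := (integrableOn_exp_mul_Ioi (by linarith : -η.re < 0) 0).const_mul _
    refine hi.mono' ((hcontF z hzs).aestronglyMeasurable measurableSet_Ioi) ?_
    refine (ae_restrict_iff' measurableSet_Ioi).mpr (.of_forall fun t ht => ?_)
    rw [norm_mul, norm_div, norm_exp_neg_ray]
    calc _ ≤ exp (-z.re) * exp (-η.re * t) / δ * ‖η‖ := by
          gcongr
          grind
      _ = _ := by ring
  have hF'meas : AEStronglyMeasurable (F' z) (volume.restrict (Ioi 0)) := by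
    refine ContinuousOn.aestronglyMeasurable (fun t ht => ?_) measurableSet_Ioi
    have := hne z hzs t (le_of_lt ht)
    refine ContinuousAt.continuousWithinAt ?_
    fun_prop (disch := positivity)
  have hmain := hasDerivAt_integral_of_dominated_loc_of_deriv_le
    (F := fun w (t : ℝ) => cexp (-(w + η * t)) / (w + η * t) * η) (F' := F')
    (μ := volume.restrict (Ioi 0)) (x₀ := z) (bound := bound) hs_nhds
    (by filter_upwards [hs_nhds] with w hw using
      (hcontF w hw).aestronglyMeasurable measurableSet_Ioi)
    hFint hF'meas
    ((ae_restrict_iff' measurableSet_Ioi).mpr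
      (.of_forall fun t ht w hw => hFbound w hw t (le_of_lt ht)))
    hbound_int
    ((ae_restrict_iff' measurableSet_Ioi).mpr
      (.of_forall fun t ht w hw => hder1 w hw t (le_of_lt ht)))
  have hF'int : IntegrableOn (F' z) (Ioi 0) := hmain.1
  have hval : ∫ t in Ioi (0 : ℝ), F' z t = -(cexp (-z) / z) := by
    rw [integral_Ioi_of_hasDerivAt_of_tendsto' hder2 hF'int
      (tendsto_exp_div_ray hη hδ (hlow z hzs))]
    simp
  have := hmain.2
  rw [hval] at this
  exact this

lemma re_pos_mem_rayDomain {η z : ℂ} (hη : 0 < η.re) (hz : 0 < z.re) : z ∈ rayDomain η := by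
  have hη0 : η ≠ 0 := fun h => by simp_all
  by_contra h
  rw [rayDomain, mem_ofPred_eq, mem_slitPlane_iff] at h
  push Not at h
  have h1 : z = η * ((z / η).re : ℝ) := by
    have : z / η = ((z / η).re : ℝ) := by
      apply Complex.ext <;> simp [h.2]
    grind
  have h2 := congrArg Complex.re h1
  simp only [Complex.mul_re, ofReal_re, ofReal_im, mul_zero, sub_zero] at h2
  nlinarith

lemma norm_rayE_le {η z : ℂ} (hη : 0 < η.re) {δ : ℝ} (hδ : 0 < δ)
    (h : ∀ t : ℝ, 0 ≤ t → δ ≤ ‖z + η * t‖) :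
    ‖rayE η z‖ ≤ exp (-z.re) / δ * (‖η‖ / η.re) := by
  have hi : IntegrableOn (fun t : ℝ => exp (-z.re) / δ * ‖η‖ * exp (-η.re * t))
    (Ioi 0) := (integrableOn_exp_mul_Ioi (by linarith : -η.re < 0) 0).const_mul _
  refine (norm_integral_le_of_norm_le hi ?_).trans (le_of_eq ?_)
  · refine (ae_restrict_iff' measurableSet_Ioi).mpr (.of_forall fun t ht => ?_)
    rw [norm_mul, norm_div, norm_exp_neg_ray]
    calc _ ≤ exp (-z.re) * exp (-η.re * t) / δ * ‖η‖ := by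
          gcongr
          grind
      _ = _ := by ring
  · rw [integral_const_mul, integral_exp_mul_Ioi (by linarith : -η.re < 0)]
    simp
    field_simp

lemma norm_rayE_le_of_re_pos {η z : ℂ} (hη : 0 < η.re) (hz : 0 < z.re) :
    ‖rayE η z‖ ≤ exp (-z.re) / z.re * (‖η‖ / η.re) := by
  refine norm_rayE_le hη hz fun t ht => ?_
  calc z.re ≤ (z + η * t).re := by simp_all
    _ ≤ _ := re_le_norm _

/-- Exponential integrals along different rays agree on convex sets reaching to `+∞`. -/
lemma rayE_eq_of_convex {η₁ η₂ : ℂ} (h₁ : 0 < η₁.re) (h₂ : 0 < η₂.re) {s : Set ℂ}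
    (hs : Convex ℝ s) (ho : IsOpen s) (hs₁ : s ⊆ rayDomain η₁) (hs₂ : s ⊆ rayDomain η₂)
    {p : ℂ} (hp : ∀ x : ℝ, 0 ≤ x → p + x ∈ s) {z : ℂ} (hz : z ∈ s) : rayE η₁ z = rayE η₂ z := by
  have hd : ∀ w ∈ s, HasDerivAt (fun z => rayE η₁ z - rayE η₂ z) 0 w := fun w hw =>
    (sub_self (-(cexp (-w) / w))) ▸
      (hasDerivAt_rayE h₁ (hs₁ hw)).sub (hasDerivAt_rayE h₂ (hs₂ hw))
  have hconst : ∀ w ∈ s, rayE η₁ w - rayE η₂ w = rayE η₁ z - rayE η₂ z := fun w hw =>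
    hs.is_const_of_fderivWithin_eq_zero (𝕜 := ℂ) (f := fun z => rayE η₁ z - rayE η₂ z)
      (fun w hw => (hd w hw).differentiableAt.differentiableWithinAt)
      (fun w hw => by
        rw [fderivWithin_of_isOpen ho hw, (hd w hw).hasFDerivAt.fderiv]
        ext; simp) hw hz
  have hlim : ∀ η : ℂ, 0 < η.re → Tendsto (fun x : ℝ => rayE η (p + x)) atTop (𝓝 0) := by
    intro η hη
    refine squeeze_zero_norm' (a := fun x : ℝ => exp (-p.re) * exp (-x) * (‖η‖ / η.re)) ?_ ?_
    · filter_upwards [eventually_ge_atTop (1 - p.re), eventually_ge_atTop 0] with x hx hx0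
      have hre : (p + x).re = p.re + x := by simp
      have h1 : 1 ≤ (p + x).re := by linarith
      refine (norm_rayE_le_of_re_pos hη (by linarith)).trans ?_
      gcongr
      rw [← exp_add, hre, neg_add]
      bound
    · have := ((tendsto_exp_neg_atTop_nhds_zero.const_mul (exp (-p.re))).mul_const (‖η‖ / η.re))
      lia
  have h3 : Tendsto (fun x : ℝ => rayE η₁ (p + x) - rayE η₂ (p + x)) atTop (𝓝 0) := by
    simpa using (hlim η₁ h₁).sub (hlim η₂ h₂)
  have h4 : Tendsto (fun x : ℝ => rayE η₁ (p + x) - rayE η₂ (p + x)) atTop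
      (𝓝 (rayE η₁ z - rayE η₂ z)) := by
    refine tendsto_const_nhds.congr' ?_
    filter_upwards [eventually_ge_atTop 0] with x hx
    grind
  exact sub_eq_zero.mp (tendsto_nhds_unique h4 h3)

lemma rayDomain_one : rayDomain 1 = slitPlane := by simp [rayDomain]

lemma E₁_eq_rayE_one {z : ℂ} (hz : z ∈ slitPlane) : E₁ z = rayE 1 z := by simp [E₁, rayE, hz]

lemma im_pos_mem_rayDomain {z : ℂ} (hz : 0 < z.im ∨ (z.im = 0 ∧ z ≠ 0)) :
    z ∈ rayDomain (1 + Complex.I) := by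
  have h2 : Complex.normSq (1 + Complex.I) = 2 := by norm_num [Complex.normSq_apply]
  by_contra h
  rw [rayDomain, mem_ofPred_eq, mem_slitPlane_iff] at h
  push Not at h
  simp only [Complex.div_re, Complex.div_im, h2, Complex.add_re, Complex.one_re, Complex.I_re,
    Complex.add_im, Complex.one_im, Complex.I_im] at h
  rcases hz with hz | ⟨hz, hz0⟩
  · linarith
  · exact hz0 (Complex.ext (by simp_all) (by simp_all))

/-- A single slanted direction serves the upper half plane together with the negative axis. It is
needed to see that the chosen values on the cut are those of the analytic continuation from above.
-/
lemma E₁_eq_rayE_one_add_I {z : ℂ} (hz : 0 < z.im ∨ z.im = 0 ∧ z.re < 0) :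
    E₁ z = rayE (1 + Complex.I) z := by
  rcases hz with hz | hz
  · rw [E₁_eq_rayE_one (mem_slitPlane_iff.mpr (Or.inr hz.ne'))]
    refine rayE_eq_of_convex (by simp) (by simp) (s := {z | 0 < z.im}) (convex_halfSpace_im_gt 0)
      (isOpen_lt continuous_const continuous_im) ?_ ?_ (p := Complex.I) ?_ hz
    · intro w hw
      rw [rayDomain_one]
      exact mem_slitPlane_iff.mpr (Or.inr (ne_of_gt hw))
    · exact fun w hw => im_pos_mem_rayDomain (Or.inl hw)
    simp
  · have : z ∉ slitPlane := by rw [mem_slitPlane_iff]; grind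
    simp [E₁, rayE, this]

/-- The path is rotated to the direction of `z` itself, after which a translation of the parameter
gives the Laplace form. -/
lemma E₁_eq_integral_of_re_pos {z : ℂ} (hz : 0 < z.re) {τ : ℝ} (hτ : 0 < τ) :
    E₁ (z * τ) = ∫ t in Ioi τ, cexp (-(z * t)) / t := by
  have hre : 0 < (z * τ).re := by simp_all
  have hz0 : z ≠ 0 := fun h => by simp_all
  rw [E₁_eq_rayE_one (mem_slitPlane_iff.mpr (Or.inl hre)),
    rayE_eq_of_convex (η₁ := 1) (η₂ := z) (by simp) hz (s := {z | 0 < z.re})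
      (convex_halfSpace_re_gt 0) (isOpen_lt continuous_const continuous_re)
      (fun w hw => re_pos_mem_rayDomain (by simp) hw) (fun w hw => re_pos_mem_rayDomain hz hw)
      (p := 1) (fun x hx => by simp; linarith) hre, rayE]
  have h := (measurePreserving_add_right (volume : Measure ℝ) τ).setIntegral_preimage_emb
    (measurableEmbedding_addRight τ) (fun t : ℝ => cexp (-(z * t)) / t) (Ioi τ)
  rw [show (fun x => x + τ) ⁻¹' Ioi τ = Ioi 0 by ext; simp] at h
  rw [← h]
  refine setIntegral_congr_fun measurableSet_Ioi fun t ht => ?_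
  have ht0 : (0 : ℝ) < t := ht
  have h1 : ((t : ℂ) + τ) ≠ 0 := by
    exact_mod_cast (by positivity : t + τ ≠ 0)
  simp only [Complex.ofReal_add]
  grind

lemma norm_E₁_le {z : ℂ} (hz : 0 < z.re) : ‖E₁ z‖ ≤ exp (-z.re) / z.re := by
  rw [E₁_eq_rayE_one (mem_slitPlane_iff.mpr (Or.inl hz))]
  simpa using norm_rayE_le_of_re_pos (η := 1) (by simp) hz

/-! ### The function `U` -/

section weight

variable {X : ℝ} {u : ℝ → ℝ}

/-- The interval carrying the weight. -/
def weightSupport (X : ℝ) : Set ℝ := Icc (exp (1 - 1 / X)) (exp 1)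

lemma isCompact_weightSupport : IsCompact (weightSupport X) := isCompact_Icc

lemma measurableSet_weightSupport : MeasurableSet (weightSupport X) := measurableSet_Icc

lemma half_le_one_sub_inv (hX : 2 ≤ X) : 1 / 2 ≤ 1 - 1 / X := by
  have : 1 / X ≤ 1 / 2 := by gcongr
  linarith

lemma pos_of_mem_weightSupport {x : ℝ} (hx : x ∈ weightSupport X) : 0 < x :=
  (exp_pos _).trans_le hx.1

lemma le_log_of_mem {x : ℝ} (hx : x ∈ weightSupport X) : 1 - 1 / X ≤ log x :=
  (le_log_iff_exp_le (pos_of_mem_weightSupport hx)).mpr hx.1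

lemma half_le_log (hX : 2 ≤ X) {x : ℝ} (hx : x ∈ weightSupport X) : 1 / 2 ≤ log x :=
  (half_le_one_sub_inv hX).trans (le_log_of_mem hx)

lemma log_le_one {x : ℝ} (hx : x ∈ weightSupport X) : log x ≤ 1 :=
  (log_le_iff_le_exp (pos_of_mem_weightSupport hx)).mpr hx.2

lemma IsWeight.eq_zero (hu : IsWeight X u) {x : ℝ} (hx : x ∉ weightSupport X) : u x = 0 := by
  by_contra h
  exact hx (hu.support_subset h)

lemma IsWeight.continuous (hu : IsWeight X u) : Continuous u := hu.smooth.continuous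

lemma IsWeight.integral_weightSupport (hu : IsWeight X u) : ∫ x in weightSupport X, u x = 1 := by
  rw [← hu.mass]
  exact setIntegral_eq_integral_of_forall_compl_eq_zero fun x hx => hu.eq_zero hx

lemma U_eq_integral (hu : IsWeight X u) (z : ℂ) :
    U u z = ∫ x in weightSupport X, (u x : ℂ) * E₁ (z * (log x : ℂ)) := by
  refine setIntegral_eq_of_subset_of_forall_sdiff_eq_zero measurableSet_Ioi
    (fun x hx => pos_of_mem_weightSupport hx) fun x hx => ?_
  rw [hu.eq_zero hx.2]; simp

/-- The variant of `U` built from the exponential integral in the direction `η`. -/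
def rayU (X : ℝ) (u : ℝ → ℝ) (η z : ℂ) : ℂ :=
  ∫ x in weightSupport X, (u x : ℂ) * rayE η (z * (log x : ℂ))

/-- The Mellin transform of the weight. -/
def weightMellin (X : ℝ) (u : ℝ → ℝ) (z : ℂ) : ℂ :=
  ∫ x in weightSupport X, (u x : ℂ) * cexp (-(z * (log x : ℂ)))

lemma mul_mem_rayDomain {η z : ℂ} (hz : z ∈ rayDomain η) {r : ℝ} (hr : 0 < r) :
    z * r ∈ rayDomain η := by
  rw [rayDomain, mem_ofPred_eq, mem_slitPlane_iff] at hz ⊢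
  rw [show z * r / η = (z / η) * r by ring]
  simp only [Complex.mul_re, ofReal_re, ofReal_im, mul_zero, sub_zero, Complex.mul_im, zero_add]
  rcases hz with h | h
  · simp_all
  grind

lemma zero_notMem_rayDomain {η : ℂ} : (0 : ℂ) ∉ rayDomain η := by simp [rayDomain]

lemma continuousOn_ofReal_log_weightSupport :
    ContinuousOn (fun x : ℝ => (log x : ℂ)) (weightSupport X) :=
  continuous_ofReal.comp_continuousOn
    (continuousOn_log.mono fun _ hx => (pos_of_mem_weightSupport hx).ne')

lemma IsWeight.exists_bound (hu : IsWeight X u) : ∃ B, 0 ≤ B ∧ ∀ x ∈ weightSupport X, ‖(u x : ℂ)‖ ≤ B := by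
  obtain ⟨B, hB⟩ := isCompact_weightSupport.exists_bound_of_continuousOn (f := fun x => (u x : ℂ))
    (continuous_ofReal.comp hu.continuous).continuousOn (s := weightSupport X)
  exact ⟨max B 0, le_max_right _ _, fun x hx => (hB x hx).trans (le_max_left _ _)⟩

/-- The factor `log x` from the chain rule cancels the one in the denominator of `E₁'`. Near 0 the
derivative is `-1/z` plus something regular, since `weightMellin` takes the value 1 there; this is
what makes `exp(-U)` entire. -/
lemma hasDerivAt_rayU (hX : 2 ≤ X) (hu : IsWeight X u) {η z : ℂ} (hη : 0 < η.re)
    (hz : z ∈ rayDomain η) :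
    HasDerivAt (rayU X u η) (-(weightMellin X u z / z)) z := by
  have hz0 : z ≠ 0 := fun h => zero_notMem_rayDomain (h ▸ hz)
  have hpos : ∀ x ∈ weightSupport X, 0 < log x := fun x hx => by linarith [half_le_log hX hx]
  obtain ⟨B, hB0, hB⟩ := hu.exists_bound
  obtain ⟨ε, hε, hball⟩ := Metric.isOpen_iff.mp (isOpen_rayDomain η) z hz
  set δ := min ε (‖z‖ / 2)
  have hδ0 : 0 < δ := by positivity
  have hcont : ∀ w ∈ rayDomain η, ContinuousOn
      (fun x : ℝ => (u x : ℂ) * rayE η (w * (log x : ℂ))) (weightSupport X) := by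
    intro w hw
    refine (continuous_ofReal.comp hu.continuous).continuousOn.mul ?_
    intro x hx
    have h1 := (hasDerivAt_rayE hη (mul_mem_rayDomain hw (hpos x hx))).continuousAt
    exact h1.comp_continuousWithinAt (f := fun x : ℝ => w * (log x : ℂ))
      (continuousWithinAt_const.mul (continuousOn_ofReal_log_weightSupport x hx))
  have hmain := hasDerivAt_integral_of_dominated_loc_of_deriv_le
    (F := fun w (x : ℝ) => (u x : ℂ) * rayE η (w * (log x : ℂ)))
    (F' := fun w (x : ℝ) => -((u x : ℂ) * cexp (-(w * (log x : ℂ))) / w))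
    (μ := volume.restrict (weightSupport X)) (x₀ := z) (s := ball z δ)
    (bound := fun _ => B * exp (2 * ‖z‖) / (‖z‖ / 2)) (ball_mem_nhds _ hδ0)
    (by filter_upwards [ball_mem_nhds z hε] with w hw using
      (hcont w (hball hw)).aestronglyMeasurable measurableSet_weightSupport)
    ((hcont z hz).integrableOn_compact isCompact_weightSupport)
    (by
      refine ContinuousOn.aestronglyMeasurable ?_ measurableSet_weightSupport
      refine (ContinuousOn.div_const (ContinuousOn.mul
        (continuous_ofReal.comp hu.continuous).continuousOn ?_) z).neg
      exact Complex.continuous_exp.comp_continuousOn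
        (continuousOn_const.mul continuousOn_ofReal_log_weightSupport).neg)
    (by
      refine (ae_restrict_iff' measurableSet_weightSupport).mpr
        (.of_forall fun x hx w hw => ?_)
      have h1 : ‖w - z‖ < ‖z‖ / 2 := by
        have := ball_subset_ball (min_le_right _ _) hw
        simpa [dist_eq_norm] using this
      have h2 : ‖z‖ / 2 ≤ ‖w‖ := by
        have := norm_sub_norm_le z w
        rw [norm_sub_rev] at this
        linarith
      have h3 : ‖w‖ ≤ 2 * ‖z‖ := by
        have := norm_sub_norm_le w z
        linarith
      rw [norm_neg, norm_div, norm_mul, norm_exp]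
      have h4 : (-(w * (log x : ℂ))).re ≤ 2 * ‖z‖ := by
        refine (re_le_norm _).trans ?_
        rw [norm_neg, norm_mul, norm_real, norm_eq_abs, abs_of_pos (hpos x hx)]
        nlinarith [log_le_one hx]
      have := hB x hx
      gcongr)
    (by
      refine integrableOn_const (hs := ?_) (hC := enorm_ne_top)
      exact isCompact_weightSupport.measure_lt_top.ne)
    (by
      refine (ae_restrict_iff' measurableSet_weightSupport).mpr
        (.of_forall fun x hx w hw => ?_)
      have hw' := hball (ball_subset_ball (min_le_left _ _) hw)
      have hw0 : w ≠ 0 := fun h => zero_notMem_rayDomain (h ▸ hw')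
      have hl : (log x : ℂ) ≠ 0 := mod_cast (hpos x hx).ne'
      have h1 := hasDerivAt_rayE hη (mul_mem_rayDomain hw' (hpos x hx))
      have h2 : HasDerivAt (fun w : ℂ => w * (log x : ℂ)) (log x : ℂ) w := by
        simpa using (hasDerivAt_id w).mul_const (log x : ℂ)
      have h3 := (h1.comp w h2).const_mul (u x : ℂ)
      grind)
  have h := hmain.2
  rw [integral_neg, integral_div] at h
  exact h

lemma differentiable_weightMellin (hX : 2 ≤ X) (hu : IsWeight X u) :
    Differentiable ℂ (weightMellin X u) := by
  intro z
  obtain ⟨B, hB0, hB⟩ := hu.exists_bound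
  have hcu : ContinuousOn (fun x => (u x : ℂ)) (weightSupport X) :=
    (continuous_ofReal.comp hu.continuous).continuousOn
  have hce : ∀ w : ℂ, ContinuousOn (fun x : ℝ => cexp (-(w * (log x : ℂ))))
      (weightSupport X) := fun w => Complex.continuous_exp.comp_continuousOn
        (continuousOn_const.mul continuousOn_ofReal_log_weightSupport).neg
  have hmain := hasDerivAt_integral_of_dominated_loc_of_deriv_le
    (F := fun w (x : ℝ) => (u x : ℂ) * cexp (-(w * (log x : ℂ))))
    (F' := fun w (x : ℝ) =>
      (u x : ℂ) * (cexp (-(w * (log x : ℂ))) * -(log x : ℂ)))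
    (μ := volume.restrict (weightSupport X)) (x₀ := z) (s := ball z 1)
    (bound := fun _ => B * (exp (‖z‖ + 1) * 1)) (ball_mem_nhds _ one_pos)
    (.of_forall fun w =>
      (hcu.mul (hce w)).aestronglyMeasurable measurableSet_weightSupport)
    ((hcu.mul (hce z)).integrableOn_compact isCompact_weightSupport)
    ((hcu.mul ((hce z).mul continuousOn_ofReal_log_weightSupport.neg)).aestronglyMeasurable
      measurableSet_weightSupport)
    (by
      refine (ae_restrict_iff' measurableSet_weightSupport).mpr
        (.of_forall fun x hx w hw => ?_)
      have h1 : ‖w - z‖ < 1 := by simpa [dist_eq_norm] using hw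
      have h3 : ‖w‖ ≤ ‖z‖ + 1 := by
        have := norm_sub_norm_le w z
        linarith
      have hl := half_le_log hX hx
      have hl1 : ‖(log x : ℂ)‖ ≤ 1 := by
        rw [norm_real, norm_eq_abs, abs_of_nonneg (by linarith)]
        exact log_le_one hx
      rw [norm_mul, norm_mul, norm_neg, norm_exp]
      have h4 : (-(w * (log x : ℂ))).re ≤ ‖z‖ + 1 := by
        refine (re_le_norm _).trans ?_
        rw [norm_neg, norm_mul]
        nlinarith [norm_nonneg w]
      bound)
    (by
      refine integrableOn_const (hs := ?_) (hC := enorm_ne_top)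
      exact isCompact_weightSupport.measure_lt_top.ne)
    (.of_forall fun x w _ => by
      have h2 : HasDerivAt (fun w : ℂ => -(w * (log x : ℂ))) (-(log x : ℂ)) w := by
        simpa using ((hasDerivAt_id w).mul_const (log x : ℂ)).fun_neg
      exact (h2.cexp).const_mul (u x : ℂ))
  exact hmain.2.differentiableAt

lemma weightMellin_zero (hu : IsWeight X u) : weightMellin X u 0 = 1 := by
  simp only [weightMellin, zero_mul, neg_zero, Complex.exp_zero, mul_one]
  rw [integral_complex_ofReal, hu.integral_weightSupport]
  simp

lemma U_eq_rayU_one (hX : 2 ≤ X) (hu : IsWeight X u) {z : ℂ} (hz : z ∈ slitPlane) :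
    U u z = rayU X u 1 z := by
  rw [U_eq_integral hu]
  refine setIntegral_congr_fun measurableSet_weightSupport fun x hx => ?_
  have hp : 0 < log x := by linarith [half_le_log hX hx]
  have := mul_mem_rayDomain (by rwa [rayDomain_one] : z ∈ rayDomain 1) hp
  rw [rayDomain_one] at this
  simp only [E₁_eq_rayE_one this]

lemma U_eq_rayU_one_add_I (hX : 2 ≤ X) (hu : IsWeight X u) {z : ℂ}
    (hz : 0 < z.im ∨ z.im = 0 ∧ z.re < 0) : U u z = rayU X u (1 + Complex.I) z := by
  rw [U_eq_integral hu]
  refine setIntegral_congr_fun measurableSet_weightSupport fun x hx => ?_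
  have hp : 0 < log x := by linarith [half_le_log hX hx]
  have h : 0 < (z * (log x : ℂ)).im ∨ (z * (log x : ℂ)).im = 0 ∧ (z * (log x : ℂ)).re < 0 := by
    simp only [Complex.mul_im, Complex.mul_re, ofReal_re, ofReal_im, mul_zero]
    rcases hz with h | ⟨h, h'⟩
    · simp_all
    · exact Or.inr ⟨by simp [h], by nlinarith⟩
  simp only [E₁_eq_rayE_one_add_I h]

lemma isPreconnected_rayDomain {η : ℂ} (hη : η ≠ 0) : IsPreconnected (rayDomain η) := by
  have h : rayDomain η = (fun w => w * η) '' slitPlane := by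
    ext z
    constructor
    · intro hz
      exact ⟨z / η, hz, by field_simp⟩
    · rintro ⟨w, hw, rfl⟩
      simpa [rayDomain, hη] using hw
  rw [h]
  exact (Complex.starConvex_one_slitPlane.isPathConnected Complex.one_mem_slitPlane
    ).isConnected.isPreconnected.image _ (by fun_prop)

/-- `exp (-U)` extends to an entire function whose only zero is a zero at the origin. -/
theorem exists_entire_exp_neg_U (hX : 2 ≤ X) (hu : IsWeight X u) :
    ∃ W : ℂ → ℂ, Differentiable ℂ W ∧ W 0 = 0 ∧ ∀ z, z ≠ 0 → W z = cexp (-U u z) := by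
  have hN := differentiable_weightMellin hX hu
  -- The entire function `(weightMellin(z) - 1)/z` has a primitive `R`, and `exp(-U) · e^{-R} / z`
  -- has derivative zero on each cut plane. Hence `exp(-U) = C z e^R` there.
  have hQ : Differentiable ℂ (dslope (weightMellin X u) 0) := by
    rw [← differentiableOn_univ, Complex.differentiableOn_dslope univ_mem]
    fun_prop
  obtain ⟨R, hR⟩ := hQ.isExactOn_univ
  replace hR : ∀ z, HasDerivAt R (dslope (weightMellin X u) 0 z) z := fun z => hR z (mem_univ z)
  have hconst : ∀ η : ℂ, 0 < η.re → ∃ C, ∀ z ∈ rayDomain η,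
      cexp (-rayU X u η z) = C * (z * cexp (R z)) := by
    intro η hη
    have hη0 : η ≠ 0 := fun h => by simp_all
    have hd : ∀ z ∈ rayDomain η, HasDerivAt
        (fun z => cexp (-rayU X u η z) * (cexp (-R z) / z)) 0 z := by
      intro z hz
      have hz0 : z ≠ 0 := fun h => zero_notMem_rayDomain (h ▸ hz)
      have h1 := ((hasDerivAt_rayU hX hu hη hz).fun_neg.cexp).mul
        (((hR z).fun_neg.cexp).div (hasDerivAt_id z) hz0)
      refine h1.congr_deriv ?_
      rw [dslope_of_ne _ hz0, slope_def_field, weightMellin_zero hu]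
      simp only [Pi.div_apply, id]
      grind
    obtain ⟨C, hC⟩ := (isOpen_rayDomain η).exists_is_const_of_deriv_eq_zero
      (isPreconnected_rayDomain hη0)
      (f := fun z => cexp (-rayU X u η z) * (cexp (-R z) / z))
      (fun z hz => (hd z hz).differentiableAt.differentiableWithinAt)
      (fun z hz => (hd z hz).deriv)
    refine ⟨C, fun z hz => ?_⟩
    have hz0 : z ≠ 0 := fun h => zero_notMem_rayDomain (h ▸ hz)
    rw [← hC z hz, Complex.exp_neg (R z)]
    field_simp
  obtain ⟨C, hC⟩ := hconst 1 (by simp)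
  obtain ⟨C', hC'⟩ := hconst (1 + Complex.I) (by simp)
  -- The point `i` lies in both cut planes, and both formulas represent `U` there, so the two
  -- constants agree.
  have hCC : C = C' := by
    have h1 := hC Complex.I (by rw [rayDomain_one]; simp [mem_slitPlane_iff])
    have h2 := hC' Complex.I (im_pos_mem_rayDomain (by simp))
    rw [← U_eq_rayU_one hX hu (by simp [mem_slitPlane_iff])] at h1
    rw [← U_eq_rayU_one_add_I hX hu (by simp), h1] at h2
    simp_all
  have hRd : Differentiable ℂ R := fun z => (hR z).differentiableAt
  refine ⟨fun z => C * (z * cexp (R z)), by fun_prop, by simp, fun z hz => ?_⟩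
  by_cases h : z ∈ slitPlane
  · rw [U_eq_rayU_one hX hu h, hC z (by rwa [rayDomain_one])]
  · rw [mem_slitPlane_iff] at h
    push Not at h
    have him : z.im = 0 := h.2
    have hre : z.re < 0 := lt_of_le_of_ne h.1 fun h0 => hz (Complex.ext h0 him)
    rw [U_eq_rayU_one_add_I hX hu (Or.inr ⟨him, hre⟩),
      hC' z (im_pos_mem_rayDomain (Or.inr ⟨him, hz⟩)), hCC]

lemma differentiableAt_U (hX : 2 ≤ X) (hu : IsWeight X u) {z : ℂ} (hz : z ∈ slitPlane) :
    DifferentiableAt ℂ (U u) z := by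
  have h := (hasDerivAt_rayU hX hu (η := 1) (by simp) (by rwa [rayDomain_one])).differentiableAt
  refine h.congr_of_eventuallyEq ?_
  filter_upwards [Complex.isOpen_slitPlane.mem_nhds hz] with w hw using U_eq_rayU_one hX hu hw

lemma norm_U_le_of_re_pos (hX : 2 ≤ X) (hu : IsWeight X u) {z : ℂ} (hz : 0 < z.re) :
    ‖U u z‖ ≤ 2 * exp (-z.re / 2) / z.re := by
  rw [U_eq_integral hu]
  have hi : IntegrableOn (fun x => u x * (2 * exp (-z.re / 2) / z.re)) (weightSupport X) :=
    (hu.continuous.mul continuous_const).continuousOn.integrableOn_compact isCompact_weightSupport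
  refine (norm_integral_le_of_norm_le hi ?_).trans (le_of_eq ?_)
  · refine (ae_restrict_iff' measurableSet_weightSupport).mpr (.of_forall fun x hx => ?_)
    have hl := half_le_log hX hx
    have hre : (z * (log x : ℂ)).re = z.re * log x := by simp
    have h1 : z.re / 2 ≤ z.re * log x := by nlinarith
    rw [norm_mul, norm_real, norm_eq_abs, abs_of_nonneg (hu.nonneg x)]
    refine mul_le_mul_of_nonneg_left ?_ (hu.nonneg x)
    refine (norm_E₁_le (by linarith)).trans ?_
    rw [hre]
    calc exp (-(z.re * log x)) / (z.re * log x)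
        ≤ exp (-z.re / 2) / (z.re / 2) := by bound
      _ = _ := by field_simp
  · rw [integral_mul_const, hu.integral_weightSupport, one_mul]

end weight

section weightDecay

variable {X : ℝ} {u : ℝ → ℝ}

/-! ### Decay of `U` in vertical strips -/

/-- One integration by parts leaves the integral of `e^{-(z+t)} / (z+t)²`, and `|z + t| ≥ |Im z|`
along the whole ray. -/
lemma norm_E₁_sub_le {z : ℂ} (hz : z.im ≠ 0) :
    ‖E₁ z - cexp (-z) / z‖ ≤ exp (-z.re) / |z.im| ^ 2 := by
  have hzs : z ∈ slitPlane := mem_slitPlane_iff.mpr (Or.inr hz)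
  have him : 0 < |z.im| := by grind
  have hlow : ∀ t : ℝ, |z.im| ≤ ‖z + (t : ℂ)‖ := fun t => by
    have := abs_im_le_norm (z + (t : ℂ))
    simp_all
  have hne : ∀ t : ℝ, z + (t : ℂ) ≠ 0 := fun t h0 => by
    have := hlow t
    simp_all
  have hexp : ∀ t : ℝ, ‖cexp (-(z + (t : ℂ)))‖ = exp (-z.re) * exp (-1 * t) := by
    intro t
    have := norm_exp_neg_ray 1 z t
    simp_all
  have hi : IntegrableOn (fun t : ℝ => exp (-1 * t)) (Ioi 0) :=
    integrableOn_exp_mul_Ioi (by norm_num) 0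
  have hc1 : Continuous fun t : ℝ => cexp (-(z + t)) / (z + t) :=
    Continuous.div (by fun_prop) (by fun_prop) hne
  have hc2 : Continuous fun t : ℝ => cexp (-(z + t)) / (z + t) ^ 2 :=
    Continuous.div (by fun_prop) (by fun_prop) fun t => pow_ne_zero _ (hne t)
  have hi1 : IntegrableOn (fun t : ℝ => cexp (-(z + t)) / (z + t)) (Ioi 0) := by
    refine (hi.const_mul (exp (-z.re) / |z.im|)).mono' hc1.aestronglyMeasurable
      (.of_forall fun t => ?_)
    rw [norm_div, hexp, div_mul_eq_mul_div]
    bound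
  have hb2 : ∀ t : ℝ, ‖cexp (-(z + t)) / (z + t) ^ 2‖ ≤
      exp (-z.re) / |z.im| ^ 2 * exp (-1 * t) := fun t => by
    rw [norm_div, hexp, norm_pow, div_mul_eq_mul_div]
    bound
  have hi2 : IntegrableOn (fun t : ℝ => cexp (-(z + t)) / (z + t) ^ 2) (Ioi 0) :=
    (hi.const_mul (exp (-z.re) / |z.im| ^ 2)).mono' hc2.aestronglyMeasurable
      (.of_forall hb2)
  have hder : ∀ t ∈ Ici (0 : ℝ), HasDerivAt (fun t : ℝ => cexp (-(z + t)) / (z + t))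
      (-(cexp (-(z + t)) / (z + t)) - cexp (-(z + t)) / (z + t) ^ 2) t := by
    intro t _
    have h0 := hne t
    have h1 : HasDerivAt (fun t : ℝ => z + (t : ℂ)) 1 t := by
      simpa using (ofRealCLM.hasDerivAt (x := t)).const_add z
    have h2 := (h1.fun_neg.cexp).div h1 h0
    refine h2.congr_deriv ?_
    field_simp
  have hlim := tendsto_exp_div_ray (η := 1) (z := z) (by simp) him (fun t _ => by grind)
  simp only [one_mul] at hlim
  have hval := integral_Ioi_of_hasDerivAt_of_tendsto' hder (hi1.neg.sub hi2) hlim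
  have hE : E₁ z = ∫ t in Ioi (0 : ℝ), cexp (-(z + t)) / (z + t) := by simp [E₁, hzs]
  rw [integral_sub (f := fun t : ℝ => -(cexp (-(z + t)) / (z + t))) hi1.neg hi2,
    integral_neg, ← hE] at hval
  have h3 : E₁ z - cexp (-z) / z =
      -∫ t in Ioi (0 : ℝ), cexp (-(z + t)) / (z + t) ^ 2 := by
    simp only [ofReal_zero, add_zero] at hval
    grind
  rw [h3, norm_neg]
  refine (norm_integral_le_of_norm_le (hi.const_mul (exp (-z.re) / |z.im| ^ 2))
    (.of_forall hb2)).trans (le_of_eq ?_)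
  rw [integral_const_mul, integral_exp_mul_Ioi (by norm_num)]
  simp

lemma IsWeight.eq_zero_left (hu : IsWeight X u) : u (exp (1 - 1 / X)) = 0 := by
  have h : Tendsto u (𝓝[<] (exp (1 - 1 / X))) (𝓝 (u (exp (1 - 1 / X)))) :=
    (hu.continuous.tendsto _).mono_left nhdsWithin_le_nhds
  refine tendsto_nhds_unique h (tendsto_const_nhds.congr' ?_)
  filter_upwards [self_mem_nhdsWithin] with x hx
  exact (hu.eq_zero fun h' => absurd h'.1 (not_le.mpr hx)).symm

lemma IsWeight.eq_zero_right (hu : IsWeight X u) : u (exp 1) = 0 := by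
  have h : Tendsto u (𝓝[>] (exp 1)) (𝓝 (u (exp 1))) :=
    (hu.continuous.tendsto _).mono_left nhdsWithin_le_nhds
  refine tendsto_nhds_unique h (tendsto_const_nhds.congr' ?_)
  filter_upwards [self_mem_nhdsWithin] with x hx
  exact (hu.eq_zero fun h' => absurd h'.2 (not_le.mpr hx)).symm

lemma weight_endpoints_le (hX : 2 ≤ X) : exp (1 - 1 / X) ≤ exp 1 :=
  exp_le_exp.mpr (by linarith [show 0 ≤ 1 / X by positivity])

/-- One integration by parts for the leading term of `U`. -/
lemma exists_norm_integral_weight_le (hX : 2 ≤ X) (hu : IsWeight X u) {M : ℝ} (hM : 0 ≤ M) :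
    ∃ C, 0 ≤ C ∧ ∀ z : ℂ, z ≠ 0 → -M ≤ z.re → ‖∫ x in weightSupport X, (u x : ℂ) *
        (cexp (-(z * (log x : ℂ))) / (z * (log x : ℂ)))‖ ≤ C / ‖z‖ ^ 2 := by
  set a := exp (1 - 1 / X) with ha
  set b := exp 1 with hb
  have hab : a ≤ b := weight_endpoints_le hX
  have hpos : ∀ x ∈ uIcc a b, 0 < x ∧ 0 < log x := fun x hx => by
    rw [uIcc_of_le hab] at hx
    exact ⟨pos_of_mem_weightSupport hx, by linarith [half_le_log hX hx]⟩
  have hdu : Differentiable ℝ u := hu.smooth.differentiable (by simp)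
  -- Chosen so that the integrand is `-z⁻² G v'` with `v = x^{-z}`. `G` vanishes at both endpoints,
  -- so parts moves the derivative to `G` and keeps the whole factor `z⁻²`.
  set G : ℝ → ℝ := fun x => x * u x / log x with hG
  set G' : ℝ → ℝ := fun x =>
    ((1 * u x + x * deriv u x) * log x - x * u x * x⁻¹) / log x ^ 2
  have hder : ∀ x ∈ uIcc a b, HasDerivAt G (G' x) x := fun x hx =>
    (((hasDerivAt_id x).mul (hdu x).hasDerivAt).div (hasDerivAt_log (hpos x hx).1.ne')
      (hpos x hx).2.ne')
  have hcd : Continuous (deriv u) := hu.smooth.continuous_deriv (by simp)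
  have hcG' : ContinuousOn G' (uIcc a b) := by
    intro x hx
    have h1 := (hpos x hx).1.ne'
    have h2 := (hpos x hx).2.ne'
    have h3 : ContinuousAt u x := hu.continuous.continuousAt
    refine ContinuousAt.continuousWithinAt ?_
    fun_prop (disch := grind)
  obtain ⟨B, hB⟩ := isCompact_uIcc.exists_bound_of_continuousOn hcG'
  have hB0 : 0 ≤ B := (norm_nonneg _).trans (hB a left_mem_uIcc)
  refine ⟨B * exp M * |b - a|, by positivity, fun z hz hzM => ?_⟩
  set v : ℝ → ℂ := fun x => cexp (-(z * (log x : ℂ))) with hv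
  have hvder : ∀ x ∈ uIcc a b, HasDerivAt v (-(z / x) * v x) x := fun x hx => by
    have h1 := (hasDerivAt_log (hpos x hx).1.ne').ofReal_comp
    have h2 := ((h1.const_mul z).fun_neg).cexp
    refine h2.congr_deriv ?_
    push_cast
    ring
  have hvc : ContinuousOn v (uIcc a b) := fun x hx => (hvder x hx).continuousAt.continuousWithinAt
  have hv'c : ContinuousOn (fun x : ℝ => -(z / x) * v x) (uIcc a b) := by
    refine ContinuousOn.mul ?_ hvc
    refine (ContinuousOn.div continuousOn_const continuous_ofReal.continuousOn ?_).neg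
    intro x hx
    exact_mod_cast (hpos x hx).1.ne'
  have hparts := intervalIntegral.integral_mul_deriv_eq_deriv_mul (a := a) (b := b)
    (u := fun x => (G x : ℂ)) (u' := fun x => (G' x : ℂ)) (v := v)
    (v' := fun x : ℝ => -(z / x) * v x) (fun x hx => (hder x hx).ofReal_comp) hvder
    ((continuous_ofReal.comp_continuousOn hcG').intervalIntegrable)
    hv'c.intervalIntegrable
  have hGa : G a = 0 := by simp only [hG, ha, hu.eq_zero_left, mul_zero, zero_div]
  have hGb : G b = 0 := by simp only [hG, hb, hu.eq_zero_right, mul_zero, zero_div]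
  rw [hGa, hGb] at hparts
  have hL : ∫ x in weightSupport X, (u x : ℂ) *
      (cexp (-(z * (log x : ℂ))) / (z * (log x : ℂ))) =
      (-(1 / z ^ 2)) * ∫ x in a..b, (G x : ℂ) * (-(z / x) * v x) := by
    rw [intervalIntegral.integral_of_le hab, ← integral_Icc_eq_integral_Ioc, ← integral_const_mul]
    refine setIntegral_congr_fun measurableSet_Icc fun x hx => ?_
    have hx' : x ∈ uIcc a b := by rwa [uIcc_of_le hab]
    have h1 : (x : ℂ) ≠ 0 := mod_cast (hpos x hx').1.ne'
    simp only [hG, hv]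
    push_cast
    field_simp
  rw [hL, hparts, norm_mul]
  simp only [ofReal_zero, zero_mul, sub_zero, zero_sub, norm_neg, norm_div, norm_one, norm_pow]
  have hbd : ‖∫ x in a..b, (G' x : ℂ) * v x‖ ≤ B * exp M * |b - a| := by
    refine intervalIntegral.norm_integral_le_of_norm_le_const fun x hx => ?_
    have hx' := uIoc_subset_uIcc hx
    have hxs : x ∈ weightSupport X := by rwa [uIcc_of_le hab] at hx'
    rw [norm_mul, norm_real, hv, norm_exp]
    gcongr
    · bound
    · have : (-(z * (log x : ℂ))).re = -z.re * log x := by simp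
      nlinarith [(hpos x hx').2, log_le_one hxs]
  calc 1 / ‖z‖ ^ 2 * ‖∫ x in a..b, (G' x : ℂ) * v x‖
      ≤ 1 / ‖z‖ ^ 2 * (B * exp M * |b - a|) := by gcongr
    _ = _ := by ring

/-- `E₁` alone decays only like `1/|z|` in a vertical strip, too slowly for a sum over zeros.
Smoothness of `u` wins a second power, which matches the convergence of `∑ |ρ|⁻²`. The constant
depends on `u`, but it is used only for convergence and analyticity, never in an asymptotic
estimate. -/
theorem exists_norm_U_le (hX : 2 ≤ X) (hu : IsWeight X u) {M : ℝ} (hM : 0 ≤ M) :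
    ∃ C, 0 ≤ C ∧ ∀ z : ℂ, z.im ≠ 0 → -M ≤ z.re → ‖U u z‖ ≤ C / |z.im| ^ 2 := by
  obtain ⟨C, hC, h⟩ := exists_norm_integral_weight_le hX hu hM
  refine ⟨C + 4 * exp M, by positivity, fun z hz hzM => ?_⟩
  have hz0 : z ≠ 0 := fun h => hz (by simp [h])
  have hlog : ∀ x ∈ weightSupport X, 0 < log x := fun x hx => by linarith [half_le_log hX hx]
  have hcu : ContinuousOn (fun x => (u x : ℂ)) (weightSupport X) :=
    (continuous_ofReal.comp hu.continuous).continuousOn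
  have hzs : z ∈ rayDomain 1 := by rw [rayDomain_one]; exact mem_slitPlane_iff.mpr (Or.inr hz)
  have hi1 : IntegrableOn (fun x : ℝ => (u x : ℂ) * E₁ (z * (log x : ℂ))) (weightSupport X) := by
    refine ContinuousOn.integrableOn_compact isCompact_weightSupport ?_
    have hc : ContinuousOn (fun x : ℝ => (u x : ℂ) * rayE 1 (z * (log x : ℂ)))
        (weightSupport X) := by
      refine hcu.mul fun x hx => ?_
      have h1 := (hasDerivAt_rayE (η := 1) (by simp) (mul_mem_rayDomain hzs (hlog x hx))).continuousAt
      exact h1.comp_continuousWithinAt (f := fun x : ℝ => z * (log x : ℂ))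
        (continuousWithinAt_const.mul (continuousOn_ofReal_log_weightSupport x hx))
    refine hc.congr fun x hx => ?_
    have := mul_mem_rayDomain hzs (hlog x hx)
    rw [rayDomain_one] at this
    simp only [E₁_eq_rayE_one this]
  have hi2 : IntegrableOn (fun x : ℝ => (u x : ℂ) *
      (cexp (-(z * (log x : ℂ))) / (z * (log x : ℂ)))) (weightSupport X) := by
    refine ContinuousOn.integrableOn_compact isCompact_weightSupport (hcu.mul ?_)
    refine ContinuousOn.div (Complex.continuous_exp.comp_continuousOn
        (continuousOn_const.mul continuousOn_ofReal_log_weightSupport).neg)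
      (continuousOn_const.mul continuousOn_ofReal_log_weightSupport) fun x hx => ?_
    exact mul_ne_zero hz0 (by exact_mod_cast (hlog x hx).ne')
  have hdec : U u z = (∫ x in weightSupport X, (u x : ℂ) *
        (cexp (-(z * (log x : ℂ))) / (z * (log x : ℂ)))) +
      ∫ x in weightSupport X, (u x : ℂ) * (E₁ (z * (log x : ℂ)) -
        cexp (-(z * (log x : ℂ))) / (z * (log x : ℂ))) := by
    rw [U_eq_integral hu, ← sub_eq_iff_eq_add', ← integral_sub hi1 hi2]
    grind
  have hb2 : ‖∫ x in weightSupport X, (u x : ℂ) * (E₁ (z * (log x : ℂ)) -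
        cexp (-(z * (log x : ℂ))) / (z * (log x : ℂ)))‖ ≤
      4 * exp M / |z.im| ^ 2 := by
    have hi : IntegrableOn (fun x => u x * (4 * exp M / |z.im| ^ 2)) (weightSupport X) :=
      (hu.continuous.mul continuous_const).continuousOn.integrableOn_compact isCompact_weightSupport
    refine (norm_integral_le_of_norm_le hi ?_).trans (le_of_eq ?_)
    · refine (ae_restrict_iff' measurableSet_weightSupport).mpr
        (.of_forall fun x hx => ?_)
      have hl := half_le_log hX hx
      have hre : (z * (log x : ℂ)).re = z.re * log x := by simp
      have him' : (z * (log x : ℂ)).im = z.im * log x := by simp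
      rw [norm_mul, norm_real, norm_eq_abs, abs_of_nonneg (hu.nonneg x)]
      refine mul_le_mul_of_nonneg_left ?_ (hu.nonneg x)
      refine (norm_E₁_sub_le (by grind)).trans ?_
      rw [hre, him', abs_mul, abs_of_pos (hlog x hx)]
      calc exp (-(z.re * log x)) / (|z.im| * log x) ^ 2
          ≤ exp M / (|z.im| * (1 / 2)) ^ 2 := by
            gcongr
            nlinarith [log_le_one hx]
        _ = _ := by grind
    · rw [integral_mul_const, hu.integral_weightSupport, one_mul]
  rw [hdec]
  refine (norm_add_le _ _).trans ?_
  rw [add_div]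
  refine add_le_add ((h z hz0 hzM).trans ?_) hb2
  gcongr
  exact abs_im_le_norm z

/-! ### The distribution function of the weight -/

/-- The distribution function of the weight on the logarithmic scale. -/
def weightCdf (u : ℝ → ℝ) (t : ℝ) : ℝ := ∫ x in (0 : ℝ)..Real.exp t, u x

lemma hasDerivAt_weightCdf (hu : IsWeight X u) (t : ℝ) :
    HasDerivAt (weightCdf u) (u (exp t) * exp t) t := by
  have h := intervalIntegral.integral_hasDerivAt_right (a := 0) (b := exp t)
    (hu.continuous.intervalIntegrable _ _)
    (hu.continuous.stronglyMeasurableAtFilter _ _) hu.continuous.continuousAt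
  exact h.comp t (hasDerivAt_exp t)

lemma weightCdf_eq_setIntegral (hu : IsWeight X u) (t : ℝ) :
    weightCdf u t = ∫ x in weightSupport X, (Iio (exp t)).indicator u x := by
  rw [weightCdf, intervalIntegral.integral_of_le (exp_nonneg t),
    integral_Ioc_eq_integral_Ioo, ← integral_indicator measurableSet_Ioo,
    ← integral_indicator measurableSet_weightSupport]
  congr 1
  ext x
  by_cases hx : x ∈ weightSupport X
  · have h0 := pos_of_mem_weightSupport hx
    by_cases hxt : x < exp t
    · simp_all
    simp_all
  · rw [indicator_of_notMem hx, indicator_apply, hu.eq_zero hx, ite_self]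

lemma weightCdf_eq_zero (hu : IsWeight X u) {t : ℝ} (ht : t ≤ 1 - 1 / X) :
    weightCdf u t = 0 := by
  rw [weightCdf_eq_setIntegral hu]
  refine setIntegral_eq_zero_of_forall_eq_zero fun x hx => ?_
  refine indicator_of_notMem ?_ _
  simp only [mem_Iio, not_lt]
  exact (exp_le_exp.mpr ht).trans hx.1

lemma weightCdf_eq_one (hu : IsWeight X u) {t : ℝ} (ht : 1 ≤ t) :
    weightCdf u t = 1 := by
  rw [weightCdf_eq_setIntegral hu, ← hu.integral_weightSupport]
  refine setIntegral_congr_fun measurableSet_weightSupport fun x hx => ?_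
  by_cases h : x < exp t
  · simp [h]
  · have hx1 : x = exp 1 := le_antisymm hx.2 ((exp_le_exp.mpr ht).trans (not_lt.mp h))
    rw [hx1, hu.eq_zero_right, indicator_apply, hu.eq_zero_right, ite_self]

lemma weightCdf_mem_Icc (hu : IsWeight X u) (t : ℝ) :
    weightCdf u t ∈ Icc (0 : ℝ) 1 := by
  have hmono : Monotone (weightCdf u) := monotone_of_hasDerivAt_nonneg
    (fun t => hasDerivAt_weightCdf hu t) fun t => mul_nonneg (hu.nonneg _) (exp_nonneg _)
  constructor
  · rw [← weightCdf_eq_zero hu (t := min t (1 - 1 / X)) (min_le_right _ _)]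
    bound
  · rw [← weightCdf_eq_one hu (t := max t 1) (le_max_right _ _)]
    bound

/-- The Laplace transform representation of `U` in the right half plane. -/
theorem U_eq_laplace (hX : 2 ≤ X) (hu : IsWeight X u) {z : ℂ} (hz : 0 < z.re) :
    U u z = ∫ t in Ioi (0 : ℝ), (weightCdf u t : ℂ) * (cexp (-(z * t)) / t) := by
  have hlog : ∀ x ∈ weightSupport X, 1 / 2 ≤ log x := fun x hx => half_le_log hX hx
  -- Since `log x ≥ 1/2` on the support, nothing is lost by starting at `1/4`, and `1/t` stays
  -- bounded by 4 for Fubini.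
  have h1 : U u z = ∫ x in weightSupport X, ∫ t in Ioi (1 / 4 : ℝ),
      (u x : ℂ) * (if log x < t then cexp (-(z * t)) / t else 0) := by
    rw [U_eq_integral hu]
    refine setIntegral_congr_fun measurableSet_weightSupport fun x hx => ?_
    have hl := hlog x hx
    rw [E₁_eq_integral_of_re_pos hz (by linarith), integral_const_mul]
    congr 1
    rw [← integral_indicator measurableSet_Ioi, ← integral_indicator measurableSet_Ioi]
    congr 1
    ext t
    by_cases ht : log x < t
    · have : (1 / 4 : ℝ) < t := by linarith
      simp_all
    · simp only [indicator_apply, mem_Ioi, ht, if_false, ite_self]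
  have hintg : Integrable (Function.uncurry fun (x t : ℝ) =>
      (u x : ℂ) * (if log x < t then cexp (-(z * t)) / t else 0))
      ((volume.restrict (weightSupport X)).prod (volume.restrict (Ioi (1 / 4 : ℝ)))) := by
    have hb : Integrable (fun p : ℝ × ℝ => u p.1 * (4 * exp (-z.re * p.2)))
        ((volume.restrict (weightSupport X)).prod (volume.restrict (Ioi (1 / 4 : ℝ)))) := by
      refine Integrable.mul_prod (f := u) (g := fun t => 4 * exp (-z.re * t)) ?_ ?_
      · exact hu.continuous.continuousOn.integrableOn_compact isCompact_weightSupport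
      · exact (integrableOn_exp_mul_Ioi (by linarith) _).const_mul 4
    refine hb.mono' ?_ ?_
    · refine Measurable.aestronglyMeasurable ?_
      refine ((continuous_ofReal.comp hu.continuous).measurable.comp measurable_fst).mul ?_
      refine Measurable.ite (measurableSet_lt (measurable_log.comp measurable_fst)
        measurable_snd) ?_ measurable_const
      refine Measurable.div ?_ (Complex.measurable_ofReal.comp measurable_snd)
      exact Complex.measurable_exp.comp
        ((measurable_const.mul (Complex.measurable_ofReal.comp measurable_snd)).neg)
    · rw [Measure.prod_restrict]
      refine (ae_restrict_iff' (measurableSet_weightSupport.prod measurableSet_Ioi)).mpr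
        (.of_forall ?_)
      rintro ⟨x, t⟩ ⟨-, ht⟩
      have ht' : (1 / 4 : ℝ) < t := ht
      simp only [Function.uncurry]
      rw [norm_mul, norm_real, norm_eq_abs, abs_of_nonneg (hu.nonneg x)]
      refine mul_le_mul_of_nonneg_left ?_ (hu.nonneg x)
      split_ifs
      · rw [norm_div, norm_exp, norm_real, norm_eq_abs, abs_of_pos (by linarith)]
        have : (-(z * (t : ℂ))).re = -z.re * t := by simp
        rw [this, div_le_iff₀ (by linarith)]
        have := exp_pos (-z.re * t)
        nlinarith
      · simp; positivity
  rw [h1, integral_integral_swap hintg]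
  have h2 : ∀ t : ℝ, ∫ x in weightSupport X,
      (u x : ℂ) * (if log x < t then cexp (-(z * t)) / t else 0) =
        (weightCdf u t : ℂ) * (cexp (-(z * t)) / t) := by
    intro t
    rw [weightCdf_eq_setIntegral hu, ← integral_complex_ofReal, ← integral_mul_const]
    refine setIntegral_congr_fun measurableSet_weightSupport fun x hx => ?_
    have hiff : log x < t ↔ x < exp t :=
      log_lt_iff_lt_exp (pos_of_mem_weightSupport hx)
    by_cases h : x < exp t
    · simp [hiff, h]
    · simp [hiff, h]
  simp only [h2]
  symm
  refine setIntegral_eq_of_subset_of_forall_sdiff_eq_zero measurableSet_Ioi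
    (Ioi_subset_Ioi (by norm_num)) fun t ht => ?_
  have ht' : t ≤ 1 / 4 := by simpa using ht.2
  rw [weightCdf_eq_zero hu (by linarith [half_le_one_sub_inv hX])]
  simp

end weightDecay

section

open scoped ArithmeticFunction.zeta

/-! ### Exponentials of Dirichlet series -/

/-- A Dirichlet series whose coefficients satisfy the recursion `a · log = (G · log) * a` is the
exponential of the Dirichlet series with coefficients `G`. -/
theorem LSeries_eq_exp {a G : ℕ → ℂ} (ha1 : a 1 = 1) (hG1 : G 1 = 0)
    (hrec : ∀ n, n ≠ 0 → logMul a n = LSeries.convolution (logMul G) a n) {s : ℂ}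
    (ha : abscissaOfAbsConv a < s.re) (hG : abscissaOfAbsConv G < s.re) :
    LSeries a s = cexp (LSeries G s) := by
  obtain ⟨y, hy1, hy2⟩ := exists_between (max_lt ha hG)
  lift y to ℝ using ⟨(hy2.trans_le le_top).ne, ((OrderBot.bot_le _).trans_lt hy1).ne'⟩
  have hay : abscissaOfAbsConv a < y := by grind
  have hGy : abscissaOfAbsConv G < y := by grind
  have hys : y < s.re := mod_cast hy2
  set H : Set ℂ := {z | y < z.re} with hH
  have hd : ∀ z ∈ H, HasDerivAt (fun z => LSeries a z * cexp (-LSeries G z)) 0 z := by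
    intro z hz
    have hz' : (y : EReal) < z.re := mod_cast hz
    have h1 := LSeries_hasDerivAt (hay.trans hz')
    have h2 := LSeries_hasDerivAt (hGy.trans hz')
    have h3 : LSeries (logMul a) z = LSeries (logMul G) z * LSeries a z := by
      rw [← LSeries_convolution (by rw [abscissaOfAbsConv_logMul]; grind)
        (hay.trans hz')]
      exact LSeries_congr (fun {n} hn => hrec n hn) z
    have h4 := h1.mul h2.fun_neg.cexp
    refine h4.congr_deriv ?_
    grind
  have hconv : Convex ℝ H := convex_halfSpace_re_gt y
  have hopen : IsOpen H := isOpen_lt continuous_const continuous_re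
  have hconst : ∀ z ∈ H, LSeries a z * cexp (-LSeries G z) =
      LSeries a s * cexp (-LSeries G s) := fun z hz =>
    hconv.is_const_of_fderivWithin_eq_zero (𝕜 := ℂ)
      (f := fun z => LSeries a z * cexp (-LSeries G z))
      (fun w hw => (hd w hw).differentiableAt.differentiableWithinAt)
      (fun w hw => by
        rw [fderivWithin_of_isOpen hopen hw, (hd w hw).hasFDerivAt.fderiv]
        ext; simp) hz hys
  have hlim : Tendsto (fun x : ℝ => LSeries a x * cexp (-LSeries G x)) atTop (𝓝 1) := by
    have h1 := LSeries.tendsto_atTop (hay.trans_le le_top)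
    have h2 := LSeries.tendsto_atTop (hGy.trans_le le_top)
    rw [ha1] at h1
    rw [hG1] at h2
    have := h1.mul ((Complex.continuous_exp.tendsto _).comp h2.neg)
    simp_all
  have h5 : LSeries a s * cexp (-LSeries G s) = 1 := by
    refine tendsto_nhds_unique (tendsto_const_nhds.congr' ?_) hlim
    filter_upwards [eventually_gt_atTop y] with x hx
    simp_all
  calc LSeries a s = LSeries a s * cexp (-LSeries G s) * cexp (LSeries G s) := by
        rw [mul_assoc, ← Complex.exp_add]; simp
    _ = _ := by grind

/-- The coefficients of the exponential of `∑ Λ(n) g(n) / log n · n⁻ˢ`. -/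
def expCoeff (g : ℕ → ℝ) (n : ℕ) : ℝ :=
  -- The cast supplies both initial values at once: 0 at `n = 0` and 1 at `n = 1`.
  if n ≤ 1 then n
  else (∑ m ∈ n.properDivisors.attach, Λ (n / m) * g (n / m) * expCoeff g m) / log n
termination_by n
decreasing_by exact (Nat.mem_properDivisors.mp m.2).2

lemma expCoeff_zero (g : ℕ → ℝ) : expCoeff g 0 = 0 := by rw [expCoeff]; simp

lemma expCoeff_one (g : ℕ → ℝ) : expCoeff g 1 = 1 := by rw [expCoeff]; simp

lemma log_mul_expCoeff (g : ℕ → ℝ) (n : ℕ) :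
    log n * expCoeff g n = ∑ p ∈ n.divisorsAntidiagonal, Λ p.1 * g p.1 * expCoeff g p.2 := by
  have h1 : ∑ p ∈ n.divisorsAntidiagonal, Λ p.1 * g p.1 * expCoeff g p.2 =
      ∑ m ∈ n.divisors, Λ (n / m) * g (n / m) * expCoeff g m := by
    rw [← Nat.map_div_left_divisors, Finset.sum_map]
    rfl
  rw [h1]
  rcases eq_or_ne n 0 with rfl | hn
  · simp
  have h2 : ∑ m ∈ n.divisors, Λ (n / m) * g (n / m) * expCoeff g m =
      ∑ m ∈ n.properDivisors, Λ (n / m) * g (n / m) * expCoeff g m := by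
    rw [← Nat.insert_self_properDivisors hn, Finset.sum_insert (by simp),
      Nat.div_self (Nat.pos_of_ne_zero hn)]
    simp
  rw [h2]
  by_cases h : n ≤ 1
  · have : n = 1 := by omega
    simp_all
  · have hl : log n ≠ 0 := (log_pos (by simp_all)).ne'
    conv_lhs => rw [expCoeff, if_neg h]
    rw [mul_div_cancel₀ _ hl, Finset.sum_attach n.properDivisors
      fun m => Λ (n / m) * g (n / m) * expCoeff g m]

/-- The recursion determines its solution: the only term on the right involving `b n` carries the
factor `Λ 1 = 0`, so everything else refers to proper divisors. -/
lemma log_mul_induction {b : ℕ → ℝ} {g : ℕ → ℝ}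
    (hb : ∀ n : ℕ, log n * b n = ∑ p ∈ n.divisorsAntidiagonal, Λ p.1 * g p.1 * b p.2)
    (hb0 : b 0 = 0) (hb1 : b 1 = 1) : b = expCoeff g := by
  ext n
  induction n using Nat.strong_induction_on with
  | _ n ih =>
    rcases eq_or_ne n 0 with rfl | hn
    · rw [hb0, expCoeff_zero]
    rcases eq_or_ne n 1 with rfl | hn1
    · rw [hb1, expCoeff_one]
    have hl : log n ≠ 0 := (log_pos (by exact_mod_cast (by omega : 1 < n))).ne'
    refine mul_left_cancel₀ hl ?_
    rw [hb, log_mul_expCoeff]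
    refine sum_congr rfl fun p hp => ?_
    obtain ⟨hp1, -⟩ := mem_divisorsAntidiagonal.mp hp
    rcases eq_or_ne p.1 1 with h1 | h1
    · bound
    · have h0 : p.1 ≠ 0 := by lia
      have h2 : p.2 ≠ 0 := by lia
      rw [ih p.2 (by rw [← hp1]; exact (Nat.lt_mul_iff_one_lt_left (Nat.pos_of_ne_zero h2)).mpr (by omega))]

lemma sum_vonMangoldt_antidiagonal (n : ℕ) : ∑ p ∈ n.divisorsAntidiagonal, Λ p.1 = log n := by
  rw [Nat.sum_divisorsAntidiagonal (f := fun a _ => Λ a)]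
  exact vonMangoldt_sum

/-- The recursion is majorised by `∑_{d ∣ n} Λ(d) = log n`, the recursion of the constant function
1. -/
lemma abs_expCoeff_le_one {g : ℕ → ℝ} (hg : ∀ n, |g n| ≤ 1) (n : ℕ) : |expCoeff g n| ≤ 1 := by
  induction n using Nat.strong_induction_on with
  | _ n ih =>
    by_cases h : n ≤ 1
    · rw [expCoeff, if_pos h]
      simp_all
    · have hl : 0 < log n := log_pos (by simp_all)
      refine le_of_mul_le_mul_left ?_ hl
      rw [← abs_of_pos hl, ← abs_mul, abs_of_pos hl, log_mul_expCoeff, mul_one,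
        ← sum_vonMangoldt_antidiagonal n]
      refine (Finset.abs_sum_le_sum_abs _ _).trans (sum_le_sum fun p hp => ?_)
      obtain ⟨hp1, hn⟩ := mem_divisorsAntidiagonal.mp hp
      rw [abs_mul, abs_mul, abs_of_nonneg vonMangoldt_nonneg]
      rcases eq_or_ne p.1 1 with h1 | h1
      · bound
      · have h0 : p.1 ≠ 0 := by lia
        have h2 : p.2 ≠ 0 := by lia
        have h3 := ih p.2 (by rw [← hp1]; exact (Nat.lt_mul_iff_one_lt_left (Nat.pos_of_ne_zero h2)).mpr (by omega))
        calc Λ p.1 * |g p.1| * |expCoeff g p.2| ≤ Λ p.1 * 1 * 1 := by bound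
          _ = _ := by ring

lemma expCoeff_nonneg {g : ℕ → ℝ} (hg : ∀ n, 0 ≤ g n) (n : ℕ) : 0 ≤ expCoeff g n := by
  induction n using Nat.strong_induction_on with
  | _ n ih =>
    rw [expCoeff]
    split_ifs
    · positivity
    · refine div_nonneg (sum_nonneg fun m _ => ?_) (log_natCast_nonneg n)
      exact mul_nonneg (mul_nonneg vonMangoldt_nonneg (hg _))
        (ih _ (Nat.mem_properDivisors.mp m.2).2)

/-- Multiplication by `log` is a derivation for Dirichlet convolution and `log = Λ * ζ`. In terms of
series: multiplying by `ζ(s)` adds 1 to the weight `g` in the exponent. -/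
lemma sum_divisors_expCoeff_log {g : ℕ → ℝ} (n : ℕ) : log n * ∑ m ∈ n.divisors, expCoeff g m =
      ∑ p ∈ n.divisorsAntidiagonal, Λ p.1 * (1 + g p.1) * ∑ m ∈ p.2.divisors, expCoeff g m := by
  set a : ArithmeticFunction ℝ := ⟨expCoeff g, expCoeff_zero g⟩
  set G : ArithmeticFunction ℝ := ⟨fun n => Λ n * g n, by simp⟩ with hG
  have haG : ∀ n : ℕ, log n * a n = (G * a) n := fun n => by exact log_mul_expCoeff g n
  have hb : ∀ n : ℕ, ∑ m ∈ n.divisors, expCoeff g m = (a * (ζ : ArithmeticFunction ℝ)) n := by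
    intro n
    rw [coe_mul_zeta_apply]
    rfl
  have hder : log n * (a * (ζ : ArithmeticFunction ℝ)) n = (G * a * ζ) n + (a * (Λ * ζ)) n := by
    rw [vonMangoldt_mul_zeta, mul_apply, mul_apply, mul_apply, mul_sum, ← sum_add_distrib]
    refine sum_congr rfl fun p hp => ?_
    obtain ⟨hp1, hn⟩ := mem_divisorsAntidiagonal.mp hp
    have h0 : p.1 ≠ 0 := by lia
    have h2 : p.2 ≠ 0 := by lia
    rw [← haG, ← hp1, Nat.cast_mul, log_mul (by positivity) (by positivity),
      natCoe_apply, zeta_apply_ne h2, log_apply]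
    ring
  simp only [hb]
  rw [hder, show G * a * ζ = G * (a * ζ) by ring,
    show a * (Λ * (ζ : ArithmeticFunction ℝ)) = Λ * (a * ζ) by ring,
    mul_apply, mul_apply, ← sum_add_distrib]
  refine sum_congr rfl fun p _ => ?_
  simp only [hG, coe_mk]
  ring

lemma sum_divisors_expCoeff (g : ℕ → ℝ) (n : ℕ) :
    ∑ m ∈ n.divisors, expCoeff g m = expCoeff (fun n => 1 + g n) n := by
  have := log_mul_induction (b := fun n => ∑ m ∈ n.divisors, expCoeff g m)
    (g := fun n => 1 + g n) sum_divisors_expCoeff_log (by simp) (by simp [expCoeff_one])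
  lia

/-- Euler-type exponential formula, twisted by a completely multiplicative function. -/
theorem LSeries_expCoeff_mul {N : ℕ} (χ : DirichletCharacter ℂ N) (g : ℕ → ℝ) {s : ℂ}
    (ha : abscissaOfAbsConv (fun n => (expCoeff g n : ℂ) * χ n) < s.re)
    (hG : abscissaOfAbsConv (fun n => ((Λ n * g n / log n : ℝ) : ℂ) * χ n) < s.re) :
    LSeries (fun n => (expCoeff g n : ℂ) * χ n) s =
      cexp (LSeries (fun n => ((Λ n * g n / log n : ℝ) : ℂ) * χ n) s) := by
  refine LSeries_eq_exp (by simp [expCoeff_one]) (by simp) (fun n hn => ?_) ha hG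
  rw [LSeries.convolution_def]
  simp only [logMul]
  have h := congrArg (fun x : ℝ => (x : ℂ) * χ n) (log_mul_expCoeff g n)
  simp only [ofReal_mul, Complex.ofReal_sum] at h
  rw [← natCast_log, ← mul_assoc, h, sum_mul]
  refine sum_congr rfl fun p hp => ?_
  obtain ⟨hp1, -⟩ := mem_divisorsAntidiagonal.mp hp
  rw [← hp1, Nat.cast_mul, map_mul, ← natCast_log]
  by_cases h1 : log p.1 = 0
  · have : (Λ p.1 : ℝ) = 0 := by
      rcases Nat.lt_or_ge 1 p.1 with h | h
      · exact absurd h1 (log_pos (by simp_all)).ne'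
      · interval_cases p.1 <;> simp
    simp [this]
  · have h1' : (log p.1 : ℂ) ≠ 0 := mod_cast h1
    simp only [ofReal_mul, ofReal_div]
    field_simp

lemma expCoeff_const_one {n : ℕ} (hn : n ≠ 0) : expCoeff (fun _ => 1) n = 1 := by
  have h := log_mul_induction (b := fun n => if n = 0 then 0 else 1) (g := fun _ => 1) (fun n => ?_)
    (by simp) (by simp)
  · lia
  · rcases eq_or_ne n 0 with rfl | hn
    · simp
    · rw [if_neg hn, mul_one, ← sum_vonMangoldt_antidiagonal n]
      refine sum_congr rfl fun p hp => ?_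
      obtain ⟨hp1, hn⟩ := mem_divisorsAntidiagonal.mp hp
      grind

end

/-! ### Transfer of identities between exponential sums and Laplace transforms -/

lemma integrableOn_pow_mul_exp_neg (n : ℕ) :
    IntegrableOn (fun y : ℝ => y ^ n * exp (-y)) (Ioi 0) := by
  have h := GammaIntegral_convergent (s := n + 1) (by positivity)
  refine h.congr_fun (fun y _ => ?_) measurableSet_Ioi
  simp only [add_sub_cancel_right, rpow_natCast]
  ring

lemma norm_exp_neg_mul_le {a : ℂ} (ha : 1 ≤ a.re) {y : ℝ} (hy : 0 ≤ y) :
    ‖cexp (-(a * y))‖ ≤ exp (-y) := by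
  rw [norm_exp]
  simp only [Complex.neg_re, re_mul_ofReal]
  exact exp_le_exp.mpr (by nlinarith)

lemma hasDerivAt_exp_neg_mul (a : ℂ) (y : ℝ) :
    HasDerivAt (fun y : ℝ => cexp (-(a * y))) (-a * cexp (-(a * y))) y := by
  have h : HasDerivAt (fun y : ℝ => -(a * (y : ℂ))) (-a) y := by
    simpa using ((ofRealCLM.hasDerivAt (x := y)).const_mul a).fun_neg
  exact h.cexp.congr_deriv (by ring)

lemma tendsto_pow_mul_exp_neg (n : ℕ) : Tendsto (fun y : ℝ => y ^ n * exp (-y)) atTop (𝓝 0) :=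
  tendsto_pow_mul_exp_neg_atTop_nhds_zero n

lemma integrableOn_mul_exp_neg_mul {a : ℂ} (ha : 1 ≤ a.re) {G : ℝ → ℂ} (hG : Continuous G)
    {C : ℝ} {n : ℕ} (hb : ∀ y, 0 ≤ y → ‖G y‖ ≤ C * (1 + y ^ n)) :
    IntegrableOn (fun y : ℝ => cexp (-(a * y)) * G y) (Ioi 0) := by
  refine Integrable.mono' (((integrableOn_pow_mul_exp_neg 0).add
    (integrableOn_pow_mul_exp_neg n)).const_mul C)
    (by fun_prop) ?_
  refine (ae_restrict_iff' measurableSet_Ioi).mpr (.of_forall fun y hy => ?_)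
  rw [norm_mul]
  calc _ ≤ exp (-y) * (C * (1 + y ^ n)) :=
        mul_le_mul (norm_exp_neg_mul_le ha hy.le) (hb y hy.le) (norm_nonneg _) (exp_nonneg _)
    _ = _ := by simp only [Pi.add_apply]; ring

lemma tendsto_exp_neg_mul_mul {a : ℂ} (ha : 1 ≤ a.re) {G : ℝ → ℂ}
    {C : ℝ} {n : ℕ} (hb : ∀ y, 0 ≤ y → ‖G y‖ ≤ C * (1 + y ^ n)) :
    Tendsto (fun y : ℝ => cexp (-(a * y)) * G y) atTop (𝓝 0) := by
  have h := ((tendsto_pow_mul_exp_neg 0).add (tendsto_pow_mul_exp_neg n)).const_mul C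
  rw [add_zero, mul_zero] at h
  refine squeeze_zero_norm' ?_ h
  filter_upwards [eventually_ge_atTop 0] with y hy
  rw [norm_mul]
  calc _ ≤ exp (-y) * (C * (1 + y ^ n)) :=
        mul_le_mul (norm_exp_neg_mul_le ha hy) (hb y hy) (norm_nonneg _) (exp_nonneg _)
    _ = _ := by ring

/-- Two integrations by parts in a Laplace transform. -/
lemma sq_mul_laplace {a : ℂ} (ha : 1 ≤ a.re) {K K₁ K₂ : ℝ → ℂ}
    (hK : ∀ y, HasDerivAt K (K₁ y) y) (hK₁ : ∀ y, HasDerivAt K₁ (K₂ y) y) (hK₂ : Continuous K₂)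
    {C : ℝ} {n : ℕ} (hb : ∀ y, 0 ≤ y → ‖K y‖ ≤ C * (1 + y ^ n))
    (hb₁ : ∀ y, 0 ≤ y → ‖K₁ y‖ ≤ C * (1 + y ^ n)) (hb₂ : ∀ y, 0 ≤ y → ‖K₂ y‖ ≤ C * (1 + y ^ n)) :
    a ^ 2 * ∫ y in Ioi (0 : ℝ), cexp (-(a * y)) * K y =
      (∫ y in Ioi (0 : ℝ), cexp (-(a * y)) * K₂ y) + a * K 0 + K₁ 0 := by
  have hKc : Continuous K := continuous_iff_continuousAt.mpr fun y => (hK y).continuousAt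
  have i0 := integrableOn_mul_exp_neg_mul ha hKc hb
  have i2 := integrableOn_mul_exp_neg_mul ha hK₂ hb₂
  have hlim := ((tendsto_exp_neg_mul_mul ha hb).const_mul a).add (tendsto_exp_neg_mul_mul ha hb₁)
  rw [mul_zero, add_zero] at hlim
  have h := integral_Ioi_of_hasDerivAt_of_tendsto' (a := (0 : ℝ)) (m := 0)
    (f := fun y : ℝ => a * (cexp (-(a * y)) * K y) + cexp (-(a * y)) * K₁ y)
    (f' := fun y : ℝ => cexp (-(a * y)) * K₂ y - a ^ 2 * (cexp (-(a * y)) * K y))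
    (fun y _ => by
      have h1 := ((hasDerivAt_exp_neg_mul a y).mul (hK y)).const_mul a
      have h2 := (hasDerivAt_exp_neg_mul a y).mul (hK₁ y)
      exact (h1.add h2).congr_deriv (by ring))
    (i2.sub (i0.const_mul _))
    hlim
  rw [integral_sub i2 (i0.const_mul _), integral_const_mul] at h
  simp only [ofReal_zero, mul_zero, neg_zero, Complex.exp_zero] at h
  grind

lemma laplace_id_exp {a : ℂ} (ha : 1 ≤ a.re) (k : ℕ) :
    ∫ y in Ioi (0 : ℝ), cexp (-(a * y)) * (y * ((exp (-y) ^ k : ℝ) : ℂ)) =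
      1 / (a + k) ^ 2 := by
  have hk : 1 ≤ (a + k).re := by simp; linarith
  have h := sq_mul_laplace hk (K := fun y => (y : ℂ)) (K₁ := fun _ => 1) (K₂ := fun _ => 0)
    (fun y => ofRealCLM.hasDerivAt) (fun y => hasDerivAt_const _ _) continuous_const
    (C := 1) (n := 1) (fun y hy => by simp [abs_of_nonneg hy])
    (fun y hy => by simp_all) (fun y hy => by simp; linarith)
  simp only [mul_zero, integral_zero, ofReal_zero, zero_add] at h
  have h0 : (a + k) ^ 2 ≠ 0 := by grind
  rw [eq_div_iff h0, mul_comm, ← h]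
  congr 1
  refine setIntegral_congr_fun measurableSet_Ioi fun y _ => ?_
  rw [← exp_nat_mul, Complex.ofReal_exp, mul_left_comm, mul_comm (y : ℂ), ← Complex.exp_add]
  push_cast
  ring

lemma exists_derivative_eq (p : Polynomial ℝ) : ∃ P : Polynomial ℝ, P.derivative = p := by
  induction p using Polynomial.induction_on' with
  | add p q hp hq =>
    obtain ⟨P, rfl⟩ := hp
    obtain ⟨Q, rfl⟩ := hq
    exact ⟨P + Q, by simp⟩
  | monomial n a =>
    refine ⟨Polynomial.monomial (n + 1) (a / (n + 1)), ?_⟩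
    rw [Polynomial.derivative_monomial]
    grind

lemma exists_derivative_eq_eval (p : Polynomial ℝ) (x : ℝ) :
    ∃ P : Polynomial ℝ, P.derivative = p ∧ P.eval 1 = x := by
  obtain ⟨P, hP⟩ := exists_derivative_eq p
  exact ⟨P + Polynomial.C (x - P.eval 1), by simp [hP], by simp⟩

/-- Approximation by polynomials in `e^{-y}`, together with two derivatives. -/
lemma exists_polynomial_exp_near {g g₁ g₂ : ℝ → ℝ} (hg : ∀ y, HasDerivAt g (g₁ y) y)
    (hg₁ : ∀ y, HasDerivAt g₁ (g₂ y) y) (hg₂ : Continuous g₂)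
    (hlim : Tendsto (fun y => exp (2 * y) * (g₁ y + g₂ y)) atTop (𝓝 0)) {ε : ℝ} (hε : 0 < ε) :
    ∃ (P : Polynomial ℝ) (k₁ k₂ : ℝ → ℝ),
      (∀ y, HasDerivAt (fun y => g y - P.eval (exp (-y))) (k₁ y) y) ∧
      (∀ y, HasDerivAt k₁ (k₂ y) y) ∧ Continuous k₂ ∧ g 0 - P.eval 1 = 0 ∧ k₁ 0 = 0 ∧
      (∀ y, 0 ≤ y → |g y - P.eval (exp (-y))| ≤ ε * y) ∧ (∀ y, 0 ≤ y → |k₁ y| ≤ ε) ∧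
      (∀ y, 0 ≤ y → |k₂ y| ≤ ε * (1 + y)) := by
  have hg₁c : Continuous g₁ := continuous_iff_continuousAt.mpr fun y => (hg₁ y).continuousAt
  -- In the variable `t = e^{-y}`, `ψ` is the second derivative of `g`; the decay hypothesis makes
  -- it continuous on `[0, 1]` with value 0 at 0. Weierstrass approximates `ψ` by `p`, and `p` is
  -- integrated twice from `t = 1`, that is `y = 0`, with matching initial values.
  set ψ : ℝ → ℝ := fun t => if t = 0 then 0 else (g₁ (-log t) + g₂ (-log t)) / t ^ 2 with hψ
  have hψc : ContinuousOn ψ (Icc 0 1) := by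
    intro t ht
    rcases eq_or_ne t 0 with rfl | h0
    · have hψ0 : ψ 0 = 0 := by simp [hψ]
      have h1 : ContinuousWithinAt ψ (Ioi 0) 0 := by
        rw [ContinuousWithinAt, hψ0]
        have h2 := hlim.comp (tendsto_neg_atBot_atTop.comp tendsto_log_nhdsGT_zero)
        refine h2.congr' ?_
        filter_upwards [self_mem_nhdsWithin] with t ht
        simp only [hψ, Function.comp_apply]
        rw [if_neg ht.ne', mul_neg, exp_neg, two_mul, exp_add, exp_log ht]
        field_simp
      exact h1.insert.mono fun t ht => ht.1.eq_or_lt.imp Eq.symm id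
    · refine ContinuousAt.continuousWithinAt ?_
      have : ψ =ᶠ[𝓝 t] fun t => (g₁ (-log t) + g₂ (-log t)) / t ^ 2 := by
        filter_upwards [isOpen_ne.mem_nhds h0] with r hr
        lia
      refine ContinuousAt.congr ?_ this.symm
      have hl : ContinuousAt (fun t => -log t) t := by fun_prop
      exact ((hg₁c.continuousAt.comp hl).add (hg₂.continuousAt.comp hl)).div (by fun_prop)
        (pow_ne_zero _ h0)
  obtain ⟨p, hp⟩ := exists_polynomial_near_of_continuousOn 0 1 ψ hψc ε hε
  obtain ⟨Q, hQ, hQ1⟩ := exists_derivative_eq_eval p (-g₁ 0)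
  obtain ⟨P, hP, hP1⟩ := exists_derivative_eq_eval Q (g 0)
  have he : ∀ y, HasDerivAt (fun y : ℝ => exp (-y)) (-exp (-y)) y := fun y => by
    simpa using (hasDerivAt_neg y).exp
  set j : ℝ → ℝ := fun y => exp y * g₁ y + Q.eval (exp (-y)) with hj
  set j₁ : ℝ → ℝ := fun y => exp y * (g₁ y + g₂ y) - exp (-y) * p.eval (exp (-y)) with hj₁
  have hdj : ∀ y, HasDerivAt j (j₁ y) y := fun y => by
    have h1 := (hasDerivAt_exp y).mul (hg₁ y)
    have h2 := (Q.hasDerivAt (exp (-y))).comp y (he y)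
    refine (h1.add h2).congr_deriv ?_
    grind
  have hj₁b : ∀ y, 0 ≤ y → |j₁ y| ≤ ε := by
    intro y hy
    have hle : exp (-y) ≤ 1 := by simp_all
    have h1 : j₁ y = -(exp (-y) * (p.eval (exp (-y)) - ψ (exp (-y)))) := by
      simp only [hj₁, hψ]
      rw [if_neg (exp_pos _).ne', log_exp, neg_neg, exp_neg]
      grind
    rw [h1, abs_neg, abs_mul, abs_of_pos (exp_pos _)]
    have := (hp (exp (-y)) ⟨(exp_pos _).le, hle⟩).le
    calc _ ≤ 1 * ε := mul_le_mul hle this (abs_nonneg _) zero_le_one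
      _ = ε := one_mul _
  have mvt : ∀ {f f' : ℝ → ℝ}, (∀ y, HasDerivAt f (f' y) y) → (∀ y, 0 ≤ y → |f' y| ≤ ε) → f 0 = 0 →
      ∀ y, 0 ≤ y → |f y| ≤ ε * y := by
    intro f f' hf hf' h0 y hy
    have := Convex.norm_image_sub_le_of_norm_hasDerivWithin_le (s := Ici (0 : ℝ)) (C := ε)
      (fun x _ => (hf x).hasDerivWithinAt) (fun x hx => hf' x hx) (convex_Ici 0)
      (x := 0) (y := y) self_mem_Ici hy
    simpa [h0, abs_of_nonneg hy] using this
  have hj0 : j 0 = 0 := by simp_all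
  have hjb := mvt hdj hj₁b hj0
  have hk₁b : ∀ y, 0 ≤ y → |exp (-y) * j y| ≤ ε := by
    intro y hy
    rw [abs_mul, abs_of_pos (exp_pos _)]
    have h1 : y * exp (-y) ≤ 1 := by
      rw [exp_neg, mul_inv_le_iff₀ (exp_pos y)]
      linarith [add_one_le_exp y]
    calc _ ≤ exp (-y) * (ε * y) := by bound
      _ = ε * (y * exp (-y)) := by ring
      _ ≤ ε := by nlinarith
  have hdk : ∀ y, HasDerivAt (fun y => g y - P.eval (exp (-y))) (exp (-y) * j y) y := by
    intro y
    have h2 := (P.hasDerivAt (exp (-y))).comp y (he y)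
    refine ((hg y).sub h2).congr_deriv ?_
    rw [hP]
    rw [mul_add, ← mul_assoc, ← exp_add]
    simp
    ring
  refine ⟨P, fun y => exp (-y) * j y, fun y => exp (-y) * (j₁ y - j y), hdk, fun y => ?_,
    ?_, by linarith, by simp [hj0], mvt hdk hk₁b (by simp [hP1]), hk₁b, fun y hy => ?_⟩
  · exact ((he y).mul (hdj y)).congr_deriv (by ring)
  · fun_prop
  · rw [abs_mul, abs_of_pos (exp_pos _)]
    calc _ ≤ 1 * (ε + ε * y) := by
          refine mul_le_mul (by simp_all) ((abs_sub _ _).trans ?_) (abs_nonneg _) zero_le_one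
          grind
      _ = _ := by ring

/-- If an exponential sum `∑ cᵢ e^{-kλᵢ}` equals `∑ w_z / (a_z + k)²` for all `k`, then the same
relation holds with `e^{-ky}` replaced by any rapidly decaying twice differentiable function. -/
theorem tsum_eq_tsum_laplace {ι Z : Type*} {c : ι → ℂ} {lam : ι → ℝ} {w a : Z → ℂ}
    (hlam : ∀ i, 0 ≤ lam i) (ha : ∀ z, 1 ≤ (a z).re)
    (hc : Summable fun i => ‖c i‖ * (1 + lam i)) (hw : Summable fun z => ‖w z‖ / ‖a z‖ ^ 2)
    (hmon : ∀ k : ℕ, ∑' i, c i * ((exp (-lam i) ^ k : ℝ) : ℂ) = ∑' z, w z / (a z + k) ^ 2)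
    {g g₁ g₂ : ℝ → ℝ} (hg : ∀ y, HasDerivAt g (g₁ y) y)
    (hg₁ : ∀ y, HasDerivAt g₁ (g₂ y) y) (hg₂ : Continuous g₂)
    (hlim : Tendsto (fun y => exp (2 * y) * (g₁ y + g₂ y)) atTop (𝓝 0)) :
    HasSum (fun z => w z * ∫ y in Ioi (0 : ℝ), cexp (-(a z * y)) * (y * (g y : ℂ)))
      (∑' i, c i * (g (lam i) : ℂ)) := by
  have ha0 : ∀ z, a z ≠ 0 := fun z h => by have := ha z; rw [h] at this; norm_num at this
  have hc1 : Summable fun i => ‖c i‖ := by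
    refine hc.of_nonneg_of_le (fun _ => norm_nonneg _) fun i => ?_
    bound
  have hgc : Continuous g := continuous_iff_continuousAt.mpr fun y => (hg y).continuousAt
  set T : Polynomial ℝ → Z → ℂ := fun P z =>
    w z * ∑ k ∈ Finset.range (P.natDegree + 1), (P.coeff k : ℂ) * (1 / (a z + k) ^ 2) with hT
  have hTint : ∀ (P : Polynomial ℝ) z, w z * ∫ y in Ioi (0 : ℝ), cexp (-(a z * y)) *
      (y * ((P.eval (exp (-y)) : ℝ) : ℂ)) = T P z := by
    intro P z
    simp only [hT]
    congr 1
    have : ∀ y : ℝ, cexp (-(a z * y)) * (y * ((P.eval (exp (-y)) : ℝ) : ℂ)) =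
        ∑ k ∈ Finset.range (P.natDegree + 1), (P.coeff k : ℂ) *
          (cexp (-(a z * y)) * (y * ((exp (-y) ^ k : ℝ) : ℂ))) := by
      intro y
      rw [Polynomial.eval_eq_sum_range]
      push_cast
      rw [mul_sum, mul_sum]
      grind
    simp_rw [this]
    rw [integral_finsetSum]
    · simp_rw [integral_const_mul, laplace_id_exp (ha z)]
    · intro k _
      refine Integrable.const_mul (integrableOn_mul_exp_neg_mul (ha z) (by fun_prop)
        (C := 1) (n := 1) fun y hy => ?_) _
      rw [norm_mul, norm_real, norm_real, norm_of_nonneg hy, norm_of_nonneg (by positivity)]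
      have : exp (-y) ^ k ≤ 1 := pow_le_one₀ (exp_nonneg _) (by simp_all)
      nlinarith
  have hmono : ∀ k : ℕ, HasSum (fun z => w z / (a z + k) ^ 2)
      (∑' i, c i * ((exp (-lam i) ^ k : ℝ) : ℂ)) := by
    intro k
    rw [hmon]
    refine Summable.hasSum (Summable.of_norm_bounded hw fun z => ?_)
    rw [norm_div, norm_pow]
    have h1 : ‖a z‖ ≤ ‖a z + k‖ := by
      rw [Complex.norm_def, Complex.norm_def]
      refine sqrt_le_sqrt ?_
      simp only [Complex.normSq_apply, Complex.add_re, Complex.add_im, Complex.natCast_re,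
        Complex.natCast_im, add_zero]
      have := ha z
      bound
    have := norm_pos_iff.mpr (ha0 z)
    gcongr
  have hTsum : ∀ P : Polynomial ℝ,
      HasSum (T P) (∑' i, c i * ((P.eval (exp (-lam i)) : ℝ) : ℂ)) := by
    intro P
    have h1 : HasSum (fun z => ∑ k ∈ Finset.range (P.natDegree + 1),
        (P.coeff k : ℂ) * (w z / (a z + k) ^ 2)) (∑ k ∈ Finset.range (P.natDegree + 1),
        (P.coeff k : ℂ) * ∑' i, c i * ((exp (-lam i) ^ k : ℝ) : ℂ)) :=
      hasSum_sum fun k _ => (hmono k).mul_left _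
    convert! h1 using 1
    · ext z
      simp only [hT, mul_sum]
      grind
    · simp_rw [← tsum_mul_left]
      rw [← Summable.tsum_finsetSum]
      · refine tsum_congr fun i => ?_
        rw [Polynomial.eval_eq_sum_range]
        push_cast
        rw [mul_sum]
        grind
      · intro k _
        refine Summable.mul_left _ (Summable.of_norm_bounded hc1 fun i => ?_)
        rw [norm_mul, norm_real, norm_of_nonneg (by positivity)]
        exact mul_le_of_le_one_right (norm_nonneg _)
          (pow_le_one₀ (exp_nonneg _) (by simp_all))
  set B : ℝ := ∫ y in Ioi (0 : ℝ), exp (-y) * (2 + y * (1 + y)) with hB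
  set I : Z → ℂ := fun z => w z * ∫ y in Ioi (0 : ℝ), cexp (-(a z * y)) * (y * (g y : ℂ))
    with hI
  have key : ∀ ε, 0 < ε → ∃ P : Polynomial ℝ, (∀ z, ‖I z - T P z‖ ≤ ε * B * (‖w z‖ / ‖a z‖ ^ 2)) ∧
      ∀ i, ‖c i * (g (lam i) : ℂ) - c i * ((P.eval (exp (-lam i)) : ℝ) : ℂ)‖ ≤
        ε * (‖c i‖ * (1 + lam i)) := by
    intro ε hε
    obtain ⟨P, k₁, k₂, hk, hk₁, hk₂, h0, h01, hb, hb₁, hb₂⟩ :=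
      exists_polynomial_exp_near hg hg₁ hg₂ hlim hε
    set k : ℝ → ℝ := fun y => g y - P.eval (exp (-y)) with hkdef
    have hk₁c : Continuous k₁ := continuous_iff_continuousAt.mpr fun y => (hk₁ y).continuousAt
    refine ⟨P, fun z => ?_, fun i => ?_⟩
    · have hPb : ∃ D, ∀ y, 0 ≤ y → |P.eval (exp (-y))| ≤ D := by
        obtain ⟨D, hD⟩ := isCompact_Icc.exists_bound_of_continuousOn
          (s := Icc (0 : ℝ) 1) P.continuous.continuousOn
        exact ⟨D, fun y hy => hD _ ⟨exp_nonneg _, by simp_all⟩⟩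
      obtain ⟨D, hD⟩ := hPb
      have hD0 : 0 ≤ D := (abs_nonneg _).trans (hD 0 le_rfl)
      have hsub : I z - T P z =
          w z * ∫ y in Ioi (0 : ℝ), cexp (-(a z * y)) * ((y * k y : ℝ) : ℂ) := by
        rw [hI, ← hTint, ← mul_sub, ← integral_sub]
        · congr 1
          refine integral_congr_ae (.of_forall fun y => ?_)
          simp only [hkdef]
          push_cast
          ring
        · refine integrableOn_mul_exp_neg_mul (ha z) (by fun_prop) (C := ε + D) (n := 2)
            fun y hy => ?_
          rw [norm_mul, norm_real, norm_real, norm_of_nonneg hy, norm_eq_abs]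
          have h1 : |g y| ≤ ε * y + D := by
            have : g y = k y + P.eval (exp (-y)) := by grind
            rw [this]
            exact (abs_add_le _ _).trans (add_le_add (hb y hy) (hD y hy))
          nlinarith [sq_nonneg (y - 1), mul_nonneg hD0 (sq_nonneg (y - 1))]
        · have := P.continuous
          refine integrableOn_mul_exp_neg_mul (ha z) (by fun_prop) (C := D) (n := 1) fun y hy => ?_
          rw [norm_mul, norm_real, norm_real, norm_of_nonneg hy, norm_eq_abs]
          nlinarith [hD y hy, abs_nonneg (P.eval (exp (-y)))]
      -- Only `∑ |w| / |a|²` converges, so a uniformly small error in the test function would not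
      -- suffice. As `k 0 = 0`, the function `y k(y)` and its derivative vanish at 0, and two
      -- integrations by parts produce the missing `a⁻²`.
      have hparts := sq_mul_laplace (ha z) (K := fun y => ((y * k y : ℝ) : ℂ))
        (K₁ := fun y => ((k y + y * k₁ y : ℝ) : ℂ)) (K₂ := fun y => ((2 * k₁ y + y * k₂ y : ℝ) : ℂ))
        (fun y => (((hasDerivAt_id y).mul (hk y)).congr_deriv (by simp)).ofReal_comp)
        (fun y => (((hk y).add ((hasDerivAt_id y).mul (hk₁ y))).congr_deriv
          (by simp; ring)).ofReal_comp)
        (by fun_prop) (C := 4 * ε) (n := 2) (fun y hy => by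
          rw [norm_real, norm_eq_abs, abs_mul, abs_of_nonneg hy]
          nlinarith [hb y hy, mul_nonneg hε.le (sq_nonneg y)])
        (fun y hy => by
          rw [norm_real, norm_eq_abs]
          refine (abs_add_le _ _).trans ?_
          rw [abs_mul, abs_of_nonneg hy]
          nlinarith [hb y hy, hb₁ y hy, mul_nonneg hε.le (sq_nonneg (y - 1))])
        (fun y hy => by
          rw [norm_real, norm_eq_abs]
          refine (abs_add_le _ _).trans ?_
          rw [abs_mul, abs_mul, abs_of_nonneg hy, abs_two]
          nlinarith [hb₂ y hy, hb₁ y hy, mul_nonneg hε.le (sq_nonneg (y - 1))])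
      have hk0 : k 0 = 0 := by simp_all
      simp only [hk0, h01, mul_zero, ofReal_zero, add_zero] at hparts
      have hbound : ‖∫ y in Ioi (0 : ℝ), cexp (-(a z * y)) *
          ((2 * k₁ y + y * k₂ y : ℝ) : ℂ)‖ ≤ ε * B := by
        rw [hB, ← integral_const_mul]
        refine norm_integral_le_of_norm_le ?_ ?_
        · have h1 := (integrableOn_pow_mul_exp_neg 0).const_mul 2
          have h2 := (integrableOn_pow_mul_exp_neg 1).add (integrableOn_pow_mul_exp_neg 2)
          refine ((h1.add h2).const_mul ε).congr (.of_forall fun y => ?_)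
          simp only [Pi.add_apply]
          ring
        · refine (ae_restrict_iff' measurableSet_Ioi).mpr (.of_forall fun y hy => ?_)
          have hy : (0 : ℝ) < y := hy
          rw [norm_mul, norm_real, norm_eq_abs, mul_left_comm]
          refine mul_le_mul (norm_exp_neg_mul_le (ha z) hy.le) ?_ (abs_nonneg _) (exp_nonneg _)
          refine (abs_add_le _ _).trans ?_
          rw [abs_mul, abs_mul, abs_of_pos hy, abs_two]
          nlinarith [hb₂ y hy.le, hb₁ y hy.le]
      have hpos := norm_pos_iff.mpr (ha0 z)
      rw [hsub, norm_mul]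
      rw [← hparts, norm_mul, norm_pow] at hbound
      calc _ ≤ ‖w z‖ * (ε * B / ‖a z‖ ^ 2) := by
            refine mul_le_mul_of_nonneg_left ?_ (norm_nonneg _)
            rw [le_div_iff₀ (by positivity), mul_comm]
            lia
        _ = _ := by ring
    · rw [← mul_sub, ← Complex.ofReal_sub, norm_mul, norm_real, norm_eq_abs]
      calc _ ≤ ‖c i‖ * (ε * lam i) := by bound
        _ ≤ _ := by nlinarith [norm_nonneg (c i), mul_nonneg hε.le (norm_nonneg (c i))]
  have hB0 : 0 ≤ B := setIntegral_nonneg measurableSet_Ioi fun y hy => by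
    have hy : (0 : ℝ) < y := hy
    positivity
  have hIs : Summable I := by
    obtain ⟨P, hP, -⟩ := key 1 one_pos
    have := (Summable.of_norm_bounded (hw.mul_left (1 * B)) hP).add (hTsum P).summable
    grind
  have heq : ∑' z, I z = ∑' i, c i * (g (lam i) : ℂ) := by
    set M := B * (∑' z, ‖w z‖ / ‖a z‖ ^ 2) + ∑' i, ‖c i‖ * (1 + lam i)
    have hM0 : 0 ≤ M := add_nonneg (mul_nonneg hB0 (tsum_nonneg fun _ => by positivity))
      (tsum_nonneg fun i => mul_nonneg (norm_nonneg _) (by grind))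
    have hle : ∀ ε, 0 < ε → ‖∑' z, I z - ∑' i, c i * (g (lam i) : ℂ)‖ ≤ ε * M := by
      intro ε hε
      obtain ⟨P, hP1, hP2⟩ := key ε hε
      have e1 := tsum_of_norm_bounded (hw.mul_left (ε * B)).hasSum hP1
      have e2 := tsum_of_norm_bounded (hc.mul_left ε).hasSum hP2
      have sP : Summable fun i => c i * ((P.eval (exp (-lam i)) : ℝ) : ℂ) := by
        obtain ⟨D, hD⟩ := isCompact_Icc.exists_bound_of_continuousOn
          (s := Icc (0 : ℝ) 1) P.continuous.continuousOn
        refine Summable.of_norm_bounded (hc1.mul_right D) fun i => ?_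
        rw [norm_mul, norm_real]
        exact mul_le_mul_of_nonneg_left (hD _ ⟨exp_nonneg _, by simpa using hlam i⟩) (norm_nonneg _)
      have sg : Summable fun i => c i * (g (lam i) : ℂ) :=
        ((Summable.of_norm_bounded (hc.mul_left ε) hP2).add sP).congr fun i => by ring
      rw [hIs.tsum_sub (hTsum P).summable, (hTsum P).tsum_eq, tsum_mul_left] at e1
      rw [sg.tsum_sub sP, tsum_mul_left] at e2
      have := norm_sub_le_norm_sub_add_norm_sub (∑' z, I z)
        (∑' i, c i * ((P.eval (exp (-lam i)) : ℝ) : ℂ)) (∑' i, c i * (g (lam i) : ℂ))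
      rw [norm_sub_rev (∑' i, c i * ((P.eval (exp (-lam i)) : ℝ) : ℂ))] at this
      linarith
    refine eq_of_norm_sub_le_zero (le_of_forall_pos_le_add fun ε hε => ?_)
    have := hle (ε / (M + 1)) (by positivity)
    refine this.trans ?_
    rw [zero_add, div_mul_eq_mul_div, div_le_iff₀ (by positivity)]
    nlinarith
  rw [← heq]
  exact hIs.hasSum

/-! ### The explicit formula -/

section explicit

variable {X : ℝ} {u : ℝ → ℝ}

lemma IsWeight.contDiff_weightCdf (hu : IsWeight X u) : ContDiff ℝ 2 (weightCdf u) := by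
  have h : ContDiff ℝ (1 + 1) (weightCdf u) := by
    rw [contDiff_succ_iff_deriv]
    refine ⟨fun t => (hasDerivAt_weightCdf hu t).differentiableAt, by simp, ?_⟩
    have : deriv (weightCdf u) = fun t => u (exp t) * exp t :=
      funext fun t => (hasDerivAt_weightCdf hu t).deriv
    rw [this]
    have hu1 : ContDiff ℝ 1 u := hu.smooth.of_le (by simp)
    fun_prop
  fun_prop

/-- The test function `e^{-σy} y^{-2}`, cut off smoothly near the origin. -/
lemma exists_deriv_test (hX : 2 ≤ X) (hu : IsWeight X u) {σ : ℝ} (hσ : 2 < σ) : ∃ g₁ g₂ : ℝ → ℝ,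
      (∀ y, HasDerivAt (fun y => weightCdf u (y / log X) * (exp (-(σ * y)) / y ^ 2))
        (g₁ y) y) ∧ (∀ y, HasDerivAt g₁ (g₂ y) y) ∧ Continuous g₂ ∧
      Tendsto (fun y => exp (2 * y) * (g₁ y + g₂ y)) atTop (𝓝 0) := by
  have hl : 0 < log X := by bound
  set f : ℝ → ℝ := fun y => exp (-(σ * y)) / y ^ 2
  set g : ℝ → ℝ := fun y => weightCdf u (y / log X) * f y with hg
  have hgsmooth : ContDiff ℝ (1 + 1) g := by
    refine contDiff_iff_contDiffAt.mpr fun y => ?_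
    rcases lt_or_ge y (log X / 2) with hy | hy
    · refine (contDiffAt_const (c := (0 : ℝ))).congr_of_eventuallyEq ?_
      filter_upwards [eventually_lt_nhds hy] with x hx
      simp only [hg]
      rw [weightCdf_eq_zero hu, zero_mul]
      refine le_trans ?_ (half_le_one_sub_inv hX)
      rw [div_le_iff₀ hl]; linarith
    · have hy0 : y ≠ 0 := by linarith
      refine ContDiffAt.mul (ContDiffAt.of_le ?_ (m := 1 + 1) (n := 2) (by norm_num))
        (ContDiffAt.div ?_ (by fun_prop) (pow_ne_zero _ hy0))
      · exact (hu.contDiff_weightCdf.comp (contDiff_id.div_const _)).contDiffAt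
      fun_prop
  obtain ⟨hg1, -, hg2⟩ := contDiff_succ_iff_deriv.mp hgsmooth
  obtain ⟨hg3, hg4⟩ := contDiff_one_iff_deriv.mp hg2
  refine ⟨deriv g, deriv (deriv g), fun y => (hg1 y).hasDerivAt, fun y => (hg3 y).hasDerivAt,
    hg4, ?_⟩
  have hgf : ∀ y, log X < y → g =ᶠ[𝓝 y] f := fun y hy => by
    filter_upwards [eventually_gt_nhds hy] with x hx
    simp only [hg]
    rw [weightCdf_eq_one hu ((one_le_div hl).mpr hx.le), one_mul]
  set f₁ : ℝ → ℝ := fun y => -(exp (-(σ * y)) * (σ / y ^ 2 + 2 / y ^ 3))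
  set f₂ : ℝ → ℝ := fun y => exp (-(σ * y)) * (σ ^ 2 / y ^ 2 + 4 * σ / y ^ 3 + 6 / y ^ 4) with hf₂
  have he : ∀ y, HasDerivAt (fun y => exp (-(σ * y))) (-σ * exp (-(σ * y))) y := fun y => by
    have : HasDerivAt (fun y => -(σ * y)) (-σ) y := by simpa using ((hasDerivAt_id y).const_mul σ).fun_neg
    exact this.exp.congr_deriv (by ring)
  have hdf : ∀ y, 0 < y → HasDerivAt f (f₁ y) y := fun y hy => by
    refine ((he y).div (hasDerivAt_pow 2 y) (by positivity)).congr_deriv ?_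
    grind
  have hdf₁ : ∀ y, 0 < y → HasDerivAt f₁ (f₂ y) y := fun y hy => by
    have h1 := ((hasDerivAt_pow 2 y).inv (by positivity)).const_mul σ
    have h2 := ((hasDerivAt_pow 3 y).inv (by positivity)).const_mul 2
    refine ((he y).mul (h1.add h2)).fun_neg.congr_deriv ?_
    simp only [hf₂, Pi.add_apply, Pi.inv_apply]; field_simp; ring
  have hev : ∀ y, log X < y → deriv g y + deriv (deriv g) y = f₁ y + f₂ y := by
    intro y hy
    have h1 : deriv g =ᶠ[𝓝 y] f₁ := by
      filter_upwards [eventually_gt_nhds hy] with x hx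
      rw [(hgf x hx).deriv_eq, (hdf x (hl.trans hx)).deriv]
    rw [h1.eq_of_nhds, h1.deriv_eq, (hdf₁ y (hl.trans hy)).deriv]
  have hT : ∀ n : ℕ, n ≠ 0 → Tendsto (fun y : ℝ => (y ^ n)⁻¹) atTop (𝓝 0) := fun n hn =>
    tendsto_inv_atTop_zero.comp (tendsto_pow_atTop hn)
  -- Surviving the factor `e^{2y}` requires `σ > 2`. With `σ = s - 2` in the application, this is
  -- the origin of the condition `s > 4`.
  have hE : Tendsto (fun y => exp (-((σ - 2) * y))) atTop (𝓝 0) :=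
    tendsto_exp_neg_atTop_nhds_zero.comp (tendsto_id.const_mul_atTop (by linarith))
  have hlim := hE.mul (((((hT 2 (by simp)).const_mul (σ ^ 2 - σ)).add
    ((hT 3 (by simp)).const_mul (4 * σ - 2))).add ((hT 4 (by simp)).const_mul 6)))
  rw [zero_mul] at hlim
  refine hlim.congr' ?_
  filter_upwards [eventually_gt_atTop (log X)] with y hy
  rw [hev y hy, show exp (-((σ - 2) * y)) = exp (2 * y) * exp (-(σ * y)) by rw [← exp_add]; ring_nf]
  grind

lemma U_mul_log_eq (hX : 2 ≤ X) (hu : IsWeight X u) {z : ℂ} (hz : 0 < z.re) :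
    U u (z * (log X : ℂ)) = ∫ y in Ioi (0 : ℝ),
      (weightCdf u (y / log X) : ℂ) * (cexp (-(z * y)) / y) := by
  have hl : 0 < log X := by bound
  have hl' : (log X : ℂ) ≠ 0 := mod_cast hl.ne'
  rw [U_eq_laplace hX hu (by simp_all)]
  have h := integral_comp_mul_left_Ioi (fun y : ℝ => (weightCdf u (y / log X) : ℂ) *
    (cexp (-(z * y)) / y)) 0 hl
  rw [mul_zero] at h
  have h2 : ∫ y in Ioi (0 : ℝ), (weightCdf u (y / log X) : ℂ) * (cexp (-(z * y)) / y) =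
      log X • ∫ t in Ioi (0 : ℝ), (weightCdf u (log X * t / log X) : ℂ) *
        (cexp (-(z * (log X * t : ℝ))) / (log X * t : ℝ)) := by simp_all
  rw [h2, ← integral_smul]
  refine setIntegral_congr_fun measurableSet_Ioi fun t ht => ?_
  simp only [Complex.real_smul]
  push_cast
  field_simp

lemma abscissaOfAbsConv_twist_vonMangoldt {q : ℕ} (χ : DirichletCharacter ℂ q) :
    abscissaOfAbsConv ((fun n : ℕ => χ n) * fun n : ℕ => (Λ n : ℂ)) ≤ 1 :=
  abscissaOfAbsConv_le_of_forall_lt_LSeriesSummable fun y hy =>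
    DirichletCharacter.LSeriesSummable_twist_vonMangoldt χ (by simp_all)

lemma abscissaOfAbsConv_vonMangoldt_div_log {q : ℕ} (χ : DirichletCharacter ℂ q) {g : ℕ → ℝ}
    (hg : ∀ n, |g n| ≤ 1) :
    abscissaOfAbsConv (fun n => ((Λ n * g n / log n : ℝ) : ℂ) * χ n) ≤ 1 := by
  refine abscissaOfAbsConv_le_of_le_const ⟨1, fun n _ => ?_⟩
  rw [norm_mul, norm_real, norm_eq_abs, abs_div, abs_mul,
    abs_of_nonneg vonMangoldt_nonneg, abs_of_nonneg (log_natCast_nonneg n)]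
  have h1 : Λ n * |g n| / log n ≤ 1 := by
    refine div_le_one_of_le₀ ?_ (log_natCast_nonneg n)
    exact (mul_le_of_le_one_right vonMangoldt_nonneg (hg n)).trans vonMangoldt_le_log
  exact mul_le_one₀ h1 (norm_nonneg _) (χ.norm_le_one _)

variable {q : ℕ} [NeZero q] {χ : DirichletCharacter ℂ q}

lemma deriv_logDeriv_LFunction (χ : DirichletCharacter ℂ q) {s : ℂ} (hs : 1 < s.re) :
    deriv (logDeriv χ.LFunction) s = LSeries (logMul ((fun n : ℕ => χ n) * fun n : ℕ => (Λ n : ℂ))) s := by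
  have h : logDeriv χ.LFunction =ᶠ[𝓝 s] fun z => -LSeries ((fun n : ℕ => χ n) * fun n : ℕ => (Λ n : ℂ)) z := by
    filter_upwards [(isOpen_lt continuous_const continuous_re).mem_nhds hs] with z hz
    rw [logDeriv_apply, χ.deriv_LFunction_eq_deriv_LSeries hz, χ.LFunction_eq_LSeries hz,
      DirichletCharacter.LSeries_twist_vonMangoldt_eq χ hz]
    ring
  rw [h.deriv_eq, deriv.fun_neg, LSeries_deriv, neg_neg]
  exact (abscissaOfAbsConv_twist_vonMangoldt χ).trans_lt (by exact_mod_cast hs)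

lemma re_lt_one_of_LFunction_eq_zero (hχ : χ ≠ 1) {ρ : ℂ} (h : χ.LFunction ρ = 0) : ρ.re < 1 := by
  by_contra! h1
  exact χ.LFunction_ne_zero_of_one_le_re (Or.inl hχ) h1 h

lemma one_add_norm_le_of_re_lt {ρ : ℂ} (h : ρ.re < 1) : 1 + ‖ρ‖ ≤ 4 * ‖(2 : ℂ) - ρ‖ := by
  have h1 : 1 ≤ ‖(2 : ℂ) - ρ‖ := by
    refine le_trans ?_ (re_le_norm _)
    simp; linarith
  have h2 : ‖ρ‖ ≤ ‖(2 : ℂ) - ρ‖ + 2 := by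
    have := norm_sub_le (2 : ℂ) (2 - ρ)
    simp at this
    linarith
  linarith

lemma summable_zeros_LFunction (hχ : χ ≠ 1) : Summable fun ρ : {z | χ.LFunction z = 0} =>
    (analyticOrderNatAt χ.LFunction ρ : ℝ) / (1 + ‖(ρ : ℂ)‖) ^ 2 := by
  obtain ⟨C, hC⟩ := exists_growthBound_LFunction hχ
  exact summable_zeros (χ.differentiable_LFunction hχ)
    (χ.LFunction_ne_zero_of_one_le_re (Or.inl hχ) (s := 2) (by norm_num)) hC

/-- The smooth weight `w(n)`, equal to `1` for `n ≤ X^{1-1/X}` and to `0` for `n ≥ X`. -/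
def primeWeight (u : ℝ → ℝ) (X : ℝ) (n : ℕ) : ℝ := 1 - weightCdf u (log n / log X)

lemma primeWeight_mem_Icc (hu : IsWeight X u) (n : ℕ) :
    primeWeight u X n ∈ Icc (0 : ℝ) 1 := by
  have := weightCdf_mem_Icc hu (log n / log X)
  exact ⟨by rw [primeWeight]; grind, by rw [primeWeight]; grind⟩

lemma LFunction_eq_exp (χ : DirichletCharacter ℂ q) {s : ℂ} (hs : 1 < s.re) :
    χ.LFunction s = cexp (LSeries (fun n => ((Λ n * 1 / log n : ℝ) : ℂ) * χ n) s) := by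
  have hs' : (1 : EReal) < s.re := mod_cast hs
  rw [← LSeries_expCoeff_mul χ (fun _ => 1), χ.LFunction_eq_LSeries hs]
  · refine LSeries_congr (fun {n} hn => ?_) s
    rw [expCoeff_const_one hn]
    simp
  · refine (abscissaOfAbsConv_le_of_le_const ⟨1, fun n hn => ?_⟩).trans_lt hs'
    rw [expCoeff_const_one hn]
    simpa using χ.norm_le_one _
  · exact (abscissaOfAbsConv_vonMangoldt_div_log χ (g := fun _ => 1) (by simp)).trans_lt hs'

/-- The explicit formula, obtained by transferring `(L'/L)'(2 + k)` to the test function `v(e^y)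
e^{-(s-2)y} / y²`. On the arithmetic side `log n` is the frequency, and `1/y²` turns the coefficient
`Λ(n) log n` into `Λ(n)/log n`. On the side of the zeros the kernel of `1/(a+k)²` is `y e^{-ay}
e^{-ky}`, so a single `1/y` remains and the Laplace integral is that of `U`. -/
lemma hasSum_U_zeros (hχ : χ ≠ 1) (hX : 2 ≤ X) (hu : IsWeight X u) {s : ℝ} (hs : 4 < s) :
    HasSum (fun ρ : {z | χ.LFunction z = 0} =>
      -((analyticOrderNatAt χ.LFunction ρ : ℂ) * U u ((s - ρ) * (log X : ℂ))))
      (LSeries (fun n => ((Λ n * weightCdf u (log n / log X) / log n : ℝ) : ℂ) * χ n) s) := by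
  have hab := abscissaOfAbsConv_twist_vonMangoldt χ
  have h2 : ∀ k : ℕ, (1 : ℝ) < ((2 : ℂ) + k).re := fun k => by simp; linarith
  have hre : ∀ ρ : {z | χ.LFunction z = 0}, (ρ : ℂ).re < 1 := fun ρ =>
    re_lt_one_of_LFunction_eq_zero hχ ρ.2
  obtain ⟨g₁, g₂, hg, hg₁, hg₂, hlim⟩ := exists_deriv_test hX hu (σ := s - 2) (by linarith)
  obtain ⟨C, hC⟩ := exists_growthBound_LFunction hχ
  have key := tsum_eq_tsum_laplace (c := fun n => term (logMul ((fun n : ℕ => χ n) * fun n : ℕ => (Λ n : ℂ))) 2 n)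
    (lam := fun n => log n) (w := fun ρ : {z | χ.LFunction z = 0} =>
      -(analyticOrderNatAt χ.LFunction ρ : ℂ)) (a := fun ρ => 2 - ρ)
    (fun n => log_natCast_nonneg n) (fun ρ => by have := hre ρ; simp; linarith)
    ?_ ?_ ?_ hg hg₁ hg₂ hlim
  · convert! key using 1
    · ext ρ
      have hz : 0 < ((s : ℂ) - ρ).re := by have := hre ρ; simp; linarith
      rw [U_mul_log_eq hX hu hz, neg_mul]
      congr 2
      refine setIntegral_congr_fun measurableSet_Ioi fun y hy => ?_
      rw [show -(((s : ℂ) - ρ) * y) = -((2 - (ρ : ℂ)) * y) + (-((s - 2) * y) : ℝ) by push_cast; ring,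
        Complex.exp_add]
      push_cast
      field_simp
    · refine tsum_congr fun n => ?_
      rcases eq_or_ne n 0 with rfl | hn
      · simp
      rcases eq_or_ne n 1 with rfl | hn1
      · simp
      have hl : (log n : ℂ) ≠ 0 := by
        exact_mod_cast (log_pos (by exact_mod_cast (by omega : 1 < n))).ne'
      have hn' : (n : ℂ) ≠ 0 := mod_cast hn
      rw [term_of_ne_zero hn, term_of_ne_zero hn]
      have hexp : ((exp (-((s - 2) * log n)) : ℝ) : ℂ) = (n : ℂ) ^ (2 : ℂ) / (n : ℂ) ^ (s : ℂ) := by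
        rw [← Complex.cpow_sub _ _ hn', Complex.cpow_def_of_ne_zero hn', ← natCast_log]
        push_cast
        ring
      have h2 : (n : ℂ) ^ (2 : ℂ) ≠ 0 := by simp [hn']
      rw [ofReal_mul, ofReal_div _ (_ ^ 2), hexp]
      simp only [logMul, Pi.mul_apply]
      rw [← natCast_log]
      simp only [ofReal_mul, ofReal_div, ofReal_pow]
      field_simp
  · have hlog : abscissaOfAbsConv (logMul ((fun n : ℕ => χ n) * fun n : ℕ => (Λ n : ℂ))) < (2 : ℂ).re := by
      rw [abscissaOfAbsConv_logMul]
      exact hab.trans_lt (by exact_mod_cast (by norm_num : (1 : ℝ) < 2))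
    have s1 := (LSeriesSummable_of_abscissaOfAbsConv_lt_re hlog).norm
    have s2 := (LSeriesSummable_logMul_of_lt_re hlog).norm
    refine (s1.add s2).congr fun n => ?_
    rcases eq_or_ne n 0 with rfl | hn
    · simp
    rw [mul_add, mul_one, term_of_ne_zero hn, term_of_ne_zero hn, logMul.eq_1 (logMul _)]
    simp only [norm_div, norm_mul, ← natCast_log, norm_real, norm_eq_abs,
      abs_of_nonneg (log_natCast_nonneg n)]
    ring
  · refine ((summable_zeros_LFunction hχ).mul_left 16).of_nonneg_of_le
      (fun _ => by positivity) fun ρ => ?_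
    have h1 := one_add_norm_le_of_re_lt (hre ρ)
    have h3 : 0 < ‖(2 : ℂ) - ρ‖ := by linarith [norm_nonneg (ρ : ℂ)]
    have h4 : (1 + ‖(ρ : ℂ)‖) ^ 2 ≤ 16 * ‖(2 : ℂ) - ρ‖ ^ 2 := by nlinarith [norm_nonneg (ρ : ℂ)]
    rw [norm_neg, Complex.norm_natCast, mul_div_assoc', div_le_div_iff₀ (by positivity) (by positivity)]
    nlinarith
  · intro k
    have h := deriv_logDeriv_eq_tsum (DirichletCharacter.differentiable_LFunction hχ) hC
      (s := 2 + k) (χ.LFunction_ne_zero_of_one_le_re (Or.inl hχ) (h2 k).le)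
    rw [deriv_logDeriv_LFunction χ (h2 k), ← tsum_neg] at h
    convert! h using 1
    · refine tsum_congr fun n => ?_
      rcases eq_or_ne n 0 with rfl | hn
      · simp
      have hn' : (n : ℂ) ≠ 0 := mod_cast hn
      rw [term_of_ne_zero hn, term_of_ne_zero hn, Complex.cpow_add _ _ hn', Complex.cpow_natCast,
        exp_neg, exp_log (by positivity)]
      push_cast
      rw [inv_pow]
      field_simp
    grind

/-- The hybrid formula far to the right. -/
theorem LFunction_eq_exp_mul_exp (hχ : χ ≠ 1) (hX : 2 ≤ X) (hu : IsWeight X u) {s : ℝ}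
    (hs : 4 < s) :
    χ.LFunction s =
      cexp (LSeries (fun n => ((Λ n * primeWeight u X n / log n : ℝ) : ℂ) * χ n) s) *
      cexp (-∑' ρ : {z | χ.LFunction z = 0},
        (analyticOrderNatAt χ.LFunction ρ : ℂ) * U u ((s - ρ) * (log X : ℂ))) := by
  have hs1 : (1 : EReal) < ((s : ℂ).re : EReal) := by
    exact_mod_cast (by linarith : 1 < s)
  have hw : ∀ n, |primeWeight u X n| ≤ 1 := fun n => by
    have := primeWeight_mem_Icc hu n
    grind
  have hv : ∀ n : ℕ, |weightCdf u (log n / log X)| ≤ 1 := fun n => by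
    have := weightCdf_mem_Icc hu (log n / log X)
    grind
  have h1 := LSeriesSummable_of_abscissaOfAbsConv_lt_re
    ((abscissaOfAbsConv_vonMangoldt_div_log χ hw).trans_lt hs1)
  have h2 := LSeriesSummable_of_abscissaOfAbsConv_lt_re ((abscissaOfAbsConv_vonMangoldt_div_log χ
      (g := fun n => weightCdf u (log n / log X)) hv).trans_lt hs1)
  rw [← tsum_neg, (hasSum_U_zeros hχ hX hu hs).tsum_eq, ← Complex.exp_add, ← LSeries_add h1 h2,
    LFunction_eq_exp χ (by simpa using by linarith)]
  congr 2
  ext n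
  simp only [Pi.add_apply, primeWeight]
  push_cast
  ring

end explicit

/-! ### Trivial zeros -/

section trivialZeros

variable {q : ℕ} [NeZero q] {χ : DirichletCharacter ℂ q}

lemma _root_.DirichletCharacter.IsPrimitive.ne_one (h : χ.IsPrimitive) (hq : q ≠ 1) : χ ≠ 1 := by
  rintro rfl
  rw [DirichletCharacter.isPrimitive_def, DirichletCharacter.conductor_one] at h
  lia

/-- Otherwise the functional equation would force the completed `L`-function to vanish identically,
contradicting `L(2, χ) ≠ 0`. -/
lemma rootNumber_ne_zero (hp : χ.IsPrimitive) (hq : q ≠ 1) : χ.rootNumber ≠ 0 := by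
  intro h0
  have h3 : χ.completedLFunction = 0 := by
    funext z
    have := hp.completedLFunction_one_sub (1 - z)
    simp_all
  have h4 := χ.LFunction_eq_completed_div_gammaFactor 2 (Or.inr hq)
  rw [h3, Pi.zero_apply, zero_div] at h4
  exact χ.LFunction_ne_zero_of_one_le_re (Or.inl (hp.ne_one hq)) (s := 2) (by norm_num) h4

lemma completedLFunction_ne_zero_of_re_nonpos (hp : χ.IsPrimitive) (hq : q ≠ 1) {s : ℂ}
    (hs : s.re ≤ 0) : χ.completedLFunction s ≠ 0 := by
  have hχ := hp.ne_one hq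
  have h := hp.completedLFunction_one_sub (1 - s)
  rw [sub_sub_cancel] at h
  have hs1 : 1 ≤ (1 - s).re := by simp_all
  have hL : χ⁻¹.LFunction (1 - s) ≠ 0 :=
    χ⁻¹.LFunction_ne_zero_of_one_le_re (Or.inl (inv_ne_one.mpr hχ)) hs1
  rw [χ⁻¹.LFunction_eq_completed_div_gammaFactor _ (Or.inr hq)] at hL
  have hc : χ⁻¹.completedLFunction (1 - s) ≠ 0 := by grind
  have hr := rootNumber_ne_zero hp hq
  rw [h]
  refine mul_ne_zero (mul_ne_zero ?_ hr) hc
  simp [NeZero.ne q]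

/-- To the left of `Re s = 1` an `L`-function is its completion times a nonvanishing factor and a
cosine. -/
lemma LFunction_eq_completed_mul_cos (hq : q ≠ 1) : ∃ e : ℤ, ∃ h : ℂ → ℂ,
    (∀ s : ℂ, s.re < 1 → h s ≠ 0 ∧ DifferentiableAt ℂ h s) ∧ ∀ s : ℂ, s.re < 1 →
      χ.LFunction s = χ.completedLFunction s * h s * Complex.cos (π * (s - e) / 2) := by
  have hd : ∀ a : ℂ, ∀ s : ℂ, 0 < (a - s).re →
      DifferentiableAt ℂ (fun s => ((Complex.Gammaℝ (a - s))⁻¹)⁻¹) s := fun a s hs => by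
    refine DifferentiableAt.inv ?_ (inv_ne_zero (Complex.Gammaℝ_ne_zero_of_re_pos hs))
    exact (Complex.differentiable_Gammaℝ_inv (a - s)).comp s (by fun_prop)
  have key : ∀ s : ℂ, s.re < 1 → (Complex.Gammaℝ (1 + s))⁻¹ =
      Complex.Gammaℝ (1 - s) * Complex.cos (π * s / 2) := fun s hs => by
    have h := Complex.Gammaℝ_one_sub_mul_Gammaℝ_one_add s
    have h1 : Complex.Gammaℝ (1 - s) ≠ 0 := Complex.Gammaℝ_ne_zero_of_re_pos (by simp_all)
    grind
  rcases χ.even_or_odd with hχ | hχ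
  · refine ⟨1, fun s => ((Complex.Gammaℝ (2 - s))⁻¹)⁻¹, fun s hs => ?_, fun s hs => ?_⟩
    · have : 0 < (2 - s).re := by simp; linarith
      exact ⟨by simpa using Complex.Gammaℝ_ne_zero_of_re_pos this, hd _ s this⟩
    · have := key (s - 1) (by simp; linarith)
      rw [add_sub_cancel, show (1 : ℂ) - (s - 1) = 2 - s by ring] at this
      rw [χ.LFunction_eq_completed_div_gammaFactor s (Or.inr hq), hχ.gammaFactor_def, div_eq_mul_inv,
        this]
      grind
  · refine ⟨0, fun s => ((Complex.Gammaℝ (1 - s))⁻¹)⁻¹, fun s hs => ?_, fun s hs => ?_⟩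
    · have : 0 < (1 - s).re := by simp_all
      exact ⟨by simpa using Complex.Gammaℝ_ne_zero_of_re_pos this, hd _ s this⟩
    · have := key s hs
      rw [χ.LFunction_eq_completed_div_gammaFactor s (Or.inr hq), hχ.gammaFactor_def, div_eq_mul_inv,
        add_comm, this]
      grind

/-- For `Re s ≤ 0` the completed function and the auxiliary factor do not vanish, so the zeros are
those of a cosine: simple and at integers. Simplicity and integrality are all that the geometric
bound in `norm_tsum_trivial_le` requires. -/
lemma trivial_zero (hp : χ.IsPrimitive) (hq : q ≠ 1) {ρ : ℂ} (hρ : ρ.re ≤ 0)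
    (h0 : χ.LFunction ρ = 0) :
    (∃ n : ℕ, ρ = -(n : ℂ)) ∧ analyticOrderNatAt χ.LFunction ρ = 1 := by
  obtain ⟨e, h, hh, heq⟩ := LFunction_eq_completed_mul_cos (χ := χ) hq
  have hc := completedLFunction_ne_zero_of_re_nonpos hp hq hρ
  have hρ1 : ρ.re < 1 := by linarith
  have hcos : Complex.cos (π * (ρ - e) / 2) = 0 := by grind
  refine ⟨?_, ?_⟩
  · obtain ⟨k, hk⟩ := Complex.cos_eq_zero_iff.mp hcos
    have hpi : (π : ℂ) ≠ 0 := by simp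
    have h1 : ρ = ((2 * k + 1 + e : ℤ) : ℂ) := by grind
    have h2 : 2 * k + 1 + e ≤ 0 := by
      rw [h1, Complex.intCast_re] at hρ
      exact_mod_cast hρ
    refine ⟨(-(2 * k + 1 + e)).toNat, ?_⟩
    have : (((-(2 * k + 1 + e)).toNat : ℤ) : ℂ) = -ρ := by
      rw [Int.toNat_of_nonneg (by omega), h1]; simp
    rw [Int.cast_natCast] at this
    grind
  · have hχ := hp.ne_one hq
    have hL := (DirichletCharacter.differentiable_LFunction hχ).analyticAt ρ
    have hev : χ.LFunction =ᶠ[𝓝 ρ] fun s => χ.completedLFunction s * h s *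
        Complex.cos (π * (s - e) / 2) := by
      filter_upwards [(isOpen_lt continuous_re continuous_const).mem_nhds hρ1] with s hs
      grind
    have hdcos : HasDerivAt (fun s : ℂ => Complex.cos (π * (s - e) / 2))
        (-Complex.sin (π * (ρ - e) / 2) * (π / 2)) ρ := by
      have : HasDerivAt (fun s : ℂ => π * (s - e) / 2) (π / 2) ρ := by
        simpa using (((hasDerivAt_id ρ).sub_const (e : ℂ)).const_mul (π : ℂ)).div_const 2
      exact this.ccos
    have hg := (((DirichletCharacter.differentiable_completedLFunction hχ) ρ).mul
      (hh ρ hρ1).2).hasDerivAt.mul hdcos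
    have hder : deriv χ.LFunction ρ ≠ 0 := by
      rw [hev.deriv_eq]
      have := hg.deriv
      simp only [Pi.mul_apply] at this
      erw [this]
      rw [hcos, mul_zero, zero_add]
      refine mul_ne_zero (mul_ne_zero hc (hh ρ hρ1).1) (mul_ne_zero (neg_ne_zero.mpr ?_) ?_)
      · intro hsin
        have := Complex.sin_sq_add_cos_sq (π * (ρ - e) / 2)
        grind
      simp
    rw [analyticOrderNatAt, hL.analyticOrderAt_eq_one_of_zero_deriv_ne_zero h0 hder]
    rfl

end trivialZeros

/-! ### The hybrid formula at the central point -/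

section hybrid

variable {X : ℝ} {u : ℝ → ℝ} {q : ℕ} [NeZero q] {χ : DirichletCharacter ℂ q}

lemma primeWeight_eq_zero (hX : 2 ≤ X) (hu : IsWeight X u) {n : ℕ} (hn : X ≤ n) :
    primeWeight u X n = 0 := by
  have hl : 0 < log X := by bound
  rw [primeWeight, weightCdf_eq_one hu, sub_self]
  rw [one_le_div hl]
  gcongr

lemma abscissaOfAbsConv_eq_bot {f : ℕ → ℂ} {N : ℕ} (hf : ∀ n, N ≤ n → f n = 0) :
    abscissaOfAbsConv f = ⊥ := by
  refine le_bot_iff.mp (abscissaOfAbsConv_le_of_forall_lt_LSeriesSummable' fun y _ => ?_)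
  refine summable_of_ne_finset_zero (s := Finset.range N) fun n hn => ?_
  have : f n = 0 := by grind
  rcases eq_or_ne n 0 with rfl | h0
  · simp
  simp_all

/-- The logarithm of the Euler product part of the hybrid formula. -/
def logEulerPart (u : ℝ → ℝ) (X : ℝ) {q : ℕ} (χ : DirichletCharacter ℂ q) (s : ℂ) : ℂ :=
  LSeries (fun n => ((Λ n * primeWeight u X n / log n : ℝ) : ℂ) * χ n) s

lemma differentiable_logEulerPart {q : ℕ} {χ : DirichletCharacter ℂ q} (hX : 2 ≤ X) (hu : IsWeight X u) :
    Differentiable ℂ (logEulerPart u X χ) := by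
  intro s
  refine (LSeries_hasDerivAt ?_).differentiableAt
  rw [abscissaOfAbsConv_eq_bot (N := ⌈X⌉₊)]
  · simp
  · intro n hn
    rw [primeWeight_eq_zero hX hu ((Nat.le_ceil X).trans (by gcongr))]
    simp

/-- Away from the low-lying nontrivial zeros, the terms of the sum over zeros are analytic and
uniformly summable near the critical point. -/
lemma exists_bound_U_zero (hp : χ.IsPrimitive) (hq : q ≠ 1) (hX : 2 ≤ X) (hu : IsWeight X u) :
    ∃ C, 0 ≤ C ∧ ∀ ρ : ℂ, χ.LFunction ρ = 0 → (ρ.re ≤ 0 ∨ 2 < |ρ.im|) → ∀ s : ℂ, 1 / 4 < s.re →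
      |s.im| < 1 → (s - ρ) * (log X : ℂ) ∈ slitPlane ∧
        ‖U u ((s - ρ) * (log X : ℂ))‖ ≤ C / (1 + ‖ρ‖) ^ 2 := by
  have hl : 0 < log X := by bound
  obtain ⟨C, hC, hCU⟩ := exists_norm_U_le hX hu hl.le
  refine ⟨64 / log X ^ 2 + 16 * C / log X ^ 2, by positivity, fun ρ h0 hρ s hs hs1 => ?_⟩
  have hre := re_lt_one_of_LFunction_eq_zero (hp.ne_one hq) h0
  by_cases hr : ρ.re ≤ 0
  · obtain ⟨⟨n, rfl⟩, -⟩ := trivial_zero hp hq hr h0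
    have hz : (1 + (n : ℝ)) * log X / 4 ≤ ((s - -(n : ℂ)) * (log X : ℂ)).re := by
      rw [re_mul_ofReal]
      simp only [sub_neg_eq_add, Complex.add_re, Complex.natCast_re]
      nlinarith
    have hz0 : 0 < (1 + (n : ℝ)) * log X / 4 := by positivity
    refine ⟨Or.inl (hz0.trans_le hz), (norm_U_le_of_re_pos hX hu (hz0.trans_le hz)).trans ?_⟩
    set x := ((s - -(n : ℂ)) * (log X : ℂ)).re
    have hx0 : 0 < x := by grind
    have he : exp (-x / 2) ≤ 2 / x := by
      rw [neg_div, exp_neg, inv_le_comm₀ (exp_pos _) (by positivity), inv_div]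
      linarith [add_one_le_exp (x / 2)]
    calc 2 * exp (-x / 2) / x ≤ 2 * (2 / x) / x := by gcongr
      _ = 4 / x ^ 2 := by ring
      _ ≤ 4 / ((1 + (n : ℝ)) * log X / 4) ^ 2 := by gcongr
      _ = (64 / log X ^ 2) / (1 + n) ^ 2 := by grind
      _ ≤ _ := by
        rw [norm_neg, Complex.norm_natCast]
        bound
  · push Not at hr
    have him : 2 < |ρ.im| := by grind
    have h1 : (1 + ‖ρ‖) / 4 ≤ |(s - ρ).im| := by
      have h2 := Complex.norm_le_abs_re_add_abs_im ρ
      rw [abs_of_pos hr] at h2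
      have h3 : |ρ.im| - |s.im| ≤ |(s - ρ).im| := by
        rw [Complex.sub_im, abs_sub_comm s.im]
        grind
      linarith
    have h4 : 0 < (1 + ‖ρ‖) / 4 := by positivity
    have h5 : |((s - ρ) * (log X : ℂ)).im| = |(s - ρ).im| * log X := by
      rw [Complex.im_mul_ofReal, abs_mul, abs_of_pos hl]
    have h6 : ((s - ρ) * (log X : ℂ)).im ≠ 0 := by grind
    refine ⟨Or.inr h6, (hCU _ h6 ?_).trans ?_⟩
    · rw [re_mul_ofReal, Complex.sub_re]; nlinarith
    · rw [h5]
      calc C / (|(s - ρ).im| * log X) ^ 2 ≤ C / ((1 + ‖ρ‖) / 4 * log X) ^ 2 := by gcongr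
        _ = (16 * C / log X ^ 2) / (1 + ‖ρ‖) ^ 2 := by grind
        _ ≤ _ := by bound

lemma finite_low_zeros (hχ : χ ≠ 1) :
    {ρ : {z | χ.LFunction z = 0} | ¬((ρ : ℂ).re ≤ 0 ∨ 2 < |(ρ : ℂ).im|)}.Finite := by
  have h := finite_zeros_inter_closedBall (DirichletCharacter.differentiable_LFunction hχ)
    (χ.LFunction_ne_zero_of_one_le_re (Or.inl hχ) (s := 2) (by norm_num)) 3
  refine Finite.of_finite_image (f := Subtype.val) (h.subset ?_) Subtype.val_injective.injOn
  rintro _ ⟨ρ, hρ, rfl⟩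
  simp only [mem_ofPred_eq, not_or, not_le, not_lt] at hρ
  refine ⟨ρ.2, ?_⟩
  rw [mem_closedBall_zero_iff]
  have h2 := Complex.norm_le_abs_re_add_abs_im (ρ : ℂ)
  rw [abs_of_pos hρ.1] at h2
  linarith [re_lt_one_of_LFunction_eq_zero hχ ρ.2]

/-- The term of a zero in the hybrid formula at `s`. -/
def zeroTermAt (u : ℝ → ℝ) (X : ℝ) (χ : DirichletCharacter ℂ q) (s ρ : ℂ) : ℂ :=
  (analyticOrderNatAt χ.LFunction ρ : ℂ) * U u ((s - ρ) * (log X : ℂ))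

lemma summable_zeroTermAt (hp : χ.IsPrimitive) (hq : q ≠ 1) (hX : 2 ≤ X) (hu : IsWeight X u)
    {s : ℂ} (hs : 1 / 4 < s.re) (hs1 : |s.im| < 1) :
    Summable fun ρ : {z | χ.LFunction z = 0} => zeroTermAt u X χ s ρ := by
  have hχ := hp.ne_one hq
  obtain ⟨C, hC, hb⟩ := exists_bound_U_zero hp hq hX hu
  refine Summable.of_norm_bounded_eventually ((summable_zeros_LFunction hχ).mul_left C) ?_
  filter_upwards [(finite_low_zeros hχ).compl_mem_cofinite] with ρ hρ
  have := (hb ρ ρ.2 (not_not.mp hρ) s hs hs1).2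
  rw [zeroTermAt, norm_mul, Complex.norm_natCast]
  calc _ ≤ (analyticOrderNatAt χ.LFunction ρ : ℝ) * (C / (1 + ‖(ρ : ℂ)‖) ^ 2) := by gcongr
    _ = _ := by ring

/-- Analytic continuation from `s > 4` inside `Re s > 1/4`, `|Im s| < 1`. Zeros with `Re ρ ≤ 0` or
`|Im ρ| > 2` keep `s - ρ` off the cut, and their sum converges normally. The finitely many others,
for which `U` may meet its singularity or its cut, enter only through the entire function `exp(-U)`.
-/
theorem LFunction_half_eq (hp : χ.IsPrimitive) (hq : q ≠ 1) (hX : 2 ≤ X) (hu : IsWeight X u)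
    (h0 : χ.LFunction (1 / 2) ≠ 0) :
    χ.LFunction (1 / 2) = cexp (logEulerPart u X χ (1 / 2)) *
      cexp (-∑' ρ : {z | χ.LFunction z = 0}, zeroTermAt u X χ (1 / 2) ρ) := by
  classical
  have hχ := hp.ne_one hq
  have hl : (log X : ℂ) ≠ 0 := mod_cast (log_pos (by linarith)).ne'
  obtain ⟨C, hC, hb⟩ := exists_bound_U_zero hp hq hX hu
  obtain ⟨W, hW, hW0, hWU⟩ := exists_entire_exp_neg_U hX hu
  set F := (finite_low_zeros hχ).toFinset with hF
  have hmemF : ∀ ρ : {z | χ.LFunction z = 0}, ρ ∉ F → ((ρ : ℂ).re ≤ 0 ∨ 2 < |(ρ : ℂ).im|) :=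
    fun ρ hρ => by
      rw [hF, Finite.mem_toFinset] at hρ
      grind
  set D : Set ℂ := {s | 1 / 4 < s.re} ∩ {s | |s.im| < 1}
  have hDo : IsOpen D := (isOpen_lt continuous_const continuous_re).inter
    (isOpen_lt continuous_im.abs continuous_const)
  have hDc : Convex ℝ D := by
    refine (convex_halfSpace_re_gt _).inter ?_
    have : {s : ℂ | |s.im| < 1} = {s | -1 < s.im} ∩ {s | s.im < 1} := by ext; simp [abs_lt]
    rw [this]
    exact (convex_halfSpace_im_gt _).inter (convex_halfSpace_im_lt _)
  set G : {z | χ.LFunction z = 0} → ℂ → ℂ := fun ρ s => if ρ ∈ F then 0 else zeroTermAt u X χ s ρ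
    with hG
  have hGd : DifferentiableOn ℂ (fun s => ∑' ρ, G ρ s) D := by
    refine Complex.differentiableOn_tsum_of_summable_norm ((summable_zeros_LFunction hχ).mul_left C) ?_ hDo ?_
    · intro ρ s hs
      by_cases hρ : ρ ∈ F
      · simp only [hG, hρ, if_true]; fun_prop
      · simp only [hG, hρ, if_false, zeroTermAt]
        have h1 := differentiableAt_U hX hu (hb ρ ρ.2 (hmemF ρ hρ) s hs.1 hs.2).1
        refine (DifferentiableAt.const_mul ?_ _).differentiableWithinAt
        fun_prop
    · intro ρ s hs
      by_cases hρ : ρ ∈ F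
      · simp only [hG, hρ, if_true, norm_zero]; positivity
      · simp only [hG, hρ, if_false, zeroTermAt, norm_mul, Complex.norm_natCast]
        have := (hb ρ ρ.2 (hmemF ρ hρ) s hs.1 hs.2).2
        calc _ ≤ (analyticOrderNatAt χ.LFunction ρ : ℝ) * (C / (1 + ‖(ρ : ℂ)‖) ^ 2) := by gcongr
          _ = _ := by ring
  -- The right-hand side written so as to be analytic on all of `D`, also at the zeros of `L(s, χ)`.
  set R : ℂ → ℂ := fun s => cexp (logEulerPart u X χ s) *
    ((∏ ρ ∈ F, W ((s - ρ) * (log X : ℂ)) ^ analyticOrderNatAt χ.LFunction ρ) *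
      cexp (-∑' ρ, G ρ s)) with hR
  have hRd : DifferentiableOn ℂ R D := by
    refine (differentiable_logEulerPart hX hu).cexp.differentiableOn.mul
      (DifferentiableOn.mul (Differentiable.differentiableOn ?_) hGd.neg.cexp)
    fun_prop
  have hRexp : ∀ s ∈ D, χ.LFunction s ≠ 0 → R s = cexp (logEulerPart u X χ s) *
      cexp (-∑' ρ : {z | χ.LFunction z = 0}, zeroTermAt u X χ s ρ) := by
    intro s hs hs0
    simp only [hR]
    congr 1
    have hsum := summable_zeroTermAt hp hq hX hu hs.1 hs.2
    have hsplit : ∑' ρ : {z | χ.LFunction z = 0}, zeroTermAt u X χ s ρ =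
        (∑ ρ ∈ F, zeroTermAt u X χ s ρ) + ∑' ρ, G ρ s := by
      have h1 : Summable fun ρ : {z | χ.LFunction z = 0} =>
          if ρ ∈ F then zeroTermAt u X χ s ρ else 0 :=
        summable_of_ne_finset_zero (s := F) fun ρ hρ => if_neg hρ
      have h2 : Summable fun ρ => G ρ s :=
        (hsum.sub h1).congr fun ρ => by grind
      have h3 : ∑ ρ ∈ F, zeroTermAt u X χ s ρ =
          ∑' ρ : {z | χ.LFunction z = 0}, if ρ ∈ F then zeroTermAt u X χ s ρ else 0 := by
        rw [tsum_eq_sum (s := F) fun ρ hρ => if_neg hρ]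
        simp
      rw [h3, ← h1.tsum_add h2]
      refine tsum_congr fun ρ => ?_
      grind
    rw [hsplit, neg_add, Complex.exp_add, ← sum_neg_distrib, Complex.exp_sum]
    congr 1
    refine prod_congr rfl fun ρ _ => ?_
    have hne : (s - (ρ : ℂ)) * (log X : ℂ) ≠ 0 := by grind
    rw [hWU _ hne, ← Complex.exp_nat_mul, zeroTermAt]
    simp
  have hreal : ∀ x : ℝ, 4 < x → R x = χ.LFunction x := by
    intro x hx
    have hxD : (x : ℂ) ∈ D := ⟨by simp; linarith, by simp⟩
    rw [hRexp x hxD (χ.LFunction_ne_zero_of_one_le_re (Or.inl hχ) (by simp; linarith)),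
      LFunction_eq_exp_mul_exp hχ hX hu hx]
    rfl
  -- Agreement for real `s > 4` suffices for the identity theorem, since such points accumulate at
  -- 5.
  have heq : EqOn R χ.LFunction D := by
    refine AnalyticOnNhd.eqOn_of_preconnected_of_frequently_eq (z₀ := (5 : ℂ))
      (hRd.analyticOnNhd hDo)
      (fun z _ => (DirichletCharacter.differentiable_LFunction hχ).analyticAt z)
      hDc.isPreconnected ⟨by norm_num, by simp⟩ ?_
    have ht : Tendsto (fun x : ℝ => (x : ℂ)) (𝓝[≠] 5) (𝓝[≠] (5 : ℂ)) := by
      refine tendsto_nhdsWithin_iff.mpr ⟨?_, ?_⟩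
      · exact (continuous_ofReal.tendsto' 5 (5 : ℂ) (by simp)).mono_left nhdsWithin_le_nhds
      · filter_upwards [self_mem_nhdsWithin] with x hx
        have hx : x ≠ 5 := hx
        simpa using (by exact_mod_cast hx : (x : ℂ) ≠ 5)
    refine ht.frequently (Eventually.frequently ?_)
    filter_upwards [nhdsWithin_le_nhds (Ioi_mem_nhds (by norm_num : (4 : ℝ) < 5))] with x hx
    grind
  have hhalf : (1 / 2 : ℂ) ∈ D := by
    exact ⟨by bound, by simp⟩
  grind

lemma summable_zeroTerm (hp : χ.IsPrimitive) (hq : q ≠ 1) (hX : 2 ≤ X) (hu : IsWeight X u) :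
    Summable fun ρ : nontrivialZeros χ => zeroTerm u X χ ρ := by
  have h := summable_zeroTermAt hp hq hX hu (s := 1 / 2) (by norm_num) (by norm_num)
  let i : nontrivialZeros χ → {z | χ.LFunction z = 0} := fun ρ => ⟨ρ, ρ.2.2.2⟩
  have hi : Function.Injective i := fun a b hab => Subtype.ext (Subtype.mk.inj hab)
  exact (h.comp_injective hi).congr fun ρ => rfl

lemma exp_neg_half_log_le {X : ℝ} (hX : 2 ≤ X) : exp (-log X / 2) ≤ 3 / 4 := by
  have h3 := log_le_log (by norm_num) hX
  have h4 := log_two_gt_d9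
  have h2 := add_one_le_exp (log X / 2)
  rw [neg_div, exp_neg, inv_le_comm₀ (exp_pos _) (by norm_num)]
  linarith

/-- At `ρ = -n` the argument of `U` is `(1/2 + n) log X`, where `U` is `O(X^{-(1/2+n)/2} / log X)`.
The terms are dominated by a geometric progression of ratio `X^{-1/2} ≤ 3/4`, with a constant
independent of `u` and `q`. -/
lemma norm_tsum_trivial_le (hp : χ.IsPrimitive) (hq : q ≠ 1) (hX : 2 ≤ X) (hu : IsWeight X u) :
    ‖∑' ρ : {z | χ.LFunction z = 0}, {ρ : {z | χ.LFunction z = 0} | (ρ : ℂ).re ≤ 0}.indicator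
        (fun ρ => zeroTermAt u X χ (1 / 2) ρ) ρ‖ ≤ 16 * exp (-log X / 4) / log X := by
  have hl : 0 < log X := by bound
  rw [← tsum_subtype]
  set T := {ρ : {z | χ.LFunction z = 0} | (ρ : ℂ).re ≤ 0}
  have hn : ∀ ρ : T, ∃ n : ℕ, ((ρ : {z | χ.LFunction z = 0}) : ℂ) = -(n : ℂ) := fun ρ =>
    (trivial_zero hp hq ρ.2 (ρ : {z | χ.LFunction z = 0}).2).1
  choose n hn using hn
  have hinj : Function.Injective n := fun a b hab =>
    Subtype.ext (Subtype.ext (by grind))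
  set r := exp (-log X / 2) with hr
  have hr1 : r ≤ 3 / 4 := exp_neg_half_log_le hX
  have hr0 : 0 < r := exp_pos _
  have hgeo := hasSum_geometric_of_lt_one hr0.le (by linarith : r < 1)
  set b : ℕ → ℝ := fun k => 4 * exp (-log X / 4) / log X * r ^ k with hb
  have hbs : Summable b := hgeo.summable.mul_left _
  have hb0 : ∀ k, 0 ≤ b k := by bound
  have hbound : ∀ ρ : T, ‖zeroTermAt u X χ (1 / 2) ρ‖ ≤ b (n ρ) := by
    intro ρ
    rw [zeroTermAt, (trivial_zero hp hq ρ.2 (ρ : {z | χ.LFunction z = 0}).2).2, Nat.cast_one,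
      one_mul, hn ρ]
    have hz : ((1 / 2 - -(n ρ : ℂ)) * (log X : ℂ)).re = (1 / 2 + n ρ) * log X := by simp
    refine (norm_U_le_of_re_pos hX hu (by nlinarith)).trans ?_
    rw [hz]
    have h1 : exp (-((1 / 2 + n ρ) * log X) / 2) = exp (-log X / 4) * r ^ n ρ := by
      rw [hr, ← exp_nat_mul, ← exp_add]
      ring
    rw [h1, hb]
    calc _ ≤ 2 * (exp (-log X / 4) * r ^ n ρ) / (1 / 2 * log X) := by bound
      _ = _ := by ring
  have hs := hbs.comp_injective hinj
  refine (tsum_of_norm_bounded hs.hasSum hbound).trans ?_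
  calc ∑' ρ, b (n ρ) ≤ ∑' k, b k := tsum_comp_le_tsum_of_inj hbs hb0 hinj
    _ = 4 * exp (-log X / 4) / log X * (1 - r)⁻¹ := by rw [tsum_mul_left, hgeo.tsum_eq]
    _ ≤ 4 * exp (-log X / 4) / log X * 4 := by
        gcongr
        rw [inv_le_comm₀ (by linarith) (by norm_num)]
        linarith
    _ = _ := by ring

/-- The hybrid formula: up to a factor close to `1`, `Z_X(χ)` is `L(1/2, χ)` divided by an Euler
product. -/
theorem norm_Z_eq (hp : χ.IsPrimitive) (hq : q ≠ 1) (hX : 2 ≤ X) (hu : IsWeight X u) :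
    ∃ t : ℝ, |t| ≤ 16 * exp (-log X / 4) / log X ∧
      ‖Z u X χ‖ = ‖χ.LFunction (1 / 2) * cexp (-logEulerPart u X χ (1 / 2))‖ * exp t := by
  by_cases h0 : χ.LFunction (1 / 2) = 0
  · have hl : 0 < log X := log_pos (by linarith)
    exact ⟨0, by rw [abs_zero]; positivity, by rw [Z, if_pos h0, h0]; simp⟩
  set S : Set {z | χ.LFunction z = 0} := {ρ | (ρ : ℂ).re ≤ 0}
  set f : {z | χ.LFunction z = 0} → ℂ := fun ρ => zeroTermAt u X χ (1 / 2) ρ with hf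
  have hsum : Summable f := summable_zeroTermAt hp hq hX hu (s := 1 / 2) (by norm_num) (by norm_num)
  have hnon : ∑' ρ : nontrivialZeros χ, zeroTerm u X χ ρ = ∑' ρ, Sᶜ.indicator f ρ := by
    rw [← tsum_subtype]
    let e : nontrivialZeros χ ≃ ↥Sᶜ :=
      { toFun := fun ρ => ⟨⟨ρ, ρ.2.2.2⟩, not_le.mpr ρ.2.1⟩
        invFun := fun ρ => ⟨(ρ : {z | χ.LFunction z = 0}), not_le.mp ρ.2,
          re_lt_one_of_LFunction_eq_zero (hp.ne_one hq) (ρ : {z | χ.LFunction z = 0}).2,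
          (ρ : {z | χ.LFunction z = 0}).2⟩
        left_inv := fun ρ => rfl
        right_inv := fun ρ => rfl }
    exact e.tsum_eq fun ρ : ↥Sᶜ => f ρ
  have hsplit : ∑' ρ, f ρ = ∑' ρ, S.indicator f ρ + ∑' ρ, Sᶜ.indicator f ρ := by
    rw [← (hsum.indicator S).tsum_add (hsum.indicator Sᶜ)]
    exact tsum_congr fun ρ => (congrFun (indicator_self_add_compl S f) ρ).symm
  refine ⟨(∑' ρ, S.indicator f ρ).re,
    (Complex.abs_re_le_norm _).trans (norm_tsum_trivial_le hp hq hX hu), ?_⟩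
  have hZ : Z u X χ = cexp (-∑' ρ, Sᶜ.indicator f ρ) := by rw [Z, if_neg h0, hnon]
  rw [hZ, LFunction_half_eq hp hq hX hu h0, ← norm_exp, ← norm_mul]
  congr 1
  simp only [← Complex.exp_add]
  congr 1
  have hsplit' := hsplit
  simp only [hf] at hsplit'
  rw [hsplit']
  ring

end hybrid

/-! ### Theta functions of Dirichlet characters -/

section theta

variable {q : ℕ} [NeZero q] {χ : DirichletCharacter ℂ q}

/-- The terms of the theta series attached to `χ`. -/
def thetaTerm (κ : ℕ) (χ : DirichletCharacter ℂ q) (t : ℝ) (n : ℤ) : ℂ :=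
  χ n * (n : ℂ) ^ κ * exp (-π * n ^ 2 * t / q)

/-- The theta series `∑ χ(n) n^κ exp(-π n² t / q)` over all integers. -/
def theta (κ : ℕ) (χ : DirichletCharacter ℂ q) (t : ℝ) : ℂ := ∑' n : ℤ, thetaTerm κ χ t n

/-- A pair of kernels related by Poisson summation, from which the theta series are built. -/
structure IsThetaKernel (κ : ℕ) (E C : UnitAddCircle → ℝ → ℝ) (c : ℂ) : Prop where
  ne_zero : c ≠ 0
  hasSum_left : ∀ (a : ℝ) {t : ℝ}, 0 < t →
    HasSum (fun n : ℤ => (n + a) ^ κ * exp (-π * (n + a) ^ 2 * t)) (E a t)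
  hasSum_right : ∀ (a : ℝ) {t : ℝ}, 0 < t → HasSum (fun n : ℤ =>
    c * (n : ℂ) ^ κ * cexp (2 * π * Complex.I * a * n) * exp (-π * n ^ 2 * t)) (C a t : ℂ)
  functional_equation : ∀ a x, E a x = 1 / x ^ ((κ : ℝ) + 1 / 2) * C a (1 / x)
  continuousOn : ∀ a, ContinuousOn (E a) (Ioi 0)

lemma isThetaKernel_even : IsThetaKernel 0 HurwitzZeta.evenKernel HurwitzZeta.cosKernel 1 where
  ne_zero := one_ne_zero
  hasSum_left a t ht := by simpa using HurwitzZeta.hasSum_int_evenKernel a ht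
  hasSum_right a t ht := by simpa using HurwitzZeta.hasSum_int_cosKernel a ht
  functional_equation a x := by simpa using HurwitzZeta.evenKernel_functional_equation a x
  continuousOn := HurwitzZeta.continuousOn_evenKernel

lemma isThetaKernel_odd :
    IsThetaKernel 1 HurwitzZeta.oddKernel HurwitzZeta.sinKernel (-Complex.I) where
  ne_zero := neg_ne_zero.mpr Complex.I_ne_zero
  hasSum_left a t ht := by simpa using HurwitzZeta.hasSum_int_oddKernel a ht
  hasSum_right a t ht := by simpa using HurwitzZeta.hasSum_int_sinKernel a ht
  functional_equation a x := by
    have := HurwitzZeta.oddKernel_functional_equation a x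
    linarith
  continuousOn := HurwitzZeta.continuousOn_oddKernel

variable {κ : ℕ} {E C : UnitAddCircle → ℝ → ℝ} {c : ℂ}

/-- The integers are sorted by residue modulo `q`: for `n = mq + j` the inner sum over `m` is the
kernel at `j/q`. -/
lemma IsThetaKernel.hasSum_thetaTerm (h : IsThetaKernel κ E C c) (χ : DirichletCharacter ℂ q)
    {t : ℝ} (ht : 0 < t) : HasSum (thetaTerm κ χ t)
      (∑ j : Fin q, χ (j : ℕ) * (q : ℂ) ^ κ * E ((j : ℕ) / q : ℝ) (q * t)) := by
  have hq : (q : ℝ) ≠ 0 := mod_cast NeZero.ne q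
  have hqt : 0 < q * t := by positivity
  rw [← (Int.divModEquiv q).symm.hasSum_iff, ← (Equiv.prodComm (Fin q) ℤ).hasSum_iff]
  have h1 : ∀ j : Fin q, HasSum (fun m : ℤ => χ (j : ℕ) * (q : ℂ) ^ κ *
      (((m + ((j : ℕ) / q : ℝ)) ^ κ * exp (-π * (m + ((j : ℕ) / q : ℝ)) ^ 2 * (q * t)) :
        ℝ) : ℂ)) (χ (j : ℕ) * (q : ℂ) ^ κ * E ((j : ℕ) / q : ℝ) (q * t)) := fun j =>
    (Complex.hasSum_ofReal.mpr (h.hasSum_left ((j : ℕ) / q : ℝ) hqt)).mul_left _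
  have h2 : ∀ (j : Fin q) (m : ℤ), (thetaTerm κ χ t ∘ (Int.divModEquiv q).symm) (m, j) =
      χ (j : ℕ) * (q : ℂ) ^ κ * (((m + ((j : ℕ) / q : ℝ)) ^ κ *
        exp (-π * (m + ((j : ℕ) / q : ℝ)) ^ 2 * (q * t)) : ℝ) : ℂ) := by
    intro j m
    have hqc : (q : ℂ) ≠ 0 := by simp_all
    have e1 : (Int.divModEquiv q).symm (m, j) = m * q + (j : ℕ) := rfl
    have e2 : (((m * q + (j : ℕ) : ℤ)) : ℂ) = q * (m + (j : ℕ) / q) := by push_cast; field_simp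
    have e3 : -π * ((m * q + (j : ℕ) : ℤ) : ℝ) ^ 2 * t / q =
        -π * (m + ((j : ℕ) / q : ℝ)) ^ 2 * (q * t) := by push_cast; field_simp
    rw [Function.comp_apply, e1, thetaTerm, e2, e3, mul_pow]
    have e4 : (((m * q + (j : ℕ) : ℤ)) : ZMod q) = ((j : ℕ) : ZMod q) := by simp
    rw [e4]
    push_cast
    ring
  have hs : Summable ((thetaTerm κ χ t ∘ (Int.divModEquiv q).symm) ∘ (Equiv.prodComm (Fin q) ℤ)) := by
    rw [← summable_norm_iff]
    refine (summable_prod_of_nonneg fun _ => norm_nonneg _).mpr ⟨fun j => ?_, Summable.of_finite⟩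
    exact (h1 j).summable.norm.congr fun m => congrArg norm (h2 j m).symm
  have h3 := hs.hasSum.prod_fiberwise (g := fun j : Fin q =>
    χ (j : ℕ) * (q : ℂ) ^ κ * E ((j : ℕ) / q : ℝ) (q * t)) fun j => by grind
  rw [(hasSum_fintype _).unique h3]
  exact hs.hasSum

/-- Primitivity enters here: the twisted Gauss sum equals `χ⁻¹(n)` times the Gauss sum for every
`n`, including those not coprime to `q`. -/
lemma IsThetaKernel.hasSum_right_twist (h : IsThetaKernel κ E C c) (hp : χ.IsPrimitive)
    {t : ℝ} (ht : 0 < t) :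
    HasSum (fun n : ℤ => c * gaussSum χ ZMod.stdAddChar * thetaTerm κ χ⁻¹ t n)
      (∑ j : Fin q, χ (j : ℕ) * C ((j : ℕ) / q : ℝ) (t / q)) := by
  have hq : (0 : ℝ) < q := mod_cast NeZero.pos q
  have h1 := hasSum_sum (s := Finset.univ) fun (j : Fin q) _ =>
    (h.hasSum_right ((j : ℕ) / q : ℝ) (div_pos ht hq)).mul_left (χ (j : ℕ))
  convert! h1 using 2 with n
  have h2 := gaussSum_mulShift_of_isPrimitive ZMod.stdAddChar hp (n : ZMod q)
  rw [mul_assoc c, thetaTerm, show gaussSum χ ZMod.stdAddChar * (χ⁻¹ n * (n : ℂ) ^ κ *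
    exp (-π * n ^ 2 * t / q)) = (χ⁻¹ n * gaussSum χ ZMod.stdAddChar) * ((n : ℂ) ^ κ *
    exp (-π * n ^ 2 * t / q)) by ring, ← h2, gaussSum, ← sum_range_zmod
      (fun j => χ j * (ZMod.stdAddChar.mulShift (n : ZMod q)) j), Finset.sum_range, sum_mul,
    mul_sum]
  refine sum_congr rfl fun j _ => ?_
  rw [AddChar.mulShift_apply]
  have h3 : ZMod.stdAddChar ((n : ZMod q) * ((j : ℕ) : ZMod q)) =
      cexp (2 * π * Complex.I * (((j : ℕ) / q : ℝ) : ℂ) * n) := by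
    have := ZMod.stdAddChar_coe (N := q) (n * (j : ℕ))
    push_cast at this
    rw [this]
    push_cast
    ring
  grind

lemma gaussSum_ne_zero (hp : χ.IsPrimitive) (hq : q ≠ 1) : gaussSum χ ZMod.stdAddChar ≠ 0 := by
  intro h
  refine rootNumber_ne_zero hp hq ?_
  rw [DirichletCharacter.rootNumber, h]
  simp

lemma IsThetaKernel.hasSum_theta (h : IsThetaKernel κ E C c) (χ : DirichletCharacter ℂ q)
    {t : ℝ} (ht : 0 < t) : HasSum (thetaTerm κ χ t) (theta κ χ t) :=
  (h.hasSum_thetaTerm χ ht).summable.hasSum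

/-- Poisson summation on each residue class, recombined by Gauss sums. The value of `ε` is never
used; its modulus is recovered from the symmetry itself in `exists_logTheta_neg`. -/
lemma IsThetaKernel.exists_functional_equation (h : IsThetaKernel κ E C c) (hp : χ.IsPrimitive)
    (hq : q ≠ 1) : ∃ ε : ℂ, ε ≠ 0 ∧ ∀ t : ℝ, 0 < t →
      theta κ χ (1 / t) = ε * ((t ^ ((κ : ℝ) + 1 / 2) : ℝ) : ℂ) * theta κ χ⁻¹ t := by
  have hq0 : (0 : ℝ) < q := mod_cast NeZero.pos q
  refine ⟨(q : ℂ) ^ κ * ((q : ℝ) ^ (-((κ : ℝ) + 1 / 2)) : ℝ) * (c * gaussSum χ ZMod.stdAddChar),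
    mul_ne_zero (mul_ne_zero (pow_ne_zero _ (by exact_mod_cast NeZero.ne q)) ?_)
      (mul_ne_zero h.ne_zero (gaussSum_ne_zero hp hq)), fun t ht => ?_⟩
  · exact_mod_cast (rpow_pos_of_pos hq0 _).ne'
  · have h1 := (h.hasSum_right_twist hp ht).unique ((h.hasSum_theta χ⁻¹ ht).mul_left _)
    rw [(h.hasSum_theta χ (one_div_pos.mpr ht)).unique (h.hasSum_thetaTerm χ (one_div_pos.mpr ht)),
      show ∀ x y z w : ℂ, x * y * z * (w : ℂ) * theta κ χ⁻¹ t = x * y * w * (z * theta κ χ⁻¹ t) from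
        fun x y z w => by ring, ← h1, mul_sum]
    refine sum_congr rfl fun j _ => ?_
    rw [h.functional_equation, show 1 / (q * (1 / t)) = t / q by field_simp,
      mul_rpow hq0.le (by positivity), one_div t, inv_rpow ht.le, rpow_neg hq0.le]
    push_cast
    field_simp

lemma star_theta {q : ℕ} (κ : ℕ) (χ : DirichletCharacter ℂ q) (t : ℝ) :
    (starRingEnd ℂ) (theta κ χ t) = theta κ χ⁻¹ t := by
  rw [theta, theta, Complex.conj_tsum]
  refine tsum_congr fun n => ?_
  rw [thetaTerm, thetaTerm, map_mul, map_mul, map_pow, conj_ofReal, ← MulChar.star_apply']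
  simp

lemma IsThetaKernel.continuousOn_theta (h : IsThetaKernel κ E C c) (χ : DirichletCharacter ℂ q) :
    ContinuousOn (theta κ χ) (Ioi 0) := by
  have hq0 : (0 : ℝ) < q := mod_cast NeZero.pos q
  refine ContinuousOn.congr (f := fun t => ∑ j : Fin q, χ (j : ℕ) * (q : ℂ) ^ κ *
    (E ((j : ℕ) / q : ℝ) (q * t) : ℂ)) ?_
    fun t ht => (h.hasSum_theta χ ht).unique (h.hasSum_thetaTerm χ ht)
  refine continuousOn_finsetSum _ fun j _ => continuousOn_const.mul ?_
  refine continuous_ofReal.comp_continuousOn ((h.continuousOn _).comp (by fun_prop) ?_)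
  exact fun t ht => mul_pos hq0 ht

lemma IsThetaKernel.exists_norm_theta_le (h : IsThetaKernel κ E C c) (hq : q ≠ 1)
    (χ : DirichletCharacter ℂ q) :
    ∃ B, ∀ t : ℝ, 1 ≤ t → ‖theta κ χ t‖ ≤ B * exp (-(π / q * t)) := by
  have hq0 : (0 : ℝ) < q := mod_cast NeZero.pos q
  have hs := (h.hasSum_theta χ one_pos).summable.norm
  refine ⟨exp (π / q) * ∑' n, ‖thetaTerm κ χ 1 n‖, fun t ht => ?_⟩
  have key : ∀ n : ℤ, ‖thetaTerm κ χ t n‖ ≤ exp (-(π / q * (t - 1))) * ‖thetaTerm κ χ 1 n‖ := by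
    intro n
    rw [thetaTerm, thetaTerm, norm_mul, norm_mul _ ((exp _ : ℝ) : ℂ), norm_real,
      norm_real, norm_of_nonneg (exp_nonneg _),
      norm_of_nonneg (exp_nonneg _), mul_left_comm]
    rcases eq_or_ne n 0 with rfl | hn
    · have : χ 0 = 0 := χ.map_zero' hq
      simp [this]
    · refine mul_le_mul_of_nonneg_left ?_ (norm_nonneg _)
      rw [← exp_add, exp_le_exp]
      have h1 : (1 : ℝ) ≤ (n : ℝ) ^ 2 := by
        have : 1 ≤ n ^ 2 := Int.one_le_abs (pow_ne_zero 2 hn) |>.trans (by simp)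
        exact_mod_cast this
      have h2 : 0 ≤ π / q := by positivity
      have h3 : -π * (n : ℝ) ^ 2 * t / q = -(π / q * (n ^ 2 * t)) := by ring
      have h4 : -π * (n : ℝ) ^ 2 * 1 / q = -(π / q * (n ^ 2)) := by ring
      rw [h3, h4, ← neg_add, neg_le_neg_iff, ← mul_add]
      refine mul_le_mul_of_nonneg_left ?_ h2
      nlinarith
  refine (tsum_of_norm_bounded (hs.mul_left _).hasSum key).trans (le_of_eq ?_)
  rw [tsum_mul_left, mul_right_comm, ← exp_add]
  ring_nf

end theta

/-! ### Mellin transforms of the theta series. -/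

section mellin

variable {q : ℕ} [NeZero q] {χ : DirichletCharacter ℂ q}
variable {κ : ℕ} {E C : UnitAddCircle → ℝ → ℝ} {c : ℂ}

lemma thetaTerm_neg {q : ℕ} {χ : DirichletCharacter ℂ q} (hpar : χ (-1) = (-1) ^ κ) (t : ℝ) (n : ℤ) :
    thetaTerm κ χ t (-n) = thetaTerm κ χ t n := by
  have h1 : χ ((-n : ℤ) : ZMod q) = (-1) ^ κ * χ n := by grind
  have h2 : (((-n : ℤ)) : ℂ) ^ κ = (-1) ^ κ * (n : ℂ) ^ κ := by
    rw [Int.cast_neg, ← neg_one_mul, mul_pow]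
  have h3 : ((-1 : ℂ) ^ κ) * (-1) ^ κ = 1 := by rw [← mul_pow]; simp
  rw [thetaTerm, thetaTerm, h1, h2]
  grind

lemma IsThetaKernel.hasSum_nat (h : IsThetaKernel κ E C c) (hq : q ≠ 1)
    (hpar : χ (-1) = (-1) ^ κ) {t : ℝ} (ht : 0 < t) :
    HasSum (fun n : ℕ => χ n * (n : ℂ) ^ κ * exp (-(π * n ^ 2 / q) * t))
      (theta κ χ t / 2) := by
  have h1 := (h.hasSum_theta χ ht).nat_add_neg
  have h0 : thetaTerm κ χ t 0 = 0 := by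
    have : χ 0 = 0 := χ.map_zero' hq
    simp [thetaTerm, this]
  rw [h0, add_zero] at h1
  refine (h1.div_const 2).congr_fun fun n => ?_
  rw [thetaTerm_neg hpar, thetaTerm, show -(π * (n : ℝ) ^ 2 / q) * t =
    -π * ((n : ℤ) : ℝ) ^ 2 * t / q by push_cast; ring]
  simp

/-- The theta series as one half of a pair related by a functional equation. -/
lemma IsThetaKernel.mellin_theta (h : IsThetaKernel κ E C c) (hp : χ.IsPrimitive) (hq : q ≠ 1) :
    Differentiable ℂ (mellin (theta κ χ)) ∧ ∀ s, MellinConvergent (theta κ χ) s := by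
  obtain ⟨ε, hε, hFE⟩ := h.exists_functional_equation hp hq
  have hq0 : (0 : ℝ) < q := mod_cast NeZero.pos q
  have htop : ∀ (ψ : DirichletCharacter ℂ q) (r : ℝ),
      (fun x => theta κ ψ x - 0) =O[atTop] (fun x : ℝ => x ^ r) := by
    intro ψ r
    obtain ⟨B, hB⟩ := h.exists_norm_theta_le hq ψ
    have h1 : (theta κ ψ · - 0) =O[atTop] fun x => exp (-(π / q) * x) := by
      refine IsBigO.of_bound B ?_
      filter_upwards [eventually_ge_atTop 1] with x hx
      simp_all
    exact h1.trans (isLittleO_exp_neg_mul_rpow_atTop (by positivity) r).isBigO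
  let P : WeakFEPair ℂ :=
    { f := theta κ χ
      g := theta κ χ⁻¹
      k := κ + 1 / 2
      ε := ε
      f₀ := 0
      g₀ := 0
      hf_int := (h.continuousOn_theta χ).locallyIntegrableOn measurableSet_Ioi
      hg_int := (h.continuousOn_theta χ⁻¹).locallyIntegrableOn measurableSet_Ioi
      hk := by positivity
      hε := hε
      h_feq := fun x hx => by simp_all
      hf_top := htop χ
      hg_top := htop χ⁻¹ }
  have hP : IsStrongFEPair P := ⟨rfl, rfl⟩
  refine ⟨?_, fun s => (hP.hasMellin s).1⟩
  have := hP.differentiable_Λ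
  rwa [hP.Λ_eq] at this

/-- Termwise integration is legitimate for large `Re s`; the rest is continuation. The relevant
point is `s = κ/2 + 1/4`, where `2s - κ = 1/2`. -/
lemma IsThetaKernel.mellin_theta_eq (h : IsThetaKernel κ E C c) (hp : χ.IsPrimitive) (hq : q ≠ 1)
    (hpar : χ (-1) = (-1) ^ κ) {s : ℂ} (hs : 0 < s.re) :
    mellin (theta κ χ) s / 2 =
      Complex.Gamma s * (((q / π : ℝ) : ℂ) ^ s * χ.LFunction (2 * s - κ)) := by
  have hq0 : (0 : ℝ) < q := mod_cast NeZero.pos q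
  have hχ := hp.ne_one hq
  have hchi0 : χ ((0 : ℕ) : ZMod q) = 0 := by rw [Nat.cast_zero]; exact χ.map_zero' hq
  have hopen : IsOpen {s : ℂ | 0 < s.re} := isOpen_lt continuous_const continuous_re
  have hbig : ∀ s : ℂ, (κ : ℝ) + 2 < s.re → mellin (theta κ χ) s / 2 =
      Complex.Gamma s * (((q / π : ℝ) : ℂ) ^ s * χ.LFunction (2 * s - κ)) := by
    intro s hs
    have hs0 : 0 < s.re := by linarith
    have hz : 1 < (2 * s - κ).re := by simp; linarith
    have hpow : ∀ {x : ℝ} (_ : 0 < x) (z : ℂ), (x : ℂ) ^ z = cexp (log x * z) :=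
      fun {x} hx z => by
        rw [Complex.cpow_def_of_ne_zero (by exact_mod_cast hx.ne'), Complex.ofReal_log hx.le]
    have hppos : ∀ n : ℕ, n ≠ 0 → 0 < π * (n : ℝ) ^ 2 / q := fun n hn => by positivity
    have hterm : ∀ n : ℕ, χ n * (n : ℂ) ^ κ / ((π * n ^ 2 / q : ℝ) : ℂ) ^ s =
        ((q / π : ℝ) : ℂ) ^ s * LSeries.term (fun n => χ n) (2 * s - κ) n := by
      intro n
      rcases eq_or_ne n 0 with rfl | hn
      · simp_all
      have hn0 : (0 : ℝ) < n := by positivity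
      have e1 : log (π * n ^ 2 / q) = 2 * log n - log (q / π) := by
        rw [log_div (by positivity) hq0.ne', log_mul pi_ne_zero (by positivity),
          log_pow, log_div hq0.ne' pi_ne_zero]
        ring
      rw [LSeries.term_of_ne_zero hn, ← Complex.cpow_natCast, ← Complex.ofReal_natCast n,
        hpow hn0, hpow hn0, hpow (hppos n hn), hpow (by positivity), e1]
      generalize log (q / π) = lq
      rw [div_eq_mul_inv, div_eq_mul_inv, ← Complex.exp_neg, ← Complex.exp_neg, mul_assoc, ← Complex.exp_add,
        mul_left_comm, ← Complex.exp_add]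
      push_cast
      ring
    have h1 := hasSum_mellin (F := fun t => theta κ χ t / 2) (a := fun n : ℕ => χ n * (n : ℂ) ^ κ)
      (p := fun n : ℕ => π * n ^ 2 / q) (s := s)
      (fun n => by
        rcases eq_or_ne n 0 with rfl | hn
        · grind
        grind)
      hs0 (fun t ht => h.hasSum_nat hq hpar ht) ?_
    · have h2 : mellin (fun t => theta κ χ t / 2) s = mellin (theta κ χ) s / 2 := by
        simp_rw [div_eq_inv_mul, ← smul_eq_mul, mellin_const_smul]
      rw [h2] at h1
      refine h1.unique ?_
      have h3 := (χ.LSeriesSummable_of_one_lt_re hz).hasSum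
      rw [χ.LFunction_eq_LSeries hz]
      refine ((h3.mul_left (((q / π : ℝ) : ℂ) ^ s)).mul_left (Complex.Gamma s)).congr_fun
        fun n => ?_
      grind
    · refine ((χ.LSeriesSummable_of_one_lt_re hz).norm.mul_left ‖((q / π : ℝ) : ℂ) ^ s‖).congr
        fun n => ?_
      rw [← norm_mul, ← hterm, norm_div]
      rcases eq_or_ne n 0 with rfl | hn
      · simp_all
      · rw [norm_cpow_eq_rpow_re_of_pos (hppos n hn)]
  refine AnalyticOnNhd.eqOn_of_preconnected_of_eventuallyEq (z₀ := ((κ + 3 : ℝ) : ℂ))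
    (f := fun s => mellin (theta κ χ) s / 2)
    (g := fun s => Complex.Gamma s * (((q / π : ℝ) : ℂ) ^ s * χ.LFunction (2 * s - κ)))
    (U := {s : ℂ | 0 < s.re})
    (fun z _ => ((h.mellin_theta hp hq).1.div_const 2).analyticAt z)
    (DifferentiableOn.analyticOnNhd (fun z hz => DifferentiableAt.differentiableWithinAt ?_) hopen)
    (convex_halfSpace_re_gt 0).isPreconnected ?_ ?_ hs
  · have hz : 0 < z.re := hz
    refine DifferentiableAt.mul (Complex.differentiableAt_Gamma z fun m hm => ?_)
      (DifferentiableAt.mul ?_ ?_)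
    · rw [hm] at hz; simp at hz; linarith
    · refine (differentiableAt_id.const_cpow (Or.inl ?_))
      exact_mod_cast (by positivity : (0 : ℝ) < q / π).ne'
    fun_prop
  · show 0 < ((κ + 3 : ℝ) : ℂ).re
    rw [ofReal_re]; positivity
  · filter_upwards [(isOpen_lt continuous_const continuous_re).mem_nhds
      (show (κ : ℝ) + 2 < ((κ + 3 : ℝ) : ℂ).re by bound)] with z hz
    grind

end mellin

/-! ### The approximate functional equation -/

lemma volume_antidiagonal : (volume : Measure (ℝ × ℝ)) {p | p.1 + p.2 = 0} = 0 := by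
  have hm : MeasurableSet {p : ℝ × ℝ | p.1 + p.2 = 0} :=
    (measurable_fst.add measurable_snd) (measurableSet_singleton 0)
  rw [Measure.volume_eq_prod, Measure.measure_prod_null hm]
  refine .of_forall fun x => ?_
  have : Prod.mk x ⁻¹' {p : ℝ × ℝ | p.1 + p.2 = 0} = {-x} := by grind
  simp [this]

/-- The square of the integral of a function with a reflection symmetry. -/
lemma norm_integral_sq_eq {f : ℝ → ℂ} (hf : Integrable f) {ε : ℂ} (hε : ‖ε‖ = 1)
    (hsymm : ∀ x, f (-x) = ε * (starRingEnd ℂ) (f x)) :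
    ((‖∫ x, f x‖ ^ 2 : ℝ) : ℂ) =
      2 * ∫ p in {p : ℝ × ℝ | 0 ≤ p.1 + p.2}, f p.1 * (starRingEnd ℂ) (f p.2) := by
  set F : ℝ × ℝ → ℂ := fun p => f p.1 * (starRingEnd ℂ) (f p.2) with hF
  set S : Set (ℝ × ℝ) := {p | 0 ≤ p.1 + p.2} with hS
  have hSm : MeasurableSet S := measurableSet_le measurable_const (measurable_fst.add measurable_snd)
  have hconj : Integrable fun x => (starRingEnd ℂ) (f x) :=
    (Complex.conjCLE.toContinuousLinearMap).integrable_comp hf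
  have hFi : Integrable F := hf.mul_prod hconj
  have h1 : ((‖∫ x, f x‖ ^ 2 : ℝ) : ℂ) = ∫ p, F p := by
    have := integral_prod_mul (μ := (volume : Measure ℝ)) (ν := (volume : Measure ℝ)) f
      fun x => (starRingEnd ℂ) (f x)
    rw [← Measure.volume_eq_prod] at this
    rw [this, integral_conj, Complex.mul_conj, normSq_eq_norm_sq]
  have hε2 : ε * (starRingEnd ℂ) ε = 1 := by rw [Complex.mul_conj, normSq_eq_norm_sq, hε]; simp
  have hneg : ∀ p : ℝ × ℝ, F (-p) = F p.swap := fun p => by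
    simp only [hF, Prod.fst_neg, Prod.snd_neg, hsymm, map_mul, Complex.conj_conj, Prod.fst_swap,
      Prod.snd_swap]
    grind
  -- Reflection through the origin followed by the swap of coordinates preserves `F`, as `|ε| = 1`,
  -- and exchanges the two half planes up to their common boundary. This replaces the contour shift
  -- in the usual proof of an approximate functional equation.
  have h2 : ∫ p in Sᶜ, F p = ∫ p in S, F p := by
    have hnull : (Sᶜ : Set (ℝ × ℝ)) =ᵐ[volume] ((fun p : ℝ × ℝ => -p) ⁻¹' (Prod.swap ⁻¹' S) : Set _) := by
      rw [ae_eq_set]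
      refine ⟨measure_mono_null (t := ∅) ?_ measure_empty, measure_mono_null ?_ volume_antidiagonal⟩
      · rintro p ⟨h, h'⟩
        exact h' (by simp [hS] at h ⊢; linarith)
      · rintro p ⟨h, h'⟩
        simp [hS] at h h' ⊢
        linarith
    rw [setIntegral_congr_set hnull]
    have e1 : ∫ p in (fun p : ℝ × ℝ => -p) ⁻¹' (Prod.swap ⁻¹' S), F p =
        ∫ p in (fun p : ℝ × ℝ => -p) ⁻¹' (Prod.swap ⁻¹' S), F (Prod.swap (-p)) := by simp_all
    have hmp : MeasurePreserving (fun p : ℝ × ℝ => -p) volume volume :=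
      Measure.measurePreserving_neg volume
    have hsw : MeasurePreserving (Prod.swap : ℝ × ℝ → ℝ × ℝ) volume volume :=
      Measure.measurePreserving_swap
    have e2 := hmp.setIntegral_preimage_emb (MeasurableEquiv.neg (ℝ × ℝ)).measurableEmbedding
      (fun p => F p.swap) (Prod.swap ⁻¹' S)
    have e3 := hsw.setIntegral_preimage_emb MeasurableEquiv.prodComm.measurableEmbedding F S
    lia
  rw [h1, ← integral_add_compl hSm hFi, h2]
  ring

/-- The density of the logarithm of a Gamma distributed variable, without normalization. -/
def gammaKernel (α x : ℝ) : ℝ := exp (α * x - exp x)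

lemma gammaKernel_pos (α x : ℝ) : 0 < gammaKernel α x := exp_pos _

lemma integrable_comp_exp_iff {F : ℝ → ℂ} : IntegrableOn F (Ioi 0) ↔
    Integrable fun x => (exp x : ℂ) * F (exp x) := by
  have h := integrableOn_image_iff_integrableOn_abs_deriv_smul (s := univ) MeasurableSet.univ
    (fun x _ => (hasDerivAt_exp x).hasDerivWithinAt) exp_injective.injOn F
  simp_all

lemma integral_comp_exp {F : ℝ → ℂ} : ∫ t in Ioi 0, F t = ∫ x, (exp x : ℂ) * F (exp x) := by
  have h := integral_image_eq_integral_abs_deriv_smul (s := univ) MeasurableSet.univ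
    (fun x _ => (hasDerivAt_exp x).hasDerivWithinAt) exp_injective.injOn F
  simp_all

lemma exp_mul_rpow_exp (α x : ℝ) : exp x * exp x ^ (α - 1) = exp (α * x) := by
  rw [← exp_mul, ← exp_add]; ring_nf

lemma integrable_gammaKernel {α : ℝ} (hα : 0 < α) : Integrable (gammaKernel α) := by
  have h := GammaIntegral_convergent hα
  have h1 : IntegrableOn (fun x : ℝ => ((exp (-x) * x ^ (α - 1) : ℝ) : ℂ)) (Ioi 0) := h.ofReal
  rw [integrable_comp_exp_iff] at h1
  refine h1.re.congr (.of_forall fun x => ?_)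
  simp only [← ofReal_mul, RCLike.re_to_complex, ofReal_re]
  rw [mul_left_comm, exp_mul_rpow_exp, gammaKernel, ← exp_add]
  ring_nf

lemma integral_gammaKernel {α : ℝ} (hα : 0 < α) : ∫ x, gammaKernel α x = Gamma α := by
  have h := integral_comp_exp (F := fun x : ℝ => ((exp (-x) * x ^ (α - 1) : ℝ) : ℂ))
  rw [integral_complex_ofReal, ← Gamma_eq_integral hα] at h
  simp only [← ofReal_mul] at h
  rw [integral_complex_ofReal] at h
  rw [Complex.ofReal_inj.mp h]
  refine integral_congr_ae (.of_forall fun x => ?_)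
  simp only
  rw [mul_left_comm, exp_mul_rpow_exp, gammaKernel, ← exp_add]
  ring_nf

/-- The normalized kernel on the plane, a probability density. -/
def planeKernel (α : ℝ) (p : ℝ × ℝ) : ℝ :=
  gammaKernel α p.1 * gammaKernel α p.2 / Gamma α ^ 2

lemma planeKernel_nonneg (α : ℝ) (p : ℝ × ℝ) : 0 ≤ planeKernel α p :=
  div_nonneg (mul_pos (gammaKernel_pos _ _) (gammaKernel_pos _ _)).le (sq_nonneg _)

lemma integrable_planeKernel {α : ℝ} (hα : 0 < α) : Integrable (planeKernel α) :=
  ((integrable_gammaKernel hα).mul_prod (integrable_gammaKernel hα)).div_const _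

lemma integral_planeKernel_mul_exp {α β : ℝ} (hβ : 0 < α + β) :
    Integrable (fun p : ℝ × ℝ => planeKernel α p * exp (β * (p.1 + p.2))) ∧
    ∫ p : ℝ × ℝ, planeKernel α p * exp (β * (p.1 + p.2)) = (Gamma (α + β) / Gamma α) ^ 2 := by
  have h : ∀ p : ℝ × ℝ, planeKernel α p * exp (β * (p.1 + p.2)) =
      gammaKernel (α + β) p.1 * gammaKernel (α + β) p.2 / Gamma α ^ 2 := fun p => by
    rw [planeKernel, gammaKernel, gammaKernel, gammaKernel, gammaKernel, div_mul_eq_mul_div]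
    simp only [← exp_add]
    ring_nf
  have hi := (integrable_gammaKernel hβ)
  simp_rw [h]
  refine ⟨(hi.mul_prod hi).div_const _, ?_⟩
  rw [integral_div, Measure.volume_eq_prod, integral_prod_mul, integral_gammaKernel hβ, div_pow, ← sq]

lemma integral_planeKernel {α : ℝ} (hα : 0 < α) : ∫ p : ℝ × ℝ, planeKernel α p = 1 := by
  have := (integral_planeKernel_mul_exp (α := α) (β := 0) (by linarith)).2
  simp only [zero_mul, exp_zero, mul_one, add_zero] at this
  rw [this, div_self (Gamma_pos_of_pos hα).ne', one_pow]

/-- The mass of the kernel beyond `z`. -/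
def gammaTail (α z : ℝ) : ℝ := ∫ p in {p : ℝ × ℝ | z ≤ p.1 + p.2}, planeKernel α p

lemma measurableSet_halfPlane (z : ℝ) : MeasurableSet {p : ℝ × ℝ | z ≤ p.1 + p.2} :=
  measurableSet_le measurable_const (measurable_fst.add measurable_snd)

lemma gammaTail_nonneg (α z : ℝ) : 0 ≤ gammaTail α z :=
  setIntegral_nonneg (measurableSet_halfPlane z) fun p _ => planeKernel_nonneg α p

/-- Chernoff's bound: on the half plane `1 ≤ e^{β(p₁ + p₂ - z)}`, and exponential moments of the
kernel are quotients of Gamma values. -/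
lemma gammaTail_le {α β : ℝ} (hα : 0 < α) (hβ : 0 ≤ β) (z : ℝ) :
    gammaTail α z ≤ (Gamma (α + β) / Gamma α) ^ 2 * exp (-(β * z)) := by
  obtain ⟨hi, he⟩ := integral_planeKernel_mul_exp (α := α) (β := β) (by linarith)
  rw [← he, ← integral_mul_const, gammaTail, ← integral_indicator (measurableSet_halfPlane z)]
  refine integral_mono ((integrable_planeKernel hα).indicator (measurableSet_halfPlane z))
    (hi.mul_const _) fun p => ?_
  by_cases hp : p ∈ {p : ℝ × ℝ | z ≤ p.1 + p.2}
  · rw [indicator_of_mem hp, mul_assoc, ← exp_add]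
    refine le_mul_of_one_le_right (planeKernel_nonneg α p) (one_le_exp ?_)
    have : z ≤ p.1 + p.2 := hp
    nlinarith
  · rw [indicator_of_notMem hp]
    exact mul_nonneg (mul_nonneg (planeKernel_nonneg α p) (exp_nonneg _)) (exp_nonneg _)

/-- Translation by `(log a, log b)` normalises both exponentials and moves the half plane to `p₁ +
p₂ ≥ log (ab)`. Thus the cutoff depends on the product only. -/
lemma integral_shifted_kernel {α : ℝ} (hα : 0 < α) {a b : ℝ} (ha : 0 < a) (hb : 0 < b) :
    ∫ p in {p : ℝ × ℝ | 0 ≤ p.1 + p.2}, exp (α * p.1 - a * exp p.1) * exp (α * p.2 - b * exp p.2) =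
      (a * b) ^ (-α) * (Gamma α ^ 2 * gammaTail α (log (a * b))) := by
  have hk : ∀ {a : ℝ} (_ : 0 < a) (x : ℝ), exp (α * x - a * exp x) =
      a ^ (-α) * gammaKernel α (x + log a) := fun {a} ha x => by
    rw [gammaKernel, exp_add, exp_log ha, rpow_def_of_pos ha, ← exp_add]
    ring_nf
  have hG := (Gamma_pos_of_pos hα).ne'
  set v : ℝ × ℝ := (log a, log b)
  have h1 : ∀ p : ℝ × ℝ, exp (α * p.1 - a * exp p.1) * exp (α * p.2 - b * exp p.2) =
      (a * b) ^ (-α) * (Gamma α ^ 2 * planeKernel α (p + v)) := fun p => by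
    rw [hk ha, hk hb, mul_rpow ha.le hb.le, planeKernel, mul_div_cancel₀ _ (pow_ne_zero 2 hG)]
    simp only [Prod.fst_add, Prod.snd_add]
    ring
  simp_rw [h1]
  rw [integral_const_mul, integral_const_mul]
  congr 2
  have hmp : MeasurePreserving (fun p : ℝ × ℝ => p + v) volume volume :=
    measurePreserving_add_right volume v
  have := hmp.setIntegral_preimage_emb (MeasurableEquiv.addRight v).measurableEmbedding
    (planeKernel α) {p : ℝ × ℝ | log (a * b) ≤ p.1 + p.2}
  rw [gammaTail, ← this]
  congr 2
  ext p
  simp only [mem_preimage, mem_ofPred_eq, Prod.fst_add, Prod.snd_add, log_mul ha.ne' hb.ne']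
  constructor <;> intro h <;> linarith

section afe

variable {q : ℕ} [NeZero q] {χ : DirichletCharacter ℂ q}
variable {κ : ℕ} {E C : UnitAddCircle → ℝ → ℝ} {c : ℂ}

/-- The cutoff function of the approximate functional equation for `|L(1/2, χ)|²`. -/
def cutoff (κ : ℕ) (y : ℝ) : ℝ := gammaTail (κ / 2 + 1 / 4) (2 * log (π * y))

lemma cutoff_nonneg (κ : ℕ) (y : ℝ) : 0 ≤ cutoff κ y := gammaTail_nonneg _ _

/-- The exponent is a compromise: together with `(mn)^{-1/2}` it gives the summable weight
`(mn)^{-9/8}`, while the factor `q^{5/8}` it costs stays a power below the number of characters. -/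
lemma exists_cutoff_le (κ : ℕ) : ∃ B, 0 ≤ B ∧ ∀ y, 0 < y → cutoff κ y ≤ B * y ^ (-(5 / 8) : ℝ) := by
  refine ⟨(Gamma ((κ / 2 + 1 / 4 : ℝ) + 5 / 16) / Gamma (κ / 2 + 1 / 4 : ℝ)) ^ 2 *
    π ^ (-(5 / 8) : ℝ), by positivity, fun y hy => ?_⟩
  refine (gammaTail_le (by positivity) (by norm_num : (0 : ℝ) ≤ 5 / 16) _).trans (le_of_eq ?_)
  rw [mul_assoc, ← mul_rpow pi_pos.le hy.le, rpow_def_of_pos (by positivity)]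
  ring_nf

lemma summable_pair_cutoff (κ : ℕ) {x : ℝ} (hx : 0 < x) :
    Summable fun p : ℕ × ℕ => cutoff κ (p.1 * p.2 / x) / √(p.1 * p.2) := by
  obtain ⟨B, hB, h⟩ := exists_cutoff_le κ
  have hs : Summable fun n : ℕ => ((n : ℝ) ^ (9 / 8 : ℝ))⁻¹ :=
    summable_nat_rpow_inv.mpr (by norm_num)
  refine ((hs.mul_of_nonneg hs (fun _ => by positivity) fun _ => by positivity).mul_left
    (B * x ^ (5 / 8 : ℝ))).of_nonneg_of_le
    (fun p => div_nonneg (cutoff_nonneg _ _) (sqrt_nonneg _)) fun p => ?_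
  rcases eq_or_ne (p.1 * p.2) 0 with h0 | h0
  · have : ((p.1 : ℝ) * p.2) = 0 := mod_cast h0
    rw [this]
    simp only [sqrt_zero, div_zero]
    positivity
  · have h1 : (0 : ℝ) < p.1 * p.2 := mod_cast Nat.pos_of_ne_zero h0
    calc _ ≤ B * (p.1 * p.2 / x) ^ (-(5 / 8) : ℝ) / √(p.1 * p.2) := by gcongr; simp_all
      _ = B * x ^ (5 / 8 : ℝ) * ((p.1 * p.2 : ℝ) ^ (9 / 8 : ℝ))⁻¹ := by
          rw [sqrt_eq_rpow, div_rpow h1.le hx.le, rpow_neg hx.le, div_inv_eq_mul,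
            show (9 / 8 : ℝ) = 5 / 8 + 1 / 2 by norm_num, rpow_add h1, rpow_neg h1.le]
          field_simp
      _ = _ := by rw [mul_rpow (by positivity) (by positivity), mul_inv]

/-- The exponential whose superposition is the theta function in logarithmic coordinates. -/
def scaledKernel (α a x : ℝ) : ℝ := exp (α * x - a * exp x)

lemma integrable_scaledKernel {α a : ℝ} (hα : 0 < α) (ha : 0 < a) :
    Integrable (scaledKernel α a) := by
  have h1 : ∀ x, scaledKernel α a x = a ^ (-α) * gammaKernel α (x + log a) := fun x => by
    rw [scaledKernel, gammaKernel, exp_add, exp_log ha, rpow_def_of_pos ha, ← exp_add]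
    ring_nf
  rw [funext h1]
  exact ((integrable_gammaKernel hα).comp_add_right _).const_mul _

lemma integral_scaledKernel_pair (κ : ℕ) {x m n : ℝ} (hx : 0 < x) (hm : 0 < m) (hn : 0 < n) :
    (m * n) ^ κ * ∫ p in {p : ℝ × ℝ | 0 ≤ p.1 + p.2},
      scaledKernel (κ / 2 + 1 / 4) (π * m ^ 2 / x) p.1 *
        scaledKernel (κ / 2 + 1 / 4) (π * n ^ 2 / x) p.2 =
      (x / π) ^ (2 * (κ / 2 + 1 / 4) : ℝ) * Gamma (κ / 2 + 1 / 4) ^ 2 *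
        (cutoff κ (m * n / x) / √(m * n)) := by
  have hα0 : (0 : ℝ) < κ / 2 + 1 / 4 := by positivity
  have := integral_shifted_kernel hα0 (a := π * m ^ 2 / x) (b := π * n ^ 2 / x)
    (by positivity) (by positivity)
  unfold scaledKernel
  rw [this, cutoff, show π * m ^ 2 / x * (π * n ^ 2 / x) = (π * (m * n / x)) ^ 2 by ring, log_pow]
  have h0 : 0 < m * n := by positivity
  have h3 : ((π * (m * n / x)) ^ 2 : ℝ) ^ (-(κ / 2 + 1 / 4) : ℝ) =
      (x / π) ^ (2 * (κ / 2 + 1 / 4) : ℝ) * (m * n) ^ (-(2 * (κ / 2 + 1 / 4)) : ℝ) := by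
    rw [← rpow_natCast, ← rpow_mul (by positivity),
      show π * (m * n / x) = (x / π)⁻¹ * (m * n) by field_simp,
      mul_rpow (by positivity) (by positivity), inv_rpow (by positivity),
      ← rpow_neg (by positivity)]
    grind
  have h4 : (m * n) ^ κ * (m * n) ^ (-(2 * (κ / 2 + 1 / 4)) : ℝ) = (√(m * n))⁻¹ := by
    rw [← rpow_natCast, ← rpow_add h0, sqrt_eq_rpow, ← rpow_neg h0.le]
    ring_nf
  grind

/-- The theta function in logarithmic coordinates. -/
def logTheta {q : ℕ} (κ : ℕ) (χ : DirichletCharacter ℂ q) (x : ℝ) : ℂ :=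
  (exp ((κ / 2 + 1 / 4) * x) : ℂ) * (theta κ χ (exp x) / 2)

lemma exp_mul_cpow_mul_theta {q : ℕ} {χ : DirichletCharacter ℂ q} (x : ℝ) :
    (exp x : ℂ) * ((exp x : ℂ) ^ (((κ / 2 + 1 / 4 : ℝ) : ℂ) - 1) • theta κ χ (exp x)) =
      2 * logTheta κ χ x := by
  rw [logTheta, smul_eq_mul, ← mul_assoc, ← exp_mul_rpow_exp, ofReal_mul,
    ofReal_cpow (exp_nonneg x)]
  push_cast
  ring

lemma IsThetaKernel.integrable_logTheta (h : IsThetaKernel κ E C c) (hp : χ.IsPrimitive)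
    (hq : q ≠ 1) : Integrable (logTheta κ χ) := by
  have h1 := (h.mellin_theta hp hq).2 ((κ / 2 + 1 / 4 : ℝ) : ℂ)
  rw [MellinConvergent, integrable_comp_exp_iff] at h1
  simp only [exp_mul_cpow_mul_theta] at h1
  refine (h1.div_const 2).congr (.of_forall fun x => ?_)
  simp

lemma integral_logTheta {q : ℕ} {χ : DirichletCharacter ℂ q} :
    ∫ x, logTheta κ χ x = mellin (theta κ χ) ((κ / 2 + 1 / 4 : ℝ) : ℂ) / 2 := by
  rw [mellin, integral_comp_exp, ← integral_div]
  refine integral_congr_ae (.of_forall fun x => ?_)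
  simp only [exp_mul_cpow_mul_theta]
  ring

lemma IsThetaKernel.norm_integral_logTheta_sq (h : IsThetaKernel κ E C c) (hp : χ.IsPrimitive)
    (hq : q ≠ 1) (hpar : χ (-1) = (-1) ^ κ) :
    ‖∫ x, logTheta κ χ x‖ ^ 2 =
      ((q : ℝ) / π) ^ (2 * (κ / 2 + 1 / 4) : ℝ) * Gamma (κ / 2 + 1 / 4) ^ 2 *
      ‖χ.LFunction (1 / 2)‖ ^ 2 := by
  have hq0 : (0 : ℝ) < q := mod_cast NeZero.pos q
  have hα0 : (0 : ℝ) < κ / 2 + 1 / 4 := by positivity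
  have hG := Gamma_pos_of_pos hα0
  have h1 : ‖(((q : ℝ) / π : ℝ) : ℂ) ^ (((κ / 2 + 1 / 4 : ℝ)) : ℂ)‖ =
      ((q : ℝ) / π) ^ (κ / 2 + 1 / 4 : ℝ) :=
    norm_cpow_eq_rpow_re_of_pos (by positivity) _
  rw [integral_logTheta, h.mellin_theta_eq hp hq hpar (by positivity),
    show 2 * ((κ / 2 + 1 / 4 : ℝ) : ℂ) - κ = 1 / 2 by push_cast; ring, norm_mul, norm_mul,
    Complex.Gamma_ofReal, norm_real, norm_of_nonneg hG.le, h1,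
    mul_comm 2 (κ / 2 + 1 / 4 : ℝ), rpow_mul (by positivity)]
  norm_num
  ring

/-- Applying the symmetry twice multiplies by `|ε|²`, so `|ε| = 1` wherever the function is not
zero; if it vanished identically, `ε = 1` would serve. -/
lemma IsThetaKernel.exists_logTheta_neg (h : IsThetaKernel κ E C c) (hp : χ.IsPrimitive)
    (hq : q ≠ 1) :
    ∃ ε : ℂ, ‖ε‖ = 1 ∧ ∀ x, logTheta κ χ (-x) = ε * (starRingEnd ℂ) (logTheta κ χ x) := by
  obtain ⟨ε, -, hFE⟩ := h.exists_functional_equation hp hq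
  have h2' : (starRingEnd ℂ) (2 : ℂ) = 2 := Complex.conj_ofNat 2
  have h1 : ∀ x, logTheta κ χ (-x) = ε * (starRingEnd ℂ) (logTheta κ χ x) := fun x => by
    unfold logTheta
    rw [exp_neg, ← one_div, hFE _ (exp_pos x), map_mul, map_div₀, star_theta,
      conj_ofReal, ← exp_mul, h2',
      show exp ((κ / 2 + 1 / 4) * x) = exp ((κ / 2 + 1 / 4) * -x) * exp (x * (κ + 1 / 2)) by
          rw [← exp_add]; ring_nf, ofReal_mul]
    ring
  by_cases h0 : ∃ x, logTheta κ χ x ≠ 0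
  · obtain ⟨x, hx⟩ := h0
    refine ⟨ε, ?_, h1⟩
    have h2 := h1 (-x)
    rw [neg_neg, h1 x, map_mul, Complex.conj_conj, ← mul_assoc, Complex.mul_conj,
      normSq_eq_norm_sq] at h2
    have h3 : ((‖ε‖ ^ 2 : ℝ) : ℂ) = 1 := by grind
    have h4 : ‖ε‖ ^ 2 = 1 := mod_cast h3
    exact (pow_eq_one_iff_of_nonneg (norm_nonneg _) two_ne_zero).mp h4
  · push Not at h0
    exact ⟨1, norm_one, fun x => by simp [h0]⟩

lemma hasSum_integral_mul_conj {a : ℕ → ℂ} {e : ℕ → ℝ → ℝ} {f : ℝ → ℂ} {S : Set (ℝ × ℝ)}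
    (he0 : ∀ n x, 0 ≤ e n x) (hei : ∀ n, a n ≠ 0 → Integrable (e n))
    (hf : ∀ x, HasSum (fun n => a n * (e n x : ℂ)) (f x))
    (hs : Summable fun mn : ℕ × ℕ => ‖a mn.1‖ * ‖a mn.2‖ * ∫ p in S, e mn.1 p.1 * e mn.2 p.2) :
    HasSum (fun mn : ℕ × ℕ => a mn.1 * (starRingEnd ℂ) (a mn.2) *
      ((∫ p in S, e mn.1 p.1 * e mn.2 p.2 : ℝ) : ℂ))
      (∫ p in S, f p.1 * (starRingEnd ℂ) (f p.2)) := by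
  have hT : ∀ mn : ℕ × ℕ, Integrable fun p : ℝ × ℝ =>
      (a mn.1 * (starRingEnd ℂ) (a mn.2)) * ((e mn.1 p.1 * e mn.2 p.2 : ℝ) : ℂ) := by
    rintro ⟨m, n⟩
    by_cases hm : a m = 0
    · simp_all
    by_cases hn : a n = 0
    · simp_all
    exact ((hei m hm).mul_prod (hei n hn)).ofReal.const_mul _
  have hsum : ∀ p : ℝ × ℝ, HasSum (fun mn : ℕ × ℕ =>
      (a mn.1 * (starRingEnd ℂ) (a mn.2)) * ((e mn.1 p.1 * e mn.2 p.2 : ℝ) : ℂ))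
      (f p.1 * (starRingEnd ℂ) (f p.2)) := by
    intro p
    have h1 := hf p.1
    have h2 : HasSum (fun n => (starRingEnd ℂ) (a n) * (e n p.2 : ℂ)) ((starRingEnd ℂ) (f p.2)) :=
      ((hf p.2).map (starRingEnd ℂ) Complex.continuous_conj).congr_fun fun n => by simp
    have h3 := summable_mul_of_summable_norm h1.summable.norm h2.summable.norm
    refine (h1.mul h2 h3).congr_fun fun mn => ?_
    push_cast
    ring
  have hnorm : Summable fun mn : ℕ × ℕ => ∫ p in S,
      ‖(a mn.1 * (starRingEnd ℂ) (a mn.2)) * ((e mn.1 p.1 * e mn.2 p.2 : ℝ) : ℂ)‖ := by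
    refine hs.congr fun mn => ?_
    rw [← integral_const_mul]
    refine integral_congr_ae (.of_forall fun p => ?_)
    simp only [norm_mul, RCLike.norm_conj, norm_real, norm_of_nonneg (he0 _ _)]
  have h := hasSum_integral_of_summable_integral_norm (μ := volume.restrict S)
    (fun mn => (hT mn).restrict) hnorm
  rw [integral_congr_ae (.of_forall fun p => (hsum p).tsum_eq)] at h
  refine h.congr_fun fun mn => ?_
  rw [integral_const_mul, integral_complex_ofReal]

/-- The approximate functional equation for `|L(1/2, χ)|²`. -/
theorem IsThetaKernel.hasSum_norm_sq (h : IsThetaKernel κ E C c) (hp : χ.IsPrimitive) (hq : q ≠ 1)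
    (hpar : χ (-1) = (-1) ^ κ) :
    HasSum (fun p : ℕ × ℕ => χ p.1 * (starRingEnd ℂ) (χ p.2) *
      ((cutoff κ (p.1 * p.2 / q) / √(p.1 * p.2) : ℝ) : ℂ))
      ((‖χ.LFunction (1 / 2)‖ ^ 2 / 2 : ℝ) : ℂ) := by
  have hq0 : (0 : ℝ) < q := mod_cast NeZero.pos q
  have hchi0 : χ ((0 : ℕ) : ZMod q) = 0 := by rw [Nat.cast_zero]; exact χ.map_zero' hq
  have hα0 : (0 : ℝ) < κ / 2 + 1 / 4 := by positivity
  obtain ⟨ε, hε, hεs⟩ := h.exists_logTheta_neg hp hq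
  have hmain := norm_integral_sq_eq (h.integrable_logTheta hp hq) hε hεs
  rw [h.norm_integral_logTheta_sq hp hq hpar] at hmain
  have hc0 : (0 : ℝ) < ((q : ℝ) / π) ^ (2 * (κ / 2 + 1 / 4) : ℝ) *
    Gamma (κ / 2 + 1 / 4) ^ 2 := by positivity
  have hpair := fun m n : ℕ => fun (hm : 0 < m) (hn : 0 < n) =>
    integral_scaledKernel_pair κ hq0 (Nat.cast_pos.mpr hm) (Nat.cast_pos.mpr hn)
  generalize hcc : ((q : ℝ) / π) ^ (2 * (κ / 2 + 1 / 4) : ℝ) *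
    Gamma (κ / 2 + 1 / 4) ^ 2 = cc at hmain hc0 hpair
  have hei : ∀ n : ℕ, n ≠ 0 → Integrable (scaledKernel (κ / 2 + 1 / 4) (π * n ^ 2 / q)) :=
    fun n hn => integrable_scaledKernel hα0 (by
      positivity)
  have hfsum : ∀ x, HasSum (fun n : ℕ => χ n * (n : ℂ) ^ κ *
      (scaledKernel (κ / 2 + 1 / 4) (π * n ^ 2 / q) x : ℂ)) (logTheta κ χ x) := fun x => by
    refine ((h.hasSum_nat hq hpar (exp_pos x)).mul_left
      (exp ((κ / 2 + 1 / 4) * x) : ℂ)).congr_fun fun n => ?_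
    rw [scaledKernel, sub_eq_add_neg, exp_add, ← neg_mul]
    push_cast
    ring
  have hepos : ∀ (n : ℕ) x, 0 ≤ scaledKernel (κ / 2 + 1 / 4) (π * n ^ 2 / q) x :=
    fun n x => exp_nonneg _
  have hval : ∀ mn : ℕ × ℕ, χ mn.1 ≠ 0 → χ mn.2 ≠ 0 → (mn.1 * mn.2 : ℝ) ^ κ *
      ∫ p in {p : ℝ × ℝ | 0 ≤ p.1 + p.2}, scaledKernel (κ / 2 + 1 / 4) (π * mn.1 ^ 2 / q) p.1 *
          scaledKernel (κ / 2 + 1 / 4) (π * mn.2 ^ 2 / q) p.2 =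
      cc * (cutoff κ (mn.1 * mn.2 / q) / √(mn.1 * mn.2)) := fun mn h1 h2 =>
    hpair mn.1 mn.2 (Nat.pos_of_ne_zero fun h0 => h1 (h0 ▸ hchi0))
      (Nat.pos_of_ne_zero fun h0 => h2 (h0 ▸ hchi0))
  have hfinal := hasSum_integral_mul_conj (S := {p : ℝ × ℝ | 0 ≤ p.1 + p.2}) hepos
    (fun n hn => hei n fun h0 => hn (by rw [h0, hchi0, zero_mul])) hfsum (by
      refine ((summable_pair_cutoff κ hq0).mul_left cc).of_nonneg_of_le
        (fun mn => mul_nonneg (by positivity) (integral_nonneg fun _ =>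
          mul_nonneg (hepos _ _) (hepos _ _))) fun mn => ?_
      have hr : 0 ≤ cc * (cutoff κ (mn.1 * mn.2 / q) / √(mn.1 * mn.2)) :=
        mul_nonneg hc0.le (div_nonneg (cutoff_nonneg _ _) (sqrt_nonneg _))
      by_cases h1 : χ mn.1 = 0
      · simpa only [h1, zero_mul, norm_zero] using hr
      by_cases h2 : χ mn.2 = 0
      · simpa only [h2, zero_mul, norm_zero, mul_zero] using hr
      simp only [norm_mul, norm_pow, Complex.norm_natCast]
      rw [mul_mul_mul_comm, ← mul_pow, mul_assoc, hval mn h1 h2]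
      exact mul_le_of_le_one_left hr
        (mul_le_one₀ (χ.norm_le_one _) (norm_nonneg _) (χ.norm_le_one _)))
  have hc0' : (cc : ℂ) ≠ 0 := mod_cast hc0.ne'
  have hfinal2 := hfinal.mul_left (cc : ℂ)⁻¹
  have hlim : (cc : ℂ)⁻¹ * (∫ p in {p : ℝ × ℝ | 0 ≤ p.1 + p.2},
      logTheta κ χ p.1 * (starRingEnd ℂ) (logTheta κ χ p.2)) =
      ((‖χ.LFunction (1 / 2)‖ ^ 2 / 2 : ℝ) : ℂ) := by
    rw [inv_mul_eq_iff_eq_mul₀ hc0']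
    refine mul_left_cancel₀ (two_ne_zero (α := ℂ)) ?_
    rw [← hmain]
    push_cast
    ring
  rw [hlim] at hfinal2
  refine hfinal2.congr_fun fun mn => ?_
  by_cases h1 : χ mn.1 = 0
  · grind
  by_cases h2 : χ mn.2 = 0
  · grind
  have h3 := congrArg (fun r : ℝ => (r : ℂ)) (hval mn h1 h2)
  simp only [ofReal_mul, ofReal_pow, Complex.ofReal_natCast] at h3
  simp only [map_mul, map_pow, Complex.conj_natCast]
  rw [mul_mul_mul_comm, ← mul_pow, mul_assoc (χ mn.1 * _), h3]
  field_simp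

end afe

section

open scoped ArithmeticFunction.Moebius

/-! ### Orthogonality of primitive characters. -/

section orthogonality

lemma conj_char_apply {m : ℕ} (ψ : DirichletCharacter ℂ m) {b : ZMod m} (hb : IsUnit b) :
    (starRingEnd ℂ) (ψ b) = ψ b⁻¹ := by
  have h0 : ψ b ≠ 0 := (hb.map ψ).ne_zero
  refine mul_right_cancel₀ h0 ?_
  rw [← map_mul, ZMod.inv_mul_of_unit b hb, map_one, mul_comm, Complex.mul_conj, normSq_eq_norm_sq]
  obtain ⟨v, rfl⟩ := hb
  simp

variable {q : ℕ} [NeZero q]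

-- Characters whose conductor divides `m` are exactly those lifted from level `m`, so the sum is
-- ordinary orthogonality modulo `m`.
open Classical in
lemma sum_char_conductor_dvd {m : ℕ} (hm : m ∣ q) {a b : ℤ} (ha : IsCoprime a q)
    (hb : IsCoprime b q) :
    ∑ χ : DirichletCharacter ℂ q with χ.conductor ∣ m, χ a * (starRingEnd ℂ) (χ b) =
      if (m : ℤ) ∣ a - b then (m.totient : ℂ) else 0 := by
  have : NeZero m := ⟨fun h => NeZero.ne q (by simp_all)⟩
  have hmb := hb.of_isCoprime_of_dvd_right (Int.natCast_dvd_natCast.mpr hm)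
  have hset : (Finset.univ.filter fun χ : DirichletCharacter ℂ q => χ.conductor ∣ m) =
      Finset.univ.image (DirichletCharacter.changeLevel hm (R := ℂ)) := by
    ext χ
    simp only [mem_filter, Finset.mem_univ, true_and, Finset.mem_image]
    rw [← DirichletCharacter.mem_conductorSet_iff_conductor_dvd χ hm]
    constructor
    · intro h
      exact ⟨h.χ₀, h.eq_changeLevel.symm⟩
    · rintro ⟨ψ, rfl⟩
      exact DirichletCharacter.changeLevel_factorsThrough ψ hm
  rw [hset, Finset.sum_image (fun x _ y _ h => DirichletCharacter.changeLevel_injective hm h)]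
  have hu : IsUnit ((b : ZMod m)) := (ZMod.coe_int_isUnit_iff_isCoprime b m).mpr hmb.symm
  have h := DirichletCharacter.sum_char_inv_mul_char_eq ℂ hu (a : ZMod m)
  simp only [ZMod.intCast_eq_intCast_iff_dvd_sub] at h
  rw [← h]
  refine sum_congr rfl fun ψ _ => ?_
  rw [DirichletCharacter.changeLevel_eq_cast_of_dvd' ψ hm ha,
    DirichletCharacter.changeLevel_eq_cast_of_dvd' ψ hm hb, conj_char_apply ψ hu, mul_comm]

lemma mem_primitiveChars {χ : DirichletCharacter ℂ q} : χ ∈ primitiveChars q ↔ χ.IsPrimitive := by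
  classical
  exact mem_filter.trans ⟨fun h => h.2, fun h => ⟨Finset.mem_univ _, h⟩⟩

/-- Möbius inversion of `sum_char_conductor_dvd` over the conductor. -/
lemma sum_primitiveChars_eq {a b : ℤ} (ha : IsCoprime a q) (hb : IsCoprime b q) :
    ∑ χ ∈ primitiveChars q, χ a * (starRingEnd ℂ) (χ b) =
      ∑ x ∈ q.divisorsAntidiagonal, (μ x.1 : ℂ) *
        if (x.2 : ℤ) ∣ a - b then (x.2.totient : ℂ) else 0 := by
  classical
  have h := (sum_eq_iff_sum_mul_moebius_eq_on (R := ℂ)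
    (f := fun d => ∑ χ : DirichletCharacter ℂ q with χ.conductor = d, χ a * (starRingEnd ℂ) (χ b))
    (g := fun m => if (m : ℤ) ∣ a - b then (m.totient : ℂ) else 0)
    {m | m ∣ q} (fun _ _ h1 h2 => h1.trans h2)).mp (fun m hm0 hm => by
      rw [← sum_char_conductor_dvd hm ha hb]
      have := Finset.sum_fiberwise_of_maps_to
        (s := Finset.univ.filter fun χ : DirichletCharacter ℂ q => χ.conductor ∣ m)
        (t := m.divisors) (g := fun χ => χ.conductor)
        (fun χ hχ => mem_divisors.mpr ⟨(mem_filter.mp hχ).2, hm0.ne'⟩)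
        (fun χ => χ a * (starRingEnd ℂ) (χ b))
      rw [← this]
      refine sum_congr rfl fun d hd => ?_
      rw [Finset.filter_filter]
      refine sum_congr (Finset.filter_congr fun χ _ => ?_) fun _ _ => rfl
      grind)
      q (NeZero.pos q) dvd_rfl
  rw [h]
  refine sum_congr (Finset.ext fun χ => ?_) fun _ _ => rfl
  rw [mem_primitiveChars, mem_filter]
  bound

/-- With `|μ| ≤ 1` what remains is `∑ φ(d)` over the common divisors of `q` and `a - b`, which is
their gcd. No cancellation in `μ` is needed. -/
lemma norm_sum_primitiveChars_le {a b : ℤ} (ha : IsCoprime a q) (hb : IsCoprime b q) :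
    ‖∑ χ ∈ primitiveChars q, χ a * (starRingEnd ℂ) (χ b)‖ ≤ Nat.gcd q (a - b).natAbs := by
  rw [sum_primitiveChars_eq ha hb, ← Nat.map_div_left_divisors, Finset.sum_map]
  refine (norm_sum_le _ _).trans ?_
  have hg : (Nat.gcd q (a - b).natAbs : ℝ) =
      ∑ d ∈ q.divisors, if (d : ℤ) ∣ a - b then (d.totient : ℝ) else 0 := by
    rw [← sum_filter]
    have h1 := Nat.sum_totient (Nat.gcd q (a - b).natAbs)
    have h2 : q.divisors.filter (fun d : ℕ => (d : ℤ) ∣ a - b) =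
        (Nat.gcd q (a - b).natAbs).divisors := by
      ext d
      have hg0 : Nat.gcd q (a - b).natAbs ≠ 0 := Nat.gcd_ne_zero_left (NeZero.ne q)
      simp only [mem_filter, mem_divisors, Nat.dvd_gcd_iff, ne_eq, NeZero.ne q,
        not_false_eq_true, and_true, hg0, Int.natCast_dvd]
    rw [h2, ← Nat.cast_sum, h1]
  rw [hg]
  refine sum_le_sum fun d _ => ?_
  change ‖((μ (q / d) : ℤ) : ℂ) * (if (d : ℤ) ∣ a - b then (d.totient : ℂ) else 0)‖ ≤ _
  rw [norm_mul]
  have h1 : ‖((μ (q / d) : ℤ) : ℂ)‖ ≤ 1 := by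
    exact_mod_cast ArithmeticFunction.abs_moebius_le_one
  have h2 : ‖(if (d : ℤ) ∣ a - b then (d.totient : ℂ) else 0)‖ =
      if (d : ℤ) ∣ a - b then (d.totient : ℝ) else 0 := by bound
  rw [h2]
  refine mul_le_of_le_one_left ?_ h1
  positivity

end orthogonality

/-! ### The number of primitive characters, and divisor bounds. -/

section counting

/-- Euler's function as an arithmetic function. -/
def totientFun : ArithmeticFunction ℤ := ⟨fun n => (n.totient : ℤ), by simp⟩

lemma isMultiplicative_totientFun : totientFun.IsMultiplicative := by
  refine ⟨by bound, fun {m n} h => ?_⟩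
  simp [totientFun, Nat.totient_mul h]

lemma card_primitiveChars (q : ℕ) [NeZero q] :
    ((primitiveChars q).card : ℤ) = (μ * totientFun) q := by
  have h := sum_primitiveChars_eq (q := q) (a := 1) (b := 1) isCoprime_one_left isCoprime_one_left
  simp only [Int.cast_one, map_one, mul_one, sum_const, nsmul_eq_mul] at h
  exact_mod_cast h

lemma moebius_mul_totient_prime_pow {p : ℕ} (hp : p.Prime) (k : ℕ) :
    (μ * totientFun) (p ^ (k + 1)) = ((p ^ (k + 1)).totient : ℤ) - (p ^ k).totient := by
  rw [ArithmeticFunction.mul_apply, Nat.sum_divisorsAntidiagonal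
    (f := fun a b => (μ a) * totientFun b), Nat.divisors_prime_pow hp, Finset.sum_map,
    Finset.sum_range_succ', Finset.sum_range_succ', sum_eq_zero]
  · simp only [zero_add, Function.Embedding.coeFn_mk, pow_one, pow_zero, Nat.div_one,
      ArithmeticFunction.moebius_apply_prime hp, ArithmeticFunction.moebius_apply_one, totientFun,
      ArithmeticFunction.coe_mk, pow_succ p k, Nat.mul_div_cancel _ hp.pos]
    ring
  · intro i _
    simp only [Function.Embedding.coeFn_mk]
    rw [ArithmeticFunction.moebius_apply_prime_pow hp (by lia), if_neg (by lia), zero_mul]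

/-- The number of primitive characters is `p - 2` modulo `p` and `p^{k-2}(p-1)²` modulo `p^k`, `k ≥
2`. It vanishes only for modulus 2, and the worst remaining ratio, 4, occurs for `p = 2`. -/
lemma le_four_mul_moebius_mul_totient {p : ℕ} (hp : p.Prime) (k : ℕ)
    (h : (μ * totientFun) (p ^ (k + 1)) ≠ 0) :
    ((p ^ (k + 1) : ℕ) : ℤ) ≤ 4 * (μ * totientFun) (p ^ (k + 1)) := by
  rw [moebius_mul_totient_prime_pow hp] at h ⊢
  have h2 : (2 : ℤ) ≤ p := mod_cast hp.two_le
  cases k with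
  | zero =>
    simp only [zero_add, pow_one, pow_zero, Nat.totient_one, Nat.totient_prime hp] at h ⊢
    lia
  | succ k =>
    simp only [Nat.totient_prime_pow_succ hp] at h ⊢
    push_cast [hp.one_le]
    have h1 : (0 : ℤ) < (p : ℤ) ^ k := by positivity
    have : 4 * ((p : ℤ) ^ (k + 1) * (p - 1) - p ^ k * (p - 1)) - p ^ (k + 1 + 1) =
      p ^ k * ((3 * p - 2) * (p - 2)) := by ring
    nlinarith [mul_nonneg h1.le (mul_nonneg (by linarith : (0 : ℤ) ≤ 3 * p - 2) (by linarith : (0 : ℤ) ≤ p - 2))]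

/-- When there are primitive characters modulo `q`, there are many of them. -/
lemma le_card_divisors_sq_mul_card_primitiveChars (q : ℕ) [NeZero q]
    (h : (primitiveChars q).Nonempty) :
    (q : ℝ) ≤ (q.divisors.card : ℝ) ^ 2 * (primitiveChars q).card := by
  have hq := NeZero.ne q
  have hm : (μ * totientFun).IsMultiplicative :=
    isMultiplicative_moebius.mul isMultiplicative_totientFun
  have h0 : (μ * totientFun) q ≠ 0 := by
    rw [← card_primitiveChars]
    exact_mod_cast h.card_pos.ne'
  have hfac := hm.multiplicative_factorization _ hq
  have key : (q : ℤ) ≤ (q.divisors.card : ℤ) ^ 2 * (primitiveChars q).card := by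
    rw [card_primitiveChars, hfac, Nat.card_divisors hq]
    conv_lhs => rw [← Nat.prod_factorization_pow_eq_self hq]
    rw [hfac] at h0
    unfold Finsupp.prod at h0 ⊢
    rw [Nat.support_factorization] at h0 ⊢
    push_cast
    rw [← Finset.prod_pow, ← prod_mul_distrib]
    refine prod_le_prod (fun _ _ => by positivity) fun p hp => ?_
    have hpp := prime_of_mem_primeFactors hp
    have hk : 1 ≤ q.factorization p :=
      hpp.factorization_pos_of_dvd hq (Nat.dvd_of_mem_primeFactors hp)
    obtain ⟨k, hk'⟩ := Nat.exists_eq_add_of_le' hk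
    have h1 := prod_ne_zero_iff.mp h0 p hp
    rw [hk'] at h1 ⊢
    have h2 := le_four_mul_moebius_mul_totient hpp k h1
    have h3 : (0 : ℤ) ≤ (μ * totientFun) (p ^ (k + 1)) := by linarith
    -- The local factor 4 is absorbed by the square of the local divisor count, which is at least 2.
    refine le_trans (by exact_mod_cast h2) (mul_le_mul_of_nonneg_right ?_ h3)
    push_cast
    nlinarith
  exact_mod_cast key

lemma le_card_divisors_mul_totient {q : ℕ} (hq : q ≠ 0) : q ≤ q.divisors.card * q.totient := by
  rw [Nat.totient_eq_prod_factorization hq, Nat.card_divisors hq]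
  conv_lhs => rw [← Nat.prod_factorization_pow_eq_self hq]
  unfold Finsupp.prod
  rw [Nat.support_factorization, ← prod_mul_distrib]
  refine prod_le_prod (fun _ _ => by positivity) fun p hp => ?_
  have hpp := prime_of_mem_primeFactors hp
  have hk : 1 ≤ q.factorization p :=
    hpp.factorization_pos_of_dvd hq (Nat.dvd_of_mem_primeFactors hp)
  obtain ⟨k, hk'⟩ := Nat.exists_eq_add_of_le' hk
  obtain ⟨r, hr⟩ := Nat.exists_eq_add_of_le' hpp.two_le
  rw [hk', hr]
  lia

/-- For `p ≥ 2^{1/ε}` one has `k + 1 ≤ 2^k ≤ p^{εk}`. Only boundedly many smaller primes remain, and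
each costs at most the constant `A`. -/
lemma exists_card_divisors_le {ε : ℝ} (hε : 0 < ε) :
    ∃ C : ℝ, 0 < C ∧ ∀ q : ℕ, q ≠ 0 → (q.divisors.card : ℝ) ≤ C * (q : ℝ) ^ ε := by
  set P : ℕ := ⌈(2 : ℝ) ^ (1 / ε)⌉₊ with hP
  set A : ℝ := 1 + 1 / (ε * log 2)
  have hl2 := log_pos one_lt_two
  have hA1 : 1 ≤ A := by bound
  have hloc : ∀ p k : ℕ, p.Prime → (k + 1 : ℝ) ≤ (if p < P then A else 1) * ((p : ℝ) ^ ε) ^ k := by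
    intro p k hp
    have hp2 : (2 : ℝ) ≤ p := mod_cast hp.two_le
    split_ifs with hpP
    · have h1 : 1 + k * (ε * log 2) ≤ ((p : ℝ) ^ ε) ^ k := by
        calc _ ≤ exp (k * (ε * log 2)) := by linarith [add_one_le_exp (k * (ε * log 2))]
          _ = ((2 : ℝ) ^ ε) ^ k := by rw [rpow_def_of_pos two_pos, ← exp_nat_mul]; ring_nf
          _ ≤ _ := by gcongr
      have h2 : (k : ℝ) + 1 ≤ A * (1 + k * (ε * log 2)) := by
        have : (1 + 1 / (ε * log 2)) * (1 + k * (ε * log 2)) =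
          1 + k + (k * (ε * log 2) + 1 / (ε * log 2)) := by grind
        have : 0 ≤ k * (ε * log 2) + 1 / (ε * log 2) := by positivity
        linarith
      nlinarith
    · have h1 : (2 : ℝ) ≤ (p : ℝ) ^ ε := by
        have : (2 : ℝ) ^ (1 / ε) ≤ p := by simp_all
        calc (2 : ℝ) = ((2 : ℝ) ^ (1 / ε)) ^ ε := by
              rw [← rpow_mul (by norm_num), one_div_mul_cancel hε.ne', rpow_one]
          _ ≤ _ := by gcongr
      rw [one_mul]
      calc (k + 1 : ℝ) ≤ 2 ^ k := mod_cast Nat.lt_two_pow_self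
        _ ≤ _ := by gcongr
  refine ⟨A ^ P, by positivity, fun q hq => ?_⟩
  rw [Nat.card_divisors hq]
  have hqq : (q : ℝ) ^ ε = ∏ p ∈ q.primeFactors, ((p : ℝ) ^ ε) ^ q.factorization p := by
    conv_lhs => rw [← Nat.prod_factorization_pow_eq_self hq]
    unfold Finsupp.prod
    push_cast
    rw [← finsetProd_rpow _ _ fun _ _ => by positivity]
    refine prod_congr rfl fun p _ => ?_
    rw [← rpow_natCast, ← rpow_natCast, ← rpow_mul (by positivity),
      ← rpow_mul (by positivity), mul_comm]
  push_cast
  calc ∏ p ∈ q.primeFactors, ((q.factorization p : ℝ) + 1) ≤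
        ∏ p ∈ q.primeFactors, ((if p < P then A else 1) * ((p : ℝ) ^ ε) ^ q.factorization p) :=
        prod_le_prod (fun _ _ => by positivity) fun p hp =>
          hloc p _ (prime_of_mem_primeFactors hp)
    _ = (∏ p ∈ q.primeFactors, if p < P then A else 1) * (q : ℝ) ^ ε := by
        rw [prod_mul_distrib, hqq]
    _ ≤ _ := by
        gcongr
        rw [← Finset.prod_filter, Finset.prod_const]
        refine pow_le_pow_right₀ hA1 ?_
        calc _ ≤ (Finset.range P).card := Finset.card_le_card fun p hp =>
              Finset.mem_range.mpr (mem_filter.mp hp).2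
          _ = P := Finset.card_range P

end counting

end

/-! ### Off-diagonal terms of the twisted moment. -/

section offDiagonal

lemma summable_nat_rpow_exp : Summable fun n : ℕ => (n : ℝ) ^ (-(9 / 8) : ℝ) :=
  summable_nat_rpow.mpr (by norm_num)

lemma summable_int_rpow_exp : Summable fun n : ℤ => |(n : ℝ)| ^ (-(9 / 8) : ℝ) :=
  summable_abs_int_rpow (by norm_num)

lemma hasSum_dvd_rpow {d : ℕ} (hd : d ≠ 0) :
    HasSum ({x : ℤ | (d : ℤ) ∣ x}.indicator fun x => |(x : ℝ)| ^ (-(9 / 8) : ℝ))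
      ((d : ℝ) ^ (-(9 / 8) : ℝ) * ∑' n : ℤ, |(n : ℝ)| ^ (-(9 / 8) : ℝ)) := by
  have hinj : Function.Injective fun l : ℤ => (d : ℤ) * l :=
    mul_right_injective₀ (by lia)
  rw [← hinj.hasSum_iff]
  · refine (summable_int_rpow_exp.hasSum.mul_left _).congr_fun fun l => ?_
    rw [Function.comp_apply, indicator_of_mem (show (d : ℤ) * l ∈ {x : ℤ | (d : ℤ) ∣ x} from dvd_mul_right _ _)]
    push_cast
    rw [abs_mul, Nat.abs_cast, mul_rpow (by positivity) (by positivity)]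
  · intro x hx
    refine indicator_of_notMem ?_ _
    rintro ⟨l, rfl⟩
    grind

/-- The weight `(mn)^{-9/8}`. -/
def pairWeight (p : ℕ × ℕ) : ℝ := (p.1 : ℝ) ^ (-(9 / 8) : ℝ) * (p.2 : ℝ) ^ (-(9 / 8) : ℝ)

lemma pairWeight_nonneg (p : ℕ × ℕ) : 0 ≤ pairWeight p := by unfold pairWeight; positivity

lemma pairWeight_swap (p : ℕ × ℕ) : pairWeight p.swap = pairWeight p := mul_comm _ _

/-- The linear form `hm + εkn`. -/
def pairForm (h k : ℕ) (ε : ℤ) (p : ℕ × ℕ) : ℤ := h * p.1 + ε * (k * p.2)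

/-- The sum of `(mn)^{-9/8}` over the pairs with `d ∣ hm ± kn ≠ 0` and `kn ≤ hm`. -/
lemma tsum_dvd_half_le {d h k H : ℕ} (hd : d ≠ 0) (hh : h ≠ 0) (hhH : h ≤ H) {ε : ℤ}
    (hε : ε = 1 ∨ ε = -1) :
    Summable ({p | (d : ℤ) ∣ pairForm h k ε p ∧ pairForm h k ε p ≠ 0 ∧
      k * p.2 ≤ h * p.1}.indicator pairWeight) ∧
    ∑' p, ({p | (d : ℤ) ∣ pairForm h k ε p ∧ pairForm h k ε p ≠ 0 ∧
      k * p.2 ≤ h * p.1}.indicator pairWeight) p ≤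
      (2 * H : ℝ) ^ (9 / 8 : ℝ) * ((∑' n : ℕ, (n : ℝ) ^ (-(9 / 8) : ℝ)) *
        ((d : ℝ) ^ (-(9 / 8) : ℝ) * ∑' n : ℤ, |(n : ℝ)| ^ (-(9 / 8) : ℝ))) := by
  have h1 := summable_nat_rpow_exp.hasSum
  have h2 := hasSum_dvd_rpow hd
  have hi0 : ∀ x, 0 ≤ ({x : ℤ | (d : ℤ) ∣ x}.indicator fun x => |(x : ℝ)| ^ (-(9 / 8) : ℝ)) x :=
    fun x => indicator_nonneg (fun _ _ => by positivity) x
  have h3 := (h1.mul h2 (h1.summable.mul_of_nonneg h2.summable (fun _ => by positivity)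
    hi0)).mul_left ((2 * H : ℝ) ^ (9 / 8 : ℝ))
  have hG0 : ∀ x : ℕ × ℤ, 0 ≤ (2 * H : ℝ) ^ (9 / 8 : ℝ) * ((x.1 : ℝ) ^ (-(9 / 8) : ℝ) *
      ({x : ℤ | (d : ℤ) ∣ x}.indicator fun x => |(x : ℝ)| ^ (-(9 / 8) : ℝ)) x.2) := by bound
  -- The pair `(n, x)` with `x = hm + εkn` determines `(m, n)`. On `kn ≤ hm` one has `|x| ≤ 2Hm`, so
  -- `m^{-9/8}` may be traded for `|x|^{-9/8}`, and the double sum decouples into one over `n` and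
  -- one over multiples of `d`.
  have hinj : Function.Injective fun p : ℕ × ℕ => ((p.2, pairForm h k ε p) : ℕ × ℤ) := by
    rintro ⟨m, n⟩ ⟨m', n'⟩ hmn
    simp only [pairForm, Prod.mk.injEq] at hmn
    obtain ⟨rfl, h4⟩ := hmn
    simp_all
  have hle : ∀ p, ({p | (d : ℤ) ∣ pairForm h k ε p ∧ pairForm h k ε p ≠ 0 ∧
      k * p.2 ≤ h * p.1}.indicator pairWeight) p ≤
      (2 * H : ℝ) ^ (9 / 8 : ℝ) * ((p.2 : ℝ) ^ (-(9 / 8) : ℝ) *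
      ({x : ℤ | (d : ℤ) ∣ x}.indicator fun x => |(x : ℝ)| ^ (-(9 / 8) : ℝ)) (pairForm h k ε p)) := by
    intro p
    refine indicator_le' (fun p hp => ?_) (fun p _ => hG0 (p.2, pairForm h k ε p)) p
    obtain ⟨hp1, hp2, hp3⟩ := hp
    rw [indicator_of_mem (show pairForm h k ε p ∈ {x : ℤ | (d : ℤ) ∣ x} from hp1)]
    have hx0 : 0 < |((pairForm h k ε p : ℤ) : ℝ)| := by positivity
    have hp3' : ((k : ℝ) * p.2) ≤ h * p.1 := mod_cast hp3
    have hhH' : (h : ℝ) ≤ H := mod_cast hhH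
    have hx : |((pairForm h k ε p : ℤ) : ℝ)| ≤ 2 * H * p.1 := by
      have h5 : (h : ℝ) * p.1 ≤ H * p.1 := by gcongr
      have h6 : (0 : ℝ) ≤ k * p.2 := by positivity
      unfold pairForm
      rcases hε with rfl | rfl <;> rw [abs_le] <;> push_cast <;> constructor <;> linarith
    have hm0 : (0 : ℝ) < 2 * H * p.1 := by grind
    have hH0 : (0 : ℝ) < 2 * H := by nlinarith
    have hm : (0 : ℝ) < p.1 := by simp_all
    have h7 : (p.1 : ℝ) ^ (-(9 / 8) : ℝ) ≤ (2 * H : ℝ) ^ (9 / 8 : ℝ) *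
        |((pairForm h k ε p : ℤ) : ℝ)| ^ (-(9 / 8) : ℝ) := by
      have := rpow_le_rpow_of_nonpos hx0 hx (by norm_num : (-(9 / 8) : ℝ) ≤ 0)
      rw [mul_rpow hH0.le hm.le, rpow_neg hH0.le] at this
      rwa [← inv_mul_le_iff₀ (by positivity)]
    calc _ ≤ ((2 * H : ℝ) ^ (9 / 8 : ℝ) * |((pairForm h k ε p : ℤ) : ℝ)| ^ (-(9 / 8) : ℝ)) *
          (p.2 : ℝ) ^ (-(9 / 8) : ℝ) := by unfold pairWeight; gcongr
      _ = _ := by ring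
  have hce := h3.summable.comp_injective hinj
  have hs := hce.of_nonneg_of_le (fun p => indicator_nonneg (fun p _ => pairWeight_nonneg p) p) hle
  refine ⟨hs, ?_⟩
  rw [← h3.tsum_eq]
  exact (hs.tsum_le_tsum hle hce).trans (tsum_comp_le_tsum_of_inj h3.summable hG0 hinj)

/-- The sum of `(mn)^{-9/8}` over the pairs with `d ∣ hm ± kn ≠ 0`. -/
lemma tsum_dvd_le {d h k H : ℕ} (hd : d ≠ 0) (hh : h ≠ 0) (hk : k ≠ 0) (hhH : h ≤ H) (hkH : k ≤ H)
    {ε : ℤ} (hε : ε = 1 ∨ ε = -1) :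
    Summable ({p | (d : ℤ) ∣ pairForm h k ε p ∧ pairForm h k ε p ≠ 0}.indicator pairWeight) ∧
    ∑' p, ({p | (d : ℤ) ∣ pairForm h k ε p ∧ pairForm h k ε p ≠ 0}.indicator pairWeight) p ≤
      2 * ((2 * H : ℝ) ^ (9 / 8 : ℝ) * ((∑' n : ℕ, (n : ℝ) ^ (-(9 / 8) : ℝ)) *
        ((d : ℝ) ^ (-(9 / 8) : ℝ) * ∑' n : ℤ, |(n : ℝ)| ^ (-(9 / 8) : ℝ)))) := by
  obtain ⟨s1, b1⟩ := tsum_dvd_half_le (k := k) hd hh hhH hε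
  obtain ⟨s2, b2⟩ := tsum_dvd_half_le (k := h) hd hk hkH hε
  have s2' := (Equiv.prodComm ℕ ℕ).summable_iff.mpr s2
  rw [← (Equiv.prodComm ℕ ℕ).tsum_eq] at b2
  have hεε : ε * ε = 1 := by lia
  -- Exchanging the roles of `(h, m)` and `(k, n)` changes the form by a sign at most, so the region
  -- `hm ≤ kn` reduces to the one already treated.
  have hsw : ∀ p : ℕ × ℕ, pairForm k h ε p.swap = ε * pairForm h k ε p := fun p => by
    simp only [pairForm, Prod.fst_swap, Prod.snd_swap]
    grind
  have hnn : ∀ (s : Set (ℕ × ℕ)) p, 0 ≤ s.indicator pairWeight p := fun s p =>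
    indicator_nonneg (fun p _ => pairWeight_nonneg p) p
  have hle : ∀ p, ({p | (d : ℤ) ∣ pairForm h k ε p ∧ pairForm h k ε p ≠ 0}.indicator pairWeight) p ≤
      ({p | (d : ℤ) ∣ pairForm h k ε p ∧ pairForm h k ε p ≠ 0 ∧
        k * p.2 ≤ h * p.1}.indicator pairWeight) p +
      (({p | (d : ℤ) ∣ pairForm k h ε p ∧ pairForm k h ε p ≠ 0 ∧
        h * p.2 ≤ k * p.1}.indicator pairWeight) ∘ (Equiv.prodComm ℕ ℕ)) p := by
    intro p
    rw [Function.comp_apply, Equiv.prodComm_apply]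
    by_cases hp : p ∈ {p | (d : ℤ) ∣ pairForm h k ε p ∧ pairForm h k ε p ≠ 0}
    swap
    · rw [indicator_of_notMem hp]
      grind
    rw [indicator_of_mem hp]
    rcases le_total (k * p.2) (h * p.1) with hc | hc
    · refine le_add_of_le_of_nonneg (le_of_eq ?_) (hnn _ _)
      exact (indicator_of_mem (s := {p | (d : ℤ) ∣ pairForm h k ε p ∧ pairForm h k ε p ≠ 0 ∧
        k * p.2 ≤ h * p.1}) ⟨hp.1, hp.2, hc⟩ pairWeight).symm
    · refine le_add_of_nonneg_of_le (hnn _ _) (le_of_eq ?_)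
      rw [← pairWeight_swap]
      exact (indicator_of_mem (s := {p | (d : ℤ) ∣ pairForm k h ε p ∧ pairForm k h ε p ≠ 0 ∧
        h * p.2 ≤ k * p.1}) ⟨by rw [hsw]; exact hp.1.mul_left _,
          by grind, hc⟩ pairWeight).symm
  have hs := (s1.add s2').of_nonneg_of_le (hnn _) hle
  refine ⟨hs, (hs.tsum_le_tsum hle (s1.add s2')).trans ?_⟩
  rw [s1.tsum_add s2', two_mul]
  grind

/-- The off-diagonal contribution. -/
lemma exists_offDiagonal_le : ∃ C : ℝ, 0 < C ∧ ∀ (q h k H : ℕ) (ε : ℤ), q ≠ 0 → h ≠ 0 → k ≠ 0 →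
    h ≤ H → k ≤ H → (ε = 1 ∨ ε = -1) →
    Summable ({p | pairForm h k ε p ≠ 0}.indicator fun p =>
      (Nat.gcd q (pairForm h k ε p).natAbs : ℝ) * pairWeight p) ∧
    ∑' p, ({p | pairForm h k ε p ≠ 0}.indicator fun p =>
      (Nat.gcd q (pairForm h k ε p).natAbs : ℝ) * pairWeight p) p ≤
      C * (H : ℝ) ^ (9 / 8 : ℝ) * q.divisors.card := by
  set c₁ := ∑' n : ℕ, (n : ℝ) ^ (-(9 / 8) : ℝ)
  set c₂ := ∑' n : ℤ, |(n : ℝ)| ^ (-(9 / 8) : ℝ)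
  refine ⟨2 * (2 : ℝ) ^ (9 / 8 : ℝ) * c₁ * c₂ + 1, by positivity, ?_⟩
  intro q h k H ε hq hh hk hhH hkH hε
  have key := fun d (hd : d ∈ q.divisors) => tsum_dvd_le (d := d) (pos_of_mem_divisors hd).ne'
    hh hk hhH hkH hε
  have hS : Summable fun p => ∑ d ∈ q.divisors, (d : ℝ) *
      ({p | (d : ℤ) ∣ pairForm h k ε p ∧ pairForm h k ε p ≠ 0}.indicator pairWeight) p :=
    summable_sum fun d hd => (key d hd).1.mul_left _
  have hnn : ∀ p, ∀ d ∈ q.divisors, 0 ≤ (d : ℝ) *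
      ({p | (d : ℤ) ∣ pairForm h k ε p ∧ pairForm h k ε p ≠ 0}.indicator pairWeight) p := fun p d _ =>
    mul_nonneg (by positivity) (indicator_nonneg (fun p _ => pairWeight_nonneg p) p)
  have hle : ∀ p, ({p | pairForm h k ε p ≠ 0}.indicator fun p =>
      (Nat.gcd q (pairForm h k ε p).natAbs : ℝ) * pairWeight p) p ≤ ∑ d ∈ q.divisors, (d : ℝ) *
      ({p | (d : ℤ) ∣ pairForm h k ε p ∧ pairForm h k ε p ≠ 0}.indicator pairWeight) p := by
    intro p
    refine indicator_le' (fun p hp => ?_) (fun p _ => sum_nonneg (hnn p)) p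
    have hmem : Nat.gcd q (pairForm h k ε p).natAbs ∈ q.divisors :=
      mem_divisors.mpr ⟨Nat.gcd_dvd_left _ _, hq⟩
    -- The gcd is itself one of the divisors `d` of `q` dividing the form, so it is bounded by the
    -- sum of all of them.
    refine le_trans (le_of_eq ?_) (Finset.single_le_sum (hnn p) hmem)
    congr 1
    exact (indicator_of_mem (s := {r | ((Nat.gcd q (pairForm h k ε p).natAbs : ℕ) : ℤ) ∣
      pairForm h k ε r ∧ pairForm h k ε r ≠ 0})
      ⟨Int.natCast_dvd.mpr (Nat.gcd_dvd_right _ _), hp⟩ pairWeight).symm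
  have hs := hS.of_nonneg_of_le (fun p => indicator_nonneg (fun p _ =>
    mul_nonneg (by positivity) (pairWeight_nonneg p)) p) hle
  refine ⟨hs, (hs.tsum_le_tsum hle hS).trans ?_⟩
  rw [Summable.tsum_finsetSum fun d hd => (key d hd).1.mul_left _]
  -- The weight `d` is compensated by the factor `d^{-9/8}` from summing over multiples of `d`; each
  -- divisor costs only `O(H^{9/8})`.
  have hterm : ∀ d ∈ q.divisors, ∑' p, (d : ℝ) *
      ({p | (d : ℤ) ∣ pairForm h k ε p ∧ pairForm h k ε p ≠ 0}.indicator pairWeight) p ≤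
      (2 * (2 : ℝ) ^ (9 / 8 : ℝ) * c₁ * c₂ + 1) * (H : ℝ) ^ (9 / 8 : ℝ) := by
    intro d hd
    rw [tsum_mul_left]
    have hd1 : (1 : ℝ) ≤ d := mod_cast pos_of_mem_divisors hd
    have h3 : (d : ℝ) * (d : ℝ) ^ (-(9 / 8) : ℝ) ≤ 1 := by
      rw [← rpow_one_add' (by positivity) (by norm_num)]
      exact rpow_le_one_of_one_le_of_nonpos hd1 (by norm_num)
    calc _ ≤ (d : ℝ) * (2 * ((2 * H : ℝ) ^ (9 / 8 : ℝ) * (c₁ * ((d : ℝ) ^ (-(9 / 8) : ℝ) * c₂)))) := by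
          gcongr; grind
      _ = (d * (d : ℝ) ^ (-(9 / 8) : ℝ)) * (2 * (2 : ℝ) ^ (9 / 8 : ℝ) * c₁ * c₂ * (H : ℝ) ^ (9 / 8 : ℝ)) := by
          rw [mul_rpow (by positivity) (by positivity)]; ring
      _ ≤ 1 * (2 * (2 : ℝ) ^ (9 / 8 : ℝ) * c₁ * c₂ * (H : ℝ) ^ (9 / 8 : ℝ)) := by gcongr
      _ ≤ _ := by
          have : 0 ≤ (H : ℝ) ^ (9 / 8 : ℝ) := by positivity
          linarith
  refine (sum_le_sum hterm).trans (le_of_eq ?_)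
  rw [sum_const, nsmul_eq_mul]
  ring

end offDiagonal

/-! ### The second moment twisted by two residues. -/

section twistedMoment

/-- The weights in the approximate functional equation. -/
def afeWeight (κ q : ℕ) (p : ℕ × ℕ) : ℝ := cutoff κ (p.1 * p.2 / q) / √(p.1 * p.2)

lemma afeWeight_nonneg (κ q : ℕ) (p : ℕ × ℕ) : 0 ≤ afeWeight κ q p :=
  div_nonneg (cutoff_nonneg _ _) (sqrt_nonneg _)

lemma exists_afeWeight_le : ∃ B : ℝ, 0 < B ∧ ∀ κ ∈ Finset.range 2, ∀ q : ℕ, q ≠ 0 → ∀ p : ℕ × ℕ,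
    afeWeight κ q p ≤ B * (q : ℝ) ^ (5 / 8 : ℝ) * pairWeight p := by
  obtain ⟨B₀, h₀, hB₀⟩ := exists_cutoff_le 0
  obtain ⟨B₁, h₁, hB₁⟩ := exists_cutoff_le 1
  refine ⟨B₀ + B₁ + 1, by positivity, fun κ hκ q hq p => ?_⟩
  have hle : ∀ y, 0 < y → cutoff κ y ≤ (B₀ + B₁ + 1) * y ^ (-(5 / 8) : ℝ) := by
    intro y hy
    have hκ2 := Finset.mem_range.mp hκ
    interval_cases κ
    · exact (hB₀ y hy).trans (by bound)
    · exact (hB₁ y hy).trans (by bound)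
  have hq0 : (0 : ℝ) < q := by positivity
  unfold afeWeight
  rcases eq_or_ne (p.1 * p.2) 0 with h0 | h0
  · have : ((p.1 : ℝ) * p.2) = 0 := mod_cast h0
    rw [this]
    simp only [sqrt_zero, div_zero]
    exact mul_nonneg (by positivity) (pairWeight_nonneg p)
  · have h1 : (0 : ℝ) < p.1 * p.2 := mod_cast Nat.pos_of_ne_zero h0
    calc _ ≤ (B₀ + B₁ + 1) * (p.1 * p.2 / q) ^ (-(5 / 8) : ℝ) / √(p.1 * p.2) := by gcongr; simp_all
      _ = (B₀ + B₁ + 1) * (q : ℝ) ^ (5 / 8 : ℝ) * (p.1 * p.2 : ℝ) ^ (-(9 / 8) : ℝ) := by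
          rw [sqrt_eq_rpow, div_rpow h1.le hq0.le, rpow_neg hq0.le, div_inv_eq_mul,
            show (-(9 / 8) : ℝ) = -(5 / 8) + -(1 / 2) by norm_num, rpow_add h1,
            rpow_neg h1.le (1 / 2)]
          field_simp
      _ = _ := by rw [mul_rpow (by positivity) (by positivity), pairWeight]

lemma summable_afeWeight (κ : ℕ) {q : ℕ} (hq : q ≠ 0) : Summable (afeWeight κ q) :=
  summable_pair_cutoff κ (by positivity)

/-- The pairs on the diagonal `hm = kn`. -/
def diagonalPairs (q h k : ℕ) : Set (ℕ × ℕ) :=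
  {p | h * p.1 = k * p.2 ∧ p.1.Coprime q ∧ p.2.Coprime q}

/-- The diagonal contribution. -/
def diagonal (κ q h k : ℕ) : ℝ := ∑' p, (diagonalPairs q h k).indicator (afeWeight κ q) p

variable {q : ℕ} [NeZero q]

/-- The factor `χ(m) + (-1)^κ χ(-m)` is `2χ(m)` when `χ` has parity `κ` and 0 otherwise. One formula
then covers both parities and can be summed over all primitive characters; the price is the
additional correlation with `-hm`. -/
lemma hasSum_norm_LFunction_sq {χ : DirichletCharacter ℂ q} (hp : χ.IsPrimitive) (hq : q ≠ 1) :
    HasSum (fun p : ℕ × ℕ => ∑ κ ∈ Finset.range 2, (afeWeight κ q p : ℂ) *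
      ((χ p.1 + (-1) ^ κ * χ (-(p.1 : ZMod q))) * (starRingEnd ℂ) (χ p.2)))
      ((‖χ.LFunction (1 / 2)‖ ^ 2 : ℝ) : ℂ) := by
  have hneg : ∀ a : ZMod q, χ (-a) = χ (-1) * χ a := fun a => by rw [← map_mul, neg_one_mul]
  have h2 : ((‖χ.LFunction (1 / 2)‖ ^ 2 : ℝ) : ℂ) =
      2 * ((‖χ.LFunction (1 / 2)‖ ^ 2 / 2 : ℝ) : ℂ) := by push_cast; ring
  rw [h2]
  simp only [Finset.sum_range_succ]
  rcases χ.even_or_odd with he | ho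
  · refine ((isThetaKernel_even.hasSum_norm_sq hp hq (by bound)).mul_left
      2).congr_fun fun p => ?_
    rw [hneg (p.1 : ZMod q), show χ (-1) = 1 from he, afeWeight]
    ring
  · refine ((isThetaKernel_odd.hasSum_norm_sq hp hq (by rw [pow_one]; exact ho)).mul_left
      2).congr_fun fun p => ?_
    rw [hneg (p.1 : ZMod q), show χ (-1) = -1 from ho, afeWeight, afeWeight]
    ring

/-- The correlation of two residues over the primitive characters. -/
def primCorrelation (q : ℕ) [NeZero q] (a b : ℤ) : ℂ :=
  ∑ χ ∈ primitiveChars q, χ a * (starRingEnd ℂ) (χ b)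

lemma hasSum_twisted (hq : q ≠ 1) (h k : ℕ) :
    HasSum (fun p : ℕ × ℕ => ∑ κ ∈ Finset.range 2, (afeWeight κ q p : ℂ) *
      (primCorrelation q (h * p.1) (k * p.2) + (-1) ^ κ * primCorrelation q (-(h * p.1)) (k * p.2)))
      (∑ χ ∈ primitiveChars q, χ h * (starRingEnd ℂ) (χ k) *
        ((‖χ.LFunction (1 / 2)‖ ^ 2 : ℝ) : ℂ)) := by
  have h1 := hasSum_sum (s := primitiveChars q) fun χ hχ =>
    (hasSum_norm_LFunction_sq (mem_primitiveChars.mp hχ) hq).mul_left (χ h * (starRingEnd ℂ) (χ k))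
  refine h1.congr_fun fun p => ?_
  simp only [mul_sum, primCorrelation]
  rw [Finset.sum_comm]
  refine sum_congr rfl fun κ _ => ?_
  rw [← sum_add_distrib, mul_sum]
  refine sum_congr rfl fun χ _ => ?_
  push_cast
  rw [← mul_neg]
  grind

lemma primCorrelation_eq_zero {a b : ℤ} (h : ¬ (IsCoprime a q ∧ IsCoprime b q)) :
    primCorrelation q a b = 0 := by
  refine sum_eq_zero fun χ _ => ?_
  by_cases ha : IsCoprime a q
  · rw [(χ.apply_eq_zero_iff b).mpr fun hb => h ⟨ha, hb⟩, map_zero, mul_zero]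
  · rw [(χ.apply_eq_zero_iff a).mpr ha, zero_mul]

lemma primCorrelation_self {a : ℤ} (ha : IsCoprime a q) :
    primCorrelation q a a = (primitiveChars q).card := by
  unfold primCorrelation
  rw [sum_congr rfl fun χ _ => ?_, sum_const, nsmul_eq_mul, mul_one]
  have hu : IsUnit ((a : ZMod q)) := (ZMod.coe_int_isUnit_iff_isCoprime a q).mpr ha.symm
  rw [conj_char_apply χ hu, ← map_mul, ZMod.mul_inv_of_unit _ hu, map_one]

lemma norm_primCorrelation_le {h k : ℕ} {ε : ℤ} (hε : ε = 1 ∨ ε = -1) (p : ℕ × ℕ)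
    (hx : pairForm h k ε p ≠ 0) :
    ‖primCorrelation q (-ε * (h * p.1)) (k * p.2)‖ ≤ Nat.gcd q (pairForm h k ε p).natAbs := by
  by_cases hc : IsCoprime (-ε * (h * p.1) : ℤ) q ∧ IsCoprime (k * p.2 : ℤ) q
  · refine (norm_sum_primitiveChars_le hc.1 hc.2).trans (le_of_eq ?_)
    congr 2
    unfold pairForm
    rcases hε with rfl | rfl
    · lia
    lia
  · rw [primCorrelation_eq_zero hc, norm_zero]
    positivity

/-- The second moment of `L(1/2, χ)` twisted by `χ(h) conj χ(k)`. -/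
lemma exists_twisted_le : ∃ C : ℝ, 0 < C ∧ ∀ (q : ℕ) [NeZero q] (h k H : ℕ), q ≠ 1 →
    h.Coprime q → k.Coprime q → h ≤ H → k ≤ H →
    ‖∑ χ ∈ primitiveChars q, χ h * (starRingEnd ℂ) (χ k) * ((‖χ.LFunction (1 / 2)‖ ^ 2 : ℝ) : ℂ) -
      (((primitiveChars q).card * ∑ κ ∈ Finset.range 2, diagonal κ q h k : ℝ) : ℂ)‖ ≤
      C * (H : ℝ) ^ (9 / 8 : ℝ) * q.divisors.card * (q : ℝ) ^ (5 / 8 : ℝ) := by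
  obtain ⟨B, hB, hBle⟩ := exists_afeWeight_le
  obtain ⟨C, hC, hCle⟩ := exists_offDiagonal_le
  refine ⟨4 * B * C, by positivity, ?_⟩
  intro q _ h k H hq1 hhq hkq hhH hkH
  have hq := NeZero.ne q
  have hh : h ≠ 0 := by grind
  have hk : k ≠ 0 := by grind
  have h1 := hasSum_twisted hq1 h k
  have h2 : HasSum (fun p => (((primitiveChars q).card * ∑ κ ∈ Finset.range 2,
      (diagonalPairs q h k).indicator (afeWeight κ q) p : ℝ) : ℂ))
      (((primitiveChars q).card * ∑ κ ∈ Finset.range 2, diagonal κ q h k : ℝ) : ℂ) := by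
    rw [Complex.hasSum_ofReal]
    exact (hasSum_sum fun κ _ => ((summable_afeWeight κ hq).indicator _).hasSum).mul_left _
  have key := fun ε hε => hCle q h k H ε hq hh hk hhH hkH hε
  have s1 := key 1 (Or.inl rfl)
  have s2 := key (-1) (Or.inr rfl)
  have h3 := ((s1.1.hasSum.add s2.1.hasSum).mul_left (2 * (B * (q : ℝ) ^ (5 / 8 : ℝ))))
  refine (HasSum.norm_le_of_bounded (h1.sub h2) h3 fun p => ?_).trans ?_
  · set g₁ := ({p | pairForm h k 1 p ≠ 0}.indicator fun p =>
      (Nat.gcd q (pairForm h k 1 p).natAbs : ℝ) * pairWeight p) p with hg₁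
    set g₂ := ({p | pairForm h k (-1) p ≠ 0}.indicator fun p =>
      (Nat.gcd q (pairForm h k (-1) p).natAbs : ℝ) * pairWeight p) p with hg₂
    have hg₁0 : 0 ≤ g₁ := indicator_nonneg (fun p _ =>
      mul_nonneg (by positivity) (pairWeight_nonneg p)) p
    have hg₂0 : 0 ≤ g₂ := indicator_nonneg (fun p _ =>
      mul_nonneg (by positivity) (pairWeight_nonneg p)) p
    by_cases hcop : p.1.Coprime q ∧ p.2.Coprime q
    swap
    · have e1 : ∀ a : ℤ, (a = h * p.1 ∨ a = -(h * p.1)) → primCorrelation q a (k * p.2) = 0 := by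
        intro a ha
        refine primCorrelation_eq_zero fun hc => hcop ⟨?_, ?_⟩
        · have : IsCoprime ((h * p.1 : ℕ) : ℤ) q := by
            rcases ha with rfl | rfl
            · exact hc.1
            · exact IsCoprime.neg_left_iff _ _ |>.mp hc.1
          exact (Nat.isCoprime_iff_coprime.mp this).coprime_mul_left
        · have : IsCoprime ((k * p.2 : ℕ) : ℤ) q := by lia
          exact (Nat.isCoprime_iff_coprime.mp this).coprime_mul_left
      have e2 : ∀ κ, (diagonalPairs q h k).indicator (afeWeight κ q) p = 0 := fun κ =>
        indicator_of_notMem (fun hp => hcop hp.2) _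
      simp only [e1 _ (Or.inl rfl), e1 _ (Or.inr rfl), e2, mul_zero, add_zero,
        Finset.sum_const_zero, ofReal_zero, sub_zero, norm_zero]
      positivity
    have hp1 : p.1 ≠ 0 := by grind
    have hp2 : p.2 ≠ 0 := by grind
    -- The reflected term has no diagonal, because `hm + kn > 0`.
    have hb1 : ‖primCorrelation q (-(h * p.1)) (k * p.2)‖ * pairWeight p ≤ g₁ := by
      have hx : pairForm h k 1 p ≠ 0 := by
        unfold pairForm
        positivity
      rw [hg₁, indicator_of_mem (show p ∈ {p | pairForm h k 1 p ≠ 0} from hx)]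
      refine mul_le_mul_of_nonneg_right ?_ (pairWeight_nonneg p)
      have := norm_primCorrelation_le (q := q) (Or.inl rfl) p hx
      lia
    have hb2 : ‖primCorrelation q (h * p.1) (k * p.2) -
        (((primitiveChars q).card : ℝ) * (diagonalPairs q h k).indicator 1 p : ℝ)‖ *
        pairWeight p ≤ g₂ := by
      by_cases hd : h * p.1 = k * p.2
      · have hmem : p ∈ diagonalPairs q h k := ⟨hd, hcop⟩
        have hd' : (h * p.1 : ℤ) = k * p.2 := by lia
        have hco : IsCoprime (k * p.2 : ℤ) q := by
          have := Nat.isCoprime_iff_coprime.mpr (Nat.Coprime.mul_left hkq hcop.2)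
          lia
        rw [indicator_of_mem hmem, hd', primCorrelation_self hco]
        simpa using hg₂0
      · have hx : pairForm h k (-1) p ≠ 0 := by
          unfold pairForm
          lia
        rw [indicator_of_notMem (fun hp => hd hp.1), hg₂,
          indicator_of_mem (show p ∈ {p | pairForm h k (-1) p ≠ 0} from hx)]
        refine mul_le_mul_of_nonneg_right ?_ (pairWeight_nonneg p)
        have := norm_primCorrelation_le (q := q) (Or.inr rfl) p hx
        simpa using this
    have hrw : ∑ κ ∈ Finset.range 2, (afeWeight κ q p : ℂ) *
        (primCorrelation q (h * p.1) (k * p.2) +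
        (-1) ^ κ * primCorrelation q (-(h * p.1)) (k * p.2)) -
        (((primitiveChars q).card * ∑ κ ∈ Finset.range 2,
          (diagonalPairs q h k).indicator (afeWeight κ q) p : ℝ) : ℂ) =
        ∑ κ ∈ Finset.range 2, (afeWeight κ q p : ℂ) *
        ((primCorrelation q (h * p.1) (k * p.2) -
          (((primitiveChars q).card : ℝ) * (diagonalPairs q h k).indicator 1 p : ℝ)) +
        (-1) ^ κ * primCorrelation q (-(h * p.1)) (k * p.2)) := by
      rw [mul_sum, Complex.ofReal_sum, ← sum_sub_distrib]
      refine sum_congr rfl fun κ _ => ?_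
      have : (diagonalPairs q h k).indicator (afeWeight κ q) p =
          afeWeight κ q p * (diagonalPairs q h k).indicator 1 p := by
        by_cases hp : p ∈ diagonalPairs q h k
        · simp [hp]
        · simp [hp]
      rw [this]
      push_cast
      ring
    rw [hrw]
    have hterm : ∀ κ ∈ Finset.range 2, ‖(afeWeight κ q p : ℂ) *
        ((primCorrelation q (h * p.1) (k * p.2) -
          (((primitiveChars q).card : ℝ) * (diagonalPairs q h k).indicator 1 p : ℝ)) +
        (-1) ^ κ * primCorrelation q (-(h * p.1)) (k * p.2))‖ ≤
        B * (q : ℝ) ^ (5 / 8 : ℝ) * (g₁ + g₂) := by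
      intro κ hκ
      rw [norm_mul, norm_real, norm_of_nonneg (afeWeight_nonneg κ q p)]
      refine (mul_le_mul (hBle κ hκ q hq p) (norm_add_le _ _) (norm_nonneg _)
        (mul_nonneg (by positivity) (pairWeight_nonneg p))).trans ?_
      rw [norm_mul, norm_pow, norm_neg, norm_one, one_pow, one_mul, mul_assoc (B * _)]
      bound
    refine (norm_sum_le _ _).trans ((sum_le_sum hterm).trans (le_of_eq ?_))
    rw [sum_const, Finset.card_range, nsmul_eq_mul]
    ring
  · calc _ ≤ 2 * (B * (q : ℝ) ^ (5 / 8 : ℝ)) * (C * (H : ℝ) ^ (9 / 8 : ℝ) * q.divisors.card +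
        C * (H : ℝ) ^ (9 / 8 : ℝ) * q.divisors.card) := by bound
      _ = _ := by ring

end twistedMoment

section

open scoped ArithmeticFunction.Moebius

/-! ### Harmonic sums over integers coprime to `q`. -/

section coprimeHarmonic

/-- The error `y^{-1/2}`, weaker than the true `1/y` for large `y`, makes later sums converge
comfortably. For `y < 1` the harmonic sum is empty and `-log y` is absorbed, so the estimate applies
to `t/d` with no restriction on `d`. -/
lemma abs_harmonic_floor_sub_le {y : ℝ} (hy : 0 < y) :
    |(harmonic ⌊y⌋₊ : ℝ) - log y - eulerMascheroniConstant| ≤ 3 * y ^ (-(1 / 2) : ℝ) := by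
  have hγ0 := one_half_lt_eulerMascheroniConstant
  have hγ1 := eulerMascheroniConstant_lt_two_thirds
  rcases lt_or_ge y 1 with h | h
  · have h1 : ⌊y⌋₊ = 0 := by simp_all
    have h2 : 1 ≤ y ^ (-(1 / 2) : ℝ) :=
      one_le_rpow_of_pos_of_le_one_of_nonpos hy h.le (by norm_num)
    have h3 : -log y ≤ 2 * y ^ (-(1 / 2) : ℝ) := by
      have := log_le_sub_one_of_pos (show 0 < y ^ (-(1 / 2) : ℝ) by positivity)
      rw [log_rpow hy] at this
      linarith
    have h4 := log_neg hy h
    rw [h1, harmonic_zero, Rat.cast_zero, abs_le]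
    grind
  · set n := ⌊y⌋₊ with hn
    have hn1 : 1 ≤ n := by simp_all
    have hn1' : (1 : ℝ) ≤ n := mod_cast hn1
    have hny : (n : ℝ) ≤ y := Nat.floor_le hy.le
    have hyn : y < n + 1 := by bound
    have e1 := eulerMascheroniSeq_lt_eulerMascheroniConstant n
    have e2 := eulerMascheroniConstant_lt_eulerMascheroniSeq' n
    rw [eulerMascheroniSeq] at e1
    rw [eulerMascheroniSeq', if_neg (by lia)] at e2
    have h2 : log (n + 1) - log n ≤ 1 / n := by
      rw [← log_div (by positivity) (by positivity)]
      refine (log_le_sub_one_of_pos (by positivity)).trans (le_of_eq ?_)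
      grind
    have h3 : (1 : ℝ) / n ≤ 2 * y ^ (-(1 / 2) : ℝ) := by
      have h5 : (1 : ℝ) / n ≤ 2 * y ^ (-1 : ℝ) := by
        rw [rpow_neg_one, div_le_iff₀ (by positivity), mul_assoc, inv_mul_eq_div, mul_div_assoc',
          le_div_iff₀ hy]
        linarith
      refine h5.trans ?_
      bound
    have l1 := log_le_log (by positivity) hny
    have l2 := log_le_log hy hyn.le
    grind

/-- The sum of `1/j` over `j ≤ t` coprime to `r`. -/
def coprimeHarmonic (r : ℕ) (t : ℝ) : ℝ :=
  ∑ j ∈ (Finset.Icc 1 ⌊t⌋₊).filter fun j => j.Coprime r, (j : ℝ)⁻¹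

lemma sum_moebius_divisors_filter (r j : ℕ) (hr : r ≠ 0) :
    ∑ d ∈ r.divisors, (if d ∣ j then (μ d : ℝ) else 0) = if j.Coprime r then 1 else 0 := by
  rw [← sum_filter]
  have h2 : r.divisors.filter (fun d => d ∣ j) = (Nat.gcd j r).divisors := by
    ext d
    have hg0 : Nat.gcd j r ≠ 0 := by positivity
    simp only [mem_filter, mem_divisors, Nat.dvd_gcd_iff]
    tauto
  have h := congrArg (fun f : ArithmeticFunction ℤ => f (Nat.gcd j r)) moebius_mul_coe_zeta
  simp only [coe_mul_zeta_apply, one_apply] at h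
  rw [h2, ← Int.cast_sum, h]
  simp

lemma coprimeHarmonic_eq {r : ℕ} (hr : r ≠ 0) (t : ℝ) :
    coprimeHarmonic r t = ∑ d ∈ r.divisors, (μ d : ℝ) / d * (harmonic ⌊t / d⌋₊ : ℝ) := by
  have h1 : coprimeHarmonic r t = ∑ j ∈ Finset.Icc 1 ⌊t⌋₊,
      ∑ d ∈ r.divisors, (if d ∣ j then (μ d : ℝ) else 0) * (j : ℝ)⁻¹ := by
    rw [coprimeHarmonic, sum_filter]
    refine sum_congr rfl fun j _ => ?_
    rw [← sum_mul, sum_moebius_divisors_filter r j hr]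
    simp
  rw [h1, Finset.sum_comm]
  refine sum_congr rfl fun d hd => ?_
  have hd0 := pos_of_mem_divisors hd
  have hd0' : (0 : ℝ) < d := mod_cast hd0
  have h2 : ∀ j, (if d ∣ j then (μ d : ℝ) else 0) * (j : ℝ)⁻¹ =
      if d ∣ j then (μ d : ℝ) * (j : ℝ)⁻¹ else 0 := by simp
  simp_rw [h2]
  rw [← sum_filter, harmonic_eq_sum_Icc, Nat.floor_div_natCast]
  push_cast
  rw [mul_sum]
  refine (Finset.sum_nbij' (fun i => d * i) (fun j => j / d) ?_ ?_ ?_ ?_ ?_).symm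
  · intro i hi
    rw [Finset.mem_Icc] at hi
    rw [mem_filter, Finset.mem_Icc]
    refine ⟨⟨Nat.mul_pos hd0 hi.1, ?_⟩, dvd_mul_right _ _⟩
    exact (Nat.mul_le_mul_left d hi.2).trans (Nat.mul_div_le _ _)
  · intro j hj
    rw [mem_filter, Finset.mem_Icc] at hj
    rw [Finset.mem_Icc]
    exact ⟨Nat.div_pos (Nat.le_of_dvd hj.1.1 hj.2) hd0, Nat.div_le_div_right hj.1.2⟩
  · simp_all
  · intro j hj
    exact Nat.mul_div_cancel' (mem_filter.mp hj).2
  grind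

/-- The function `n ↦ n^{-s}` as an arithmetic function. -/
def powFun (s : ℝ) : ArithmeticFunction ℝ := ⟨fun n => if n = 0 then 0 else (n : ℝ) ^ (-s), by simp⟩

lemma isMultiplicative_powFun (s : ℝ) : (powFun s).IsMultiplicative := by
  refine IsMultiplicative.iff_ne_zero.mpr ⟨by simp [powFun], fun {m n} hm hn _ => ?_⟩
  simp [powFun, hn, mul_rpow]

lemma sum_moebius_rpow {r : ℕ} (hr : Squarefree r) (s : ℝ) :
    ∑ d ∈ r.divisors, (μ d : ℝ) * (d : ℝ) ^ (-s) = ∏ p ∈ r.primeFactors, (1 - (p : ℝ) ^ (-s)) := by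
  have h := (isMultiplicative_powFun s).prodPrimeFactors_one_sub_of_squarefree _ hr
  rw [prod_congr rfl (g := fun p : ℕ => 1 - (p : ℝ) ^ (-s)), sum_congr rfl
    (g := fun d : ℕ => (μ d : ℝ) * (d : ℝ) ^ (-s))] at h
  · lia
  · intro d hd
    simp [powFun, (pos_of_mem_divisors hd).ne']
  · intro p hp
    simp [powFun, (prime_of_mem_primeFactors hp).ne_zero]

lemma sum_moebius_div {r : ℕ} (hr : Squarefree r) :
    ∑ d ∈ r.divisors, (μ d : ℝ) / d = ∏ p ∈ r.primeFactors, (1 - 1 / (p : ℝ)) := by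
  have := sum_moebius_rpow hr 1
  simpa only [rpow_neg_one, ← div_eq_mul_inv, one_div] using this

/-- The derivative at `s = 1` of `∑_{d ∣ r} μ(d) d^{-s} = ∏_{p ∣ r} (1 - p^{-s})`. -/
lemma sum_moebius_mul_log_div {r : ℕ} (hr : Squarefree r) :
    -∑ d ∈ r.divisors, (μ d : ℝ) / d * log d = (∏ p ∈ r.primeFactors, (1 - 1 / (p : ℝ))) *
        ∑ p ∈ r.primeFactors, log p / (p - 1) := by
  have hpow : ∀ n : ℕ, n ≠ 0 → HasDerivAt (fun s : ℝ => (n : ℝ) ^ (-s))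
      (-(log n / n)) 1 := fun n hn => by
    have hn0 : (0 : ℝ) < n := by positivity
    have := (hasDerivAt_neg (1 : ℝ)).const_rpow hn0
    refine this.congr_deriv ?_
    rw [rpow_neg_one]
    ring
  have h1 : HasDerivAt (fun s : ℝ => ∑ d ∈ r.divisors, (μ d : ℝ) * (d : ℝ) ^ (-s))
      (∑ d ∈ r.divisors, (μ d : ℝ) * (-(log d / d))) 1 :=
    HasDerivAt.fun_sum fun d hd => (hpow d (pos_of_mem_divisors hd).ne').const_mul _
  have h2 : HasDerivAt (fun s : ℝ => ∏ p ∈ r.primeFactors, (1 - (p : ℝ) ^ (-s)))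
      (∑ p ∈ r.primeFactors, (∏ p' ∈ r.primeFactors.erase p, (1 - (p' : ℝ) ^ (-1 : ℝ))) •
        (-(-(log p / p)))) 1 :=
    HasDerivAt.fun_finsetProd fun p hp =>
      (hpow p (prime_of_mem_primeFactors hp).ne_zero).const_sub 1
  simp_rw [sum_moebius_rpow hr] at h1
  have h3 := h1.unique h2
  have h4 : -∑ d ∈ r.divisors, (μ d : ℝ) / d * log d =
      ∑ d ∈ r.divisors, (μ d : ℝ) * (-(log d / d)) := by
    rw [← sum_neg_distrib]
    grind
  rw [h4, h3, mul_sum]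
  refine sum_congr rfl fun p hp => ?_
  have hp2 : (2 : ℝ) ≤ p := mod_cast (prime_of_mem_primeFactors hp).two_le
  rw [← Finset.mul_prod_erase _ _ hp]
  simp only [rpow_neg_one, smul_eq_mul]
  grind

lemma prod_one_sub_inv_primeFactors {q : ℕ} (hq : q ≠ 0) :
    ∏ p ∈ q.primeFactors, (1 - 1 / (p : ℝ)) = q.totient / q := by
  have h := congrArg (fun n : ℕ => (n : ℝ)) (Nat.totient_mul_prod_primeFactors q)
  push_cast at h
  have hq0 : (q : ℝ) ≠ 0 := mod_cast hq
  have hp0 : ∏ p ∈ q.primeFactors, (p : ℝ) ≠ 0 := prod_ne_zero_iff.mpr fun p hp => by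
    exact_mod_cast (prime_of_mem_primeFactors hp).ne_zero
  rw [eq_div_iff hq0]
  refine mul_right_cancel₀ hp0 ?_
  rw [h, mul_right_comm, ← prod_mul_distrib, mul_comm]
  congr 1
  refine prod_congr rfl fun p hp => ?_
  have hpp := prime_of_mem_primeFactors hp
  have : (p : ℝ) ≠ 0 := mod_cast hpp.ne_zero
  rw [Nat.cast_sub hpp.one_le]
  grind

/-- Split at `p = y + 1` with `y = √(log q)`. The smaller primes contribute at most 1 each; the
larger ones at most `(log p)/y`, and `∑ log p ≤ log q`. Any bound that is `o(log q)` would do. -/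
lemma sum_log_primeFactors_le {q : ℕ} (hq : q ≠ 0) :
    ∑ p ∈ q.primeFactors, log p / (p - 1) ≤ 2 * √(log q) + 1 := by
  have hlog : ∑ p ∈ q.primeFactors, log p ≤ log q := by
    rw [← log_prod fun p hp => by
      exact_mod_cast (prime_of_mem_primeFactors hp).ne_zero]
    refine log_le_log (prod_pos fun p hp => by
      exact_mod_cast (prime_of_mem_primeFactors hp).pos) ?_
    rw [← Nat.cast_prod]
    exact_mod_cast Nat.le_of_dvd (Nat.pos_of_ne_zero hq) (Nat.prod_primeFactors_dvd q)
  set y := √(log q)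
  have hlq : 0 ≤ log q := by positivity
  have hy0 : 0 ≤ y := sqrt_nonneg _
  rcases hy0.eq_or_lt with h0 | hy0
  · have hl0 : log q = 0 := by grind
    have : q.primeFactors = ∅ := by
      rw [Finset.eq_empty_iff_forall_notMem]
      intro p hp
      have hpp := prime_of_mem_primeFactors hp
      have h1 := Finset.single_le_sum (f := fun p : ℕ => log p) (fun p _ => log_natCast_nonneg p) hp
      have h2 : 0 < log p := log_pos (by exact_mod_cast hpp.one_lt)
      linarith
    grind
  have key : ∀ p ∈ q.primeFactors, log p / (p - 1) ≤
      (if p ∈ Finset.Icc 1 ⌊y + 1⌋₊ then 1 else 0) + log p / y := by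
    intro p hp
    have hp2 : (2 : ℝ) ≤ p := mod_cast (prime_of_mem_primeFactors hp).two_le
    have hlp : 0 ≤ log p := by positivity
    split_ifs with hc
    · have h1 := log_le_sub_one_of_pos (show (0 : ℝ) < p by linarith)
      have h2 : log p / (p - 1) ≤ 1 := (div_le_one (by linarith)).mpr h1
      have : 0 ≤ log p / y := by positivity
      linarith
    · have h1 : y + 1 < p := by
        by_contra hcon
        refine hc (Finset.mem_Icc.mpr ⟨(prime_of_mem_primeFactors hp).one_le, ?_⟩)
        exact le_floor (not_lt.mp hcon)
      rw [zero_add]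
      bound
  refine (sum_le_sum key).trans ?_
  rw [sum_add_distrib, ← Finset.sum_div, ← sum_filter, sum_const, nsmul_eq_mul, mul_one]
  have h1 : (((q.primeFactors.filter fun p => p ∈ Finset.Icc 1 ⌊y + 1⌋₊).card : ℕ) : ℝ) ≤ y + 1 := by
    have : (q.primeFactors.filter fun p => p ∈ Finset.Icc 1 ⌊y + 1⌋₊).card ≤ ⌊y + 1⌋₊ := by
      calc _ ≤ (Finset.Icc 1 ⌊y + 1⌋₊).card := Finset.card_le_card fun p hp =>
            (mem_filter.mp hp).2
        _ = _ := by simp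
    exact (by gcongr : _ ≤ ((⌊y + 1⌋₊ : ℕ) : ℝ)).trans (Nat.floor_le (by linarith))
  have h2 : (∑ p ∈ q.primeFactors, log p) / y ≤ y := by
    rw [div_le_iff₀ hy0, mul_self_sqrt hlq]
    exact hlog
  linarith

/-- Coprimality depends only on the radical of `q`, to which the squarefree identities for `∑
μ(d)/d` and `∑ μ(d) log d / d` apply. The secondary term keeps the factor `φ(q)/q`, so it is small
relative to the main term even when `φ(q)/q` is small. -/
lemma abs_coprimeHarmonic_sub_le {q : ℕ} (hq : q ≠ 0) {t : ℝ} (ht : 0 < t) :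
    |coprimeHarmonic q t - q.totient / q * log t| ≤ q.totient / q * (2 * √(log q) + 2) +
        3 * q.divisors.card * t ^ (-(1 / 2) : ℝ) := by
  set r := UniqueFactorizationMonoid.radical q
  have hrs : Squarefree r := UniqueFactorizationMonoid.squarefree_radical
  have hr0 : r ≠ 0 := by positivity
  have hrp : r.primeFactors = q.primeFactors := Nat.primeFactors_radical q
  have hrq : r ∣ q := UniqueFactorizationMonoid.radical_dvd_self
  have hH : coprimeHarmonic q t = coprimeHarmonic r t := by
    unfold coprimeHarmonic
    congr 1
    refine Finset.filter_congr fun j hj => ?_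
    have hj0 : j ≠ 0 := by grind
    rw [← Nat.disjoint_primeFactors hj0 hq, ← Nat.disjoint_primeFactors hj0 hr0, hrp]
  set c : ℝ := q.totient / q with hc
  have hc0 : 0 ≤ c := by positivity
  have hsum := sum_moebius_div hrs
  have hsl := sum_moebius_mul_log_div hrs
  rw [hrp, prod_one_sub_inv_primeFactors hq] at hsum hsl
  have hlp := sum_log_primeFactors_le hq
  have hlp0 : 0 ≤ ∑ p ∈ q.primeFactors, log p / (p - 1) := sum_nonneg fun p hp => by
    have : (1 : ℝ) ≤ p := mod_cast (prime_of_mem_primeFactors hp).one_le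
    positivity
  have hdec : coprimeHarmonic r t - c * log t = c * eulerMascheroniConstant +
      c * (∑ p ∈ q.primeFactors, log p / (p - 1)) +
      ∑ d ∈ r.divisors, (μ d : ℝ) / d * ((harmonic ⌊t / d⌋₊ : ℝ) - log (t / d) -
        eulerMascheroniConstant) := by
    rw [coprimeHarmonic_eq hr0, ← hsl]
    rw [hc, ← hsum, sum_mul, sum_mul, ← sum_neg_distrib, ← sum_add_distrib,
      ← sum_add_distrib, ← sum_sub_distrib]
    refine sum_congr rfl fun d hd => ?_
    have hd0 : (d : ℝ) ≠ 0 := mod_cast (pos_of_mem_divisors hd).ne'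
    rw [log_div ht.ne' hd0]
    ring
  have herr : |∑ d ∈ r.divisors, (μ d : ℝ) / d * ((harmonic ⌊t / d⌋₊ : ℝ) - log (t / d) -
        eulerMascheroniConstant)| ≤ 3 * q.divisors.card * t ^ (-(1 / 2) : ℝ) := by
    have hterm : ∀ d ∈ r.divisors, |(μ d : ℝ) / d * ((harmonic ⌊t / d⌋₊ : ℝ) - log (t / d) -
        eulerMascheroniConstant)| ≤ 3 * t ^ (-(1 / 2) : ℝ) := by
      intro d hd
      have hd1 : (1 : ℝ) ≤ d := mod_cast pos_of_mem_divisors hd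
      have hμ : |(μ d : ℝ)| ≤ 1 := mod_cast abs_moebius_le_one
      rw [abs_mul, abs_div, abs_of_pos (show (0 : ℝ) < d by linarith)]
      calc _ ≤ 1 / d * (3 * (t / d) ^ (-(1 / 2) : ℝ)) := by
            gcongr
            exact abs_harmonic_floor_sub_le (by positivity)
        _ = 3 * t ^ (-(1 / 2) : ℝ) * (d : ℝ) ^ (-(1 / 2) : ℝ) := by
            rw [div_rpow ht.le (by positivity), one_div, ← rpow_neg_one,
              show (-1 : ℝ) = -(1 / 2) + -(1 / 2) by norm_num, rpow_add (by positivity)]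
            field_simp
        _ ≤ 3 * t ^ (-(1 / 2) : ℝ) * 1 := by
            gcongr
            exact rpow_le_one_of_one_le_of_nonpos hd1 (by norm_num)
        _ = _ := mul_one _
    refine (Finset.abs_sum_le_sum_abs _ _).trans ((sum_le_sum hterm).trans ?_)
    rw [sum_const, nsmul_eq_mul]
    calc _ ≤ (q.divisors.card : ℝ) * (3 * t ^ (-(1 / 2) : ℝ)) := by gcongr
      _ = _ := by ring
  rw [hH, hdec]
  have hγ0 := one_half_lt_eulerMascheroniConstant
  have hγ1 := eulerMascheroniConstant_lt_two_thirds
  refine (abs_add_le _ _).trans (add_le_add ?_ herr)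
  rw [← mul_add, abs_of_nonneg (by positivity)]
  nlinarith

end coprimeHarmonic

end

/-! ### The diagonal of the twisted moment. -/

section diagonalTerm

/-- With `h = ga`, `k = gb` and `(a, b) = 1`, the solutions of `hm = kn` are `m = bj`, `n = aj`. -/
lemma diagonal_eq_tsum (κ : ℕ) {q a b g : ℕ} (hg : g ≠ 0) (hb : b ≠ 0)
    (hab : a.Coprime b) (haq : a.Coprime q) (hbq : b.Coprime q) :
    diagonal κ q (g * a) (g * b) =
      ∑' j : ℕ, {j : ℕ | j.Coprime q}.indicator (fun j => afeWeight κ q (b * j, a * j)) j := by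
  have hinj : Function.Injective fun j : ℕ => ((b * j, a * j) : ℕ × ℕ) := fun i j hij =>
    Nat.eq_of_mul_eq_mul_left (Nat.pos_of_ne_zero hb) (Prod.mk.inj hij).1
  rw [diagonal, ← hinj.tsum_eq]
  · refine tsum_congr fun j => ?_
    by_cases hj : j.Coprime q
    · have h1 : (b * j, a * j) ∈ diagonalPairs q (g * a) (g * b) :=
        ⟨by ring, hbq.mul_left hj, haq.mul_left hj⟩
      rw [indicator_of_mem h1, indicator_of_mem (show j ∈ {j : ℕ | j.Coprime q} from hj)]
    · rw [indicator_of_notMem (fun h => hj h.2.1.coprime_mul_left),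
        indicator_of_notMem (show j ∉ {j : ℕ | j.Coprime q} from hj)]
  · rintro ⟨m, n⟩ hp
    have hmem : (m, n) ∈ diagonalPairs q (g * a) (g * b) := by simp_all
    have h1 : g * a * m = g * b * n := hmem.1
    have h1' : a * m = b * n := by
      rw [mul_assoc, mul_assoc] at h1
      simp_all
    obtain ⟨j, rfl⟩ : b ∣ m := hab.symm.dvd_of_dvd_mul_left ⟨n, h1'⟩
    refine ⟨j, ?_⟩
    have : a * j = n := by
      refine Nat.eq_of_mul_eq_mul_left (Nat.pos_of_ne_zero hb) ?_
      lia
    simp [this]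

lemma mem_halfPlane_iff {x N : ℝ} (hx : 0 < x) (hN : 0 < N) {j : ℝ} (hj : 0 < j) (s : ℝ) :
    2 * log (π * (N * j ^ 2 / x)) ≤ s ↔ j ≤ √(x / (π * N)) * exp (s / 4) := by
  have h1 : log (π * (N * j ^ 2 / x)) = 2 * log j - 2 * log (√(x / (π * N))) := by
    rw [log_sqrt (by positivity), show π * (N * j ^ 2 / x) = j ^ 2 / (x / (π * N)) by
      field_simp, log_div (by positivity) (by positivity), log_pow]
    ring
  rw [← log_le_log_iff hj (by positivity), h1,
    log_mul (sqrt_pos.mpr (by positivity)).ne' (exp_ne_zero _), log_exp]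
  grind

lemma measurable_coprimeHarmonic (q : ℕ) : Measurable (coprimeHarmonic q) := by
  have h : Measurable fun n : ℕ => ∑ j ∈ (Finset.Icc 1 n).filter fun j => j.Coprime q, (j : ℝ)⁻¹ :=
    measurable_from_top
  exact h.comp Nat.measurable_floor

lemma hasSum_coprimeHarmonic (q : ℕ) (hq : q ≠ 1) (t : ℝ) :
    HasSum ({j : ℕ | j.Coprime q}.indicator fun j => if (j : ℝ) ≤ t then (j : ℝ)⁻¹ else 0)
      (coprimeHarmonic q t) := by
  have h0 : ∀ j ∉ (Finset.Icc 1 ⌊t⌋₊).filter fun j => j.Coprime q,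
      ({j : ℕ | j.Coprime q}.indicator fun j => if (j : ℝ) ≤ t then (j : ℝ)⁻¹ else 0) j = 0 := by
    intro j hj
    by_cases hc : j.Coprime q
    · have hj0 : j ≠ 0 := by grind
      rw [indicator_of_mem (show j ∈ {j : ℕ | j.Coprime q} from hc), if_neg]
      intro hle
      exact hj (mem_filter.mpr ⟨Finset.mem_Icc.mpr ⟨by lia, le_floor hle⟩, hc⟩)
    simp_all
  convert! (hasSum_sum_of_ne_finset_zero h0 : HasSum _ _) using 1
  refine sum_congr rfl fun j hj => ?_
  rw [mem_filter, Finset.mem_Icc] at hj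
  rw [indicator_of_mem (show j ∈ {j : ℕ | j.Coprime q} from hj.2), if_pos]
  exact (Nat.le_floor_iff' (by lia)).mp hj.1.2

/-- The cutoff is an integral over a half plane depending on `j`. Exchanging sum and integral
leaves, at each point of the plane, a sharply truncated harmonic sum, averaged against a probability
density; no Mellin inversion is required. -/
lemma diagonal_eq_integral (κ : ℕ) {q a b g : ℕ} (hq0 : q ≠ 0) (hq : q ≠ 1) (hg : g ≠ 0) (ha : a ≠ 0)
    (hb : b ≠ 0) (hab : a.Coprime b) (haq : a.Coprime q) (hbq : b.Coprime q) :
    diagonal κ q (g * a) (g * b) = (√(a * b))⁻¹ * ∫ p : ℝ × ℝ, planeKernel (κ / 2 + 1 / 4) p *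
        coprimeHarmonic q (√(q / (π * (a * b))) * exp ((p.1 + p.2) / 4)) := by
  have hα : (0 : ℝ) < κ / 2 + 1 / 4 := by positivity
  have hx : (0 : ℝ) < q := by positivity
  have ha' : (0 : ℝ) < a := by positivity
  have hb' : (0 : ℝ) < b := by positivity
  have hN : (0 : ℝ) < a * b := by positivity
  set x₀ := √(q / (π * (a * b))) with hx₀
  set F : ℕ → ℝ × ℝ → ℝ := fun j p => planeKernel (κ / 2 + 1 / 4) p *
    ({j : ℕ | j.Coprime q}.indicator fun j : ℕ => if (j : ℝ) ≤ x₀ * exp ((p.1 + p.2) / 4) then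
      (j : ℝ)⁻¹ else 0) j with hF
  have hF' : ∀ j : ℕ, j.Coprime q → F j = fun p => (j : ℝ)⁻¹ *
      {p : ℝ × ℝ | 2 * log (π * (a * b * (j : ℝ) ^ 2 / q)) ≤ p.1 + p.2}.indicator
        (planeKernel (κ / 2 + 1 / 4)) p := by
    intro j hj
    have hj0 : j ≠ 0 := by grind
    have hj' : (0 : ℝ) < j := by positivity
    funext p
    simp only [hF]
    rw [indicator_of_mem (show j ∈ {j : ℕ | j.Coprime q} from hj)]
    have := mem_halfPlane_iff hx hN hj' (p.1 + p.2)
    by_cases hp : (j : ℝ) ≤ x₀ * exp ((p.1 + p.2) / 4)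
    · rw [if_pos hp, indicator_of_mem (show p ∈ {p : ℝ × ℝ | _ ≤ p.1 + p.2} from this.mpr hp),
        mul_comm]
    simp_all
  have hF0 : ∀ j : ℕ, ¬ j.Coprime q → F j = fun _ => 0 := by simp_all
  have hFi : ∀ j, Integrable (F j) := fun j => by
    by_cases hj : j.Coprime q
    · rw [hF' j hj]
      exact ((integrable_planeKernel hα).indicator (measurableSet_halfPlane _)).const_mul _
    · rw [hF0 j hj]
      simp
  have hFnn : ∀ j p, 0 ≤ F j p := fun j p => mul_nonneg (planeKernel_nonneg _ _)
    (indicator_nonneg (fun i _ => by positivity) j)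
  have hFint : ∀ j, ∫ p, F j p = √(a * b) *
      {j : ℕ | j.Coprime q}.indicator (fun j => afeWeight κ q (b * j, a * j)) j := fun j => by
    by_cases hj : j.Coprime q
    · have hj0 : j ≠ 0 := by grind
      have hj' : (0 : ℝ) < j := by positivity
      rw [hF' j hj, indicator_of_mem (show j ∈ {j : ℕ | j.Coprime q} from hj), integral_const_mul,
        integral_indicator (measurableSet_halfPlane _), afeWeight, cutoff, gammaTail]
      push_cast
      rw [show (b * j * (a * j) : ℝ) = a * b * (j : ℝ) ^ 2 by ring, sqrt_mul hN.le, sqrt_sq hj'.le]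
      grind
    · rw [hF0 j hj, indicator_of_notMem (show j ∉ {j : ℕ | j.Coprime q} from hj), integral_zero,
        mul_zero]
  have hsum : Summable fun j => ∫ p, ‖F j p‖ := by
    simp_rw [norm_of_nonneg (hFnn _ _), hFint]
    refine Summable.mul_left _ (Summable.indicator ?_ _)
    exact (summable_afeWeight κ hq0).comp_injective fun i j hij =>
      Nat.eq_of_mul_eq_mul_left (Nat.pos_of_ne_zero hb) (Prod.mk.inj hij).1
  have h := (hasSum_integral_of_summable_integral_norm hFi hsum).tsum_eq
  simp_rw [hFint] at h
  rw [tsum_mul_left, ← diagonal_eq_tsum κ hg hb hab haq hbq] at h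
  rw [eq_inv_mul_iff_mul_eq₀ (sqrt_pos.mpr hN).ne', h]
  refine integral_congr_ae (.of_forall fun p => ?_)
  exact ((hasSum_coprimeHarmonic q hq _).mul_left _).tsum_eq

/-- The mean of `e^{-s/8}` and of `|s|` under the kernel. -/
def kernelMoment (κ : ℕ) : ℝ :=
  ∫ p : ℝ × ℝ, planeKernel (κ / 2 + 1 / 4) p * (exp (-(p.1 + p.2) / 8) + |p.1 + p.2|)

lemma integrable_kernelMoment (κ : ℕ) : Integrable fun p : ℝ × ℝ =>
    planeKernel (κ / 2 + 1 / 4) p * (exp (-(p.1 + p.2) / 8) + |p.1 + p.2|) := by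
  have hα : (0 : ℝ) < κ / 2 + 1 / 4 := by positivity
  have hκ : (0 : ℝ) ≤ κ := by positivity
  have h1 := (integral_planeKernel_mul_exp (α := κ / 2 + 1 / 4) (β := 1 / 8) (by linarith)).1
  have h2 := (integral_planeKernel_mul_exp (α := κ / 2 + 1 / 4) (β := -(1 / 8)) (by linarith)).1
  refine ((h1.add h2).const_mul 9).mono' ?_ (.of_forall fun p => ?_)
  · refine (integrable_planeKernel hα).aestronglyMeasurable.mul ?_
    fun_prop
  · have hK := planeKernel_nonneg (κ / 2 + 1 / 4) p
    rw [norm_of_nonneg (mul_nonneg hK (by positivity))]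
    have e1 := add_one_le_exp (1 / 8 * (p.1 + p.2))
    have e2 := add_one_le_exp (-(1 / 8) * (p.1 + p.2))
    have e3 := exp_pos (1 / 8 * (p.1 + p.2))
    have e4 := exp_pos (-(1 / 8) * (p.1 + p.2))
    have h3 : |p.1 + p.2| ≤ 8 * (exp (1 / 8 * (p.1 + p.2)) + exp (-(1 / 8) * (p.1 + p.2))) := by
      grind
    have h4 : exp (-(p.1 + p.2) / 8) = exp (-(1 / 8) * (p.1 + p.2)) := by ring_nf
    simp only [Pi.add_apply]
    nlinarith

lemma abs_integral_coprimeHarmonic_sub_le (κ : ℕ) {q : ℕ} (hq : q ≠ 0) {x₀ : ℝ} (hx : 0 < x₀) :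
    |(∫ p : ℝ × ℝ, planeKernel (κ / 2 + 1 / 4) p *
        coprimeHarmonic q (x₀ * exp ((p.1 + p.2) / 4))) - q.totient / q * log x₀| ≤
      q.totient / q * (2 * √(log q) + 2 + kernelMoment κ) +
        3 * q.divisors.card * x₀ ^ (-(1 / 2) : ℝ) * kernelMoment κ := by
  have hα : (0 : ℝ) < κ / 2 + 1 / 4 := by positivity
  set c : ℝ := q.totient / q with hc
  have hc0 : 0 ≤ c := by positivity
  set A : ℝ := c * (2 * √(log q) + 2) with hA
  set D : ℝ := c + 3 * q.divisors.card * x₀ ^ (-(1 / 2) : ℝ) with hD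
  have hKi := integrable_planeKernel hα
  have hb : ∀ p : ℝ × ℝ, |planeKernel (κ / 2 + 1 / 4) p *
      (coprimeHarmonic q (x₀ * exp ((p.1 + p.2) / 4)) - c * log x₀)| ≤
      A * planeKernel (κ / 2 + 1 / 4) p + D * (planeKernel (κ / 2 + 1 / 4) p *
        (exp (-(p.1 + p.2) / 8) + |p.1 + p.2|)) := by
    intro p
    have hK := planeKernel_nonneg (κ / 2 + 1 / 4) p
    rw [abs_mul, abs_of_nonneg hK]
    have h1 := abs_coprimeHarmonic_sub_le hq (show 0 < x₀ * exp ((p.1 + p.2) / 4) by positivity)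
    rw [log_mul hx.ne' (exp_ne_zero _), log_exp, mul_rpow hx.le (exp_nonneg _), ← exp_mul] at h1
    have h2 : exp ((p.1 + p.2) / 4 * -(1 / 2)) = exp (-(p.1 + p.2) / 8) := by ring_nf
    rw [h2] at h1
    have h3 : |coprimeHarmonic q (x₀ * exp ((p.1 + p.2) / 4)) - c * log x₀| ≤
        A + D * (exp (-(p.1 + p.2) / 8) + |p.1 + p.2|) := by
      have h4 : |c * ((p.1 + p.2) / 4)| ≤ c * |p.1 + p.2| := by
        rw [abs_mul, abs_of_nonneg hc0, abs_div, abs_of_pos (four_pos (α := ℝ))]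
        bound
      have h5 := abs_add_le (coprimeHarmonic q (x₀ * exp ((p.1 + p.2) / 4)) -
        c * (log x₀ + (p.1 + p.2) / 4)) (c * ((p.1 + p.2) / 4))
      have h6 : coprimeHarmonic q (x₀ * exp ((p.1 + p.2) / 4)) -
        c * (log x₀ + (p.1 + p.2) / 4) + c * ((p.1 + p.2) / 4) =
        coprimeHarmonic q (x₀ * exp ((p.1 + p.2) / 4)) - c * log x₀ := by ring
      rw [h6] at h5
      have h7 : 0 ≤ c * exp (-(p.1 + p.2) / 8) := by positivity
      have h8 : 0 ≤ 3 * (q.divisors.card : ℝ) * x₀ ^ (-(1 / 2) : ℝ) * |p.1 + p.2| := by positivity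
      linarith
    nlinarith
  have hbi : Integrable fun p : ℝ × ℝ => A * planeKernel (κ / 2 + 1 / 4) p +
      D * (planeKernel (κ / 2 + 1 / 4) p * (exp (-(p.1 + p.2) / 8) + |p.1 + p.2|)) :=
    (hKi.const_mul _).add ((integrable_kernelMoment κ).const_mul _)
  have hdi : Integrable fun p : ℝ × ℝ => planeKernel (κ / 2 + 1 / 4) p *
      (coprimeHarmonic q (x₀ * exp ((p.1 + p.2) / 4)) - c * log x₀) := by
    refine hbi.mono' (hKi.aestronglyMeasurable.mul ?_) (.of_forall hb)
    exact (((measurable_coprimeHarmonic q).comp (by fun_prop)).sub_const _).aestronglyMeasurable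
  have hsplit : ∫ p : ℝ × ℝ, planeKernel (κ / 2 + 1 / 4) p *
        coprimeHarmonic q (x₀ * exp ((p.1 + p.2) / 4)) =
      (∫ p : ℝ × ℝ, planeKernel (κ / 2 + 1 / 4) p *
      (coprimeHarmonic q (x₀ * exp ((p.1 + p.2) / 4)) - c * log x₀)) +
      c * log x₀ := by
    have h1 : c * log x₀ = ∫ p : ℝ × ℝ, planeKernel (κ / 2 + 1 / 4) p * (c * log x₀) := by
      rw [integral_mul_const, integral_planeKernel hα, one_mul]
    refine Eq.trans ?_ (congrArg (_ + ·) h1.symm)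
    rw [← integral_add hdi (hKi.mul_const _)]
    grind
  rw [hsplit, add_sub_cancel_right]
  rw [← norm_eq_abs]
  refine (norm_integral_le_of_norm_le hbi (.of_forall hb)).trans (le_of_eq ?_)
  rw [integral_add (hKi.const_mul _) ((integrable_kernelMoment κ).const_mul _),
    integral_const_mul, integral_const_mul, integral_planeKernel hα, ← kernelMoment, hA, hD]
  ring

/-- The diagonal contribution is asymptotically `φ(q)/q * log q * (h,k)/√(hk)`. -/
lemma exists_diagonal_le : ∃ C : ℝ, 0 < C ∧ ∀ (q h k H : ℕ), q ≠ 0 → q ≠ 1 → h.Coprime q →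
    k.Coprime q → h ≤ H → k ≤ H →
    |∑ κ ∈ Finset.range 2, diagonal κ q h k - (Nat.gcd h k / √(h * k)) * (q.totient / q * log q)| ≤
      (Nat.gcd h k / √(h * k)) * (C * (q.totient / q * (√(log q) + 1 + log H) +
        q.divisors.card * (H : ℝ) ^ (1 / 2 : ℝ) * (q : ℝ) ^ (-(1 / 4) : ℝ))) := by
  set M := kernelMoment 0 + kernelMoment 1 with hM
  have hMκ : ∀ κ, 0 ≤ kernelMoment κ := fun κ => integral_nonneg fun p =>
    mul_nonneg (planeKernel_nonneg _ _) (by positivity)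
  have hM0 : 0 ≤ M := by grind
  refine ⟨12 * (M + 1), by positivity, ?_⟩
  intro q h k H hq0 hq hhq hkq hhH hkH
  have hh : h ≠ 0 := by grind
  have hk : k ≠ 0 := by grind
  obtain ⟨a, b, hab, ha, hb⟩ := Nat.exists_coprime h k
  have hg : Nat.gcd h k ≠ 0 := by lia
  generalize Nat.gcd h k = g at ha hb hg ⊢
  rw [mul_comm] at ha hb
  subst ha hb
  have ha := right_ne_zero_of_mul hh
  have hb := right_ne_zero_of_mul hk
  have ha1 : (1 : ℝ) ≤ a := mod_cast Nat.pos_of_ne_zero ha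
  have hb1 : (1 : ℝ) ≤ b := mod_cast Nat.pos_of_ne_zero hb
  have hg1 : (1 : ℝ) ≤ g := mod_cast Nat.pos_of_ne_zero hg
  have haH : (a : ℝ) ≤ H := by
    exact_mod_cast (Nat.le_mul_of_pos_left a (Nat.pos_of_ne_zero hg)).trans hhH
  have hbH : (b : ℝ) ≤ H := by
    exact_mod_cast (Nat.le_mul_of_pos_left b (Nat.pos_of_ne_zero hg)).trans hkH
  have hx : (0 : ℝ) < q := by positivity
  have hN1 : (1 : ℝ) ≤ a * b := by nlinarith
  have hNH : (a * b : ℝ) ≤ (H : ℝ) ^ 2 := by nlinarith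
  have hw : (g : ℝ) / √((g * a : ℕ) * (g * b : ℕ)) = (√(a * b))⁻¹ := by
    push_cast
    rw [show (g * a * (g * b) : ℝ) = g ^ 2 * (a * b) by ring, sqrt_mul (by positivity),
      sqrt_sq (by positivity)]
    field_simp
  rw [hw, sum_congr rfl fun κ _ => diagonal_eq_integral κ hq0 hq hg ha hb hab
    hhq.coprime_mul_left hkq.coprime_mul_left, ← mul_sum, ← mul_sub, abs_mul,
    abs_of_nonneg (inv_nonneg.mpr (sqrt_nonneg _))]
  refine mul_le_mul_of_nonneg_left ?_ (inv_nonneg.mpr (sqrt_nonneg _))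
  have hπ := pi_pos
  have hx₀ : 0 < √(q / (π * (a * b))) := by positivity
  have key := fun κ => abs_integral_coprimeHarmonic_sub_le κ hq0 hx₀
  -- Each of the two parities contributes half of `log q`; their sum is the full logarithm in the
  -- statement.
  have hlog : log (√(q / (π * (a * b)))) = log q / 2 - (log π + log (a * b)) / 2 := by
    rw [log_sqrt (by positivity), log_div hx.ne' (by positivity), log_mul hπ.ne' (by positivity)]
    ring
  have hpow : √(q / (π * (a * b))) ^ (-(1 / 2) : ℝ) ≤
      2 * ((H : ℝ) ^ (1 / 2 : ℝ) * (q : ℝ) ^ (-(1 / 4) : ℝ)) := by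
    rw [sqrt_eq_rpow, ← rpow_mul (by positivity),
      show (1 / 2 * -(1 / 2) : ℝ) = -(1 / 4) by norm_num, div_rpow hx.le (by positivity),
      rpow_neg (show (0 : ℝ) ≤ π * (a * b) by positivity), div_inv_eq_mul]
    suffices h4 : (π * (a * b)) ^ (1 / 4 : ℝ) ≤ 2 * (H : ℝ) ^ (1 / 2 : ℝ) by
      calc _ ≤ (q : ℝ) ^ (-(1 / 4) : ℝ) * (2 * (H : ℝ) ^ (1 / 2 : ℝ)) :=
            mul_le_mul_of_nonneg_left h4 (by positivity)
        _ = _ := by ring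
    calc (π * (a * b)) ^ (1 / 4 : ℝ) ≤ (2 ^ 4 * (H : ℝ) ^ 2) ^ (1 / 4 : ℝ) := by
          gcongr
          linarith [pi_le_four]
      _ = _ := by
          rw [mul_rpow (by positivity) (by positivity), ← rpow_natCast,
            ← rpow_mul (by positivity), ← rpow_natCast, ← rpow_mul (by positivity)]
          norm_num
  have hlπ0 : 0 ≤ log π := log_nonneg (by linarith [pi_gt_three])
  have hlπ : log π ≤ 3 := by linarith [log_le_sub_one_of_pos hπ, pi_le_four]
  have hlN0 : 0 ≤ log (a * b) := by bound
  have hlN : log (a * b) ≤ 2 * log H := by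
    have := log_le_log (by positivity) hNH
    rwa [log_pow] at this
  set c : ℝ := q.totient / q with hc
  have hc0 : 0 ≤ c := by positivity
  set P := (H : ℝ) ^ (1 / 2 : ℝ) * (q : ℝ) ^ (-(1 / 4) : ℝ) with hP
  have hP0 : 0 ≤ P := by positivity
  have hκ : ∀ κ ∈ Finset.range 2, |(∫ p : ℝ × ℝ, planeKernel (κ / 2 + 1 / 4) p *
        coprimeHarmonic q (√(q / (π * (a * b))) * exp ((p.1 + p.2) / 4))) -
        c * log q / 2| ≤ 6 * (M + 1) * (c * (√(log q) + 1 + log H) + q.divisors.card * P) := by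
    intro κ hκ
    have hMle : kernelMoment κ ≤ M := by
      have hκ2 := Finset.mem_range.mp hκ
      interval_cases κ
      · grind
      grind
    have h1 := key κ
    rw [hlog] at h1
    generalize (∫ p : ℝ × ℝ, planeKernel (κ / 2 + 1 / 4) p *
        coprimeHarmonic q (√(q / (π * (a * b))) * exp ((p.1 + p.2) / 4))) = I at h1 ⊢
    have h2 : |I - c * log q / 2| ≤ |I - c * (log q / 2 - (log π +
        log (a * b)) / 2)| + c * (2 + log H) := by
      have h3 := abs_add_le (I - c * (log q / 2 - (log π +
        log (a * b)) / 2)) (-(c * ((log π + log (a * b)) / 2)))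
      rw [abs_neg, abs_of_nonneg (a := c * _) (by positivity)] at h3
      have h4 : c * ((log π + log (a * b)) / 2) ≤ c * (2 + log H) :=
        by bound
      grind
    have h5 : 3 * (q.divisors.card : ℝ) * √(q / (π * (a * b))) ^ (-(1 / 2) : ℝ) *
        kernelMoment κ ≤ 3 * (q.divisors.card : ℝ) * (2 * P) * M := by bound
    have h6 : c * (2 * √(log q) + 2 + kernelMoment κ) ≤ c * (2 * √(log q) + 2 + M) := by gcongr
    have h7 : 0 ≤ c * √(log q) := by positivity
    have h8 : 0 ≤ c * log H := by positivity
    have h9 : 0 ≤ (q.divisors.card : ℝ) * P := by positivity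
    have h10 : 0 ≤ M * (c * √(log q)) := by positivity
    have h11 : 0 ≤ M * (c * log H) := by positivity
    have h12 : 0 ≤ M * c := by positivity
    linarith
  rw [Finset.sum_range_succ, Finset.sum_range_one]
  have k0 := hκ 0 (by simp)
  have k1 := hκ 1 (by simp)
  grind

end diagonalTerm

/-! ### Mertens' theorems. -/

section

open scoped ArithmeticFunction.zeta

/-- `∑_{n ≤ x} Λ(n)/n`. -/
def mangoldtSum (x : ℝ) : ℝ := ∑ n ∈ Finset.Icc 0 ⌊x⌋₊, Λ n / n

/-- `∑_{n ≤ x} Λ(n)/(n log n)`. -/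
def primePowerSum (x : ℝ) : ℝ := ∑ n ∈ Finset.Icc 0 ⌊x⌋₊, (log n)⁻¹ * (Λ n / n)

/-- Mertens' first theorem. In `log N! = ∑ Λ(n) ⌊N/n⌋`, dropping the integer parts costs at most
`ψ(N) = O(N)` by Chebyshev, and `log N! = N log N + O(N)`. -/
lemma exists_abs_mangoldtSum_sub_log_le :
    ∃ C, 0 < C ∧ ∀ x, 1 ≤ x → |mangoldtSum x - log x| ≤ C := by
  refine ⟨log 4 + 6, by positivity, fun x hx => ?_⟩
  set N := ⌊x⌋₊ with hN
  have hN1 : 1 ≤ N := by simp_all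
  have hN1' : (1 : ℝ) ≤ N := mod_cast hN1
  have hN0 : (0 : ℝ) < N := by linarith
  have hl0 : log N ≤ log x := log_le_log hN0 (Nat.floor_le (by linarith))
  have hl1 : log x ≤ log N + 1 := by
    have h1 : x ≤ 2 * N := by have := Nat.lt_floor_add_one x; linarith
    have h2 := log_le_log (by linarith) h1
    rw [log_mul two_ne_zero hN0.ne'] at h2
    linarith [log_two_lt_d9]
  have hIcc : Finset.Icc 0 N = insert 0 (Finset.Ioc 0 N) := by simp
  have hA : mangoldtSum x = ∑ n ∈ Finset.Ioc 0 N, Λ n / n := by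
    rw [mangoldtSum, hIcc, Finset.sum_insert (by simp)]; simp
  have hfac : log (N.factorial) = ∑ n ∈ Finset.Ioc 0 N, Λ n * ((N / n : ℕ) : ℝ) := by
    rw [← sum_Ioc_mul_zeta_eq_sum, vonMangoldt_mul_zeta, ← Finset.prod_range_add_one_eq_factorial,
      Nat.cast_prod, log_prod (fun i _ => by positivity)]
    refine Finset.sum_nbij (fun i => i + 1) ?_ ?_ ?_ ?_
    · simp
    · simp
    · intro n hn
      simp only [Finset.coe_Ioc, mem_Ioc] at hn
      exact ⟨n - 1, by grind, by lia⟩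
    simp
  have hψ : ∑ n ∈ Finset.Ioc 0 N, Λ n ≤ (log 4 + 4) * N := by
    have h1 := Chebyshev.psi_le_const_mul_self hN0.le
    rwa [Chebyshev.psi, Nat.floor_natCast] at h1
  have hup : log (N.factorial) ≤ N * log N := by
    rw [← log_pow]
    exact log_le_log (by positivity) (by exact_mod_cast N.factorial_le_pow)
  have hlow : N * log N - N ≤ log (N.factorial) := by
    have h1 := pow_div_factorial_le_exp (N : ℝ) hN0.le N
    have h2 := log_le_log (by positivity) h1
    rw [log_exp, log_div (by positivity) (by positivity), log_pow] at h2
    linarith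
  have hle : log (N.factorial) ≤ N * mangoldtSum x := by
    rw [hfac, hA, mul_sum]
    refine sum_le_sum fun n hn => ?_
    calc Λ n * ((N / n : ℕ) : ℝ) ≤ Λ n * ((N : ℝ) / n) :=
          mul_le_mul_of_nonneg_left Nat.cast_div_le vonMangoldt_nonneg
      _ = _ := by ring
  have hge : N * mangoldtSum x - (log 4 + 4) * N ≤ log (N.factorial) := by
    have h1 : N * mangoldtSum x - ∑ n ∈ Finset.Ioc 0 N, Λ n ≤ log (N.factorial) := by
      rw [hfac, hA, mul_sum, ← sum_sub_distrib]
      refine sum_le_sum fun n hn => ?_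
      have h2 : (N : ℝ) / n - 1 ≤ ((N / n : ℕ) : ℝ) := by
        rw [← Nat.floor_div_eq_div (K := ℝ)]
        linarith [Nat.lt_floor_add_one ((N : ℝ) / n)]
      calc _ = Λ n * ((N : ℝ) / n - 1) := by ring
        _ ≤ _ := mul_le_mul_of_nonneg_left h2 vonMangoldt_nonneg
    linarith
  have e1 : log N - 1 ≤ mangoldtSum x := by nlinarith
  have e2 : mangoldtSum x ≤ log N + (log 4 + 4) := by nlinarith
  have := log_pos (show (1 : ℝ) < 4 by norm_num)
  grind

lemma hasDerivAt_inv_log {t : ℝ} (ht : 1 < t) :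
    HasDerivAt (fun t => (log t)⁻¹) (-(t⁻¹ * (log t ^ 2)⁻¹)) t := by
  have hl := log_pos ht
  refine ((hasDerivAt_log (by linarith)).inv hl.ne').congr_deriv ?_
  ring

lemma integral_Ioi_inv_mul_inv_log_sq {x : ℝ} (hx : 1 < x) :
    IntegrableOn (fun t => t⁻¹ * (log t ^ 2)⁻¹) (Ioi x) ∧
    ∫ t in Ioi x, t⁻¹ * (log t ^ 2)⁻¹ = (log x)⁻¹ := by
  have hd : ∀ t ∈ Ici x, HasDerivAt (fun t => -(log t)⁻¹) (t⁻¹ * (log t ^ 2)⁻¹) t :=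
    fun t ht => (hasDerivAt_inv_log (hx.trans_le ht)).neg.congr_deriv (neg_neg _)
  have hpos : ∀ t ∈ Ioi x, 0 ≤ t⁻¹ * (log t ^ 2)⁻¹ := fun t ht => by
    have : 0 < t := by grind
    positivity
  have hlim : Tendsto (fun t => -(log t)⁻¹) atTop (𝓝 0) := by
    simpa using (tendsto_log_atTop.inv_tendsto_atTop).neg
  refine ⟨integrableOn_Ioi_deriv_of_nonneg' hd hpos hlim, ?_⟩
  rw [integral_Ioi_of_hasDerivAt_of_nonneg' hd hpos hlim]
  ring

/-- Mertens' second theorem for prime powers, with an unspecified constant. -/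
lemma exists_primePowerSum_asymp : ∃ c K : ℝ, ∀ x, 2 ≤ x →
    |primePowerSum x - log (log x) - c| ≤ K / log x := by
  obtain ⟨C, hC, hR⟩ := exists_abs_mangoldtSum_sub_log_le
  -- The error density left by Abel summation. It is `O(1/(t log² t))`: its full integral joins the
  -- constant, and the tail beyond `x` is `O(1/log x)`.
  set ρ : ℝ → ℝ := fun t => t⁻¹ * (log t ^ 2)⁻¹ * (mangoldtSum t - log t) with hρ
  have hmeas : Measurable mangoldtSum := by
    have h : Measurable fun n : ℕ => ∑ k ∈ Finset.Icc 0 n, Λ k / k := by fun_prop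
    exact h.comp Nat.measurable_floor
  have hρm : Measurable ρ := by fun_prop
  have hρb : ∀ x, 1 < x → ∀ t ∈ Ioi x, ‖ρ t‖ ≤ t⁻¹ * (log t ^ 2)⁻¹ * C := by
    intro x hx t ht
    have h1 : 1 < t := hx.trans ht
    rw [hρ, norm_mul, norm_of_nonneg (by positivity), norm_eq_abs]
    bound
  have hρi : ∀ x, 1 < x → IntegrableOn ρ (Ioi x) := fun x hx =>
    ((integral_Ioi_inv_mul_inv_log_sq hx).1.mul_const C).mono' hρm.aestronglyMeasurable
      ((ae_restrict_iff' measurableSet_Ioi).mpr (.of_forall (hρb x hx)))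
  have hρI : ∀ x, 1 < x → |∫ t in Ioi x, ρ t| ≤ C / log x := by
    intro x hx
    refine (norm_integral_le_of_norm_le ((integral_Ioi_inv_mul_inv_log_sq hx).1.mul_const C)
      ((ae_restrict_iff' measurableSet_Ioi).mpr (.of_forall (hρb x hx)))).trans ?_
    rw [integral_mul_const, (integral_Ioi_inv_mul_inv_log_sq hx).2]
    grind
  refine ⟨1 - log (log 2) + ∫ t in Ioi 2, ρ t, 2 * C, fun x hx => ?_⟩
  have hx1 : 1 < x := by linarith
  have hl := log_pos hx1
  have hcont : ContinuousOn (fun t => -(t⁻¹ * (log t ^ 2)⁻¹)) (Icc 2 x) := by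
    refine ContinuousOn.neg (ContinuousOn.mul (continuousOn_inv₀.mono fun t ht => ?_)
      (ContinuousOn.inv₀ ((continuousOn_log.mono fun t ht => ?_).pow 2) fun t ht => ?_))
    · grind
    · grind
    · exact pow_ne_zero 2 (log_pos (by grind)).ne'
  have hderiv : ∀ t ∈ Icc 2 x, deriv (fun t => (log t)⁻¹) t = -(t⁻¹ * (log t ^ 2)⁻¹) :=
    fun t ht => (hasDerivAt_inv_log (by grind)).deriv
  have habel := sum_mul_eq_sub_integral_mul₁ (fun n => Λ n / (n : ℝ)) (f := fun t => (log t)⁻¹)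
    (by simp) (by simp) x (fun t ht => (hasDerivAt_inv_log (by grind)).differentiableAt)
    ((integrableOn_congr_fun hderiv measurableSet_Icc).mpr hcont.integrableOn_Icc)
  have hintg : ∫ t in Ioc 2 x, deriv (fun t => (log t)⁻¹) t *
      ∑ k ∈ Finset.Icc 0 ⌊t⌋₊, Λ k / (k : ℝ) =
      -((log (log x) - log (log 2)) + ∫ t in Ioc 2 x, ρ t) := by
    have hd : ∀ t ∈ uIcc 2 x, HasDerivAt (fun t => log (log t)) (t⁻¹ / log t) t := fun t ht => by
      rw [uIcc_of_le hx] at ht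
      exact (hasDerivAt_log (by grind)).log (log_pos (by grind)).ne'
    have hci : IntervalIntegrable (fun t => t⁻¹ / log t) volume 2 x := by
      refine ContinuousOn.intervalIntegrable ?_
      rw [uIcc_of_le hx]
      refine ContinuousOn.div (continuousOn_inv₀.mono fun t ht => ?_)
        (continuousOn_log.mono fun t ht => ?_) fun t ht => ?_
      · grind
      · grind
      · exact (log_pos (by grind)).ne'
    have h1 := intervalIntegral.integral_eq_sub_of_hasDerivAt hd hci
    rw [intervalIntegral.integral_of_le hx] at h1
    rw [← h1, ← integral_add ((intervalIntegrable_iff_integrableOn_Ioc_of_le hx).mp hci)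
      ((hρi 2 one_lt_two).mono_set Ioc_subset_Ioi_self), ← integral_neg]
    refine setIntegral_congr_fun measurableSet_Ioc fun t ht => ?_
    simp only [hρ]
    rw [hderiv t ⟨ht.1.le, ht.2⟩, ← mangoldtSum]
    field_simp
    ring
  have hsplit : ∫ t in Ioc 2 x, ρ t = (∫ t in Ioi 2, ρ t) - ∫ t in Ioi x, ρ t := by
    rw [← Ioc_union_Ioi_eq_Ioi hx, setIntegral_union (Ioc_disjoint_Ioi le_rfl) measurableSet_Ioi
      ((hρi 2 one_lt_two).mono_set Ioc_subset_Ioi_self) (hρi x hx1)]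
    ring
  have hP : primePowerSum x - log (log x) - (1 - log (log 2) + ∫ t in Ioi 2, ρ t) =
      (mangoldtSum x - log x) / log x - ∫ t in Ioi x, ρ t := by
    rw [primePowerSum, habel, hintg, hsplit, ← mangoldtSum]
    field_simp
    ring
  rw [hP]
  refine (abs_sub _ _).trans ?_
  rw [abs_div, abs_of_pos hl, two_mul, add_div]
  bound

/-- This integral is `Γ'(1)`, and it is what identifies the constant in Mertens' theorem as Euler's.
-/
lemma integral_exp_neg_mul_log :
    ∫ v in Ioi (0 : ℝ), exp (-v) * log v = -eulerMascheroniConstant := by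
  have h1 := Complex.hasDerivAt_GammaIntegral (s := 1) (by simp)
  have h2 : HasDerivAt Complex.Gamma _ 1 := h1.congr_of_eventuallyEq (by
    have : {s : ℂ | 0 < s.re} ∈ 𝓝 (1 : ℂ) :=
      (isOpen_lt continuous_const continuous_re).mem_nhds (by simp)
    filter_upwards [this] with s hs using Complex.Gamma_eq_integral hs)
  have h3 := h2.unique Complex.hasDerivAt_Gamma_one
  simp only [sub_self, Complex.cpow_zero, one_mul] at h3
  have h4 : ∫ v in Ioi (0 : ℝ), (log v : ℂ) * (exp (-v) : ℂ) =
      ((∫ v in Ioi (0 : ℝ), exp (-v) * log v : ℝ) : ℂ) := by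
    rw [← integral_complex_ofReal]
    refine integral_congr_ae (.of_forall fun v => ?_)
    push_cast
    ring
  rw [h4] at h3
  exact_mod_cast h3

lemma integrableOn_exp_neg_mul_abs_log :
    IntegrableOn (fun v : ℝ => exp (-v) * |log v|) (Ioi 0) := by
  have h1 := GammaIntegral_convergent (s := 1 / 2) (by norm_num)
  have h2 := GammaIntegral_convergent (s := 2) (by norm_num)
  refine ((h1.const_mul 2).add h2).mono' (by fun_prop)
    ((ae_restrict_iff' measurableSet_Ioi).mpr (.of_forall fun v hv => ?_))
  have hv0 : 0 < v := hv
  rw [norm_of_nonneg (by positivity)]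
  have e1 := log_le_sub_one_of_pos hv0
  have e2 := log_le_sub_one_of_pos (show 0 < v ^ (1 / 2 - 1 : ℝ) by positivity)
  rw [log_rpow hv0] at e2
  have e3 : 0 < v ^ (1 / 2 - 1 : ℝ) := by positivity
  have e4 : |log v| ≤ 2 * v ^ (1 / 2 - 1 : ℝ) + v := by grind
  simp only [Pi.add_apply]
  rw [show (2 : ℝ) - 1 = 1 by norm_num, rpow_one]
  calc _ ≤ exp (-v) * (2 * v ^ (1 / 2 - 1 : ℝ) + v) := by gcongr
    _ = _ := by ring

end

lemma primePowerSum_eq_zero {x : ℝ} (hx : x < 2) : primePowerSum x = 0 := by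
  refine sum_eq_zero fun n hn => ?_
  have h : ⌊x⌋₊ ≤ 1 := by
    by_contra! h
    have := (Nat.le_floor_iff' (by norm_num : (2 : ℕ) ≠ 0)).mp h
    grind
  have hn1 : n ≤ 1 := by grind
  interval_cases n <;> simp

lemma measurable_primePowerSum : Measurable primePowerSum :=
  (measurable_from_nat (f := fun N : ℕ => ∑ n ∈ Finset.Icc 0 N,
    (log n)⁻¹ * (Λ n / n))).comp Nat.measurable_floor

lemma LSeries_eq_mul_integral_primePowerSum {s : ℝ} (hs : 0 < s) :
    LSeries (fun n => (Λ n : ℂ) / log n) (1 + s) =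
      ((s * ∫ t in Ioi (1 : ℝ), primePowerSum t * t ^ (-(s + 1)) : ℝ) : ℂ) := by
  set f : ℕ → ℝ := fun n => (log n)⁻¹ * (Λ n / n) with hf
  have hf0 : ∀ n, 0 ≤ f n := fun n => by positivity
  have hO : (fun n : ℕ => ∑ k ∈ Finset.Icc 1 n, f k) =O[atTop] fun n => (n : ℝ) ^ (s / 2) := by
    have h1 : (fun n : ℕ => ∑ k ∈ Finset.Icc 1 n, f k) =O[atTop] fun n : ℕ => 1 + log n := by
      refine IsBigO.of_bound 1 (.of_forall fun n => ?_)
      rw [norm_of_nonneg (sum_nonneg fun k _ => hf0 k), one_mul]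
      refine le_trans ?_ (le_abs_self _)
      refine le_trans ?_ (harmonic_le_one_add_log n)
      rw [harmonic_eq_sum_Icc]
      push_cast
      refine sum_le_sum fun k hk => ?_
      have hk1 : 1 ≤ k := by grind
      rcases hk1.eq_or_lt with rfl | hk1
      · simp [hf]
      have hl : 0 < log k := log_pos (by simp_all)
      simp only [hf]
      calc _ ≤ (log k)⁻¹ * (log k / k) := by gcongr; exact vonMangoldt_le_log
        _ = _ := by field_simp
    refine h1.trans (IsBigO.add ?_ ?_)
    · refine IsBigO.of_bound 1 ?_
      filter_upwards [eventually_ge_atTop 1] with n hn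
      rw [norm_one, one_mul]
      exact (one_le_rpow (by simp_all) (by positivity)).trans (le_abs_self _)
    · exact ((isLittleO_log_rpow_atTop (by positivity)).comp_tendsto
        tendsto_natCast_atTop_atTop).isBigO
  have h := LSeries_eq_mul_integral_of_nonneg f (s := (s : ℂ)) (by positivity)
    (by simp_all) hO hf0
  have hL : LSeries (fun n => (Λ n : ℂ) / log n) (1 + s) = LSeries (fun n => (f n : ℂ)) s := by
    refine tsum_congr fun n => ?_
    rcases eq_or_ne n 0 with rfl | hn
    · simp
    have hn' : (n : ℂ) ≠ 0 := mod_cast hn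
    rw [term_of_ne_zero hn, term_of_ne_zero hn, Complex.cpow_add _ _ hn', Complex.cpow_one, hf]
    push_cast
    ring
  rw [hL, h, ofReal_mul, ← integral_complex_ofReal]
  congr 1
  refine setIntegral_congr_fun measurableSet_Ioi fun t ht => ?_
  have ht0 : (0 : ℝ) ≤ t := by grind
  rw [ofReal_mul, ofReal_cpow ht0, primePowerSum]
  have hI : Finset.Icc 0 ⌊t⌋₊ = insert 0 (Finset.Icc 1 ⌊t⌋₊) := by grind
  simp_all

lemma riemannZeta_eq_exp_integral_primePowerSum {s : ℝ} (hs : 0 < s) : riemannZeta (1 + s) =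
      exp (∫ v in Ioi (0 : ℝ), exp (-v) * primePowerSum (exp (v / s))) := by
  rw [← riemannZeta_eq_exp_LSeries (by simp_all), LSeries_eq_mul_integral_primePowerSum hs,
    ← Complex.ofReal_exp]
  congr 2
  have h1 := integral_comp_exp_Ioi (fun t => primePowerSum t * t ^ (-(s + 1))) 0
  rw [exp_zero] at h1
  have h2 := integral_comp_mul_left_Ioi (fun x => exp x • (primePowerSum (exp x) *
    exp x ^ (-(s + 1)))) 0 (inv_pos.mpr hs)
  rw [mul_zero, inv_inv, h1, smul_eq_mul] at h2
  rw [← h2]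
  refine setIntegral_congr_fun measurableSet_Ioi fun v _ => ?_
  simp only [smul_eq_mul]
  rw [show v / s = s⁻¹ * v by ring, ← exp_mul, mul_comm (primePowerSum _), ← mul_assoc, ← exp_add]
  grind

/-- Mertens' second theorem for prime powers: the constant is Euler's. -/
theorem tendsto_primePowerSum_sub_log_log : Tendsto (fun x => primePowerSum x - log (log x)) atTop
      (𝓝 eulerMascheroniConstant) := by
  obtain ⟨c, K, hK⟩ := exists_primePowerSum_asymp
  have hlim : Tendsto (fun x => primePowerSum x - log (log x)) atTop (𝓝 c) := by
    rw [tendsto_iff_norm_sub_tendsto_zero]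
    refine squeeze_zero' (.of_forall fun _ => norm_nonneg _)
      ((eventually_ge_atTop 2).mono fun x hx => hK x hx)
      (tendsto_const_nhds.div_atTop tendsto_log_atTop)
  set J : ℝ → ℝ := fun s => ∫ v in Ioi (0 : ℝ), exp (-v) * primePowerSum (exp (v / s))
  -- `J s = log ζ(1 + s)`, and `s ζ(1 + s) → 1`.
  have hJ0 : Tendsto (fun s => J s + log s) (𝓝[>] 0) (𝓝 0) := by
    have h1 : Tendsto (fun s : ℝ => (1 + s : ℂ)) (𝓝[>] 0) (𝓝[≠] 1) := by
      refine tendsto_nhdsWithin_iff.mpr ⟨?_, ?_⟩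
      · have : Tendsto (fun s : ℝ => (1 + s : ℂ)) (𝓝 0) (𝓝 (1 + ((0 : ℝ) : ℂ))) :=
          Continuous.tendsto (by fun_prop) 0
        simpa using this.mono_left nhdsWithin_le_nhds
      · filter_upwards [self_mem_nhdsWithin] with s hs
        simpa using (ne_of_gt hs : s ≠ 0)
    have h2 := continuous_re.continuousAt.tendsto.comp (riemannZeta_residue_one.comp h1)
    have h3 : Tendsto (fun s => exp (J s + log s)) (𝓝[>] 0) (𝓝 1) := by
      refine h2.congr' ?_
      filter_upwards [self_mem_nhdsWithin] with s hs
      have hs0 : 0 < s := hs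
      simp only [Function.comp_apply]
      rw [riemannZeta_eq_exp_integral_primePowerSum hs0, add_sub_cancel_left, ← ofReal_mul,
        ofReal_re, exp_add, exp_log hs0, mul_comm]
    have h4 := (continuousAt_log one_ne_zero).tendsto.comp h3
    rw [log_one] at h4
    exact h4.congr fun s => by simp
  -- The same limit by dominated convergence: `primePowerSum (e^{v/s}) + log s → c + log v`. Since
  -- `∫ e^{-v} (c + log v) = c - γ`, comparison of the two limits gives `c = γ`.
  have hJc : Tendsto (fun s => J s + log s) (𝓝[>] 0)
      (𝓝 (∫ v in Ioi (0 : ℝ), exp (-v) * (c + log v))) := by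
    have hexp : IntegrableOn (fun v : ℝ => exp (-v)) (Ioi 0) := integrableOn_exp_neg_Ioi 0
    have hbint : IntegrableOn (fun v => exp (-v) * |log v| +
        exp (-v) * (|c| + |K| / log 2)) (Ioi 0) :=
      integrableOn_exp_neg_mul_abs_log.add (hexp.mul_const _)
    have hb : ∀ s : ℝ, 0 < s → s < 1 → ∀ v ∈ Ioi (0 : ℝ),
        ‖exp (-v) * (primePowerSum (exp (v / s)) + log s)‖ ≤
        exp (-v) * |log v| + exp (-v) * (|c| + |K| / log 2) := by
      intro s hs0 hs1 v hv
      have hv0 : 0 < v := hv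
      rw [norm_mul, norm_of_nonneg (exp_pos _).le, ← mul_add]
      refine mul_le_mul_of_nonneg_left ?_ (exp_pos _).le
      have hl2 := log_pos one_lt_two
      rcases le_or_gt (log 2) (v / s) with h | h
      · have hx : 2 ≤ exp (v / s) := (log_le_iff_le_exp two_pos).mp h
        have h1 := hK _ hx
        rw [log_exp, log_div hv0.ne' hs0.ne'] at h1
        have h2 : K / (v / s) ≤ |K| / log 2 :=
          by bound
        rw [norm_eq_abs]
        calc _ = |(primePowerSum (exp (v / s)) - (log v - log s) - c) +
              (log v + c)| := by ring_nf
          _ ≤ _ := (abs_add_le _ _).trans (add_le_add (h1.trans h2) (abs_add_le _ _))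
          _ = _ := by ring
      · rw [primePowerSum_eq_zero ((lt_log_iff_exp_lt two_pos).mp h), zero_add, norm_eq_abs]
        have h1 : v < s := by
          rw [div_lt_iff₀ hs0] at h
          nlinarith [log_two_lt_d9]
        have h2 := log_lt_log hv0 h1
        have h3 := log_neg hs0 hs1
        rw [abs_of_neg h3, abs_of_neg (h2.trans h3)]
        have : 0 ≤ |c| + |K| / log 2 := by positivity
        linarith
    have hmeas : ∀ s : ℝ, AEStronglyMeasurable (fun v => exp (-v) *
        (primePowerSum (exp (v / s)) + log s)) (volume.restrict (Ioi 0)) := fun s => by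
      have := measurable_primePowerSum
      fun_prop
    have hev : ∀ᶠ s : ℝ in 𝓝[>] 0, s < 1 := nhdsWithin_le_nhds (Iio_mem_nhds one_pos)
    have hdct := tendsto_integral_filter_of_dominated_convergence (l := 𝓝[>] (0 : ℝ))
      (F := fun s v => exp (-v) * (primePowerSum (exp (v / s)) + log s))
      (f := fun v => exp (-v) * (c + log v)) (μ := volume.restrict (Ioi 0)) _
      (.of_forall hmeas)
      (by filter_upwards [self_mem_nhdsWithin, hev] with s hs hs1
          exact (ae_restrict_iff' measurableSet_Ioi).mpr (.of_forall (hb s hs hs1)))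
      hbint
      ((ae_restrict_iff' measurableSet_Ioi).mpr (.of_forall fun v hv => by
        have hv0 : 0 < v := hv
        have h1 : Tendsto (fun s : ℝ => exp (v / s)) (𝓝[>] 0) atTop :=
          tendsto_exp_atTop.comp (tendsto_inv_nhdsGT_zero.const_mul_atTop hv0)
        refine Tendsto.const_mul _ ?_
        refine ((hlim.comp h1).add_const (log v)).congr' ?_
        filter_upwards [self_mem_nhdsWithin] with s hs
        simp only [Function.comp_apply]
        rw [log_exp, log_div hv0.ne' (ne_of_gt hs)]
        ring))
    refine hdct.congr' ?_
    filter_upwards [self_mem_nhdsWithin, hev] with s hs hs1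
    have hi : IntegrableOn (fun v => exp (-v) * (primePowerSum (exp (v / s)) + log s)) (Ioi 0) :=
      hbint.mono' (hmeas s)
        ((ae_restrict_iff' measurableSet_Ioi).mpr (.of_forall (hb s hs hs1)))
    have he := integral_sub hi (hexp.mul_const (log s))
    rw [integral_mul_const, integral_exp_neg_Ioi_zero, one_mul] at he
    rw [← sub_eq_iff_eq_add, ← he]
    grind
  have hval : ∫ v in Ioi (0 : ℝ), exp (-v) * (c + log v) = c - eulerMascheroniConstant := by
    have hexp : IntegrableOn (fun v : ℝ => exp (-v)) (Ioi 0) := integrableOn_exp_neg_Ioi 0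
    have hlog : IntegrableOn (fun v : ℝ => exp (-v) * log v) (Ioi 0) := by
      refine Integrable.mono integrableOn_exp_neg_mul_abs_log (by fun_prop) (.of_forall fun v => ?_)
      simp
    have h := integral_add (hexp.mul_const c) hlog
    rw [integral_mul_const, integral_exp_neg_Ioi_zero, one_mul, integral_exp_neg_mul_log] at h
    grind
  have hc := tendsto_nhds_unique hJc hJ0
  grind

/-! ### Dirichlet series over integers with prescribed prime factors. -/

lemma hasSum_factoredNumbers (s : Finset ℕ) {σ : ℝ} (hσ : 0 < σ) :
    HasSum ((factoredNumbers s).indicator fun n => (n : ℝ) ^ (-σ))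
      (∏ p ∈ s with p.Prime, (1 - (p : ℝ) ^ (-σ))⁻¹) := by
  let f : ℕ →* ℝ :=
    { toFun := fun n => (n : ℝ) ^ (-σ)
      map_one' := by simp
      map_mul' := fun a b => by
        push_cast; exact mul_rpow (cast_nonneg a) (cast_nonneg b) }
  have h := (EulerProduct.summable_and_hasSum_factoredNumbers_prod_filter_prime_geometric (f := f)
    (fun {p} hp => ?_) s).2
  · exact (hasSum_subtype_iff_indicator (f := fun n : ℕ => (n : ℝ) ^ (-σ))).mp h
  · have hf : ‖f p‖ = (p : ℝ) ^ (-σ) := norm_of_nonneg (show (0 : ℝ) ≤ (p : ℝ) ^ (-σ) by positivity)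
    rw [hf]
    exact rpow_lt_one_of_one_lt_of_neg (by exact_mod_cast hp.one_lt) (by linarith)

/-- Integers composed of primes in `s` are closed under products and divisors, so restricting the
coefficients is the same as restricting the weight in the exponent. -/
lemma indicator_expCoeff (s : Finset ℕ) (g : ℕ → ℝ) :
    (factoredNumbers s).indicator (expCoeff g) = expCoeff ((factoredNumbers s).indicator g) := by
  have h1 : 1 ∈ factoredNumbers s := by simp [Nat.mem_factoredNumbers]
  refine log_mul_induction (fun n => ?_) ?_ ?_
  · rcases eq_or_ne n 0 with rfl | hn
    · simp
    by_cases hM : n ∈ factoredNumbers s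
    · rw [indicator_of_mem hM, log_mul_expCoeff]
      refine sum_congr rfl fun p hp => ?_
      have hp' := (mem_divisorsAntidiagonal.mp hp).1
      rw [indicator_of_mem (mem_factoredNumbers_of_dvd hM (hp' ▸ dvd_mul_right _ _)),
        indicator_of_mem (mem_factoredNumbers_of_dvd hM (hp' ▸ dvd_mul_left _ _))]
    · rw [indicator_of_notMem hM, mul_zero]
      refine (sum_eq_zero fun p hp => ?_).symm
      have hp' := (mem_divisorsAntidiagonal.mp hp).1
      by_cases h1 : p.1 ∈ factoredNumbers s
      · by_cases h2 : p.2 ∈ factoredNumbers s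
        · exact absurd (hp' ▸ Nat.mul_mem_factoredNumbers h1 h2) hM
        simp_all
      simp_all
  · simp [expCoeff_zero]
  · rw [indicator_of_mem h1, expCoeff_one]

lemma abscissaOfAbsConv_le_zero_of_factoredNumbers (s : Finset ℕ) {f : ℕ → ℂ}
    (hf : ∀ n, ‖f n‖ ≤ (factoredNumbers s).indicator (fun _ => (1 : ℝ)) n) :
    abscissaOfAbsConv f ≤ (0 : ℝ) := by
  refine abscissaOfAbsConv_le_of_forall_lt_LSeriesSummable fun y hy => ?_
  refine Summable.of_norm_bounded (hasSum_factoredNumbers s hy).summable fun n => ?_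
  rcases eq_or_ne n 0 with rfl | hn
  · rw [term_zero, norm_zero]
    exact indicator_nonneg (fun _ _ => by positivity) _
  rw [norm_term_eq, if_neg hn, ofReal_re]
  have h1 := hf n
  by_cases hM : n ∈ factoredNumbers s
  · rw [indicator_of_mem hM] at h1 ⊢
    rw [rpow_neg (cast_nonneg n), ← one_div]
    gcongr
  simp_all

lemma abs_vonMangoldt_mul_div_log_le {g : ℕ → ℝ} (hg : ∀ n, |g n| ≤ 1) (n : ℕ) :
    |Λ n * g n / log n| ≤ 1 := by
  rw [abs_div, abs_mul, abs_of_nonneg vonMangoldt_nonneg, abs_of_nonneg (log_natCast_nonneg n)]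
  refine div_le_one_of_le₀ ?_ (log_natCast_nonneg n)
  calc _ ≤ log n * 1 := mul_le_mul vonMangoldt_le_log (hg n) (abs_nonneg _)
        (log_natCast_nonneg n)
    _ = _ := mul_one _

/-- With finitely many primes involved, both series converge absolutely for `Re z > 0`, so the
identity may be used at `z = 1/2` and not only beyond 1. -/
lemma LSeries_indicator_expCoeff {N : ℕ} (χ : DirichletCharacter ℂ N) (s : Finset ℕ) {g : ℕ → ℝ}
    (hg : ∀ n, |g n| ≤ 1) {z : ℂ} (hz : 0 < z.re) :
    LSeries (fun n => (((factoredNumbers s).indicator (expCoeff g) n : ℝ) : ℂ) * χ n) z =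
      cexp (LSeries (fun n =>
        ((Λ n * (factoredNumbers s).indicator g n / log n : ℝ) : ℂ) * χ n) z) := by
  have hb : ∀ {f : ℕ → ℝ}, (∀ n, |f n| ≤ 1) → (∀ n ∉ factoredNumbers s, f n = 0) →
      abscissaOfAbsConv (fun n => (f n : ℂ) * χ n) < z.re := fun {f} h1 h2 => by
    refine (abscissaOfAbsConv_le_zero_of_factoredNumbers s fun n => ?_).trans_lt
      (by positivity)
    by_cases hM : n ∈ factoredNumbers s
    · rw [indicator_of_mem hM, norm_mul, norm_real]
      exact mul_le_one₀ (h1 n) (norm_nonneg _) (χ.norm_le_one n)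
    simp_all
  have hg' : ∀ n, |(factoredNumbers s).indicator g n| ≤ 1 := fun n => by
    by_cases hM : n ∈ factoredNumbers s
    · simp_all
    simp_all
  rw [indicator_expCoeff]
  refine LSeries_expCoeff_mul χ _ (hb (abs_expCoeff_le_one hg') fun n hn => ?_)
    (hb (abs_vonMangoldt_mul_div_log_le hg') fun n hn => ?_)
  · rw [← indicator_expCoeff, indicator_of_notMem hn]
  simp_all

lemma LSeries_ofReal_one {f : ℕ → ℝ} :
    LSeries (fun n => (f n : ℂ)) 1 = ((∑' n, f n / n : ℝ) : ℂ) := by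
  rw [Complex.ofReal_tsum, LSeries]
  refine tsum_congr fun n => ?_
  rcases eq_or_ne n 0 with rfl | hn
  · simp
  simp_all

lemma tsum_indicator_expCoeff_div (s : Finset ℕ) {g : ℕ → ℝ} (hg : ∀ n, |g n| ≤ 1) :
    ∑' n : ℕ, (factoredNumbers s).indicator (expCoeff g) n / n =
      exp (∑' n : ℕ, Λ n * (factoredNumbers s).indicator g n / log n / n) := by
  have h := LSeries_indicator_expCoeff (1 : DirichletCharacter ℂ 1) s hg (z := 1) (by simp)
  simp only [MulChar.one_apply (isUnit_of_subsingleton _), mul_one] at h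
  rw [LSeries_ofReal_one, LSeries_ofReal_one, ← Complex.ofReal_exp] at h
  exact_mod_cast h

/-- The terms `Λ(n)/n` at the proper prime powers. -/
def properPowerTerm (n : ℕ) : ℝ := {n : ℕ | ¬ n.Prime}.indicator (fun n => Λ n / n) n

lemma properPowerTerm_nonneg (n : ℕ) : 0 ≤ properPowerTerm n :=
  indicator_nonneg (fun n _ => div_nonneg vonMangoldt_nonneg (cast_nonneg n)) _

lemma summable_properPowerTerm : Summable properPowerTerm := by
  refine (vonMangoldt.summable_residueClass_non_primes_div (q := 1) (a := 0)).congr fun n => ?_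
  by_cases hp : n.Prime
  · simp [properPowerTerm, hp]
  · simp [properPowerTerm, hp, Subsingleton.elim (n : ZMod 1) 0]

/-- `∑_{n > x} Λ(n)/n` over the proper prime powers. -/
def properPowerTail (x : ℝ) : ℝ := ∑' n : ℕ, {n : ℕ | x < n}.indicator properPowerTerm n

lemma tendsto_properPowerTail : Tendsto properPowerTail atTop (𝓝 0) := by
  have h := tendsto_tsum_of_dominated_convergence (𝓕 := (atTop : Filter ℝ))
    (f := fun x n => {n : ℕ | x < n}.indicator properPowerTerm n) (g := fun _ => (0 : ℝ))
    summable_properPowerTerm (fun n => ?_) (.of_forall fun x n => ?_)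
  · rwa [tsum_zero] at h
  · refine tendsto_const_nhds.congr' ?_
    filter_upwards [eventually_ge_atTop (n : ℝ)] with x hx
    simp_all
  · exact (norm_indicator_le_norm_self _ _).trans (norm_of_nonneg (properPowerTerm_nonneg n)).le

lemma vonMangoldt_div_log_div_le {n : ℕ} (hn : 3 ≤ n) (hp : ¬ n.Prime) :
    Λ n / log n / n ≤ properPowerTerm n := by
  rw [properPowerTerm, indicator_of_mem (show n ∈ {n : ℕ | ¬ n.Prime} from hp)]
  refine div_le_div_of_nonneg_right (div_le_self vonMangoldt_nonneg ?_) (cast_nonneg n)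
  rw [le_log_iff_exp_le (by positivity)]
  have : (3 : ℝ) ≤ n := mod_cast hn
  linarith [exp_one_lt_d9]

/-- `∏_{p ≤ x} (1 - 1/p)`. -/
def mertensProduct (x : ℝ) : ℝ := ∏ p ∈ Finset.Icc 0 ⌊x⌋₊ with p.Prime, (1 - 1 / (p : ℝ))

lemma one_sub_inv_prime_pos {p : ℕ} (hp : p.Prime) : 0 < 1 - 1 / (p : ℝ) := by
  have : (1 : ℝ) < p := mod_cast hp.one_lt
  bound

lemma mertensProduct_pos (x : ℝ) : 0 < mertensProduct x :=
  prod_pos fun _ hp => one_sub_inv_prime_pos (mem_filter.mp hp).2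

lemma tsum_factoredNumbers_div (s : Finset ℕ) :
    HasSum (fun n : ℕ => (factoredNumbers s).indicator (fun _ => (1 : ℝ)) n / n)
      (∏ p ∈ s with p.Prime, (1 - 1 / (p : ℝ)))⁻¹ := by
  have h := hasSum_factoredNumbers s one_pos
  simp only [rpow_neg_one, Finset.prod_inv_distrib] at h
  simp only [one_div]
  refine h.congr_fun fun n => ?_
  by_cases hn : n ∈ factoredNumbers s
  · simp_all
  simp_all

lemma inv_mertensProduct_eq_exp (s : Finset ℕ) : (∏ p ∈ s with p.Prime, (1 - 1 / (p : ℝ)))⁻¹ =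
      exp (∑' n : ℕ, Λ n * (factoredNumbers s).indicator (fun _ => (1 : ℝ)) n / log n / n) := by
  rw [← tsum_indicator_expCoeff_div s (fun _ => by simp), ← (tsum_factoredNumbers_div s).tsum_eq]
  refine tsum_congr fun n => ?_
  by_cases hn : n ∈ factoredNumbers s
  · rw [indicator_of_mem hn, indicator_of_mem hn, expCoeff_const_one hn.1]
  simp_all

/-- The two sums differ by prime powers exceeding `x` whose prime is at most `x`. These are proper
powers, and their total is the tail of a convergent series. -/
lemma tsum_sub_primePowerSum_mem_Icc {x : ℝ} (hx : 2 ≤ x) :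
    (∑' n : ℕ, Λ n * (factoredNumbers (Finset.Icc 0 ⌊x⌋₊)).indicator (fun _ => (1 : ℝ)) n /
      log n / n) - primePowerSum x ∈ Icc 0 (properPowerTail x) := by
  set M := factoredNumbers (Finset.Icc 0 ⌊x⌋₊) with hM
  set t : ℕ → ℝ := fun n => Λ n / log n / n with ht
  have ht0 : ∀ n, 0 ≤ t n := fun n => by positivity
  have hP : HasSum ((Finset.Icc 0 ⌊x⌋₊ : Set ℕ).indicator t) (primePowerSum x) := by
    have : primePowerSum x = ∑ n ∈ Finset.Icc 0 ⌊x⌋₊,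
        (Finset.Icc 0 ⌊x⌋₊ : Set ℕ).indicator t n := sum_congr rfl fun n hn => by
      rw [indicator_of_mem (Finset.mem_coe.mpr hn), ht]
      ring
    rw [this]
    exact hasSum_sum_of_ne_finset_zero fun n hn => indicator_of_notMem (by grind) _
  have htail : HasSum ({n : ℕ | x < n}.indicator properPowerTerm) (properPowerTail x) :=
    (summable_properPowerTerm.indicator _).hasSum
  have hkey : ∀ n, (Finset.Icc 0 ⌊x⌋₊ : Set ℕ).indicator t n ≤ M.indicator t n ∧
      M.indicator t n ≤ (Finset.Icc 0 ⌊x⌋₊ : Set ℕ).indicator t n +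
        {n : ℕ | x < n}.indicator properPowerTerm n := fun n => by
    rcases le_or_gt (n : ℝ) x with h | h
    · have hn : n ∈ (Finset.Icc 0 ⌊x⌋₊ : Set ℕ) := by simpa using le_floor h
      rw [indicator_of_mem hn, indicator_of_notMem (show n ∉ {n : ℕ | x < n} from not_lt.mpr h),
        add_zero]
      rcases eq_or_ne n 0 with rfl | hn0
      · have h0 : t 0 = 0 := by simp [ht]
        rw [h0]
        by_cases hm : 0 ∈ M
        · simp_all
        simp_all
      · have hm : n ∈ M := mem_factoredNumbers'.mpr fun p _ hpn => by
          simp only [Finset.mem_Icc, zero_le, true_and]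
          exact (Nat.le_of_dvd (Nat.pos_of_ne_zero hn0) hpn).trans (le_floor h)
        simp_all
    · have hn : n ∉ (Finset.Icc 0 ⌊x⌋₊ : Set ℕ) := by simpa using (Nat.floor_lt (by linarith)).mpr h
      rw [indicator_of_notMem hn, indicator_of_mem (show n ∈ {n : ℕ | x < n} from h), zero_add]
      refine ⟨indicator_nonneg (fun n _ => ht0 n) n, ?_⟩
      by_cases hm : n ∈ M
      · rw [indicator_of_mem hm]
        refine vonMangoldt_div_log_div_le ?_ fun hp => ?_
        · exact_mod_cast (lt_of_le_of_lt hx h : (2 : ℝ) < n)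
        · exact hn (by simpa using mem_factoredNumbers'.mp hm n hp dvd_rfl)
      · rw [indicator_of_notMem hm]
        exact properPowerTerm_nonneg n
  have hsum : Summable (M.indicator t) :=
    Summable.of_nonneg_of_le (fun n => indicator_nonneg (fun n _ => ht0 n) n)
      (fun n => (hkey n).2) (hP.summable.add htail.summable)
  have hT : ∑' n : ℕ, Λ n * M.indicator (fun _ => (1 : ℝ)) n / log n / n =
      ∑' n, M.indicator t n := tsum_congr fun n => by
    by_cases hm : n ∈ M
    · simp_all
    simp_all
  rw [hT]
  constructor
  · exact sub_nonneg.mpr (hasSum_le (fun n => (hkey n).1) hP hsum.hasSum)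
  · exact sub_le_iff_le_add'.mpr (hasSum_le (fun n => (hkey n).2) hsum.hasSum (hP.add htail))

/-- Mertens' third theorem. -/
theorem tendsto_mertensProduct : Tendsto (fun x => log x * mertensProduct x) atTop
      (𝓝 (exp (-eulerMascheroniConstant))) := by
  set T : ℝ → ℝ := fun x => ∑' n : ℕ, Λ n *
    (factoredNumbers (Finset.Icc 0 ⌊x⌋₊)).indicator (fun _ => (1 : ℝ)) n / log n / n
  have h1 : Tendsto (fun x => T x - primePowerSum x) atTop (𝓝 0) :=
    tendsto_of_tendsto_of_tendsto_of_le_of_le' tendsto_const_nhds tendsto_properPowerTail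
      ((eventually_ge_atTop 2).mono fun x hx => (tsum_sub_primePowerSum_mem_Icc hx).1)
      ((eventually_ge_atTop 2).mono fun x hx => (tsum_sub_primePowerSum_mem_Icc hx).2)
  have h2 := ((h1.add tendsto_primePowerSum_sub_log_log).neg).rexp
  rw [zero_add] at h2
  refine h2.congr' ?_
  filter_upwards [eventually_gt_atTop 1] with x hx
  have h3 := inv_mertensProduct_eq_exp (Finset.Icc 0 ⌊x⌋₊)
  rw [← mertensProduct] at h3
  rw [← inv_inv (mertensProduct x), h3, ← exp_neg]
  nth_rewrite 2 [← exp_log (log_pos hx)]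
  rw [← exp_add]
  congr 1
  linarith

/-! ### Sums over smooth integers and the gcd form. -/

section smooth

variable {s : Finset ℕ} {a : ℕ → ℝ} {τ σ : ℝ}

/-- `n^{-τ}` on the integers composed of primes in `s`, and `0` elsewhere. -/
def smoothTerm (s : Finset ℕ) (τ : ℝ) (n : ℕ) : ℝ :=
  (factoredNumbers s).indicator (fun n => (n : ℝ) ^ (-τ)) n

/-- `∏_{p ∈ s} (1 - p^{-τ})⁻¹`. -/
def smoothSum (s : Finset ℕ) (τ : ℝ) : ℝ := ∏ p ∈ s with p.Prime, (1 - (p : ℝ) ^ (-τ))⁻¹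

lemma hasSum_smoothTerm (s : Finset ℕ) (hτ : 0 < τ) : HasSum (smoothTerm s τ) (smoothSum s τ) :=
  hasSum_factoredNumbers s hτ

lemma smoothTerm_nonneg (n : ℕ) : 0 ≤ smoothTerm s τ n :=
  indicator_nonneg (fun _ _ => by positivity) n

lemma mul_mem_factoredNumbers_iff {m n : ℕ} :
    m * n ∈ factoredNumbers s ↔ m ∈ factoredNumbers s ∧ n ∈ factoredNumbers s :=
  ⟨fun h => ⟨mem_factoredNumbers_of_dvd h (dvd_mul_right _ _),
    mem_factoredNumbers_of_dvd h (dvd_mul_left _ _)⟩,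
    fun h => Nat.mul_mem_factoredNumbers h.1 h.2⟩

lemma smoothTerm_mul (m n : ℕ) : smoothTerm s τ (m * n) = smoothTerm s τ m * smoothTerm s τ n := by
  simp only [smoothTerm, indicator_apply, mul_mem_factoredNumbers_iff]
  by_cases hm : m ∈ factoredNumbers s <;> by_cases hn : n ∈ factoredNumbers s <;> simp [hm, hn]
  exact mul_rpow (cast_nonneg m) (cast_nonneg n)

lemma smoothTerm_zero : smoothTerm s τ 0 = 0 := indicator_of_notMem (fun h => h.1 rfl) _

lemma smoothTerm_one_mul_self (n : ℕ) : smoothTerm s 1 n * (smoothTerm s 1 n * n) =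
    smoothTerm s 1 n := by
  by_cases hn : n ∈ factoredNumbers s
  · rw [smoothTerm, indicator_of_mem hn, rpow_neg_one]
    field_simp
  · rw [smoothTerm, indicator_of_notMem hn, zero_mul]

lemma smoothTerm_antitone {τ' : ℝ} (h : τ' ≤ τ) (n : ℕ) : smoothTerm s τ n ≤ smoothTerm s τ' n := by
  by_cases hn : n ∈ factoredNumbers s
  · rw [smoothTerm, smoothTerm, indicator_of_mem hn, indicator_of_mem hn]
    exact rpow_le_rpow_of_exponent_le (by exact_mod_cast Nat.one_le_iff_ne_zero.mpr hn.1)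
      (by linarith)
  · rw [smoothTerm, smoothTerm, indicator_of_notMem hn, indicator_of_notMem hn]

/-- Rankin's trick, `1 ≤ (n/N)^σ` for `n > N`. -/
lemma smoothTerm_le_of_lt {N n : ℕ} (hN : 1 ≤ N) (hσ : 0 ≤ σ) (hn : N < n) :
    smoothTerm s τ n ≤ (N : ℝ) ^ (-σ) * smoothTerm s (τ - σ) n := by
  have hN0 : (0 : ℝ) < N := mod_cast hN
  have hNn : (N : ℝ) ≤ n := by gcongr
  have hn0 : (0 : ℝ) < n := by linarith
  by_cases hm : n ∈ factoredNumbers s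
  · rw [smoothTerm, smoothTerm, indicator_of_mem hm, indicator_of_mem hm,
      show -τ = -σ + -(τ - σ) by ring, rpow_add hn0]
    exact mul_le_mul_of_nonneg_right (rpow_le_rpow_of_nonpos hN0 hNn (by linarith)) (by positivity)
  · rw [smoothTerm, smoothTerm, indicator_of_notMem hm, indicator_of_notMem hm, mul_zero]

/-- With `g = (h, k)`, `h = gx`, `k = gy` the summand is `1/(gxy)`. Forgetting that `x` and `y` are
coprime gives the cube of the Euler product. -/
lemma summable_smoothTerm_gcd (s : Finset ℕ) :
    Summable (fun p : ℕ × ℕ => smoothTerm s 1 p.1 * smoothTerm s 1 p.2 * (p.1.gcd p.2 : ℝ)) ∧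
      ∑' p : ℕ × ℕ, smoothTerm s 1 p.1 * smoothTerm s 1 p.2 * (p.1.gcd p.2 : ℝ) ≤
        smoothSum s 1 ^ 3 := by
  have h1 := hasSum_smoothTerm s one_pos
  have h2 : HasSum (fun x : ℕ × ℕ × ℕ => smoothTerm s 1 x.1 *
      (smoothTerm s 1 x.2.1 * smoothTerm s 1 x.2.2)) (smoothSum s 1 * (smoothSum s 1 *
        smoothSum s 1)) := by
    have h0 : 0 ≤ smoothTerm s 1 := smoothTerm_nonneg
    have h3 := h1.mul h1 (h1.summable.mul_of_nonneg h1.summable h0 h0)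
    exact h1.mul h3 (h1.summable.mul_of_nonneg h3.summable h0 fun x => mul_nonneg (h0 _) (h0 _))
  have hinj : Function.Injective fun p : ℕ × ℕ =>
      (p.1.gcd p.2, p.1 / p.1.gcd p.2, p.2 / p.1.gcd p.2) := by
    refine Function.LeftInverse.injective (g := fun x => (x.1 * x.2.1, x.1 * x.2.2)) fun p => ?_
    simp only [Nat.mul_div_cancel' (Nat.gcd_dvd_left _ _),
      Nat.mul_div_cancel' (Nat.gcd_dvd_right _ _)]
  have heq : (fun p : ℕ × ℕ => smoothTerm s 1 p.1 * smoothTerm s 1 p.2 * (p.1.gcd p.2 : ℝ)) =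
      (fun x : ℕ × ℕ × ℕ => smoothTerm s 1 x.1 * (smoothTerm s 1 x.2.1 * smoothTerm s 1 x.2.2)) ∘
        fun p : ℕ × ℕ => (p.1.gcd p.2, p.1 / p.1.gcd p.2, p.2 / p.1.gcd p.2) := by
    ext ⟨h, k⟩
    obtain ⟨x, hx⟩ := Nat.gcd_dvd_left h k
    obtain ⟨y, hy⟩ := Nat.gcd_dvd_right h k
    simp only [Function.comp_apply]
    rcases Nat.eq_zero_or_pos (h.gcd k) with h0 | h0
    · rw [h0]; simp [smoothTerm_zero]
    generalize h.gcd k = g at *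
    subst hx hy
    rw [smoothTerm_mul, smoothTerm_mul, Nat.mul_div_cancel_left _ h0, Nat.mul_div_cancel_left _ h0]
    linear_combination (smoothTerm s 1 x * smoothTerm s 1 y) * smoothTerm_one_mul_self g
  rw [heq]
  refine ⟨h2.summable.comp_injective hinj, ?_⟩
  refine (tsum_comp_le_tsum_of_inj h2.summable (fun x => ?_) hinj).trans (le_of_eq ?_)
  · exact mul_nonneg (smoothTerm_nonneg _) (mul_nonneg (smoothTerm_nonneg _) (smoothTerm_nonneg _))
  · rw [h2.tsum_eq]; ring

lemma hasSum_smoothTerm_dvd (s : Finset ℕ) (L : ℕ) :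
    HasSum ({r : ℕ | L ∣ r}.indicator (smoothTerm s 1)) (smoothTerm s 1 L * smoothSum s 1) := by
  rcases Nat.eq_zero_or_pos L with rfl | hL
  · rw [smoothTerm_zero, zero_mul]
    convert hasSum_zero using 2 with r
    by_cases hr : r ∈ {r : ℕ | 0 ∣ r}
    · rw [indicator_of_mem hr, zero_dvd_iff.mp hr, smoothTerm_zero]
    simp_all
  · refine ((mul_right_injective₀ hL.ne').hasSum_iff
      (f := {r : ℕ | L ∣ r}.indicator (smoothTerm s 1)) fun r hr => ?_).mp ?_
    · have h : r ∉ {r : ℕ | L ∣ r} := fun h => hr (Exists.imp (fun _ => Eq.symm) h)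
      simp_all
    · refine ((hasSum_smoothTerm s one_pos).mul_left _).congr_fun fun m => ?_
      rw [Function.comp_apply, indicator_of_mem (show L * m ∈ {r : ℕ | L ∣ r} from
        dvd_mul_right _ _), smoothTerm_mul]

/-- `∑_{h,k} a(h) a(k) (h,k) / (hk)`. -/
def gcdForm (a : ℕ → ℝ) : ℝ := ∑' p : ℕ × ℕ, a p.1 * a p.2 * ((p.1.gcd p.2 : ℝ) / (p.1 * p.2))

lemma abs_mul_rpow_le (ha : ∀ n, |a n| ≤ (factoredNumbers s).indicator (fun _ => (1 : ℝ)) n)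
    (τ : ℝ) (n : ℕ) : |a n * (n : ℝ) ^ (-τ)| ≤ smoothTerm s τ n := by
  have h := ha n
  have h0 : 0 ≤ (n : ℝ) ^ (-τ) := by positivity
  rw [abs_mul, abs_of_nonneg h0, smoothTerm]
  by_cases hm : n ∈ factoredNumbers s
  · rw [indicator_of_mem hm] at h ⊢
    nlinarith
  simp_all

lemma abs_gcdForm_term_le (ha : ∀ n, |a n| ≤ (factoredNumbers s).indicator (fun _ => (1 : ℝ)) n)
    (p : ℕ × ℕ) : |a p.1 * a p.2 * ((p.1.gcd p.2 : ℝ) / (p.1 * p.2))| ≤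
      smoothTerm s 1 p.1 * smoothTerm s 1 p.2 * (p.1.gcd p.2 : ℝ) := by
  have h1 := abs_mul_rpow_le ha 1 p.1
  have h2 := abs_mul_rpow_le ha 1 p.2
  have h3 : a p.1 * a p.2 * ((p.1.gcd p.2 : ℝ) / (p.1 * p.2)) =
      a p.1 * (p.1 : ℝ) ^ (-(1 : ℝ)) * (a p.2 * (p.2 : ℝ) ^ (-(1 : ℝ))) * (p.1.gcd p.2 : ℝ) := by
    rw [rpow_neg_one, rpow_neg_one, div_eq_mul_inv, mul_inv]; ring
  rw [h3, abs_mul, abs_mul, Nat.abs_cast]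
  exact mul_le_mul_of_nonneg_right (mul_le_mul h1 h2 (abs_nonneg _) (smoothTerm_nonneg _))
    (cast_nonneg _)

/-- `∑_{h,k} a(h) a(k) [h, k ∣ r] / r`, termwise. -/
def gcdTriple (s : Finset ℕ) (a : ℕ → ℝ) (x : (ℕ × ℕ) × ℕ) : ℝ :=
  a x.1.1 * a x.1.2 * {r : ℕ | x.1.1.lcm x.1.2 ∣ r}.indicator (smoothTerm s 1) x.2

/-- `(h,k)/(hk)` is the reciprocal of the least common multiple, and `1/r` summed over its multiples
`r` composed of primes in `s` gives that reciprocal times `smoothSum s 1`. -/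
lemma hasSum_gcdTriple (ha : ∀ n, |a n| ≤ (factoredNumbers s).indicator (fun _ => (1 : ℝ)) n)
    (p : ℕ × ℕ) : HasSum (fun r => gcdTriple s a (p, r))
      (a p.1 * a p.2 * ((p.1.gcd p.2 : ℝ) / (p.1 * p.2)) * smoothSum s 1) := by
  have h1 := (hasSum_smoothTerm_dvd s (p.1.lcm p.2)).mul_left (a p.1 * a p.2)
  have h2 : a p.1 * a p.2 * smoothTerm s 1 (p.1.lcm p.2) =
      a p.1 * a p.2 * ((p.1.gcd p.2 : ℝ) / (p.1 * p.2)) := by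
    have hz : ∀ n ∉ factoredNumbers s, a n = 0 := fun n hn => by
      have := ha n
      simp_all
    by_cases hm : p.1 ∈ factoredNumbers s
    · by_cases hn : p.2 ∈ factoredNumbers s
      · have hg : (p.1.gcd p.2 : ℝ) * (p.1.lcm p.2 : ℝ) = p.1 * p.2 := by
          exact_mod_cast Nat.gcd_mul_lcm p.1 p.2
        have hl : p.1.lcm p.2 ∈ factoredNumbers s := mem_factoredNumbers_of_dvd
          (Nat.mul_mem_factoredNumbers hm hn) (Nat.lcm_dvd_mul _ _)
        have h0 : (p.1.gcd p.2 : ℝ) ≠ 0 := by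
          exact_mod_cast (Nat.gcd_pos_of_pos_left _ (Nat.pos_of_ne_zero hm.1)).ne'
        rw [← hg, smoothTerm, indicator_of_mem hl, rpow_neg_one]
        field_simp
      grind
    grind
  rw [← mul_assoc, h2] at h1
  exact h1

lemma summable_gcdTriple (ha : ∀ n, |a n| ≤ (factoredNumbers s).indicator (fun _ => (1 : ℝ)) n) :
    Summable (gcdTriple s a) := by
  have ha' : ∀ n, |(|a n|)| ≤ (factoredNumbers s).indicator (fun _ => (1 : ℝ)) n := by grind
  have h0 : 0 ≤ gcdTriple s fun n => |a n| := fun x => mul_nonneg (by positivity)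
    (indicator_nonneg (fun _ _ => smoothTerm_nonneg _) _)
  have h1 : Summable (gcdTriple s fun n => |a n|) := by
    refine (summable_prod_of_nonneg h0).mpr ⟨fun p => (hasSum_gcdTriple (a := fun n => |a n|) ha' p).summable, ?_⟩
    have h2 := (Summable.of_norm_bounded (summable_smoothTerm_gcd s).1
      (abs_gcdForm_term_le (a := fun n => |a n|) ha')).mul_right (smoothSum s 1)
    exact h2.congr fun p => (hasSum_gcdTriple (a := fun n => |a n|) ha' p).tsum_eq.symm
  refine Summable.of_norm_bounded h1 fun x => ?_
  rw [gcdTriple, norm_mul, norm_mul, norm_of_nonneg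
    (indicator_nonneg (fun _ _ => smoothTerm_nonneg _) x.2)]
  bound

lemma tsum_gcdTriple (r : ℕ) : ∑' p : ℕ × ℕ, gcdTriple s a (p, r) =
    smoothTerm s 1 r * (∑ m ∈ r.divisors, a m) ^ 2 := by
  rcases eq_or_ne r 0 with rfl | hr0
  · rw [smoothTerm_zero, zero_mul]
    refine (tsum_congr fun p => ?_).trans tsum_zero
    rw [gcdTriple, indicator_apply, smoothTerm_zero, ite_self, mul_zero]
  rw [tsum_eq_sum (s := r.divisors ×ˢ r.divisors) fun p hp => ?_, Finset.sum_product, sq,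
    Finset.sum_mul_sum, mul_sum]
  · refine sum_congr rfl fun h hh => ?_
    rw [mul_sum]
    refine sum_congr rfl fun k hk => ?_
    rw [gcdTriple, indicator_of_mem (show r ∈ {r : ℕ | h.lcm k ∣ r} from
      Nat.lcm_dvd (Nat.dvd_of_mem_divisors hh) (Nat.dvd_of_mem_divisors hk))]
    ring
  · rw [gcdTriple, indicator_of_notMem, mul_zero]
    intro h
    refine hp (Finset.mem_product.mpr ⟨?_, ?_⟩) <;> refine mem_divisors.mpr ⟨?_, hr0⟩
    · exact (Nat.dvd_lcm_left _ _).trans h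
    · exact (Nat.dvd_lcm_right _ _).trans h

/-- Diagonalisation of the gcd form. -/
lemma gcdForm_mul_smoothSum (ha : ∀ n, |a n| ≤ (factoredNumbers s).indicator (fun _ => (1 : ℝ)) n) :
    gcdForm a * smoothSum s 1 = ∑' r, smoothTerm s 1 r * (∑ m ∈ r.divisors, a m) ^ 2 := by
  calc gcdForm a * smoothSum s 1 = ∑' p : ℕ × ℕ, ∑' r, gcdTriple s a (p, r) := by
        rw [gcdForm, ← tsum_mul_right]
        exact tsum_congr fun p => (hasSum_gcdTriple ha p).tsum_eq.symm
    _ = ∑' r, ∑' p : ℕ × ℕ, gcdTriple s a (p, r) :=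
      (Summable.tsum_comm (f := fun p r => gcdTriple s a (p, r)) (summable_gcdTriple ha)).symm
    _ = _ := tsum_congr tsum_gcdTriple

end smooth

/-! ### Truncation of the mollifier and the normalised twisted moment. -/

section mollified

variable {s : Finset ℕ} {a : ℕ → ℝ} {σ : ℝ}

/-- `a(h) a(k) (hk)^{-1/2}`. -/
def pairTerm (a : ℕ → ℝ) (p : ℕ × ℕ) : ℝ :=
  a p.1 * (p.1 : ℝ) ^ (-(1 / 2) : ℝ) * (a p.2 * (p.2 : ℝ) ^ (-(1 / 2) : ℝ))

lemma abs_pairTerm_le (ha : ∀ n, |a n| ≤ (factoredNumbers s).indicator (fun _ => (1 : ℝ)) n)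
    (p : ℕ × ℕ) : |pairTerm a p| ≤ smoothTerm s (1 / 2) p.1 * smoothTerm s (1 / 2) p.2 := by
  rw [pairTerm, abs_mul]
  exact mul_le_mul (abs_mul_rpow_le ha _ _) (abs_mul_rpow_le ha _ _) (abs_nonneg _)
    (smoothTerm_nonneg _)

lemma hasSum_smoothTerm_mul (s : Finset ℕ) {τ : ℝ} (hτ : 0 < τ) :
    HasSum (fun p : ℕ × ℕ => smoothTerm s τ p.1 * smoothTerm s τ p.2) (smoothSum s τ ^ 2) := by
  have h := hasSum_smoothTerm s hτ
  have h0 : 0 ≤ smoothTerm s τ := smoothTerm_nonneg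
  rw [sq]
  exact h.mul h (h.summable.mul_of_nonneg h.summable h0 h0)

lemma norm_pairTerm_mul_le (ha : ∀ n, |a n| ≤ (factoredNumbers s).indicator (fun _ => (1 : ℝ)) n)
    {κ : ℕ × ℕ → ℂ} (hκ : ∀ p, ‖κ p‖ ≤ 1) (p : ℕ × ℕ) :
    ‖(pairTerm a p : ℂ) * κ p‖ ≤ smoothTerm s (1 / 2) p.1 * smoothTerm s (1 / 2) p.2 := by
  rw [norm_mul, norm_real]
  exact (mul_le_of_le_one_right (norm_nonneg _) (hκ p)).trans (abs_pairTerm_le ha p)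

/-- Outside the box one index exceeds `N`, and Rankin's trick is applied to it. The multiplier `κ`
is kept arbitrary because the bound is used both for `χ(h) conj χ(k)` and for `(h,k)/√(hk)`. -/
lemma norm_tsum_pairTerm_sub_sum_le
    (ha : ∀ n, |a n| ≤ (factoredNumbers s).indicator (fun _ => (1 : ℝ)) n)
    (hσ : 0 ≤ σ) (hσ' : σ < 1 / 2) {N : ℕ} (hN : 1 ≤ N) {κ : ℕ × ℕ → ℂ} (hκ : ∀ p, ‖κ p‖ ≤ 1) :
    ‖(∑' p, (pairTerm a p : ℂ) * κ p) - ∑ p ∈ Finset.range (N + 1) ×ˢ Finset.range (N + 1),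
      (pairTerm a p : ℂ) * κ p‖ ≤ (N : ℝ) ^ (-σ) * smoothSum s (1 / 2 - σ) ^ 2 := by
  set R := Finset.range (N + 1) ×ˢ Finset.range (N + 1)
  set f : ℕ × ℕ → ℂ := fun p => (pairTerm a p : ℂ) * κ p
  have hs : Summable f := Summable.of_norm_bounded
    (hasSum_smoothTerm_mul s (by norm_num : (0 : ℝ) < 1 / 2)).summable (norm_pairTerm_mul_le ha hκ)
  have h1 : HasSum ((R : Set (ℕ × ℕ))ᶜ.indicator f) ((∑' p, f p) - ∑ p ∈ R, f p) := by
    have h2 := (hasSum_subtype_iff_indicator (f := f) (s := (R : Set (ℕ × ℕ))ᶜ)).mp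
      ((R.hasSum_compl_iff (f := f) (a := (∑' p, f p) - ∑ p ∈ R, f p)).mpr (by
        rw [sub_add_cancel]; exact hs.hasSum))
    exact h2
  refine h1.norm_le_of_bounded ((hasSum_smoothTerm_mul s (sub_pos.mpr hσ')).mul_left _) fun p => ?_
  have hm : ∀ n, smoothTerm s (1 / 2) n ≤ smoothTerm s (1 / 2 - σ) n :=
    smoothTerm_antitone (by linarith)
  have hn0 : ∀ τ n, 0 ≤ smoothTerm s τ n := fun τ n => smoothTerm_nonneg n
  by_cases hp : p ∈ R
  · rw [indicator_of_notMem (by grind), norm_zero]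
    bound
  · rw [indicator_of_mem (by grind)]
    refine (norm_pairTerm_mul_le ha hκ p).trans ?_
    have hp' : N < p.1 ∨ N < p.2 := by grind
    rcases hp' with h | h
    · calc _ ≤ (N : ℝ) ^ (-σ) * smoothTerm s (1 / 2 - σ) p.1 * smoothTerm s (1 / 2 - σ) p.2 :=
            mul_le_mul (smoothTerm_le_of_lt hN hσ h) (hm _) (hn0 _ _)
              (mul_nonneg (by positivity) (hn0 _ _))
        _ = _ := by ring
    · calc _ ≤ smoothTerm s (1 / 2 - σ) p.1 * ((N : ℝ) ^ (-σ) * smoothTerm s (1 / 2 - σ) p.2) :=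
            mul_le_mul (hm _) (smoothTerm_le_of_lt hN hσ h) (hn0 _ _) (hn0 _ _)
        _ = _ := by ring

lemma norm_sq_LSeries_eq_tsum_pairTerm {q : ℕ} [NeZero q] (χ : DirichletCharacter ℂ q)
    (ha : ∀ n, |a n| ≤ (factoredNumbers s).indicator (fun _ => (1 : ℝ)) n) :
    ((‖LSeries (fun n => (a n : ℂ) * χ n) (1 / 2)‖ ^ 2 : ℝ) : ℂ) =
      ∑' p : ℕ × ℕ, (pairTerm a p : ℂ) * (χ p.1 * conj (χ p.2)) := by
  have h1 : LSeries (fun n => (a n : ℂ) * χ n) (1 / 2) =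
      ∑' n : ℕ, ((a n * (n : ℝ) ^ (-(1 / 2) : ℝ) : ℝ) : ℂ) * χ n := tsum_congr fun n => by
    rcases eq_or_ne n 0 with rfl | hn
    · simp
    rw [term_of_ne_zero hn, ofReal_mul, ofReal_cpow (cast_nonneg n)]
    push_cast
    rw [Complex.cpow_neg]
    ring
  have h2 : Summable fun n : ℕ => ‖((a n * (n : ℝ) ^ (-(1 / 2) : ℝ) : ℝ) : ℂ) * χ n‖ := by
    refine Summable.of_nonneg_of_le (fun _ => norm_nonneg _) (fun n => ?_)
      (hasSum_smoothTerm s (by norm_num : (0 : ℝ) < 1 / 2)).summable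
    rw [norm_mul, norm_real]
    exact (mul_le_of_le_one_right (norm_nonneg _) (χ.norm_le_one n)).trans (abs_mul_rpow_le ha _ n)
  rw [ofReal_pow, ← Complex.mul_conj', h1, Complex.conj_tsum,
    tsum_mul_tsum_of_summable_norm h2 (by simp_all)]
  refine tsum_congr fun p => ?_
  simp only [pairTerm, map_mul, conj_ofReal, ofReal_mul]
  ring

lemma gcd_div_sqrt_mem_Icc (h k : ℕ) : (h.gcd k : ℝ) / √(h * k) ∈ Icc 0 1 := by
  refine ⟨by positivity, ?_⟩
  rcases Nat.eq_zero_or_pos h with rfl | hh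
  · simp
  rcases Nat.eq_zero_or_pos k with rfl | hk
  · simp
  refine div_le_one_of_le₀ (le_sqrt_of_sq_le ?_) (sqrt_nonneg _)
  rw [sq]
  exact_mod_cast Nat.mul_le_mul (Nat.gcd_le_left k hh) (Nat.gcd_le_right h hk)

/-- The twisted second moment of `L(1/2, χ)` over primitive characters. -/
def twistedMoment (q : ℕ) [NeZero q] (h k : ℕ) : ℂ :=
  ((primitiveChars q).card : ℂ)⁻¹ * ∑ χ ∈ primitiveChars q,
    χ h * conj (χ k) * ((‖χ.LFunction (1 / 2)‖ ^ 2 : ℝ) : ℂ)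

/-- The off-diagonal error `q^{5/8}` is divided by the number of characters, at least `q / d(q)²`.
The trivial `φ(q)/q · d(q) ≥ 1` is used to extract the factor `φ(q)/q`, so the error is relative to
the main term. With `d(q) ≪ q^{1/64}` the exponent becomes `-1/4 + 4/64 = -3/16`. -/
lemma exists_twistedMoment_le : ∃ C : ℝ, 0 < C ∧ ∀ (q : ℕ) [NeZero q] (h k H : ℕ), q ≠ 1 →
    (primitiveChars q).Nonempty → h.Coprime q → k.Coprime q → h ≤ H → k ≤ H → 1 ≤ H →
    ‖twistedMoment q h k - ((q.totient / q * (h.gcd k / √(h * k) * log q) : ℝ) : ℂ)‖ ≤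
      C * (q.totient / q * (h.gcd k / √(h * k) *
        (√(log q) + 1 + log H) + (H : ℝ) ^ 2 * (q : ℝ) ^ (-(3 / 16) : ℝ))) := by
  obtain ⟨C₁, hC₁, h1⟩ := exists_twisted_le
  obtain ⟨C₂, hC₂, h2⟩ := exists_diagonal_le
  obtain ⟨C₃, hC₃, h3⟩ := exists_card_divisors_le (ε := 1 / 64) (by norm_num)
  refine ⟨C₂ + (C₁ + C₂) * C₃ ^ 4, by positivity, fun q _ h k H hq hne hh hk hhH hkH hH => ?_⟩
  have hq0 := NeZero.ne q
  have e1 := h1 q h k H hq hh hk hhH hkH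
  have e2 := h2 q h k H hq0 hq hh hk hhH hkH
  have e3 := h3 q hq0
  have e4 := le_card_divisors_sq_mul_card_primitiveChars q hne
  have e5 : (q : ℝ) ≤ q.divisors.card * q.totient := by
    exact_mod_cast le_card_divisors_mul_totient hq0
  have hq1 : (1 : ℝ) ≤ q := mod_cast Nat.one_le_iff_ne_zero.mpr hq0
  have hn0 : (0 : ℝ) < (primitiveChars q).card := by positivity
  have hd1 : (1 : ℝ) ≤ q.divisors.card := by
    exact_mod_cast Finset.card_pos.mpr ⟨1, Nat.one_mem_divisors.mpr hq0⟩
  have hH1 : (1 : ℝ) ≤ H := mod_cast hH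
  obtain ⟨hρ0, hρ1⟩ := gcd_div_sqrt_mem_Icc h k
  unfold twistedMoment
  set ρ : ℝ := (h.gcd k : ℝ) / √(h * k)
  set c : ℝ := (q.totient : ℝ) / q with hc
  set d : ℝ := (q.divisors.card : ℝ)
  set n : ℝ := ((primitiveChars q).card : ℝ) with hn
  set T : ℂ := ∑ χ ∈ primitiveChars q, χ h * conj (χ k) * ((‖χ.LFunction (1 / 2)‖ ^ 2 : ℝ) : ℂ)
  set D : ℝ := ∑ κ ∈ Finset.range 2, diagonal κ q h k
  have hcd : 1 ≤ c * d := by rw [hc, div_mul_eq_mul_div, le_div_iff₀ (by linarith)]; linarith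
  have hc0 : 0 ≤ c := by positivity
  have hsplit : ((primitiveChars q).card : ℂ)⁻¹ * T - ((c * (ρ * log q) : ℝ) : ℂ) =
      (n : ℂ)⁻¹ * (T - ((n * D : ℝ) : ℂ)) + ((D - ρ * (c * log q) : ℝ) : ℂ) := by
    have : (n : ℂ) ≠ 0 := mod_cast hn0.ne'
    have hnc : ((primitiveChars q).card : ℂ) = (n : ℂ) := by simp [hn]
    rw [hnc]
    push_cast
    grind
  rw [hsplit]
  have hH2 : ∀ e : ℝ, e ≤ 2 → (H : ℝ) ^ e ≤ (H : ℝ) ^ 2 := fun e he => by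
    rw [← rpow_natCast]; exact rpow_le_rpow_of_exponent_le hH1 (by lia)
  have hd4 : d ^ 4 ≤ C₃ ^ 4 * (q : ℝ) ^ (1 / 16 : ℝ) := by
    refine (pow_le_pow_left₀ (by linarith) e3 4).trans (le_of_eq ?_)
    rw [mul_pow, ← rpow_mul_natCast (by linarith)]
    norm_num
  set V := c * ((H : ℝ) ^ 2 * (q : ℝ) ^ (-(3 / 16) : ℝ)) with hV
  have hmain : c * d ^ 4 * (H : ℝ) ^ 2 * (q : ℝ) ^ (-(1 / 4) : ℝ) ≤ C₃ ^ 4 * V := by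
    calc _ ≤ c * (C₃ ^ 4 * (q : ℝ) ^ (1 / 16 : ℝ)) * (H : ℝ) ^ 2 * (q : ℝ) ^ (-(1 / 4) : ℝ) := by
          gcongr
      _ = C₃ ^ 4 * (c * ((H : ℝ) ^ 2 * ((q : ℝ) ^ (1 / 16 : ℝ) * (q : ℝ) ^ (-(1 / 4) : ℝ)))) := by
          ring
      _ = _ := by rw [← rpow_add (by linarith)]; grind
  have f1 : ‖(n : ℂ)⁻¹ * (T - ((n * D : ℝ) : ℂ))‖ ≤ C₁ * (C₃ ^ 4 * V) := by
    rw [norm_mul, norm_inv, norm_real, norm_of_nonneg hn0.le]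
    have hqpow : (q : ℝ) ^ (5 / 8 : ℝ) ≤ q * (q : ℝ) ^ (-(1 / 4) : ℝ) := by
      nth_rewrite 2 [← rpow_one (q : ℝ)]
      rw [← rpow_add (by linarith)]
      bound
    calc _ ≤ n⁻¹ * (C₁ * (H : ℝ) ^ 2 * d * (d ^ 2 * n * (q : ℝ) ^ (-(1 / 4) : ℝ))) := by
          refine mul_le_mul_of_nonneg_left (e1.trans ?_) (by positivity)
          have := hH2 (9 / 8) (by norm_num)
          refine mul_le_mul (by gcongr) (hqpow.trans (by gcongr)) (by positivity) (by positivity)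
      _ = C₁ * (1 * (d ^ 3 * (H : ℝ) ^ 2 * (q : ℝ) ^ (-(1 / 4) : ℝ))) := by field_simp
      _ ≤ C₁ * (c * d * (d ^ 3 * (H : ℝ) ^ 2 * (q : ℝ) ^ (-(1 / 4) : ℝ))) := by gcongr
      _ = C₁ * (c * d ^ 4 * (H : ℝ) ^ 2 * (q : ℝ) ^ (-(1 / 4) : ℝ)) := by ring
      _ ≤ _ := by gcongr
  have f2 : ρ * (d * (H : ℝ) ^ (1 / 2 : ℝ) * (q : ℝ) ^ (-(1 / 4) : ℝ)) ≤ C₃ ^ 4 * V := by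
    refine le_trans ?_ hmain
    have := hH2 (1 / 2) (by norm_num)
    have hd3 : 1 ≤ d ^ 2 := by bound
    calc _ ≤ 1 * (1 * (d * 1 * (H : ℝ) ^ 2 * (q : ℝ) ^ (-(1 / 4) : ℝ))) := by
          rw [one_mul, mul_one]
          bound
      _ ≤ (c * d) * (d ^ 2 * (d * 1 * (H : ℝ) ^ 2 * (q : ℝ) ^ (-(1 / 4) : ℝ))) := by gcongr
      _ = _ := by ring
  refine (norm_add_le _ _).trans ?_
  rw [norm_real, norm_eq_abs]
  set W := ρ * (√(log q) + 1 + log H)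
  calc _ ≤ C₁ * (C₃ ^ 4 * V) + (C₂ * (c * W) + C₂ * (C₃ ^ 4 * V)) := by
        refine add_le_add f1 (e2.trans ?_)
        calc _ = C₂ * (c * W) + C₂ * (ρ * (d * (H : ℝ) ^ (1 / 2 : ℝ) *
              (q : ℝ) ^ (-(1 / 4) : ℝ))) := by ring
          _ ≤ _ := by gcongr
    _ ≤ (C₂ + (C₁ + C₂) * C₃ ^ 4) * (c * W + V) := by
        have : 0 ≤ (C₁ + C₂) * C₃ ^ 4 * (c * W) + C₂ * V := by positivity
        linarith
    _ = _ := by ring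

end mollified

/-! ### The second moment of `L(1/2, χ)` times a smooth Dirichlet series. -/

section mollifiedMoment

variable {s : Finset ℕ} {a : ℕ → ℝ} {σ : ℝ}

lemma pairTerm_mul_gcd_div_sqrt (p : ℕ × ℕ) : pairTerm a p * ((p.1.gcd p.2 : ℝ) / √(p.1 * p.2)) =
      a p.1 * a p.2 * ((p.1.gcd p.2 : ℝ) / (p.1 * p.2)) := by
  have h : ∀ n : ℕ, (n : ℝ) ^ (-(1 / 2) : ℝ) * (√n)⁻¹ = (n : ℝ)⁻¹ := fun n => by
    rw [rpow_neg (cast_nonneg n), ← sqrt_eq_rpow, ← mul_inv, mul_self_sqrt (cast_nonneg n)]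
  have hd : ∀ g x y : ℝ, g / (x * y) = g * (x⁻¹ * y⁻¹) := by grind
  rw [pairTerm, sqrt_mul (cast_nonneg _), hd, hd, ← h, ← h]
  ring

/-- The second moment of `L(1/2, χ) A(χ)` over primitive characters, where
`A(χ) = ∑ a(n) χ(n) n^{-1/2}`. -/
def mollifiedMoment (a : ℕ → ℝ) (q : ℕ) [NeZero q] : ℝ :=
  ((primitiveChars q).card : ℝ)⁻¹ * ∑ χ ∈ primitiveChars q,
    ‖χ.LFunction (1 / 2)‖ ^ 2 * ‖LSeries (fun n => (a n : ℂ) * χ n) (1 / 2)‖ ^ 2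

/-- The truncation error of `|A(χ)|²` is uniform in `χ`, so it multiplies the untwisted second
moment, the case `h = k = 1`. -/
lemma norm_mollifiedMoment_sub_le {q : ℕ} [NeZero q]
    (ha : ∀ n, |a n| ≤ (factoredNumbers s).indicator (fun _ => (1 : ℝ)) n)
    (hσ : 0 ≤ σ) (hσ' : σ < 1 / 2) {N : ℕ} (hN : 1 ≤ N) :
    ‖(mollifiedMoment a q : ℂ) - ∑ p ∈ Finset.range (N + 1) ×ˢ Finset.range (N + 1),
      (pairTerm a p : ℂ) * twistedMoment q p.1 p.2‖ ≤
      (N : ℝ) ^ (-σ) * smoothSum s (1 / 2 - σ) ^ 2 * ‖twistedMoment q 1 1‖ := by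
  set R := Finset.range (N + 1) ×ˢ Finset.range (N + 1)
  set B := (N : ℝ) ^ (-σ) * smoothSum s (1 / 2 - σ) ^ 2
  have h1 : ∑ p ∈ R, (pairTerm a p : ℂ) * twistedMoment q p.1 p.2 =
      ((primitiveChars q).card : ℂ)⁻¹ * ∑ χ ∈ primitiveChars q,
        ((‖χ.LFunction (1 / 2)‖ ^ 2 : ℝ) : ℂ) *
          ∑ p ∈ R, (pairTerm a p : ℂ) * (χ p.1 * conj (χ p.2)) := by
    simp only [twistedMoment, mul_sum]
    rw [Finset.sum_comm]
    grind
  have h2 : ‖twistedMoment q 1 1‖ = ((primitiveChars q).card : ℝ)⁻¹ *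
      ∑ χ ∈ primitiveChars q, ‖χ.LFunction (1 / 2)‖ ^ 2 := by
    have : twistedMoment q 1 1 = ((((primitiveChars q).card : ℝ)⁻¹ *
      ∑ χ ∈ primitiveChars q, ‖χ.LFunction (1 / 2)‖ ^ 2 : ℝ) : ℂ) := by simp [twistedMoment]
    rw [this, norm_real, norm_of_nonneg (by positivity)]
  have h3 : (mollifiedMoment a q : ℂ) = ((primitiveChars q).card : ℂ)⁻¹ * ∑ χ ∈ primitiveChars q,
      ((‖χ.LFunction (1 / 2)‖ ^ 2 : ℝ) : ℂ) *
        ∑' p : ℕ × ℕ, (pairTerm a p : ℂ) * (χ p.1 * conj (χ p.2)) := by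
    simp only [← norm_sq_LSeries_eq_tsum_pairTerm _ ha, mollifiedMoment]
    simp
  rw [h1, h2, h3, ← mul_sub, ← sum_sub_distrib, norm_mul, norm_inv, Complex.norm_natCast,
    mul_left_comm, mul_sum]
  refine mul_le_mul_of_nonneg_left ((norm_sum_le _ _).trans (sum_le_sum fun χ _ => ?_))
    (by positivity)
  rw [← mul_sub, norm_mul, norm_real, norm_of_nonneg (by positivity), mul_comm B]
  refine mul_le_mul_of_nonneg_left (norm_tsum_pairTerm_sub_sum_le ha hσ hσ' hN fun p => ?_)
    (by positivity)
  rw [norm_mul, RCLike.norm_conj]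
  exact mul_le_one₀ (χ.norm_le_one _) (norm_nonneg _) (χ.norm_le_one _)

/-- Three errors add up: truncating `|A(χ)|²`, the twisted moment inside the box, and extending the
main term from the box to the whole gcd form. Within the second, the logarithmic part carries the
gcd weight and is summed at exponent 1, while the power-saving part can afford exponent `1/2 - σ`.
-/
lemma exists_mollifiedMoment_le : ∃ C : ℝ, 0 < C ∧ ∀ (q : ℕ) [NeZero q] (s : Finset ℕ) (a : ℕ → ℝ)
    (N : ℕ) (σ : ℝ), q ≠ 1 → (primitiveChars q).Nonempty →
    (∀ n ∈ factoredNumbers s, n.Coprime q) →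
    (∀ n, |a n| ≤ (factoredNumbers s).indicator (fun _ => (1 : ℝ)) n) →
    0 ≤ σ → σ < 1 / 2 → 1 ≤ N →
    |mollifiedMoment a q - q.totient / q * (log q * gcdForm a)| ≤
      C * (q.totient / q * ((N : ℝ) ^ (-σ) * smoothSum s (1 / 2 - σ) ^ 2 *
        (log q + (√(log q) + 1 + log N) + (N : ℝ) ^ 2 * (q : ℝ) ^ (-(3 / 16) : ℝ)) +
        (smoothSum s 1 ^ 3 * (√(log q) + 1 + log N) +
        smoothSum s (1 / 2 - σ) ^ 2 * ((N : ℝ) ^ 2 * (q : ℝ) ^ (-(3 / 16) : ℝ))))) := by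
  obtain ⟨C, hC, hT⟩ := exists_twistedMoment_le
  refine ⟨C + 2, by positivity, fun q _ s a N σ hq hne hcop ha hσ hσ' hN => ?_⟩
  have hq0 := NeZero.ne q
  have hq1 : (1 : ℝ) ≤ q := mod_cast Nat.one_le_iff_ne_zero.mpr hq0
  have hN1 : (1 : ℝ) ≤ N := mod_cast hN
  have hm := norm_mollifiedMoment_sub_le (q := q) ha hσ hσ' hN
  have h11 := hT q 1 1 N hq hne (by simp) (by simp) hN hN hN
  have hκ : ∀ p : ℕ × ℕ, ‖(((p.1.gcd p.2 : ℝ) / √(p.1 * p.2) : ℝ) : ℂ)‖ ≤ 1 := fun p => by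
    rw [norm_real, norm_of_nonneg (gcd_div_sqrt_mem_Icc _ _).1]
    exact (gcd_div_sqrt_mem_Icc _ _).2
  have hS := norm_tsum_pairTerm_sub_sum_le ha hσ hσ' hN hκ
  have hG : ((∑' p : ℕ × ℕ, (pairTerm a p : ℂ) * (((p.1.gcd p.2 : ℝ) /
      √(p.1 * p.2) : ℝ) : ℂ))) = (gcdForm a : ℂ) := by
    rw [gcdForm, Complex.ofReal_tsum]
    refine tsum_congr fun p => ?_
    rw [← ofReal_mul, pairTerm_mul_gcd_div_sqrt]
  rw [hG] at hS
  set R := Finset.range (N + 1) ×ˢ Finset.range (N + 1) with hR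
  set E := smoothSum s (1 / 2 - σ)
  set W := √(log q) + 1 + log N
  set V := (N : ℝ) ^ 2 * (q : ℝ) ^ (-(3 / 16) : ℝ)
  set c : ℝ := (q.totient : ℝ) / q
  have hc0 : 0 ≤ c := by positivity
  have hW0 : 0 ≤ W := by positivity
  have hV0 : 0 ≤ V := by positivity
  set B := (N : ℝ) ^ (-σ) * E ^ 2
  -- the twist by `h = k = 1`
  have g1 : ‖twistedMoment q 1 1‖ ≤ (C + 1) * (c * (log q + W + V)) := by
    have := norm_le_norm_add_norm_sub' (twistedMoment q 1 1)
      ((c * (((1 : ℕ).gcd 1 : ℝ) / √((1 : ℕ) * (1 : ℕ)) * log q) : ℝ) : ℂ)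
    refine this.trans ((add_le_add_right h11 _).trans ?_)
    rw [norm_real, norm_of_nonneg (by positivity)]
    have : 0 ≤ C * (c * log q) + c * (W + V) := by positivity
    linarith
  -- comparison with the main term, termwise
  have g2 : ‖(∑ p ∈ R, (pairTerm a p : ℂ) * twistedMoment q p.1 p.2) -
      ((c * log q : ℝ) : ℂ) * ∑ p ∈ R, (pairTerm a p : ℂ) *
        (((p.1.gcd p.2 : ℝ) / √(p.1 * p.2) : ℝ) : ℂ)‖ ≤
      C * (c * (smoothSum s 1 ^ 3 * W + E ^ 2 * V)) := by
    rw [mul_sum, ← sum_sub_distrib]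
    have hterm : ∀ p ∈ R, ‖(pairTerm a p : ℂ) * twistedMoment q p.1 p.2 -
        ((c * log q : ℝ) : ℂ) * ((pairTerm a p : ℂ) *
        (((p.1.gcd p.2 : ℝ) / √(p.1 * p.2) : ℝ) : ℂ))‖ ≤
        C * (c * (smoothTerm s 1 p.1 * smoothTerm s 1 p.2 * (p.1.gcd p.2 : ℝ) * W +
          smoothTerm s (1 / 2 - σ) p.1 * smoothTerm s (1 / 2 - σ) p.2 * V)) := by
      intro p hp
      have hn0 : ∀ τ n, 0 ≤ smoothTerm s τ n := fun τ n => smoothTerm_nonneg n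
      have b1 := abs_gcdForm_term_le ha p
      rw [← pairTerm_mul_gcd_div_sqrt, abs_mul, abs_of_nonneg (gcd_div_sqrt_mem_Icc _ _).1] at b1
      have b2 : |pairTerm a p| ≤ smoothTerm s (1 / 2 - σ) p.1 * smoothTerm s (1 / 2 - σ) p.2 :=
        (abs_pairTerm_le ha p).trans (mul_le_mul (smoothTerm_antitone (by linarith) _)
          (smoothTerm_antitone (by linarith) _) (hn0 _ _) (hn0 _ _))
      have hz : pairTerm a p ≠ 0 → p.1 ∈ factoredNumbers s ∧ p.2 ∈ factoredNumbers s := fun h => by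
        have hz : ∀ n ∉ factoredNumbers s, a n = 0 := fun n hn => by
          have := ha n
          rw [indicator_of_notMem hn] at this
          grind
        exact ⟨by_contra fun h' => h (by simp [pairTerm, hz _ h']),
          by_contra fun h' => h (by simp [pairTerm, hz _ h'])⟩
      rw [mul_left_comm, ← mul_sub, norm_mul, norm_real, norm_eq_abs]
      by_cases h0 : pairTerm a p = 0
      · rw [h0, abs_zero, zero_mul]
        bound
      obtain ⟨hm1, hm2⟩ := hz h0
      simp only [hR, Finset.mem_product, Finset.mem_range] at hp
      have ht := hT q p.1 p.2 N hq hne (hcop _ hm1) (hcop _ hm2) (by lia) (by lia) hN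
      rw [← ofReal_mul, show c * log q * ((p.1.gcd p.2 : ℝ) / √(p.1 * p.2)) =
        c * ((p.1.gcd p.2 : ℝ) / √(p.1 * p.2) * log q) by ring]
      calc _ ≤ _ := mul_le_mul_of_nonneg_left ht (abs_nonneg _)
        _ = C * (c * (|pairTerm a p| * ((p.1.gcd p.2 : ℝ) / √(p.1 * p.2)) * W +
            |pairTerm a p| * V)) := by ring
        _ ≤ _ := by gcongr
    refine (norm_sum_le_of_le _ hterm).trans ?_
    rw [← mul_sum, ← mul_sum, sum_add_distrib, ← sum_mul, ← sum_mul]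
    have hs1 := summable_smoothTerm_gcd s
    have hs2 := hasSum_smoothTerm_mul s (sub_pos.mpr hσ')
    have s1 := (hs1.1.sum_le_tsum R fun p _ => mul_nonneg (mul_nonneg (smoothTerm_nonneg _)
      (smoothTerm_nonneg _)) (cast_nonneg _)).trans hs1.2
    have s2 := sum_le_hasSum R (fun p _ => mul_nonneg (smoothTerm_nonneg _)
      (smoothTerm_nonneg _)) hs2
    gcongr
  have g3 : ‖((mollifiedMoment a q - c * (log q * gcdForm a) : ℝ) : ℂ)‖ ≤
      B * ((C + 1) * (c * (log q + W + V))) + C * (c * (smoothSum s 1 ^ 3 * W + E ^ 2 * V)) +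
        c * log q * B := by
    set x := ∑ p ∈ R, (pairTerm a p : ℂ) * twistedMoment q p.1 p.2
    set y := ∑ p ∈ R, (pairTerm a p : ℂ) * (((p.1.gcd p.2 : ℝ) / √(p.1 * p.2) : ℝ) : ℂ)
    have : ((mollifiedMoment a q - c * (log q * gcdForm a) : ℝ) : ℂ) =
        ((mollifiedMoment a q : ℂ) - x) + (x - ((c * log q : ℝ) : ℂ) * y) +
          ((c * log q : ℝ) : ℂ) * (y - gcdForm a) := by
      push_cast; ring
    rw [this]
    refine norm_add₃_le.trans (add_le_add (add_le_add (hm.trans ?_) g2) ?_)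
    · gcongr
    · rw [norm_mul, norm_real, norm_of_nonneg (by positivity), norm_sub_rev]
      gcongr
  rw [norm_real, norm_eq_abs] at g3
  refine g3.trans ?_
  have hQ0 : 0 ≤ smoothSum s 1 := (hasSum_smoothTerm s one_pos).nonneg smoothTerm_nonneg
  have : 0 ≤ c * (W + V) * B + 2 * (c * (smoothSum s 1 ^ 3 * W + E ^ 2 * V)) := by positivity
  linarith

end mollifiedMoment

/-! ### Coefficients of the inverse Euler product. -/

section eulerCoeff

variable {X σ : ℝ} {q : ℕ} {u : ℝ → ℝ}

/-- The primes `p ≤ X` not dividing `q`. -/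
def smallPrimes (X : ℝ) (q : ℕ) : Finset ℕ := {p ∈ Finset.Icc 0 ⌊X⌋₊ | p.Prime ∧ ¬ p ∣ q}

lemma mem_smallPrimes {p : ℕ} : p ∈ smallPrimes X q ↔ p ≤ ⌊X⌋₊ ∧ p.Prime ∧ ¬ p ∣ q := by
  simp [smallPrimes]

lemma smallPrimes_filter_prime : {p ∈ smallPrimes X q | p.Prime} = smallPrimes X q :=
  Finset.filter_true_of_mem fun _ hp => (mem_smallPrimes.mp hp).2.1

lemma coprime_of_mem_factoredNumbers {n : ℕ} (hn : n ∈ factoredNumbers (smallPrimes X q)) :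
    n.Coprime q :=
  Nat.coprime_of_dvd fun p hp hpn =>
    (mem_smallPrimes.mp (mem_factoredNumbers'.mp hn p hp hpn)).2.2

/-- The coefficients of the Dirichlet series of `exp(-logEulerPart)`. -/
def eulerCoeff (u : ℝ → ℝ) (X : ℝ) (q : ℕ) : ℕ → ℝ :=
  (factoredNumbers (smallPrimes X q)).indicator (expCoeff fun n => -primeWeight u X n)

lemma abs_neg_primeWeight_le (hu : IsWeight X u) (n : ℕ) :
    |-primeWeight u X n| ≤ 1 := by
  rw [abs_neg, abs_of_nonneg (primeWeight_mem_Icc hu n).1]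
  exact (primeWeight_mem_Icc hu n).2

lemma abs_eulerCoeff_le (hX : 2 ≤ X) (hu : IsWeight X u) (n : ℕ) :
    |eulerCoeff u X q n| ≤ (factoredNumbers (smallPrimes X q)).indicator (fun _ => (1 : ℝ)) n := by
  rw [eulerCoeff]
  by_cases hm : n ∈ factoredNumbers (smallPrimes X q)
  · rw [indicator_of_mem hm, indicator_of_mem hm]
    exact abs_expCoeff_le_one (abs_neg_primeWeight_le hu) n
  simp_all

/-- Restricting to primes `p ≤ X` with `p ∤ q` changes nothing in the exponent: the weight vanishes
for `n ≥ X`, and `χ(n) = 0` when `n` is not coprime to `q`. -/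
lemma exp_neg_logEulerPart (hX : 2 ≤ X) (hu : IsWeight X u) (χ : DirichletCharacter ℂ q) :
    cexp (-logEulerPart u X χ (1 / 2)) =
      LSeries (fun n => (eulerCoeff u X q n : ℂ) * χ n) (1 / 2) := by
  rw [eulerCoeff, LSeries_indicator_expCoeff χ _ (abs_neg_primeWeight_le hu) (by norm_num),
    logEulerPart, ← LSeries_neg]
  congr 2
  ext n
  rw [Pi.neg_apply]
  by_cases hw : primeWeight u X n = 0
  · simp_all
  rcases eq_or_ne n 0 with rfl | hn
  · simp
  by_cases hc : n.Coprime q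
  · have hnX : (n : ℝ) < X := by
      by_contra! h
      exact hw (primeWeight_eq_zero hX hu h)
    rw [indicator_of_mem (mem_factoredNumbers'.mpr fun p hp hpn => mem_smallPrimes.mpr
      ⟨(Nat.le_of_dvd (Nat.pos_of_ne_zero hn) hpn).trans (le_floor hnX.le), hp,
        fun h => hp.one_lt.ne' (Nat.eq_one_of_dvd_coprimes hc hpn h)⟩)]
    push_cast
    ring
  · rw [MulChar.map_nonunit χ (mt (ZMod.isUnit_iff_coprime n q).mp hc), mul_zero, mul_zero, neg_zero]

/-- Summing over divisors adds 1 to the weight `-w`. The result `v = 1 - w` vanishes up to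
`X^{1-1/X}`, so the mollifier cancels nearly everything. -/
lemma sum_divisors_eulerCoeff {r : ℕ} (hr : r ∈ factoredNumbers (smallPrimes X q)) :
    ∑ m ∈ r.divisors, eulerCoeff u X q m = expCoeff (fun n => weightCdf u (log n / log X)) r := by
  have h := sum_divisors_expCoeff (fun n => -primeWeight u X n) r
  simp only [primeWeight, ← sub_eq_add_neg, sub_sub_cancel] at h
  rw [← h]
  refine sum_congr rfl fun m hm => ?_
  rw [eulerCoeff, indicator_of_mem (mem_factoredNumbers_of_dvd hr (Nat.dvd_of_mem_divisors hm))]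
  rfl

lemma abs_weightCdf_le (hu : IsWeight X u) (t : ℝ) : |weightCdf u t| ≤ 1 := by
  rw [abs_of_nonneg (weightCdf_mem_Icc hu t).1]
  exact (weightCdf_mem_Icc hu t).2

/-- The exponent in the upper bound for the diagonalised gcd form. -/
def shortPrimeBound (X : ℝ) : ℝ :=
  X ^ (1 / X) - 1 + X ^ (1 / X) / X + properPowerTail (X / X ^ (1 / X))

lemma tendsto_div_rpow_inv : Tendsto (fun X : ℝ => X / X ^ (1 / X)) atTop atTop := by
  exact Tendsto.atTop_mul_pos (by norm_num : (0 : ℝ) < 1⁻¹) tendsto_id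
    (by simpa only [div_eq_mul_inv] using tendsto_rpow_div.inv₀ one_ne_zero)

lemma tendsto_shortPrimeBound : Tendsto shortPrimeBound atTop (𝓝 0) := by
  have h := ((tendsto_rpow_div.sub_const 1).add (tendsto_rpow_div.div_atTop tendsto_id)).add
    (tendsto_properPowerTail.comp tendsto_div_rpow_inv)
  rw [sub_self, add_zero, add_zero] at h
  exact h

/-- Only `n > Y = X^{1-1/X}` count. The window `(Y, X]` is so short that its primes need no sieve:
at most `X - Y + 1` integers, each weighing at most `1/Y`. Proper prime powers are covered by a
convergent tail. -/
lemma tsum_weightCdf_le (hX : 2 ≤ X) (hY : 2 ≤ X / X ^ (1 / X)) (hu : IsWeight X u) :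
    ∑' n : ℕ, Λ n * (factoredNumbers (smallPrimes X q)).indicator
      (fun n => weightCdf u (log n / log X)) n / log n / n ≤ shortPrimeBound X := by
  set Y := X / X ^ (1 / X) with hYdef
  have hX0 : 0 < X := by linarith
  have hY0 : 0 < Y := by linarith
  have hlX : 0 < log X := by bound
  have hlY : log Y = (1 - 1 / X) * log X := by
    rw [hYdef, log_div hX0.ne' (by positivity), log_rpow hX0]; ring
  have htail : HasSum ({n : ℕ | Y < n}.indicator properPowerTerm) (properPowerTail Y) :=
    (summable_properPowerTerm.indicator _).hasSum
  set P : Set ℕ := ((Finset.Ioc ⌊Y⌋₊ ⌊X⌋₊ : Finset ℕ) : Set ℕ) with hP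
  have hshort : HasSum (P.indicator fun _ => Y⁻¹) (∑ n ∈ Finset.Ioc ⌊Y⌋₊ ⌊X⌋₊, Y⁻¹) := by
    rw [← sum_congr rfl fun n hn => indicator_of_mem (s := P)
      (f := fun _ => Y⁻¹) (Finset.mem_coe.mpr hn)]
    exact hasSum_sum_of_ne_finset_zero fun n hn => indicator_of_notMem (by grind) _
  have hbound : ∀ n : ℕ, 0 ≤ Λ n * (factoredNumbers (smallPrimes X q)).indicator
      (fun n => weightCdf u (log n / log X)) n / log n / n ∧
      Λ n * (factoredNumbers (smallPrimes X q)).indicator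
      (fun n => weightCdf u (log n / log X)) n / log n / n ≤
      P.indicator (fun _ => Y⁻¹) n + {n : ℕ | Y < n}.indicator properPowerTerm n := fun n => by
    have hl := log_natCast_nonneg n
    have hΛ := vonMangoldt_nonneg (n := n)
    have h1 : 0 ≤ P.indicator (fun _ => Y⁻¹) n := indicator_nonneg (fun _ _ => by positivity) n
    have h2 : 0 ≤ {n : ℕ | Y < n}.indicator properPowerTerm n :=
      indicator_nonneg (fun _ _ => properPowerTerm_nonneg _) n
    by_cases hm : n ∈ factoredNumbers (smallPrimes X q)
    swap
    · rw [indicator_of_notMem hm]; grind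
    rw [indicator_of_mem hm]
    obtain ⟨hw0, hw1⟩ := weightCdf_mem_Icc hu (log n / log X)
    refine ⟨by positivity, ?_⟩
    rcases le_or_gt (n : ℝ) Y with hn | hn
    · rw [weightCdf_eq_zero hu]
      · grind
      · rw [div_le_iff₀ hlX, ← hlY]
        exact log_le_log (by exact_mod_cast Nat.pos_of_ne_zero hm.1) hn
    have h3 : Λ n * weightCdf u (log n / log X) / log n / n ≤ Λ n / log n / n := by bound
    refine h3.trans ?_
    by_cases hp : n.Prime
    · refine le_trans ?_ (le_add_of_nonneg_right h2)
      have hnP : n ∈ P := by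
        simpa [hP] using ⟨(Nat.floor_lt hY0.le).mpr hn,
          (mem_smallPrimes.mp (mem_factoredNumbers'.mp hm n hp dvd_rfl)).1⟩
      rw [indicator_of_mem hnP, vonMangoldt_apply_prime hp, div_self (log_pos
        (by linarith)).ne', one_div]
      gcongr
    · refine le_trans ?_ (le_add_of_nonneg_left h1)
      rw [indicator_of_mem (show n ∈ {n : ℕ | Y < n} from hn)]
      exact vonMangoldt_div_log_div_le (by exact_mod_cast (hY.trans_lt hn : (2 : ℝ) < n)) hp
  have hs := hshort.add htail
  refine (Summable.tsum_le_tsum (fun n => (hbound n).2) (Summable.of_nonneg_of_le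
    (fun n => (hbound n).1) (fun n => (hbound n).2) hs.summable) hs.summable).trans ?_
  rw [hs.tsum_eq, shortPrimeBound, sum_const, Nat.card_Ioc, nsmul_eq_mul]
  refine add_le_add_left ?_ _
  have hYX : Y ≤ X := div_le_self hX0.le (one_le_rpow (by linarith) (by positivity))
  rw [Nat.cast_sub (Nat.floor_le_floor hYX)]
  have e1 := Nat.floor_le hX0.le
  have e2 := Nat.lt_floor_add_one Y
  calc _ ≤ (X - Y + 1) * Y⁻¹ := mul_le_mul_of_nonneg_right (by linarith) (by positivity)
    _ = _ := by grind

/-- The lower bound is the term `r = 1` of the diagonalised form. Above, the divisor sums lie in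
`[0, 1]`, so squares are at most the values themselves, and their series is the exponential of the
sum over the short window. -/
lemma gcdForm_eulerCoeff_mem_Icc (hX : 2 ≤ X) (hY : 2 ≤ X / X ^ (1 / X)) (hu : IsWeight X u) :
    gcdForm (eulerCoeff u X q) * smoothSum (smallPrimes X q) 1 ∈
      Icc 1 (exp (shortPrimeBound X)) := by
  rw [gcdForm_mul_smoothSum (abs_eulerCoeff_le hX hu)]
  set s := smallPrimes X q
  set g : ℕ → ℝ := fun n => weightCdf u (log n / log X) with hg
  have hg1 : ∀ n, |g n| ≤ 1 := fun n => abs_weightCdf_le hu _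
  have hb : ∀ r, smoothTerm s 1 r * (∑ m ∈ r.divisors, eulerCoeff u X q m) ^ 2 ≤
      (factoredNumbers s).indicator (expCoeff g) r / r := fun r => by
    by_cases hr : r ∈ factoredNumbers s
    · rw [sum_divisors_eulerCoeff hr, smoothTerm, indicator_of_mem hr, indicator_of_mem hr,
        rpow_neg_one, inv_mul_eq_div]
      have h0 := expCoeff_nonneg (g := g) (fun n => (weightCdf_mem_Icc hu _).1) r
      have h1 := (le_abs_self _).trans (abs_expCoeff_le_one hg1 r)
      exact div_le_div_of_nonneg_right (by nlinarith)
        (cast_nonneg r)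
    · rw [smoothTerm, indicator_of_notMem hr, indicator_of_notMem hr, zero_mul, zero_div]
  have h0 : ∀ r, 0 ≤ smoothTerm s 1 r * (∑ m ∈ r.divisors, eulerCoeff u X q m) ^ 2 := fun r =>
    mul_nonneg (smoothTerm_nonneg r) (sq_nonneg _)
  have hsum : Summable fun r : ℕ => (factoredNumbers s).indicator (expCoeff g) r / r := by
    refine Summable.of_norm_bounded (hasSum_smoothTerm s one_pos).summable fun r => ?_
    rw [smoothTerm]
    by_cases hr : r ∈ factoredNumbers s
    · rw [indicator_of_mem hr, indicator_of_mem hr, norm_div, rpow_neg_one, ← one_div,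
        RCLike.norm_natCast]
      exact div_le_div_of_nonneg_right (abs_expCoeff_le_one hg1 r) (cast_nonneg r)
    simp_all
  have hsum' := Summable.of_nonneg_of_le h0 hb hsum
  constructor
  · have h1 : (1 : ℕ) ∈ factoredNumbers s := by simp [Nat.mem_factoredNumbers]
    refine le_trans (le_of_eq ?_) (hsum'.le_tsum 1 fun r _ => h0 r)
    rw [smoothTerm, indicator_of_mem h1]
    simp [eulerCoeff, indicator_of_mem (show 1 ∈ factoredNumbers (smallPrimes X q) from h1),
      expCoeff_one]
  · refine (hsum'.tsum_le_tsum hb hsum).trans ?_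
    rw [tsum_indicator_expCoeff_div s hg1, exp_le_exp]
    exact tsum_weightCdf_le hX hY hu

end eulerCoeff

/-! ### Bounds for the Euler products and the normalised moment. -/

section bounds

variable {X σ : ℝ} {q : ℕ} {u : ℝ → ℝ}

lemma sum_inv_sqrt_le (N : ℕ) : ∑ n ∈ Finset.range N, (√(n + 1 : ℕ))⁻¹ ≤ 2 * √N := by
  induction N with
  | zero => simp
  | succ n ih =>
    rw [Finset.sum_range_succ]
    have h0 : 0 < √(n + 1 : ℕ) := by positivity
    have h1 := sq_sqrt (cast_nonneg (α := ℝ) (n + 1))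
    have h2 := sq_sqrt (cast_nonneg (α := ℝ) n)
    push_cast at *
    have h3 : (√(n + 1 : ℝ))⁻¹ ≤ 2 * (√(n + 1) - √n) := by
      rw [inv_le_iff_one_le_mul₀ h0]
      nlinarith
    linarith

/-- `p^{-τ} ≤ 2^{-1/4} ≤ 7/8`, and `1/(1-t) ≤ 1 + 8t` for `0 ≤ t ≤ 7/8`. -/
lemma inv_one_sub_rpow_le {p : ℕ} (hp : 2 ≤ p) {τ : ℝ} (hτ : 1 / 4 ≤ τ) :
    0 < 1 - (p : ℝ) ^ (-τ) ∧ (1 - (p : ℝ) ^ (-τ))⁻¹ ≤ exp (8 * (p : ℝ) ^ (-τ)) := by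
  have hp2 : (2 : ℝ) ≤ p := mod_cast hp
  have h1 : (p : ℝ) ^ (-τ) ≤ 7 / 8 := by
    calc (p : ℝ) ^ (-τ) ≤ (p : ℝ) ^ (-(1 / 4) : ℝ) :=
          rpow_le_rpow_of_exponent_le (by linarith) (by linarith)
      _ ≤ (2 : ℝ) ^ (-(1 / 4) : ℝ) := rpow_le_rpow_of_nonpos two_pos hp2 (by norm_num)
      _ ≤ 7 / 8 := by
        rw [← pow_le_pow_iff_left₀ (by positivity) (by norm_num) (four_ne_zero),
          ← rpow_mul_natCast two_pos.le]
        norm_num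
  have h0 : 0 ≤ (p : ℝ) ^ (-τ) := by positivity
  generalize (p : ℝ) ^ (-τ) = t at *
  refine ⟨by linarith, le_trans ?_ (add_one_le_exp _)⟩
  rw [inv_le_iff_one_le_mul₀ (by linarith)]
  nlinarith

/-- The logarithm is at most a constant times `∑_{n ≤ X} n^{-1/2+σ}`; primes may be replaced by all
integers. The exponent `1/2` of `X` here is what produces the barrier `(log q)^2` for `X`. -/
lemma smoothSum_le_exp (hX : 1 ≤ X) (hσ : 0 ≤ σ) (hσ' : σ ≤ 1 / 4) :
    smoothSum (smallPrimes X q) (1 / 2 - σ) ≤ exp (16 * X ^ (1 / 2 + σ)) := by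
  have hX0 : 0 < X := by linarith
  have hp2 : ∀ p ∈ smallPrimes X q, 2 ≤ p := fun p hp => (mem_smallPrimes.mp hp).2.1.two_le
  rw [smoothSum, smallPrimes_filter_prime]
  refine (prod_le_prod (fun p hp => inv_nonneg.mpr (inv_one_sub_rpow_le (hp2 p hp)
    (by linarith)).1.le) fun p hp => (inv_one_sub_rpow_le (hp2 p hp) (by linarith)).2).trans ?_
  rw [← exp_sum, exp_le_exp, ← mul_sum]
  have h1 : ∀ p ∈ smallPrimes X q, (p : ℝ) ^ (-(1 / 2 - σ)) ≤ X ^ σ * (√p)⁻¹ := by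
    intro p hp
    have hp0 : (0 : ℝ) < p := by have := hp2 p hp; positivity
    have hpX : (p : ℝ) ≤ X := (Nat.le_floor_iff hX0.le).mp (mem_smallPrimes.mp hp).1
    rw [neg_sub, rpow_sub hp0, ← sqrt_eq_rpow, div_eq_mul_inv]
    gcongr
  have h2 : ∑ p ∈ smallPrimes X q, (√p)⁻¹ ≤ 2 * √X := by
    have h3 : smallPrimes X q ⊆ (Finset.range ⌊X⌋₊).image (· + 1) := fun p hp => by
      have := hp2 p hp
      have := (mem_smallPrimes.mp hp).1
      exact Finset.mem_image.mpr ⟨p - 1, Finset.mem_range.mpr (by lia), by lia⟩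
    refine (Finset.sum_le_sum_of_subset_of_nonneg h3 fun _ _ _ => by positivity).trans ?_
    rw [Finset.sum_image fun _ _ _ _ h => Nat.succ_injective h]
    refine (sum_inv_sqrt_le _).trans ?_
    gcongr
    exact Nat.floor_le hX0.le
  calc _ ≤ 8 * ∑ p ∈ smallPrimes X q, X ^ σ * (√p)⁻¹ := by bound
    _ ≤ 8 * (X ^ σ * (2 * √X)) := by rw [← mul_sum]; gcongr
    _ = _ := by rw [rpow_add hX0, sqrt_eq_rpow]; ring

lemma smoothSum_one (X : ℝ) (q : ℕ) :
    smoothSum (smallPrimes X q) 1 = (∏ p ∈ smallPrimes X q, (1 - 1 / (p : ℝ)))⁻¹ := by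
  rw [smoothSum, smallPrimes_filter_prime, Finset.prod_inv_distrib]
  simp only [rpow_neg_one, one_div]

lemma prod_smallPrimes_pos (X : ℝ) (q : ℕ) : 0 < ∏ p ∈ smallPrimes X q, (1 - 1 / (p : ℝ)) :=
  prod_pos fun _ hp => one_sub_inv_prime_pos (mem_smallPrimes.mp hp).2.1

lemma largePrimeProduct_eq (X : ℝ) (q : ℕ) :
    largePrimeProduct X q = ∏ p ∈ q.primeFactors.filter fun p : ℕ => X < p, (1 - 1 / (p : ℝ)) := by
  classical
  rw [largePrimeProduct, eq_comm]
  refine Finset.prod_bij (fun p _ => (p : ℝ)) (fun p hp => ?_)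
    (fun _ _ _ _ h => by simpa using h) (fun b hb => ?_) fun _ _ => rfl
  · simp_all
  · simp [] at hb ⊢
    grind

lemma largePrimeProduct_pos (X : ℝ) (q : ℕ) : 0 < largePrimeProduct X q := by
  rw [largePrimeProduct_eq]
  exact prod_pos fun _ hp => one_sub_inv_prime_pos (prime_of_mem_primeFactors (mem_filter.mp hp).1)

lemma prod_primeFactors_small_mul (hX : 0 ≤ X) (hq : q ≠ 0) :
    (∏ p ∈ Finset.Icc 0 ⌊X⌋₊ with p.Prime ∧ p ∣ q, (1 - 1 / (p : ℝ))) *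
      largePrimeProduct X q = q.totient / q := by
  rw [← prod_one_sub_inv_primeFactors hq, largePrimeProduct_eq,
    ← Finset.prod_filter_not_mul_prod_filter q.primeFactors fun p => X < (p : ℝ)]
  congr 1
  refine prod_congr ?_ fun _ _ => rfl
  ext p
  simp only [mem_filter, Finset.mem_Icc, zero_le, not_lt, Nat.mem_primeFactors, Nat.le_floor_iff hX]
  tauto

lemma mertensProduct_eq_mul (X : ℝ) (q : ℕ) : mertensProduct X =
    (∏ p ∈ Finset.Icc 0 ⌊X⌋₊ with p.Prime ∧ p ∣ q, (1 - 1 / (p : ℝ))) *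
      ∏ p ∈ smallPrimes X q, (1 - 1 / (p : ℝ)) := by
  rw [mertensProduct, ← Finset.prod_filter_mul_prod_filter_not _ (fun p => p ∣ q),
    Finset.filter_filter, Finset.filter_filter, smallPrimes]

/-- The primes dividing `q` are split at `X`, and those at most `X` are expressed as all primes up
to `X` divided by those not dividing `q`. The last factor is exactly the one that the gcd form
cancels. -/
lemma totient_div_eq (hX : 0 ≤ X) (hq : q ≠ 0) : (q.totient / q : ℝ) =
    mertensProduct X * largePrimeProduct X q * smoothSum (smallPrimes X q) 1 := by
  rw [← prod_primeFactors_small_mul hX hq, smoothSum_one, mertensProduct_eq_mul X q]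
  have := (prod_smallPrimes_pos X q).ne'
  field_simp

lemma smoothSum_one_le (X : ℝ) (q : ℕ) : smoothSum (smallPrimes X q) 1 ≤ (mertensProduct X)⁻¹ := by
  rw [smoothSum_one]
  refine inv_anti₀ (mertensProduct_pos X) ?_
  rw [mertensProduct_eq_mul X q]
  refine mul_le_of_le_one_left (prod_smallPrimes_pos X q).le (prod_le_one (fun p hp => ?_)
    fun p _ => ?_)
  · exact (one_sub_inv_prime_pos (mem_filter.mp hp).2.1).le
  simp

/-- Dividing by the expected main term introduces one more factor `smoothSum 1`. In the power-saving
and truncation terms it is absorbed into the Euler product at `1/2 - σ`, whence the cubes; in the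
logarithmic term it must be kept as it stands, giving the fourth power. -/
lemma exists_mollifiedMoment_div_le : ∃ C : ℝ, 0 < C ∧ ∀ (q : ℕ) [NeZero q] (X : ℝ) (u : ℝ → ℝ)
    (N : ℕ) (σ : ℝ), (primitiveChars q).Nonempty → 2 ≤ X → IsWeight X u → 0 ≤ σ → σ ≤ 1 / 4 →
    1 ≤ N → 1 ≤ log q → log N ≤ log q →
    |mollifiedMoment (eulerCoeff u X q) q / (mertensProduct X * largePrimeProduct X q *
      log q) - gcdForm (eulerCoeff u X q) * smoothSum (smallPrimes X q) 1| ≤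
      C * ((N : ℝ) ^ (-σ) * smoothSum (smallPrimes X q) (1 / 2 - σ) ^ 3 +
        smoothSum (smallPrimes X q) 1 ^ 4 * ((√(log q) + 1 + log N) / log q) +
        smoothSum (smallPrimes X q) (1 / 2 - σ) ^ 3 *
          ((N : ℝ) ^ 2 * (q : ℝ) ^ (-(3 / 16) : ℝ))) := by
  obtain ⟨C, hC, h⟩ := exists_mollifiedMoment_le
  refine ⟨4 * C, by positivity, fun q _ X u N σ hne hX hu hσ hσ' hN hq hNq => ?_⟩
  have hq1 : q ≠ 1 := fun h => by simp [h] at hq; linarith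
  have h1 := h q (smallPrimes X q) (eulerCoeff u X q) N σ hq1 hne
    (fun n => coprime_of_mem_factoredNumbers) (abs_eulerCoeff_le hX hu) hσ (by linarith) hN
  have hN1 : (1 : ℝ) ≤ N := mod_cast hN
  have hlN := log_nonneg hN1
  have hsq : √(log q) ≤ log q := by rw [sqrt_le_left (by linarith)]; nlinarith
  have hc := totient_div_eq (q := q) (by linarith : 0 ≤ X) (NeZero.ne q)
  have hm := mertensProduct_pos X
  have hL := largePrimeProduct_pos X q
  have hQE : smoothSum (smallPrimes X q) 1 ≤ smoothSum (smallPrimes X q) (1 / 2 - σ) :=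
    hasSum_le (smoothTerm_antitone (by linarith)) (hasSum_smoothTerm _ one_pos)
      (hasSum_smoothTerm _ (by linarith))
  have hQ0 : 0 < smoothSum (smallPrimes X q) 1 := by
    rw [smoothSum_one]; exact inv_pos.mpr (prod_smallPrimes_pos X q)
  have hs0 := sqrt_nonneg (log q)
  have hNσ : (N : ℝ) ^ (-σ) ≤ 1 := rpow_le_one_of_one_le_of_nonpos hN1 (by linarith)
  have hNσ0 : 0 ≤ (N : ℝ) ^ (-σ) := by positivity
  have hV0 : 0 ≤ (N : ℝ) ^ 2 * (q : ℝ) ^ (-(3 / 16) : ℝ) := by positivity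
  rw [hc] at h1
  generalize mollifiedMoment (eulerCoeff u X q) q = A at *
  generalize gcdForm (eulerCoeff u X q) = S at *
  generalize smoothSum (smallPrimes X q) 1 = Q at *
  generalize smoothSum (smallPrimes X q) (1 / 2 - σ) = E at *
  generalize (N : ℝ) ^ (-σ) = ν at *
  generalize (N : ℝ) ^ 2 * (q : ℝ) ^ (-(3 / 16) : ℝ) = V at *
  have hWy : √(log q) + 1 + log N ≤ 3 * log q := by linarith
  have hW0 : 0 ≤ √(log q) + 1 + log N := by positivity
  generalize √(log q) + 1 + log N = W at *
  generalize log q = y at *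
  generalize mertensProduct X = m at *
  generalize largePrimeProduct X q = Lp at *
  have hy0 : 0 < y := by linarith
  have hE0 : 0 < E := by linarith
  have e1 : A / (m * Lp * y) - S * Q = (A - m * Lp * Q * (y * S)) / (m * Lp * y) := by field_simp
  rw [e1, abs_div, abs_of_pos (show 0 < m * Lp * y by positivity), div_le_iff₀ (by positivity)]
  refine h1.trans ?_
  have e2 : Q * (ν * E ^ 2 * (y + W + V) + (Q ^ 3 * W + E ^ 2 * V)) ≤
      4 * ((ν * E ^ 3 + Q ^ 4 * (W / y) + E ^ 3 * V) * y) := by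
    have a1 : Q * (ν * E ^ 2 * (y + W)) ≤ ν * E ^ 3 * (4 * y) := by
      calc _ ≤ E * (ν * E ^ 2 * (y + W)) := by gcongr
        _ = ν * E ^ 3 * (y + W) := by ring
        _ ≤ _ := by bound
    have a2 : Q * (ν * E ^ 2 * V) ≤ E ^ 3 * V * y := by
      calc _ ≤ E * (1 * E ^ 2 * V) := by gcongr
        _ = E ^ 3 * V * 1 := by ring
        _ ≤ _ := by gcongr
    have a3 : Q * (E ^ 2 * V) ≤ E ^ 3 * V * y := by
      calc _ ≤ E * (E ^ 2 * V) := by gcongr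
        _ = E ^ 3 * V * 1 := by ring
        _ ≤ _ := by gcongr
    have a4 : Q ^ 4 * (W / y) * y = Q ^ 4 * W := by field_simp
    have a5 : 0 ≤ Q ^ 4 * W := by positivity
    have a6 : 0 ≤ E ^ 3 * V * y := by positivity
    nlinarith
  calc _ = C * (m * Lp) * (Q * (ν * E ^ 2 * (y + W + V) + (Q ^ 3 * W + E ^ 2 * V))) := by ring
    _ ≤ C * (m * Lp) * (4 * ((ν * E ^ 3 + Q ^ 4 * (W / y) + E ^ 3 * V) * y)) := by gcongr
    _ = _ := by ring

end bounds

lemma tendsto_rpow_sub_rpow_atBot {α θ c : ℝ} (K : ℝ) (h : α < θ) (hθ : 0 < θ) (hc : 0 < c) :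
    Tendsto (fun y : ℝ => K * y ^ α - c * y ^ θ) atTop atBot := by
  have h1 : Tendsto (fun y : ℝ => K * y ^ (-(θ - α)) - c) atTop (𝓝 (K * 0 - c)) :=
    ((tendsto_rpow_neg_atTop (sub_pos.mpr h)).const_mul K).sub_const c
  refine ((tendsto_rpow_atTop hθ).atTop_mul_neg (by linarith) h1).congr' ?_
  filter_upwards [eventually_gt_atTop 0] with y hy
  rw [mul_sub, mul_left_comm, ← rpow_add hy]
  ring_nf

/-! ### Choice of parameters and the mollified asymptotic. -/

section asymptotic

variable {ι : Type*} {l : Filter ι} {X : ι → ℝ} {q : ι → ℕ} [∀ i, NeZero (q i)] {u : ι → ℝ → ℝ}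
  {δ : ℝ}

/-- The second moment of the mollified central values. -/
lemma tendsto_mollifiedMoment_div (hδ : 0 < δ) (hδ1 : δ ≤ 1) (hX2 : ∀ i, 2 ≤ X i)
    (hu : ∀ i, IsWeight (X i) (u i)) (hprim : ∀ i, (primitiveChars (q i)).Nonempty)
    (hX : Tendsto X l atTop) (hq : Tendsto q l atTop)
    (hXq : X =O[l] fun i => log (q i) ^ (2 - δ)) :
    Tendsto (fun i => mollifiedMoment (eulerCoeff (u i) (X i) (q i)) (q i) /
      (mertensProduct (X i) * largePrimeProduct (X i) (q i) * log (q i))) l (𝓝 1) := by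
  obtain ⟨C, hC, hmain⟩ := exists_mollifiedMoment_div_le
  obtain ⟨K, hK, hXK⟩ := hXq.exists_pos
  set y : ι → ℝ := fun i => log (q i)
  have hyt : Tendsto y l atTop := tendsto_log_atTop.comp (tendsto_natCast_atTop_atTop.comp hq)
  -- With `y = log q`, `(2 - δ)(1/2 + σ) ≤ β`, so the Euler product at `1/2 - σ`, cubed, is at most
  -- `exp(K₂ y^β)`. The length `N ≈ exp(y^θ)` with `β < θ < 1` is large enough for `N^{-σ}` to beat
  -- this, and small enough for both to be negligible against `q^{3/16}`.
  set σ := δ / 16 with hσ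
  set θ := 1 - δ / 8 with hθ
  set β := 1 - 3 * δ / 8 with hβ
  set K₂ := 48 * K ^ (1 / 2 + σ) with hK₂
  set N : ι → ℕ := fun i => ⌈exp (y i ^ θ)⌉₊
  have hy1 : ∀ᶠ i in l, 1 ≤ y i := hyt.eventually_ge_atTop 1
  -- the Euler product on the line `1/2 - σ`
  have hE : ∀ᶠ i in l, smoothSum (smallPrimes (X i) (q i)) (1 / 2 - σ) ^ 3 ≤
      exp (K₂ * y i ^ β) := by
    filter_upwards [hXK.bound, hy1] with i hi hyi
    have hX0 : 0 < X i := by grind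
    rw [norm_of_nonneg hX0.le, norm_of_nonneg (by positivity)] at hi
    have h1 : X i ^ (1 / 2 + σ) ≤ K ^ (1 / 2 + σ) * y i ^ β := by
      calc _ ≤ (K * y i ^ (2 - δ)) ^ (1 / 2 + σ) := rpow_le_rpow hX0.le hi (by positivity)
        _ = K ^ (1 / 2 + σ) * y i ^ ((2 - δ) * (1 / 2 + σ)) := by
            rw [mul_rpow hK.le (by positivity), ← rpow_mul (by linarith)]
        _ ≤ _ := mul_le_mul_of_nonneg_left (rpow_le_rpow_of_exponent_le hyi
            (by nlinarith)) (by positivity)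
    have h2 := smoothSum_le_exp (q := q i) (σ := σ) (by grind : 1 ≤ X i) (by positivity)
      (by linarith)
    have h0 : 0 ≤ smoothSum (smallPrimes (X i) (q i)) (1 / 2 - σ) :=
      (hasSum_smoothTerm _ (by linarith)).nonneg smoothTerm_nonneg
    refine (pow_le_pow_left₀ h0 h2 3).trans ?_
    rw [← exp_nat_mul, exp_le_exp, hK₂]
    linarith
  have hN1 : ∀ i, 1 ≤ N i := fun i => Nat.one_le_ceil_iff.mpr (exp_pos _)
  have hNlow : ∀ i, exp (y i ^ θ) ≤ N i := by bound
  have hNup : ∀ᶠ i in l, (N i : ℝ) ≤ exp (1 + y i ^ θ) := by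
    filter_upwards [hy1] with i hi
    have h1 := (Nat.ceil_lt_add_one (exp_pos (y i ^ θ)).le).le
    have h2 := one_le_exp (show 0 ≤ y i ^ θ by positivity)
    have h3 := add_one_le_exp (1 : ℝ)
    rw [exp_add]
    nlinarith
  have hlogN : ∀ᶠ i in l, log (N i) ≤ 1 + y i ^ θ := by
    filter_upwards [hNup] with i hi
    rw [← log_exp (1 + y i ^ θ)]
    gcongr
  have hθ' : ∀ᶠ i in l, 1 + y i ^ θ ≤ y i := by
    have h := (tendsto_rpow_sub_rpow_atBot (α := θ) (θ := 1) 1 (by linarith) one_pos one_pos).comp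
      hyt
    filter_upwards [h.eventually_le_atBot (-1)] with i hi
    simp only [Function.comp_apply, rpow_one] at hi
    linarith
  -- the three error terms
  have t1 : Tendsto (fun i => (N i : ℝ) ^ (-σ) *
      smoothSum (smallPrimes (X i) (q i)) (1 / 2 - σ) ^ 3) l (𝓝 0) := by
    have h := tendsto_exp_atBot.comp ((tendsto_rpow_sub_rpow_atBot (α := β) (θ := θ) K₂
      (by linarith) (by linarith) (show 0 < σ by positivity)).comp hyt)
    have hE0 : ∀ i, 0 ≤ smoothSum (smallPrimes (X i) (q i)) (1 / 2 - σ) := fun i =>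
      (hasSum_smoothTerm _ (by linarith)).nonneg smoothTerm_nonneg
    refine squeeze_zero' (.of_forall fun i => mul_nonneg (by positivity)
      (pow_nonneg (hE0 i) 3)) ?_ h
    filter_upwards [hE] with i hi
    simp only [Function.comp_apply]
    rw [sub_eq_add_neg (K₂ * y i ^ β), exp_add, mul_comm]
    refine mul_le_mul hi ?_ (by positivity) (exp_pos _).le
    calc (N i : ℝ) ^ (-σ) ≤ exp (y i ^ θ) ^ (-σ) :=
          rpow_le_rpow_of_nonpos (exp_pos _) (hNlow i) (by linarith)
      _ = _ := by rw [← exp_mul]; ring_nf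
  have t3 : Tendsto (fun i => smoothSum (smallPrimes (X i) (q i)) (1 / 2 - σ) ^ 3 *
      ((N i : ℝ) ^ 2 * (q i : ℝ) ^ (-(3 / 16) : ℝ))) l (𝓝 0) := by
    have h := (tendsto_exp_atBot.comp ((tendsto_rpow_sub_rpow_atBot (α := θ) (θ := 1) (K₂ + 2)
      (by linarith) one_pos (show (0 : ℝ) < 3 / 16 by norm_num)).comp hyt)).const_mul (exp 2)
    rw [mul_zero] at h
    have hE0 : ∀ i, 0 ≤ smoothSum (smallPrimes (X i) (q i)) (1 / 2 - σ) := fun i =>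
      (hasSum_smoothTerm _ (by linarith)).nonneg smoothTerm_nonneg
    refine squeeze_zero' (.of_forall fun i => mul_nonneg (pow_nonneg (hE0 i) 3)
      (by positivity)) ?_ h
    filter_upwards [hE, hNup, hy1] with i hi hNi hyi
    have hq0 : (0 : ℝ) < q i := mod_cast Nat.pos_of_ne_zero (NeZero.ne (q i))
    simp only [Function.comp_apply, rpow_one]
    have e1 : (N i : ℝ) ^ 2 ≤ exp (2 + 2 * y i ^ θ) := by
      refine (pow_le_pow_left₀ (cast_nonneg _) hNi 2).trans (le_of_eq ?_)
      rw [← exp_nat_mul]; grind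
    have e2 : (q i : ℝ) ^ (-(3 / 16) : ℝ) = exp (-(3 / 16) * y i) := by
      rw [rpow_def_of_pos hq0, mul_comm]
    have e3 : y i ^ β ≤ y i ^ θ := by bound
    rw [e2]
    calc _ ≤ exp (K₂ * y i ^ β) * (exp (2 + 2 * y i ^ θ) * exp (-(3 / 16) * y i)) :=
          by gcongr
      _ = exp (K₂ * y i ^ β + (2 + 2 * y i ^ θ + -(3 / 16) * y i)) := by rw [← exp_add, ← exp_add]
      _ ≤ exp (2 + ((K₂ + 2) * y i ^ θ - 3 / 16 * y i)) := by
          have : K₂ * y i ^ β ≤ K₂ * y i ^ θ := by gcongr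
          exact exp_le_exp.mpr (by linarith)
      _ = _ := exp_add _ _
  -- At exponent 1 the Euler product is `O(log X) = o(y^{δ/64})`. Its fourth power costs at most
  -- `y^{δ/16}`, against the saving `y^{θ-1} = y^{-δ/8}`.
  have t2 : Tendsto (fun i => smoothSum (smallPrimes (X i) (q i)) 1 ^ 4 *
      ((√(y i) + 1 + log (N i)) / y i)) l (𝓝 0) := by
    have hlog : (fun i => log (X i)) =o[l] fun i => y i ^ (δ / 64) := by
      have h1 : (fun z : ℝ => log K + 2 * log z) =o[atTop] fun z => z ^ (δ / 64) :=
        (isLittleO_const_left.mpr (Or.inr (tendsto_norm_atTop_atTop.comp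
          (tendsto_rpow_atTop (by positivity))))).add
          ((isLittleO_log_rpow_atTop (by positivity)).const_mul_left 2)
      refine IsBigO.trans_isLittleO (IsBigO.of_bound 1 ?_) (h1.comp_tendsto hyt)
      filter_upwards [hXK.bound, hy1] with i hi hyi
      have hX0 : 0 < X i := by grind
      rw [norm_of_nonneg hX0.le, norm_of_nonneg (by positivity)] at hi
      rw [norm_of_nonneg (log_nonneg (by grind)), one_mul]
      refine le_trans ?_ (le_abs_self _)
      have h2 := log_le_log hX0 hi
      rw [log_mul hK.ne' (by positivity), log_rpow (by linarith)] at h2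
      have := log_nonneg hyi
      simp only [Function.comp_apply]
      nlinarith
    have hQ : (fun i => smoothSum (smallPrimes (X i) (q i)) 1) =O[l] fun i => log (X i) := by
      have h1 := (tendsto_mertensProduct.inv₀ (exp_pos _).ne').comp hX
      refine IsBigO.trans (IsBigO.of_bound 1 (.of_forall fun i => ?_))
        (((isBigO_refl (fun i => log (X i)) l).mul (h1.isBigO_one ℝ)).congr
          (fun i => ?_) fun i => mul_one _ : (fun i => (mertensProduct (X i))⁻¹) =O[l] _)
      · rw [one_mul, norm_of_nonneg ((hasSum_smoothTerm _ one_pos).nonneg smoothTerm_nonneg)]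
        exact (smoothSum_one_le _ _).trans (le_abs_self _)
      · have := (log_pos (by grind : 1 < X i)).ne'
        grind
    have hW : (fun i => (√(y i) + 1 + log (N i)) / y i) =O[l] fun i => y i ^ (θ - 1) := by
      refine IsBigO.of_bound 4 ?_
      filter_upwards [hlogN, hy1] with i hi hyi
      have h1 : √(y i) ≤ y i ^ θ := by rw [sqrt_eq_rpow]; bound
      have h2 : 1 ≤ y i ^ θ := one_le_rpow hyi (by linarith)
      rw [norm_of_nonneg (by positivity), norm_of_nonneg (by positivity),
        rpow_sub_one (by linarith), ← mul_div_assoc]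
      gcongr
      linarith
    have h4 := ((hQ.trans_isLittleO hlog).pow (n := 4) (by norm_num)).mul_isBigO hW
    refine (h4.trans_isBigO (IsBigO.of_bound 1 ?_)).tendsto_zero_of_tendsto
      (tendsto_const_nhds (x := (1 : ℝ)))
    filter_upwards [hy1] with i hyi
    have hyp : 0 < y i := by linarith
    rw [← rpow_mul_natCast hyp.le, ← rpow_add hyp, norm_of_nonneg (by positivity),
      norm_one, one_mul]
    exact rpow_le_one_of_one_le_of_nonpos hyi (by linarith)
  have herr := (((t1.add t2).add t3).const_mul C)
  rw [add_zero, add_zero, mul_zero] at herr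
  have hB : Tendsto (fun i => gcdForm (eulerCoeff (u i) (X i) (q i)) *
      smoothSum (smallPrimes (X i) (q i)) 1) l (𝓝 1) := by
    have hev := (tendsto_div_rpow_inv.comp hX).eventually_ge_atTop 2
    have h1 := (tendsto_shortPrimeBound.comp hX).rexp
    rw [exp_zero] at h1
    refine tendsto_of_tendsto_of_tendsto_of_le_of_le' tendsto_const_nhds h1 ?_ ?_
    · filter_upwards [hev] with i hi using (gcdForm_eulerCoeff_mem_Icc (hX2 i) hi (hu i)).1
    · filter_upwards [hev] with i hi using (gcdForm_eulerCoeff_mem_Icc (hX2 i) hi (hu i)).2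
  have hdiff : Tendsto (fun i => mollifiedMoment (eulerCoeff (u i) (X i) (q i)) (q i) /
      (mertensProduct (X i) * largePrimeProduct (X i) (q i) * y i) -
      gcdForm (eulerCoeff (u i) (X i) (q i)) * smoothSum (smallPrimes (X i) (q i)) 1) l (𝓝 0) := by
    refine squeeze_zero_norm' ?_ herr
    filter_upwards [hy1, hlogN, hθ'] with i hyi hNi hθi
    exact hmain (q i) (X i) (u i) (N i) σ (hprim i) (hX2 i) (hu i) (by positivity) (by linarith)
      (hN1 i) hyi (hNi.trans hθi)
  simpa using hdiff.add hB

end asymptotic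

/-- The bound for the logarithm of the ratio of `|Z_X(χ)|` and `|L(1/2, χ) / P_X(χ)|`. -/
def hybridError (X : ℝ) : ℝ := 16 * exp (-log X / 4) / log X

lemma tendsto_hybridError : Tendsto hybridError atTop (𝓝 0) := by
  have h1 : Tendsto (fun X => exp (-log X / 4)) atTop (𝓝 0) :=
    tendsto_exp_atBot.comp
      ((tendsto_neg_atTop_atBot.comp tendsto_log_atTop).atBot_div_const (by norm_num))
  exact (h1.const_mul 16).div_atTop tendsto_log_atTop

lemma secondMoment_mem_Icc {X : ℝ} {q : ℕ} [NeZero q] {u : ℝ → ℝ} (hq : q ≠ 1) (hX : 2 ≤ X)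
    (hu : IsWeight X u) : secondMoment u X q ∈
      Icc (mollifiedMoment (eulerCoeff u X q) q * exp (-(2 * hybridError X)))
        (mollifiedMoment (eulerCoeff u X q) q * exp (2 * hybridError X)) := by
  have h : ∀ χ ∈ primitiveChars q, ∃ t : ℝ, |t| ≤ hybridError X ∧ ‖Z u X χ‖ ^ 2 =
      ‖χ.LFunction (1 / 2)‖ ^ 2 *
        ‖LSeries (fun n => (eulerCoeff u X q n : ℂ) * χ n) (1 / 2)‖ ^ 2 * exp (2 * t) :=
    fun χ hχ => by
      obtain ⟨t, ht, hZ⟩ := norm_Z_eq (mem_primitiveChars.mp hχ) hq hX hu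
      refine ⟨t, ht, ?_⟩
      rw [hZ, exp_neg_logEulerPart hX hu, norm_mul, mul_pow, mul_pow, ← exp_nat_mul]
      norm_num
  rw [secondMoment, mollifiedMoment, mul_assoc, mul_assoc, sum_mul, sum_mul]
  constructor <;> refine mul_le_mul_of_nonneg_left (sum_le_sum fun χ hχ => ?_)
    (by positivity) <;> obtain ⟨t, ht, hZ⟩ := h χ hχ <;> rw [hZ] <;>
    refine mul_le_mul_of_nonneg_left (exp_le_exp.mpr ?_) (by positivity) <;>
    grind

/-- In the worst case every prime in `(X, Y]` divides `q`. Beyond `Y` there are at most `ω(q)`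
factors, each at least `1 - 1/Y`, and Bernoulli's inequality applies. -/
lemma le_largePrimeProduct {X Y : ℝ} (hX : 1 ≤ X) (hXY : X ≤ Y) (q : ℕ) :
    mertensProduct Y / mertensProduct X * (1 - (q.primeFactors.card : ℝ) / Y) ≤
      largePrimeProduct X q := by
  have hY0 : 0 < Y := by linarith
  have h0 : ∀ p : ℕ, 0 ≤ 1 - 1 / (p : ℝ) := fun p => by
    rcases Nat.eq_zero_or_pos p with rfl | hp
    · simp
    bound
  have h1 : ∀ p : ℕ, 1 - 1 / (p : ℝ) ≤ 1 := by simp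
  have hM : mertensProduct Y / mertensProduct X =
      ∏ p ∈ Finset.Ioc ⌊X⌋₊ ⌊Y⌋₊ with p.Prime, (1 - 1 / (p : ℝ)) := by
    rw [div_eq_iff (mertensProduct_pos X).ne', mertensProduct, mertensProduct, mul_comm,
      ← Finset.prod_union (Finset.disjoint_left.mpr fun p hp hp' => by grind),
      ← Finset.filter_union]
    congr 2
    ext p
    have := Nat.floor_le_floor hXY
    grind
  rw [largePrimeProduct_eq, ← Finset.prod_filter_not_mul_prod_filter _ fun p : ℕ => Y < p, hM]
  have hsmall : ∏ p ∈ Finset.Ioc ⌊X⌋₊ ⌊Y⌋₊ with p.Prime, (1 - 1 / (p : ℝ)) ≤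
      ∏ p ∈ (q.primeFactors.filter fun p : ℕ => X < p).filter fun p : ℕ => ¬ Y < p, (1 - 1 / (p : ℝ)) := by
    have hsub : ((q.primeFactors.filter fun p : ℕ => X < p).filter fun p : ℕ => ¬ Y < p) ⊆
        {p ∈ Finset.Ioc ⌊X⌋₊ ⌊Y⌋₊ | p.Prime} := fun p hp => by
      simp only [mem_filter, not_lt, Nat.mem_primeFactors, Finset.mem_Ioc] at hp ⊢
      exact ⟨⟨(Nat.floor_lt (by linarith)).mpr hp.1.2, le_floor hp.2⟩, hp.1.1.1⟩
    rw [← Finset.prod_sdiff hsub]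
    exact mul_le_of_le_one_left (prod_nonneg fun _ _ => h0 _)
      (prod_le_one (fun _ _ => h0 _) fun _ _ => h1 _)
  have hlarge : 1 - (q.primeFactors.card : ℝ) / Y ≤
      ∏ p ∈ (q.primeFactors.filter fun p : ℕ => X < p).filter fun p : ℕ => Y < p, (1 - 1 / (p : ℝ)) := by
    set s := (q.primeFactors.filter fun p : ℕ => X < p).filter fun p : ℕ => Y < p
    have hY1 : 1 / Y ≤ 1 := by bound
    calc _ ≤ 1 + (s.card : ℝ) * -(1 / Y) := by
          have : (s.card : ℝ) ≤ q.primeFactors.card := by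
            exact_mod_cast Finset.card_le_card ((Finset.filter_subset _ _).trans
              (Finset.filter_subset _ _))
          have := div_le_div_of_nonneg_right this hY0.le
          grind
      _ ≤ (1 + -(1 / Y)) ^ s.card := one_add_mul_le_pow (by linarith) _
      _ ≤ _ := by
          rw [← Finset.prod_const]
          refine prod_le_prod (fun _ _ => by linarith) fun p hp => ?_
          have hp' : Y < (p : ℝ) := by grind
          have := one_div_le_one_div_of_le hY0 hp'.le
          linarith
  by_cases hneg : 0 ≤ 1 - (q.primeFactors.card : ℝ) / Y
  · exact mul_le_mul hsmall hlarge hneg (prod_nonneg fun _ _ => h0 _)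
  · exact (mul_nonpos_of_nonneg_of_nonpos (prod_nonneg fun _ _ => h0 _)
      (by linarith)).trans (mul_nonneg (prod_nonneg fun _ _ => h0 _) (prod_nonneg fun _ _ => h0 _))

lemma largePrimeProduct_le_one (X : ℝ) (q : ℕ) : largePrimeProduct X q ≤ 1 := by
  rw [largePrimeProduct_eq]
  refine prod_le_one (fun p hp => (one_sub_inv_prime_pos (prime_of_mem_primeFactors
    (mem_filter.mp hp).1)).le) fun p _ => ?_
  simp

/-- Take `Y = X^{1+2ε}`. By Mertens the primes between `X` and `Y` cost a factor tending to
`1/(1+2ε)`, and `ω(q)/Y ≪ X^{-ε}`. Since `ε` is arbitrary and the product is at most 1, the limit is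
1. -/
lemma tendsto_largePrimeProduct {ι : Type*} {l : Filter ι} {X : ι → ℝ} {q : ι → ℕ}
    (hX2 : ∀ i, 2 ≤ X i) (hX : Tendsto X l atTop)
    (h : ∀ ε : ℝ, 0 < ε → (fun i => ((q i).primeFactors.card : ℝ)) =O[l] fun i => X i ^ (1 + ε)) :
    Tendsto (fun i => largePrimeProduct (X i) (q i)) l (𝓝 1) := by
  refine tendsto_order.mpr ⟨fun η hη => ?_, fun η hη =>
    .of_forall fun i => (largePrimeProduct_le_one _ _).trans_lt hη⟩
  obtain ⟨ε, hε, hηε⟩ : ∃ ε : ℝ, 0 < ε ∧ η < (1 + 2 * ε)⁻¹ := by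
    have hc : Tendsto (fun ε : ℝ => (1 + 2 * ε)⁻¹) (𝓝[>] 0) (𝓝 (1 + 2 * 0)⁻¹) :=
      (((continuous_const.add (continuous_const.mul continuous_id)).tendsto (0 : ℝ)).inv₀
        (by norm_num)).mono_left nhdsWithin_le_nhds
    rw [mul_zero, add_zero, inv_one] at hc
    exact ((hc.eventually (lt_mem_nhds hη)).and self_mem_nhdsWithin).exists.imp
      fun ε hε => ⟨hε.2, hε.1⟩
  have hY : Tendsto (fun i => X i ^ (1 + 2 * ε)) l atTop :=
    (tendsto_rpow_atTop (by positivity)).comp hX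
  have h1 : Tendsto (fun i => mertensProduct (X i ^ (1 + 2 * ε)) / mertensProduct (X i)) l
      (𝓝 (1 + 2 * ε)⁻¹) := by
    have := ((tendsto_mertensProduct.comp hY).div (tendsto_mertensProduct.comp hX)
      (exp_pos _).ne').mul_const (1 + 2 * ε)⁻¹
    rw [div_self (exp_pos _).ne', one_mul] at this
    refine this.congr fun i => ?_
    have hl := (log_pos (by grind : 1 < X i)).ne'
    simp only [Function.comp_apply, Pi.div_apply]
    rw [log_rpow (by grind)]
    field_simp
  have h2 : Tendsto (fun i => ((q i).primeFactors.card : ℝ) / X i ^ (1 + 2 * ε)) l (𝓝 0) := by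
    refine ((h ε hε).mul (isBigO_refl (fun i => (X i ^ (1 + 2 * ε))⁻¹) l)).trans_tendsto
      (((tendsto_rpow_neg_atTop hε).comp hX).congr fun i => ?_)
    have hXi : 0 < X i := by grind
    rw [← rpow_neg hXi.le, ← rpow_add hXi]
    grind
  have h3 := h1.mul (h2.const_sub 1)
  rw [sub_zero, mul_one] at h3
  filter_upwards [h3.eventually (lt_mem_nhds hηε)] with i hi
  exact hi.trans_le (le_largePrimeProduct (by grind)
    (self_le_rpow_of_one_le (by grind) (by linarith)) _)

section asymptotic

variable {ι : Type*} {l : Filter ι} {X : ι → ℝ} {q : ι → ℕ} [∀ i, NeZero (q i)] {u : ι → ℝ → ℝ}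
  {δ : ℝ}

lemma isEquivalent_secondMoment (hδ : 0 < δ) (hX2 : ∀ i, 2 ≤ X i)
    (hu : ∀ i, IsWeight (X i) (u i)) (hprim : ∀ i, (primitiveChars (q i)).Nonempty)
    (hX : Tendsto X l atTop) (hq : Tendsto q l atTop)
    (hXq : X =O[l] fun i => log (q i) ^ (2 - δ)) :
    (fun i => secondMoment (u i) (X i) (q i)) ~[l] (fun i => largePrimeProduct (X i) (q i) *
      (log (q i) / (exp eulerMascheroniConstant * log (X i)))) := by
  have hy : ∀ᶠ i in l, 1 ≤ log (q i) := (tendsto_log_atTop.comp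
    (tendsto_natCast_atTop_atTop.comp hq)).eventually_ge_atTop 1
  -- A smaller `δ` only weakens the hypothesis, and the choice of `σ`, `θ`, `β` presupposes `δ ≤ 1`.
  have hXq' : X =O[l] fun i => log (q i) ^ (2 - min δ 1) := by
    refine hXq.trans (IsBigO.of_bound 1 ?_)
    filter_upwards [hy] with i hi
    rw [norm_of_nonneg (by positivity), norm_of_nonneg (by positivity), one_mul]
    bound
  have hR := tendsto_mollifiedMoment_div (lt_min hδ one_pos) (min_le_right δ 1) hX2 hu hprim hX hq
    hXq'
  have hr : Tendsto (fun i => secondMoment (u i) (X i) (q i) /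
      (mertensProduct (X i) * largePrimeProduct (X i) (q i) * log (q i))) l (𝓝 1) := by
    have he := (tendsto_hybridError.comp hX).const_mul 2
    have hlo := hR.mul he.neg.rexp
    have hup := hR.mul he.rexp
    rw [mul_zero, neg_zero, exp_zero, mul_one] at hlo
    rw [mul_zero, exp_zero, mul_one] at hup
    have hmem : ∀ᶠ i in l, 0 < mertensProduct (X i) * largePrimeProduct (X i) (q i) *
        log (q i) ∧ q i ≠ 1 := by
      filter_upwards [hy] with i hi
      have := mertensProduct_pos (X i)
      have := largePrimeProduct_pos (X i) (q i)
      refine ⟨by positivity, fun h => ?_⟩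
      simp [h] at hi; linarith
    refine tendsto_of_tendsto_of_tendsto_of_le_of_le' hlo hup ?_ ?_ <;>
      filter_upwards [hmem] with i hi <;> rw [div_mul_eq_mul_div] <;>
      refine div_le_div_of_nonneg_right ?_ hi.1.le
    · exact (secondMoment_mem_Icc hi.2 (hX2 i) (hu i)).1
    · exact (secondMoment_mem_Icc hi.2 (hX2 i) (hu i)).2
  refine isEquivalent_of_tendsto_one ?_
  have h2 := hr.mul ((tendsto_mertensProduct.comp hX).mul_const (exp eulerMascheroniConstant))
  rw [← exp_add, neg_add_cancel, exp_zero, one_mul] at h2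
  refine h2.congr' ?_
  filter_upwards [hy] with i hi
  have h3 := (mertensProduct_pos (X i)).ne'
  simp only [Function.comp_apply, Pi.div_apply]
  field_simp

end asymptotic

end HybridL

end

theorem theorem3 {ι : Type*} (l : Filter ι) (X : ι → ℝ) (q : ι → ℕ) [∀ i, NeZero (q i)]
    (u : ι → ℝ → ℝ) (δ : ℝ) (hδ : 0 < δ)
    (hX2 : ∀ i, 2 ≤ X i)
    (hu : ∀ i, HybridL.IsWeight (X i) (u i))
    (hprim : ∀ i, (HybridL.primitiveChars (q i)).Nonempty)
    (hX : Tendsto X l atTop) (hq : Tendsto q l atTop)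
    (hXq : X =O[l] fun i => Real.log (q i) ^ (2 - δ)) :
    (∀ᶠ i in l, ∀ χ ∈ HybridL.primitiveChars (q i),
      Summable fun ρ : HybridL.nontrivialZeros χ => HybridL.zeroTerm (u i) (X i) χ ρ) ∧
    (fun i => HybridL.secondMoment (u i) (X i) (q i)) ~[l]
      (fun i => HybridL.largePrimeProduct (X i) (q i) *
        (Real.log (q i) / (Real.exp Real.eulerMascheroniConstant * Real.log (X i)))) ∧
    ((∀ ε : ℝ, 0 < ε →
        (fun i => ((q i).primeFactors.card : ℝ)) =O[l] fun i => X i ^ (1 + ε)) →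
      (fun i => HybridL.secondMoment (u i) (X i) (q i)) ~[l]
        (fun i => Real.log (q i) /
          (Real.exp Real.eulerMascheroniConstant * Real.log (X i)))) := by
  have hmain := HybridL.isEquivalent_secondMoment hδ hX2 hu hprim hX hq hXq
  refine ⟨?_, hmain, fun hω => hmain.trans ?_⟩
  -- Modulus 1 must be left out: its character is trivial and its `L`-function, `ζ`, has a pole.
  · filter_upwards [hq.eventually_gt_atTop 1] with i hi χ hχ
    exact HybridL.summable_zeroTerm (HybridL.mem_primitiveChars.mp hχ) hi.ne' (hX2 i) (hu i)
  · have h := HybridL.tendsto_largePrimeProduct hX2 hX hω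
    exact (((isEquivalent_const_iff_tendsto one_ne_zero).mpr h).mul
      (IsEquivalent.refl (u := fun i => Real.log (q i) /
        (Real.exp Real.eulerMascheroniConstant * Real.log (X i))))).congr_right
        (Eventually.of_forall fun i => one_mul _)
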